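/- **Setting.** Let $\mathcal C$ be an Abelian braided monoidal category with unit $\underline 1$ and braiding $\Psi$, whose tensor product is additive and right exact in each variable. Let $X$ be an object with left dual ${}^\vee X$ (evaluation $\cup:{}^\vee X\otimes X\to\underline 1$, coevaluation $\cap:\underline 1\to X\otimes{}^\vee X$), and let $R:X\otimes X\to X\otimes X$ be an isomorphism satisfying the braid equation. Write $R_{X^{\otimes m},X^{\otimes n}}$ for its extension to tensor powers by the hexagon identities and ${}^\vee R$ for its dual on ${}^\vee X^{\otimes2}$. All (bi)algebras below are graded, i.e. live in the braided category $\mathrm{Gr}(\mathcal C)$ of graded spaces over $\mathcal C$: objects are families of objects of $\mathcal C$ (formal direct sums), morphisms are row-finite matrices. * $A(X)$ has components ${}^\vee X^{\otimes n}\otimes X^{\otimes n}$, product $\Psi_{{}^\vee X^{\otimes m}\otimes X^{\otimes m},\,{}^\vee X^{\otimes n}}\otimes X^{\otimes n}$, coproduct ${}^\vee X^{\otimes n}\otimes\cap\otimes X^{\otimes n}$, counit $\cup$. $\overline A(X)$ is the same coalgebra with $\Psi$ replaced by the inverse braiding in the product. $A(X,R)$ is the quotient of $A(X)$ by the ideal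 generated by ${}^\vee R\otimes\mathrm{id}-\mathrm{id}\otimes R$ in degree 2, and $\overline A(X,R^{-1})$ is the quotient of $\overline A(X)$ by the ideal generated by ${}^\vee R^{-1}\otimes\mathrm{id}-\mathrm{id}\otimes R^{-1}$. * A *coquasitriangular bialgebra* $(A,\overline A,\rho)$ in a braided category $\mathcal D$ consists of a bialgebra $A$ in $\mathcal D$, a bialgebra $\overline A$ with the same underlying coalgebra in $\overline{\mathcal D}$ ($\mathcal D$ with the inverse braiding), and a convolution-invertible bialgebra pairing $\rho:\overline A^{\rm op}\otimes A\to\underline 1$ with $(\overline\mu^{\rm op}\otimes\rho)\Delta_{A\otimes A}=(\rho\otimes\mu)\Delta_{A\otimes A}$. It is a *dual quantum braided group* if moreover $A$ and $\overline A$ have antipodes. * $\mathcal C^{\mathcal O(A,\overline A)}$ is the category of right $A$-comodules $V$ for which the two morphisms $A\otimes V\to V\otimes A$, "coact on $V$, move $A$ past $V$ by $\Psi$ and multiply in $A$" and "coact on $V$, move $A$ past $V$ by the inverse braiding and multiply in $\overline A$", agree. Its braiding is $v\otimes w\mapsto w_{0}\otimes v_{0}\,\rho(v_{1},w_{1})$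 ($v$ and $w_0$ being interchanged by $\Psi$); the inverse braiding is given in the same way by the inverse of $\Psi$ and $\overline\rho=\rho^{-}\circ\Psi^{-1}$, where $\rho^-$ is the convolution inverse of $\rho$. * $V(X,R)$ is the quotient of the tensor algebra $T(X)$ by the ideal generated by $\ker(R+\mathrm{id})\subset X\otimes X$; its coproduct is induced by the braided binomial coefficients $X^{\otimes(m+n)}\to X^{\otimes m}\otimes X^{\otimes n}$ built from $R$, and its coaction by $\cap\otimes X^{\otimes n}:X^{\otimes n}\to X^{\otimes n}\otimes A_n(X)$. Assume that the functor $-\otimes A_2(X,R)$ preserves the kernel of $R+\mathrm{id}_{X\otimes X}$ (automatic if $\otimes$ is exact), so that this kernel can be formed among $A(X,R)$-comodules. **Statement.** 1. The two ideals above coincide, so $A(X,R)$ and $\overline A(X,R^{-1})$ have the same underlying graded object; all structure morphisms descend, and so does the family of pairings given by $\Psi_{X^{\otimes m},{}^\vee X^{\otimes n}}$, followed by $R_{X^{\otimes m},X^{\otimes n}}$ and evaluation. The result $(A(X,R),\overline A(X,R^{-1}),\rho)$ is a coquasitriangular bialgebra in $\mathrm{Gr}(\mathcal C)$. 2. The algebra,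 coalgebra and comodule structures of $T(X)$ descend to $V(X,R)$, which is thereby a Hopf algebra in $\mathcal C^{\mathcal O(A(X,R),\overline A(X,R^{-1}))}$, and $(V(X,R),V(X,R)^{\rm op})$ with the trivial coquasitriangular structure $\epsilon\otimes\epsilon$ is a dual quantum braided group in that category. 3. The bosonization $$\bigl(A(X,R)\ltimes V(X,R),\ \overline A(X,R^{-1})\ltimes V(X,R)^{\rm op}\bigr)$$ on $A(X,R)\otimes V(X,R)$, with coquasitriangular structure $\rho\circ(\mathrm{id}\otimes\epsilon\otimes\mathrm{id}\otimes\epsilon)$, is a coquasitriangular bialgebra in $\mathrm{Gr}(\mathcal C)$. Here $A\ltimes V$ has the crossed product $(a\otimes v)(b\otimes w)=ab_1\otimes(v\triangleleft b_2)w$ with $v\triangleleft b=v_{0}\,\rho(v_{1},b)$, and the crossed coproduct $a\otimes v\mapsto(a_1\otimes v_{1,0})\otimes(a_2v_{1,1}\otimes v_2)$, factors being interchanged by $\Psi$; $\overline A\ltimes V^{\rm op}$ is formed in the same way from $(\overline A,A,\overline\rho)$ with the inverse braiding, and has the same coproduct. -/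

import Mathlib

open CategoryTheory MonoidalCategory Limits
universe v u

/-! ## Graded spaces over a category

An object of `Gr C` is a family of objects of `C` (the homogeneous components).  A morphism is a
matrix of morphisms of `C` each of whose rows has only finitely many nonzero entries, so that
`Gr C` is the category of formal direct sums of objects of `C`.  It inherits from `C` the tensor
product and the braiding, component by component. -/

/-- A family of objects of `C`. -/
structure Gr (C : Type u) where
  /-- the set of degrees -/
  ι : Type
  /-- the homogeneous components -/
  obj : ι → C

namespace Gr

noncomputable section

variable {C : Type u} [Category.{v} C] [Preadditive C]

/-- Rows of matrices: finitely supported families of morphisms from `P` to the members of `B`. -/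
abbrev Row (P : C) (B : Gr C) : Type v := Π₀ j : B.ι, (P ⟶ B.obj j)

/-- The row with the single entry `φ` in place `j`. -/
def single {P : C} {B : Gr C} (j : B.ι) : (P ⟶ B.obj j) →+ Row P B := by
  classical exact DFinsupp.singleAddHom (fun j => P ⟶ B.obj j) j

theorem ind {P : C} {B : Gr C} {p : Row P B → Prop} (r : Row P B) (h0 : p 0)
    (hadd : ∀ r s, p r → p s → p (r + s))
    (hs : ∀ j (φ : P ⟶ B.obj j), p (single j φ)) : p r := by
  classical
  induction r using DFinsupp.induction with
  | h0 => exact h0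
  | ha i b f _ _ ih => exact hadd _ _ (hs i b) ih

/-- Linear extension: a map out of rows from its values on one-entry rows. -/
def sumHom {P : C} {B : Gr C} {M : Type v} [AddCommMonoid M]
    (φ : ∀ j, (P ⟶ B.obj j) →+ M) : Row P B →+ M := by
  classical exact DFinsupp.sumAddHom φ

@[simp] theorem sumHom_single {P : C} {B : Gr C} {M : Type v} [AddCommMonoid M]
    (φ : ∀ j, (P ⟶ B.obj j) →+ M) (j : B.ι) (f : P ⟶ B.obj j) :
    sumHom φ (single j f) = φ j f := by
  classical exact DFinsupp.sumAddHom_single φ j f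

/-- Precomposition of every entry of a row with `φ`. -/
def pre {P Q : C} {B : Gr C} : (P ⟶ Q) →+ Row Q B →+ Row P B :=
  AddMonoidHom.flip (sumHom fun j => AddMonoidHom.mk' (fun ψ => AddMonoidHom.mk'
    (fun φ : P ⟶ Q => single j (φ ≫ ψ)) (by intros; simp)) (by intros; ext1; simp))

@[simp] theorem pre_single {P Q : C} {B : Gr C} (φ : P ⟶ Q) (j : B.ι) (ψ : Q ⟶ B.obj j) :
    pre φ (single j ψ) = single j (φ ≫ ψ) := by
  simp [pre]

/-- Row-finite matrices of morphisms. -/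
@[ext] structure Hom (A B : Gr C) where
  /-- the rows -/
  row : ∀ i : A.ι, Row (A.obj i) B

/-- Row times matrix. -/
def post {P : C} {A B : Gr C} (g : Hom A B) : Row P A →+ Row P B :=
  sumHom fun j => AddMonoidHom.flip pre (g.row j)

@[simp] theorem post_single {P : C} {A B : Gr C} (g : Hom A B) (j : A.ι) (φ : P ⟶ A.obj j) :
    post g (single j φ) = pre φ (g.row j) := by
  simp [post]

theorem post_pre {P Q : C} {A B : Gr C} (g : Hom A B) (φ : P ⟶ Q) (r : Row Q A) :
    post g (pre φ r) = pre φ (post g r) := by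
  induction r using ind with
  | h0 => simp
  | hadd r s hr hs => simp [hr, hs]
  | hs j ψ =>
    simp only [pre_single, post_single]
    generalize g.row j = s
    induction s using ind with
    | h0 => simp
    | hadd r s hr hs => simp [hr, hs]
    | hs k χ => simp

theorem pre_id {P : C} {B : Gr C} (r : Row P B) : pre (𝟙 P) r = r := by
  induction r using ind with
  | h0 => simp
  | hadd r s hr hs => simp [hr, hs]
  | hs j ψ => simp

instance category : Category (Gr C) where
  Hom := Hom
  id A := ⟨fun i => single i (𝟙 _)⟩
  comp f g := ⟨fun i => post g (f.row i)⟩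
  id_comp f := by ext1; funext i; simp [pre_id]
  comp_id {A B} f := by
    ext1; funext i
    show post _ (f.row i) = f.row i
    generalize f.row i = r
    induction r using ind with
    | h0 => simp
    | hadd r s hr hs => simp [hr, hs]
    | hs j ψ => simp
  assoc {A B D E} f g h := by
    ext1; funext i
    show post h (post g (f.row i)) = post _ (f.row i)
    generalize f.row i = r
    induction r using ind with
    | h0 => simp
    | hadd r s hr hs => simp [hr, hs]
    | hs j ψ => simp [post_pre]

@[ext] theorem hom_ext {A B : Gr C} {f g : A ⟶ B} (h : ∀ i, f.row i = g.row i) : f = g :=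
  Hom.ext (funext h)

@[simp] theorem id_row (A : Gr C) (i : A.ι) : Hom.row (𝟙 A) i = single i (𝟙 _) := rfl
@[simp] theorem comp_row {A B D : Gr C} (f : A ⟶ B) (g : B ⟶ D) (i : A.ι) :
    Hom.row (f ≫ g) i = post g (f.row i) := rfl

/-- The matrix with one entry `φ i`, in column `e i`, in each row `i`. -/
def ofMap {A B : Gr C} (e : A.ι → B.ι) (φ : ∀ i, A.obj i ⟶ B.obj (e i)) : A ⟶ B :=
  Hom.mk fun i => single (e i) (φ i)

@[simp] theorem ofMap_row {A B : Gr C} (e : A.ι → B.ι) (φ : ∀ i, A.obj i ⟶ B.obj (e i)) (i : A.ι) :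
    Hom.row (ofMap (B := B) e φ) i = single (e i) (φ i) := rfl

theorem ofMap_comp {A B D : Gr C} (e : A.ι → B.ι) (φ : ∀ i, A.obj i ⟶ B.obj (e i))
    (e' : B.ι → D.ι) (ψ : ∀ j, B.obj j ⟶ D.obj (e' j)) :
    ofMap (B := B) e φ ≫ ofMap (B := D) e' ψ = ofMap (fun i => e' (e i)) (fun i => φ i ≫ ψ (e i)) := by
  ext1 i; simp

theorem ofMap_eq_id {A : Gr C} (φ : ∀ i, A.obj i ⟶ A.obj i) (h : ∀ i, φ i = 𝟙 _) :
    ofMap (B := A) (fun i => i) φ = 𝟙 A := by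
  ext1 i; simp [h]

theorem ofMap_congr {A B : Gr C} (e : A.ι → B.ι) {φ ψ : ∀ i, A.obj i ⟶ B.obj (e i)}
    (h : ∀ i, φ i = ψ i) : ofMap (B := B) e φ = ofMap e ψ := by
  ext1 i; simp [h]

theorem post_ofMap_single {P : C} {A B : Gr C} (e : A.ι → B.ι) (φ : ∀ i, A.obj i ⟶ B.obj (e i))
    (j : A.ι) (ψ : P ⟶ A.obj j) :
    post (ofMap (B := B) e φ) (single j ψ) = single (e j) (ψ ≫ φ j) := by
  simp

theorem ind₂ {P Q : C} {A B : Gr C} {p : Row P A → Row Q B → Prop} (r : Row P A) (s : Row Q B)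
    (h1 : ∀ s, p 0 s) (h2 : ∀ r, p r 0)
    (hadd1 : ∀ r r' s, p r s → p r' s → p (r + r') s)
    (hadd2 : ∀ r s s', p r s → p r s' → p r (s + s'))
    (hs : ∀ j (φ : P ⟶ A.obj j) k (ψ : Q ⟶ B.obj k), p (single j φ) (single k ψ)) : p r s := by
  induction r using ind with
  | h0 => exact h1 _
  | hadd r r' h h' => exact hadd1 _ _ _ h h'
  | hs j φ =>
    induction s using ind with
    | h0 => exact h2 _
    | hadd s s' h h' => exact hadd2 _ _ _ h h'
    | hs k ψ => exact hs _ _ _ _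

variable [MonoidalCategory C]

/-- The family of all tensor products of a member of `A` with a member of `B`. -/
abbrev tens (A B : Gr C) : Gr C := ⟨A.ι × B.ι, fun p => A.obj p.1 ⊗ B.obj p.2⟩

/-- Tensor product of two morphisms into members of families. -/
abbrev tm {P Q : C} {A B : Gr C} {j : A.ι} {k : B.ι} (φ : P ⟶ A.obj j) (ψ : Q ⟶ B.obj k) :
    P ⊗ Q ⟶ (tens A B).obj (j, k) := φ ⊗ₘ ψ

/-- The one-member family given by the unit object. -/
abbrev unit : Gr C := ⟨Unit, fun _ => 𝟙_ C⟩

/-- The associator of `Gr C`. -/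
def assoc (A B D : Gr C) : tens (tens A B) D ≅ tens A (tens B D) where
  hom := ofMap (A := tens (tens A B) D) (B := tens A (tens B D))
    (fun p => (p.1.1, (p.1.2, p.2))) (fun _ => (α_ _ _ _).hom)
  inv := ofMap (A := tens A (tens B D)) (B := tens (tens A B) D)
    (fun p => ((p.1, p.2.1), p.2.2)) (fun _ => (α_ _ _ _).inv)
  hom_inv_id := (ofMap_comp _ _ _ _).trans (ofMap_eq_id _ fun _ => Iso.hom_inv_id _)
  inv_hom_id := (ofMap_comp _ _ _ _).trans (ofMap_eq_id _ fun _ => Iso.inv_hom_id _)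

/-- The left unitor of `Gr C`. -/
def leftU (A : Gr C) : tens unit A ≅ A where
  hom := ofMap (A := tens unit A) (B := A) (fun p => p.2) (fun _ => (λ_ _).hom)
  inv := ofMap (A := A) (B := tens unit A) (fun p => ((), p)) (fun _ => (λ_ _).inv)
  hom_inv_id := (ofMap_comp _ _ _ _).trans (ofMap_eq_id _ fun _ => Iso.hom_inv_id _)
  inv_hom_id := (ofMap_comp _ _ _ _).trans (ofMap_eq_id _ fun _ => Iso.inv_hom_id _)

/-- The right unitor of `Gr C`. -/
def rightU (A : Gr C) : tens A unit ≅ A where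
  hom := ofMap (A := tens A unit) (B := A) (fun p => p.1) (fun _ => (ρ_ _).hom)
  inv := ofMap (A := A) (B := tens A unit) (fun p => (p, ())) (fun _ => (ρ_ _).inv)
  hom_inv_id := (ofMap_comp _ _ _ _).trans (ofMap_eq_id _ fun _ => Iso.hom_inv_id _)
  inv_hom_id := (ofMap_comp _ _ _ _).trans (ofMap_eq_id _ fun _ => Iso.inv_hom_id _)

variable [MonoidalPreadditive C]

/-- Tensor product of rows. -/
def tensRow {P Q : C} {A B : Gr C} : Row P A →+ Row Q B →+ Row (P ⊗ Q) (tens A B) :=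
  sumHom fun j => AddMonoidHom.flip (sumHom fun k => AddMonoidHom.mk' (fun ψ =>
    AddMonoidHom.mk' (fun φ => single (B := tens A B) (j, k) (tm φ ψ))
      (fun a b => by rw [← map_add]; exact DFunLike.congr_arg _ (MonoidalPreadditive.add_tensor a b ψ)))
      (fun a b => AddMonoidHom.ext fun φ => by
        simp only [AddMonoidHom.mk'_apply, AddMonoidHom.add_apply]
        rw [← map_add]; exact DFunLike.congr_arg _ (MonoidalPreadditive.tensor_add φ a b)))

@[simp] theorem tensRow_single {P Q : C} {A B : Gr C} (j : A.ι) (k : B.ι) (φ : P ⟶ A.obj j)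
    (ψ : Q ⟶ B.obj k) : tensRow (single j φ) (single k ψ) =
      single (B := tens A B) (j, k) (tm φ ψ) := by
  simp [tensRow]

/-- Tensor product of matrices. -/
def tensHom {A B A' B' : Gr C} (f : A ⟶ B) (g : A' ⟶ B') : tens A A' ⟶ tens B B' :=
  Hom.mk fun p => tensRow (f.row p.1) (g.row p.2)

theorem tensHom_row {A B A' B' : Gr C} (f : A ⟶ B) (g : A' ⟶ B') (i : A.ι) (i' : A'.ι) :
    Hom.row (tensHom f g) (i, i') = tensRow (f.row i) (g.row i') := rfl

theorem pre_tensRow {P Q P' Q' : C} {A B : Gr C} (φ : P' ⟶ P) (ψ : Q' ⟶ Q) (r : Row P A)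
    (s : Row Q B) : pre (φ ⊗ₘ ψ) (tensRow r s) = tensRow (pre φ r) (pre ψ s) := by
  induction r, s using ind₂ with
  | h1 | h2 => simp
  | hadd1 _ _ _ h h' => simp [h, h']
  | hadd2 _ _ _ h h' => simp [h, h']
  | hs j a k b =>
    simp only [tensRow_single, pre_single]
    exact (pre_single (B := tens A B) (φ ⊗ₘ ψ) (j, k) (tm a b)).trans
      (congrArg (single (B := tens A B) (j, k)) (MonoidalCategory.tensorHom_comp_tensorHom φ ψ a b))

theorem post_tensRow {P Q : C} {A B A' B' : Gr C} (f : A ⟶ B) (g : A' ⟶ B') (r : Row P A)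
    (s : Row Q A') : post (tensHom f g) (tensRow r s) = tensRow (post f r) (post g s) := by
  induction r, s using ind₂ with
  | h1 | h2 => simp
  | hadd1 _ _ _ h h' => simp [h, h']
  | hadd2 _ _ _ h h' => simp [h, h']
  | hs j a k b =>
    simp only [tensRow_single, post_single]
    exact (post_single (tensHom f g) (j, k) (tm a b)).trans
      (pre_tensRow a b (f.row j) (g.row k))

theorem tensHom_ofMap {A B A' B' : Gr C} (e : A.ι → B.ι) (φ : ∀ i, A.obj i ⟶ B.obj (e i))
    (e' : A'.ι → B'.ι) (φ' : ∀ i, A'.obj i ⟶ B'.obj (e' i)) :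
    tensHom (ofMap (B := B) e φ) (ofMap (B := B') e' φ') =
      ofMap (A := tens A A') (B := tens B B') (fun p => (e p.1, e' p.2))
        (fun p => φ p.1 ⊗ₘ φ' p.2) :=
  hom_ext fun _ => tensRow_single _ _ _ _

theorem post_assoc {P Q S : C} {A B D : Gr C} (r : Row P A) (s : Row Q B) (t : Row S D) :
    post (assoc A B D).hom (tensRow (tensRow r s) t) =
      pre (α_ P Q S).hom (tensRow r (tensRow s t)) := by
  induction r, s using ind₂ with
  | h1 | h2 => simp
  | hadd1 _ _ _ h h' => simp only [map_add, AddMonoidHom.add_apply, h, h']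
  | hadd2 _ _ _ h h' => simp only [map_add, AddMonoidHom.add_apply, h, h']
  | hs j φ k ψ =>
    induction t using ind with
    | h0 => simp
    | hadd _ _ h h' => simp only [map_add, h, h']
    | hs l χ =>
      rw [tensRow_single, tensRow_single, tensRow_single]
      have h2 : tensRow (single j φ) (single (B := tens B D) (k, l) (tm ψ χ)) = _ :=
        tensRow_single (B := tens B D) j (k, l) φ (tm ψ χ)
      rw [h2]
      have h3 : post (assoc A B D).hom (single (B := tens (tens A B) D) ((j, k), l) (tm (tm φ ψ) χ)) =
          single (B := tens A (tens B D)) (j, (k, l))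
            (tm (tm φ ψ) χ ≫ (α_ (A.obj j) (B.obj k) (D.obj l)).hom) :=
        post_ofMap_single (A := tens (tens A B) D) (B := tens A (tens B D))
          (fun p => (p.1.1, (p.1.2, p.2))) (fun _ => (α_ _ _ _).hom) ((j, k), l) (tm (tm φ ψ) χ)
      have h4 : pre (α_ P Q S).hom (single (B := tens A (tens B D)) (j, (k, l)) (tm φ (tm ψ χ))) =
          single (B := tens A (tens B D)) (j, (k, l)) ((α_ P Q S).hom ≫ tm φ (tm ψ χ)) :=
        pre_single (B := tens A (tens B D)) (α_ P Q S).hom (j, (k, l)) (tm φ (tm ψ χ))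
      rw [h3, h4]
      exact congrArg (single (B := tens A (tens B D)) (j, (k, l)))
        (MonoidalCategory.associator_naturality φ ψ χ)

theorem post_leftU {P : C} {A : Gr C} (r : Row P A) :
    post (leftU A).hom (tensRow (single (B := unit) () (𝟙 (𝟙_ C))) r) = pre (λ_ P).hom r := by
  induction r using ind with
  | h0 => simp
  | hadd _ _ h h' => simp only [map_add, h, h']
  | hs l χ =>
    have h1 : tensRow (single (B := unit) () (𝟙 (𝟙_ C))) (single l χ) = _ :=
      tensRow_single (A := unit) () l (𝟙 (𝟙_ C)) χ
    rw [h1, pre_single]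
    refine (post_ofMap_single (A := tens unit A) _ _ ((), l) (tm (𝟙 (𝟙_ C)) χ)).trans ?_
    refine congrArg (single l) ?_
    refine Eq.trans ?_ (MonoidalCategory.leftUnitor_naturality χ)
    exact congrArg (· ≫ _) (MonoidalCategory.id_tensorHom _ _)

theorem post_rightU {P : C} {A : Gr C} (r : Row P A) :
    post (rightU A).hom (tensRow r (single (B := unit) () (𝟙 (𝟙_ C)))) = pre (ρ_ P).hom r := by
  induction r using ind with
  | h0 => simp
  | hadd _ _ h h' => simp only [map_add, AddMonoidHom.add_apply, h, h']
  | hs l χ =>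
    have h1 : tensRow (single l χ) (single (B := unit) () (𝟙 (𝟙_ C))) = _ :=
      tensRow_single (B := unit) l () χ (𝟙 (𝟙_ C))
    rw [h1, pre_single]
    refine (post_ofMap_single (A := tens A unit) _ _ (l, ()) (tm χ (𝟙 (𝟙_ C)))).trans ?_
    refine congrArg (single l) ?_
    refine Eq.trans ?_ (MonoidalCategory.rightUnitor_naturality χ)
    exact congrArg (· ≫ _) (MonoidalCategory.tensorHom_id _ _)

instance monoidalCategoryStruct : MonoidalCategoryStruct (Gr C) where
  tensorObj := tens
  whiskerLeft A _ _ g := tensHom (𝟙 A) g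
  whiskerRight f B := tensHom f (𝟙 B)
  tensorHom := tensHom
  tensorUnit := unit
  associator := assoc
  leftUnitor := leftU
  rightUnitor := rightU

theorem pentagon_aux (W X Y Z : Gr C) :
    tensHom (assoc W X Y).hom (𝟙 Z) ≫ (assoc W (tens X Y) Z).hom ≫ tensHom (𝟙 W) (assoc X Y Z).hom =
      (assoc (tens W X) Y Z).hom ≫ (assoc W X (tens Y Z)).hom := by
  have h1 : tensHom (assoc W X Y).hom (𝟙 Z) = _ :=
    tensHom_ofMap (A := tens (tens W X) Y) (B := tens W (tens X Y)) (A' := Z) (B' := Z)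
    (fun p => (p.1.1, (p.1.2, p.2))) (fun _ => (α_ _ _ _).hom) (fun i => i) (fun _ => 𝟙 _)
  have h2 : tensHom (𝟙 W) (assoc X Y Z).hom = _ :=
    tensHom_ofMap (A' := tens (tens X Y) Z) (B' := tens X (tens Y Z)) (A := W) (B := W)
    (fun i => i) (fun _ => 𝟙 _) (fun p => (p.1.1, (p.1.2, p.2))) (fun _ => (α_ _ _ _).hom)
  rw [h1, h2]
  simp only [assoc, ofMap_comp]
  refine ofMap_congr _ fun p => ?_
  simp only [MonoidalCategory.tensorHom_id, MonoidalCategory.id_tensorHom]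
  exact MonoidalCategory.pentagon _ _ _ _

theorem triangle_aux (X Y : Gr C) :
    (assoc X unit Y).hom ≫ tensHom (𝟙 X) (leftU Y).hom = tensHom (rightU X).hom (𝟙 Y) := by
  have h1 : tensHom (𝟙 X) (leftU Y).hom = _ :=
    tensHom_ofMap (A' := tens unit Y) (B' := Y) (A := X) (B := X)
      (fun i => i) (fun _ => 𝟙 _) (fun p => p.2) (fun _ => (λ_ _).hom)
  have h2 : tensHom (rightU X).hom (𝟙 Y) = _ :=
    tensHom_ofMap (A := tens X unit) (B := X) (A' := Y) (B' := Y)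
      (fun p => p.1) (fun _ => (ρ_ _).hom) (fun i => i) (fun _ => 𝟙 _)
  rw [h1, h2]
  simp only [assoc, ofMap_comp]
  refine ofMap_congr _ fun p => ?_
  simp only [MonoidalCategory.tensorHom_id, MonoidalCategory.id_tensorHom]
  exact MonoidalCategory.triangle _ _

instance monoidalCategory : MonoidalCategory (Gr C) := MonoidalCategory.ofTensorHom
  (id_tensorHom_id := fun _ _ => hom_ext fun _ => (tensRow_single _ _ _ _).trans
    (DFunLike.congr_arg _ (MonoidalCategory.id_tensorHom_id _ _)))
  (id_tensorHom := fun _ _ _ _ => rfl)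
  (tensorHom_id := fun _ _ => rfl)
  (tensorHom_comp_tensorHom := fun _ _ _ _ => hom_ext fun _ => post_tensRow _ _ _ _)
  (associator_naturality := fun {X₁ X₂ X₃ _ _ _} f g h => hom_ext fun p =>
    (post_assoc (f.row p.1.1) (g.row p.1.2) (h.row p.2)).trans
      (post_single (tensHom f (tensHom g h)) (p.1.1, (p.1.2, p.2))
        (α_ (X₁.obj p.1.1) (X₂.obj p.1.2) (X₃.obj p.2)).hom).symm)
  (leftUnitor_naturality := fun {X _} f => hom_ext fun p =>
    (post_leftU (f.row p.2)).trans (post_single f p.2 (λ_ (X.obj p.2)).hom).symm)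
  (rightUnitor_naturality := fun {X _} f => hom_ext fun p =>
    (post_rightU (f.row p.1)).trans (post_single f p.1 (ρ_ (X.obj p.1)).hom).symm)
  (pentagon := pentagon_aux)
  (triangle := triangle_aux)

variable [BraidedCategory C]

/-- The braiding of `Gr C`. -/
def braid (A B : Gr C) : tens A B ≅ tens B A where
  hom := ofMap (A := tens A B) (B := tens B A) (fun p => (p.2, p.1)) (fun _ => (β_ _ _).hom)
  inv := ofMap (A := tens B A) (B := tens A B) (fun p => (p.2, p.1)) (fun _ => (β_ _ _).inv)
  hom_inv_id := (ofMap_comp _ _ _ _).trans (ofMap_eq_id _ fun _ => Iso.hom_inv_id _)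
  inv_hom_id := (ofMap_comp _ _ _ _).trans (ofMap_eq_id _ fun _ => Iso.inv_hom_id _)

theorem post_braid {P Q : C} {A B : Gr C} (r : Row P A) (s : Row Q B) :
    post (braid A B).hom (tensRow r s) = pre (β_ P Q).hom (tensRow s r) := by
  induction r, s using ind₂ with
  | h1 | h2 => simp
  | hadd1 _ _ _ h h' => simp only [map_add, AddMonoidHom.add_apply, h, h']
  | hadd2 _ _ _ h h' => simp only [map_add, AddMonoidHom.add_apply, h, h']
  | hs j φ k ψ =>
    rw [tensRow_single, tensRow_single]
    have h1 : post (braid A B).hom (single (B := tens A B) (j, k) (tm φ ψ)) =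
        single (B := tens B A) (k, j) (tm φ ψ ≫ (β_ (A.obj j) (B.obj k)).hom) :=
      post_ofMap_single (A := tens A B) (B := tens B A) (fun p => (p.2, p.1))
        (fun _ => (β_ _ _).hom) (j, k) (tm φ ψ)
    have h2 : pre (β_ P Q).hom (single (B := tens B A) (k, j) (tm ψ φ)) =
        single (B := tens B A) (k, j) ((β_ P Q).hom ≫ tm ψ φ) :=
      pre_single (B := tens B A) (β_ P Q).hom (k, j) (tm ψ φ)
    rw [h1, h2]
    exact congrArg (single (B := tens B A) (k, j)) (BraidedCategory.braiding_naturality φ ψ)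

theorem braid_nat {A B A' B' : Gr C} (f : A ⟶ B) (g : A' ⟶ B') :
    tensHom f g ≫ (braid B B').hom = (braid A A').hom ≫ tensHom g f := hom_ext fun p =>
  (post_braid (f.row p.1) (g.row p.2)).trans
    (post_single (tensHom g f) (p.2, p.1) (β_ (A.obj p.1) (A'.obj p.2)).hom).symm

theorem hexagon_forward_aux (X Y Z : Gr C) :
    (assoc X Y Z).hom ≫ (braid X (tens Y Z)).hom ≫ (assoc Y Z X).hom =
      tensHom (braid X Y).hom (𝟙 Z) ≫ (assoc Y X Z).hom ≫ tensHom (𝟙 Y) (braid X Z).hom := by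
  have h1 : tensHom (braid X Y).hom (𝟙 Z) = _ :=
    tensHom_ofMap (A := tens X Y) (B := tens Y X) (A' := Z) (B' := Z)
      (fun p => (p.2, p.1)) (fun _ => (β_ _ _).hom) (fun i => i) (fun _ => 𝟙 _)
  have h2 : tensHom (𝟙 Y) (braid X Z).hom = _ :=
    tensHom_ofMap (A := Y) (B := Y) (A' := tens X Z) (B' := tens Z X)
      (fun i => i) (fun _ => 𝟙 _) (fun p => (p.2, p.1)) (fun _ => (β_ _ _).hom)
  rw [h1, h2]
  simp only [assoc, braid, ofMap_comp]
  refine ofMap_congr _ fun p => ?_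
  simp only [MonoidalCategory.tensorHom_id, MonoidalCategory.id_tensorHom]
  exact BraidedCategory.hexagon_forward _ _ _

theorem hexagon_reverse_aux (X Y Z : Gr C) :
    (assoc X Y Z).inv ≫ (braid (tens X Y) Z).hom ≫ (assoc Z X Y).inv =
      tensHom (𝟙 X) (braid Y Z).hom ≫ (assoc X Z Y).inv ≫ tensHom (braid X Z).hom (𝟙 Y) := by
  have h1 : tensHom (𝟙 X) (braid Y Z).hom = _ :=
    tensHom_ofMap (A := X) (B := X) (A' := tens Y Z) (B' := tens Z Y)
      (fun i => i) (fun _ => 𝟙 _) (fun p => (p.2, p.1)) (fun _ => (β_ _ _).hom)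
  have h2 : tensHom (braid X Z).hom (𝟙 Y) = _ :=
    tensHom_ofMap (A := tens X Z) (B := tens Z X) (A' := Y) (B' := Y)
      (fun p => (p.2, p.1)) (fun _ => (β_ _ _).hom) (fun i => i) (fun _ => 𝟙 _)
  rw [h1, h2]
  simp only [assoc, braid, ofMap_comp]
  refine ofMap_congr _ fun p => ?_
  simp only [MonoidalCategory.tensorHom_id, MonoidalCategory.id_tensorHom]
  exact BraidedCategory.hexagon_reverse _ _ _

instance braidedCategory : BraidedCategory (Gr C) where
  braiding := braid
  braiding_naturality_right X _ _ f := braid_nat (𝟙 X) f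
  braiding_naturality_left f Z := braid_nat f (𝟙 Z)
  hexagon_forward := hexagon_forward_aux
  hexagon_reverse := hexagon_reverse_aux

end
end Gr

namespace BraidedFRT

noncomputable section

/-! ## Algebraic structures in a monoidal category

`c` stands for the braiding of `A` with itself.  It is a parameter, because the same notions are
used in a braided category, in the category with the inverse braiding, and in a category of
comodules. -/

section Algebraic

variable {M : Type u} [Category.{v} M] [MonoidalCategory M]

/-- `η`, `μ` make `A` an algebra. -/
def IsAlgebra {A : M} (η : 𝟙_ M ⟶ A) (μ : A ⊗ A ⟶ A) : Prop :=
  ∃ h : MonObj A, h.one = η ∧ h.mul = μ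

/-- `ε`, `Δ` make `A` a coalgebra. -/
def IsCoalgebra {A : M} (ε : A ⟶ 𝟙_ M) (Δ : A ⟶ A ⊗ A) : Prop :=
  ∃ h : ComonObj A, h.counit = ε ∧ h.comul = Δ

/-- Apply `f` to the two middle factors. -/
def middle (P : M) {Q S S' Q' : M} (f : Q ⊗ S ⟶ S' ⊗ Q') (T : M) :
    (P ⊗ Q) ⊗ (S ⊗ T) ⟶ (P ⊗ S') ⊗ (Q' ⊗ T) :=
  (α_ P Q (S ⊗ T)).hom ≫ P ◁ ((α_ Q S T).inv ≫ f ▷ T ≫ (α_ S' Q' T).hom) ≫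
    (α_ P S' (Q' ⊗ T)).inv

/-- Structure morphisms of a would-be bialgebra. -/
structure BialgData (A : M) where
  one : 𝟙_ M ⟶ A
  mul : A ⊗ A ⟶ A
  counit : A ⟶ 𝟙_ M
  comul : A ⟶ A ⊗ A

/-- Structure morphisms of a would-be coquasitriangular bialgebra `(A, Ā, ρ)`: those of `A`, the
multiplication of `Ā` (unit, counit and comultiplication are those of `A`), and `ρ`. -/
structure PairData (A : M) extends BialgData A where
  mulBar : A ⊗ A ⟶ A
  pairing : A ⊗ A ⟶ 𝟙_ M

/-- The bialgebra axioms with respect to the braiding `c`. -/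
structure IsBialgebra {A : M} (c : A ⊗ A ⟶ A ⊗ A) (H : BialgData A) : Prop where
  algebra : IsAlgebra H.one H.mul
  coalgebra : IsCoalgebra H.counit H.comul
  mul_comul : H.mul ≫ H.comul = (H.comul ⊗ₘ H.comul) ≫ middle A c A ≫ (H.mul ⊗ₘ H.mul)
  one_comul : H.one ≫ H.comul = (λ_ (𝟙_ M)).inv ≫ (H.one ⊗ₘ H.one)
  mul_counit : H.mul ≫ H.counit = (H.counit ⊗ₘ H.counit) ≫ (λ_ (𝟙_ M)).hom
  one_counit : H.one ≫ H.counit = 𝟙 (𝟙_ M)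

/-- `S` is an antipode. -/
structure IsAntipode {A : M} (H : BialgData A) (S : A ⟶ A) : Prop where
  left : H.comul ≫ S ▷ A ≫ H.mul = H.counit ≫ H.one
  right : H.comul ≫ A ◁ S ≫ H.mul = H.counit ≫ H.one

/-- Compatibility of `f` with the bialgebra structure morphisms. -/
structure IsBialgHom {A A' : M} (f : A ⟶ A') (H : BialgData A) (H' : BialgData A') : Prop where
  one : H.one ≫ f = H'.one
  mul : H.mul ≫ f = (f ⊗ₘ f) ≫ H'.mul
  counit : f ≫ H'.counit = H.counit
  comul : f ≫ H'.comul = H.comul ≫ (f ⊗ₘ f)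

/-- Compatibility of `f` with all structure morphisms. -/
structure IsPairHom {A A' : M} (f : A ⟶ A') (B : PairData A) (B' : PairData A') : Prop
    extends IsBialgHom f B.toBialgData B'.toBialgData where
  mulBar : B.mulBar ≫ f = (f ⊗ₘ f) ≫ B'.mulBar
  pairing : (f ⊗ₘ f) ≫ B'.pairing = B.pairing

/-- The nested pairing of `P ⊗ Q` with `Q' ⊗ P'`: first `σ` on the two inner factors, then `ρ`
on the two outer ones. -/
def nested {P P' Q Q' : M} (ρ : P ⊗ P' ⟶ 𝟙_ M) (σ : Q ⊗ Q' ⟶ 𝟙_ M) :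
    (P ⊗ Q) ⊗ (Q' ⊗ P') ⟶ 𝟙_ M :=
  (α_ P Q (Q' ⊗ P')).hom ≫ P ◁ ((α_ Q Q' P').inv ≫ σ ▷ P' ≫ (λ_ P').hom) ≫ ρ

/-- `ρ : A ⊗ H ⟶ 𝟙` is a bialgebra pairing: the algebra (coalgebra) structure of `A` is `ρ`-dual
to the coalgebra (algebra) structure of `H`. -/
structure IsBialgebraPairing {A H : M} (a : BialgData A) (h : BialgData H) (ρ : A ⊗ H ⟶ 𝟙_ M) :
    Prop where
  mul_left : a.mul ▷ H ≫ ρ = (A ⊗ A) ◁ h.comul ≫ nested ρ ρ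
  mul_right : A ◁ h.mul ≫ ρ = a.comul ▷ (H ⊗ H) ≫ nested ρ ρ
  one_left : a.one ▷ H ≫ ρ = (λ_ H).hom ≫ h.counit
  one_right : A ◁ h.one ≫ ρ = (ρ_ A).hom ≫ a.counit

/-- The convolution product of `ρ, σ : A ⊗ A ⟶ 𝟙`. -/
def convolution {A : M} (c : A ⊗ A ⟶ A ⊗ A) (Δ : A ⟶ A ⊗ A) (ρ σ : A ⊗ A ⟶ 𝟙_ M) :
    A ⊗ A ⟶ 𝟙_ M :=
  (Δ ⊗ₘ Δ) ≫ middle A c A ≫ (ρ ⊗ₘ σ) ≫ (λ_ (𝟙_ M)).hom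

/-- `ρ'` is the convolution inverse of `ρ`. -/
structure IsConvolutionInverse {A : M} (c : A ⊗ A ⟶ A ⊗ A) (H : BialgData A)
    (ρ ρ' : A ⊗ A ⟶ 𝟙_ M) : Prop where
  right : convolution c H.comul ρ ρ' = (H.counit ⊗ₘ H.counit) ≫ (λ_ (𝟙_ M)).hom
  left : convolution c H.comul ρ' ρ = (H.counit ⊗ₘ H.counit) ≫ (λ_ (𝟙_ M)).hom

/-- The bialgebra `Ā`, which lives in the category with the inverse braiding. -/
def PairData.bar {A : M} (B : PairData A) : BialgData A := ⟨B.one, B.mulBar, B.counit, B.comul⟩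

/-- The opposite algebra of `Ā`; as `Ā` lives in the category with the inverse braiding, its
multiplication is `μ̄ ∘ c`. -/
def PairData.barOp {A : M} (c : A ⊗ A ⟶ A ⊗ A) (B : PairData A) : BialgData A :=
  ⟨B.one, c ≫ B.mulBar, B.counit, B.comul⟩

/-- `(A, Ā, ρ)` is a coquasitriangular bialgebra: `A` is a bialgebra for the braiding `c`, `Ā` is
a bialgebra with the same underlying coalgebra for the inverse braiding, and `ρ` is a
convolution-invertible bialgebra pairing of `Ā^op` and `A` such that
`(μ̄^op ⊗ ρ) ∘ Δ_{A ⊗ A} = (ρ ⊗ μ) ∘ Δ_{A ⊗ A}`. -/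
structure IsCoquasitriangular {A : M} (c : A ⊗ A ≅ A ⊗ A) (B : PairData A) : Prop where
  bialgebra : IsBialgebra c.hom B.toBialgData
  bialgebra_bar : IsBialgebra c.inv B.bar
  pairing : IsBialgebraPairing (B.barOp c.hom) B.toBialgData B.pairing
  invertible : ∃ ρ', IsConvolutionInverse c.hom B.toBialgData B.pairing ρ'
  quasi_comm :
    (B.comul ⊗ₘ B.comul) ≫ middle A c.hom A ≫ ((c.hom ≫ B.mulBar) ⊗ₘ B.pairing) ≫ (ρ_ A).hom =
      (B.comul ⊗ₘ B.comul) ≫ middle A c.hom A ≫ (B.pairing ⊗ₘ B.mul) ≫ (λ_ A).hom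

/-- The pair `(H, H^op)` with the trivial coquasitriangular structure `ε ⊗ ε`. -/
def trivialPair {A : M} (c : A ⊗ A ≅ A ⊗ A) (H : BialgData A) : PairData A where
  toBialgData := H
  mulBar := c.inv ≫ H.mul
  pairing := (H.counit ⊗ₘ H.counit) ≫ (λ_ (𝟙_ M)).hom

/-- The right action `V ⊗ A ⟶ V`, `v ⊗ a ↦ v₀ ρ(v₁, a)`, of `A` on a comodule. -/
def action {A V : M} (δ : V ⟶ V ⊗ A) (ρ : A ⊗ A ⟶ 𝟙_ M) : V ⊗ A ⟶ V :=
  δ ▷ A ≫ (α_ V A A).hom ≫ V ◁ ρ ≫ (ρ_ V).hom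

/-- Crossed product multiplication on `A ⊗ V`,
`(a ⊗ v)(b ⊗ w) = a b₁ ⊗ (v ◁ b₂) w`, where `v` and `b₁` are interchanged by `ψ`. -/
def crossMul {A V : M} (ψ : V ⊗ A ⟶ A ⊗ V) (μA : A ⊗ A ⟶ A) (ΔA : A ⟶ A ⊗ A)
    (act : V ⊗ A ⟶ V) (μV : V ⊗ V ⟶ V) : (A ⊗ V) ⊗ (A ⊗ V) ⟶ A ⊗ V :=
  (A ⊗ V) ◁ (ΔA ▷ V ≫ (α_ A A V).hom) ≫ middle A ψ (A ⊗ V) ≫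
    (μA ⊗ₘ ((α_ V A V).inv ≫ act ▷ V ≫ μV))

/-- Crossed coproduct comultiplication on `A ⊗ V`,
`a ⊗ v ↦ (a₁ ⊗ v₁₀) ⊗ (a₂ v₁₁ ⊗ v₂)`, where `a₂` and `v₁₀` are interchanged by `φ`. -/
def crossComul {A V : M} (φ : A ⊗ V ⟶ V ⊗ A) (μA : A ⊗ A ⟶ A) (ΔA : A ⟶ A ⊗ A)
    (δ : V ⟶ V ⊗ A) (ΔV : V ⟶ V ⊗ V) : A ⊗ V ⟶ (A ⊗ V) ⊗ (A ⊗ V) :=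
  (ΔA ⊗ₘ (ΔV ≫ δ ▷ V ≫ (α_ V A V).hom)) ≫ middle A φ (A ⊗ V) ≫
    (A ⊗ V) ◁ ((α_ A A V).inv ≫ μA ▷ V)

/-! ## Comodules over a coquasitriangular bialgebra -/

variable [BraidedCategory M]

/-- The right comodule axioms, and the condition that singles out the objects of the braided
category `C^{O(A, Ā)}`: the right coaction followed by multiplication in `A` through the braiding
agrees with multiplication in `Ā` through the inverse braiding. -/
structure IsOComodule {A V : M} (B : PairData A) (δ : V ⟶ V ⊗ A) : Prop where
  coassoc : δ ≫ V ◁ B.comul = δ ≫ δ ▷ A ≫ (α_ V A A).hom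
  counit : δ ≫ V ◁ B.counit = (ρ_ V).inv
  central : A ◁ δ ≫ (α_ A V A).inv ≫ (β_ A V).hom ▷ A ≫ (α_ V A A).hom ≫ V ◁ B.mul =
    A ◁ δ ≫ (α_ A V A).inv ≫ (β_ V A).inv ▷ A ≫ (α_ V A A).hom ≫ V ◁ B.mulBar

/-- The coaction on the tensor product of two comodules. -/
def tensorCoaction {A V W : M} (B : PairData A) (δ : V ⟶ V ⊗ A) (δ' : W ⟶ W ⊗ A) :
    V ⊗ W ⟶ (V ⊗ W) ⊗ A :=
  (δ ⊗ₘ δ') ≫ middle V (β_ A W).hom A ≫ (V ⊗ W) ◁ B.mul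

/-- The coaction on the unit object. -/
def unitCoaction {A : M} (B : PairData A) : 𝟙_ M ⟶ 𝟙_ M ⊗ A := (λ_ (𝟙_ M)).inv ≫ 𝟙_ M ◁ B.one

/-- `f` is a morphism of comodules. -/
def IsComoduleHom {A V W : M} (δ : V ⟶ V ⊗ A) (δ' : W ⟶ W ⊗ A) (f : V ⟶ W) : Prop :=
  f ≫ δ' = δ ≫ f ▷ A

/-- The braiding of comodules, `v ⊗ w ↦ w₀ ⊗ v₀ ρ(v₁, w₁)`. -/
def comoduleBraiding {A V W : M} (ρ : A ⊗ A ⟶ 𝟙_ M) (δ : V ⟶ V ⊗ A) (δ' : W ⟶ W ⊗ A) :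
    V ⊗ W ⟶ W ⊗ V :=
  V ◁ δ' ≫ (α_ V W A).inv ≫ (β_ V W).hom ▷ A ≫ (α_ W V A).hom ≫ W ◁ action δ ρ

/-- The pairing `ρ̄ = ρ' ∘ Ψ⁻¹`, where `ρ'` is the convolution inverse of `ρ`. -/
def barPairing {A : M} (ρ' : A ⊗ A ⟶ 𝟙_ M) : A ⊗ A ⟶ 𝟙_ M := (β_ A A).inv ≫ ρ'

/-- The inverse braiding of comodules, given by the inverse braiding and `ρ̄`. -/
def comoduleBraidingInv {A V W : M} (ρ' : A ⊗ A ⟶ 𝟙_ M) (δ : V ⟶ V ⊗ A) (δ' : W ⟶ W ⊗ A) :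
    V ⊗ W ⟶ W ⊗ V :=
  V ◁ δ' ≫ (α_ V W A).inv ≫ (β_ W V).inv ▷ A ≫ (α_ W V A).hom ≫ W ◁ action δ (barPairing ρ')

/-- `(V, V̄, r)` with the structure morphisms `W` is a dual quantum braided group (coquasitriangular
Hopf algebra) in the category `C^{O(A, Ā)}`, where `δ` is the coaction on `V` and `c` is the
braiding of `V` with itself in that category: all structure morphisms are morphisms of comodules,
`(V, V̄, r)` is a coquasitriangular bialgebra, and both `V` and `V̄` have antipodes. -/
structure IsDualQuantumBraidedGroupOver {A V : M} (B : PairData A) (δ : V ⟶ V ⊗ A)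
    (c : V ⊗ V ≅ V ⊗ V) (W : PairData V) : Prop where
  comodule : IsOComodule B δ
  braiding_hom : IsComoduleHom (tensorCoaction B δ δ) (tensorCoaction B δ δ) c.hom
  one_hom : IsComoduleHom (unitCoaction B) δ W.one
  mul_hom : IsComoduleHom (tensorCoaction B δ δ) δ W.mul
  mulBar_hom : IsComoduleHom (tensorCoaction B δ δ) δ W.mulBar
  counit_hom : IsComoduleHom δ (unitCoaction B) W.counit
  comul_hom : IsComoduleHom δ (tensorCoaction B δ δ) W.comul
  pairing_hom : IsComoduleHom (tensorCoaction B δ δ) (unitCoaction B) W.pairing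
  coquasitriangular : IsCoquasitriangular c W
  antipode : ∃ S, IsComoduleHom δ δ S ∧ IsAntipode W.toBialgData S
  antipode_bar : ∃ S, IsComoduleHom δ δ S ∧ IsAntipode W.bar S

/-- The structure morphisms of the bosonization `(A ⋉ V, Ā ⋉ V̄)` on `A ⊗ V`, with the pairing
`ρ ∘ (A ⊗ ε ⊗ A ⊗ ε)`.  Here `Ā ⋉ V̄` is formed in the category with the inverse braiding from
the coquasitriangular bialgebra `(Ā, A, ρ̄)`. -/
def bosonization {A V : M} (B : PairData A) (ρ' : A ⊗ A ⟶ 𝟙_ M) (δ : V ⟶ V ⊗ A)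
    (W : PairData V) : PairData (A ⊗ V) where
  one := (λ_ (𝟙_ M)).inv ≫ (B.one ⊗ₘ W.one)
  mul := crossMul (β_ V A).hom B.mul B.comul (action δ B.pairing) W.mul
  mulBar := crossMul (β_ A V).inv B.mulBar B.comul (action δ (barPairing ρ')) W.mulBar
  counit := (B.counit ⊗ₘ W.counit) ≫ (λ_ (𝟙_ M)).hom
  comul := crossComul (β_ A V).hom B.mul B.comul δ W.comul
  pairing := ((A ◁ W.counit ≫ (ρ_ A).hom) ⊗ₘ (A ◁ W.counit ≫ (ρ_ A).hom)) ≫ B.pairing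

/-- The comultiplication of `Ā ⋉ V̄`. -/
def bosonizationComulBar {A V : M} (B : PairData A) (δ : V ⟶ V ⊗ A) (W : PairData V) :
    A ⊗ V ⟶ (A ⊗ V) ⊗ (A ⊗ V) :=
  crossComul (β_ V A).inv B.mulBar B.comul δ W.comul

end Algebraic

/-! ## Tensor powers, dualities and the morphisms built from `R` -/

section Powers

variable {C : Type u} [Category.{v} C] [MonoidalCategory C]

/-- `X^{⊗n}` -/
def tpow (X : C) : ℕ → C
  | 0 => 𝟙_ C
  | n + 1 => tpow X n ⊗ X

/-- `Y^{⊗n}`, for the dual `Y` of `X`; the factors are in the opposite order. -/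
def dpow (Y : C) : ℕ → C
  | 0 => 𝟙_ C
  | n + 1 => Y ⊗ dpow Y n

/-- The canonical isomorphism `X^{⊗m} ⊗ X^{⊗n} ⟶ X^{⊗(m+n)}`. -/
def tmul (X : C) (m : ℕ) : ∀ n, tpow X m ⊗ tpow X n ⟶ tpow X (m + n)
  | 0 => (ρ_ (tpow X m)).hom
  | n + 1 => (α_ (tpow X m) (tpow X n) X).inv ≫ tmul X m n ▷ X

/-- The canonical isomorphism `Y^{⊗n} ⊗ Y^{⊗m} ⟶ Y^{⊗(m+n)}`. -/
def dmul (Y : C) (m : ℕ) : ∀ n, dpow Y n ⊗ dpow Y m ⟶ dpow Y (m + n)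
  | 0 => (λ_ (dpow Y m)).hom
  | n + 1 => (α_ Y (dpow Y n) (dpow Y m)).hom ≫ Y ◁ dmul Y m n

/-- The (nested) coevaluation `𝟙 ⟶ X^{⊗n} ⊗ Y^{⊗n}`. -/
def coevPow (X Y : C) [ExactPairing X Y] : ∀ n, 𝟙_ C ⟶ tpow X n ⊗ dpow Y n
  | 0 => (λ_ (𝟙_ C)).inv
  | n + 1 => coevPow X Y n ≫
      tpow X n ◁ ((λ_ (dpow Y n)).inv ≫ ExactPairing.coevaluation X Y ▷ dpow Y n ≫
        (α_ X Y (dpow Y n)).hom) ≫ (α_ (tpow X n) X (Y ⊗ dpow Y n)).inv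

/-- The (nested) evaluation `Y^{⊗n} ⊗ X^{⊗n} ⟶ 𝟙`. -/
def evPow (X Y : C) [ExactPairing X Y] : ∀ n, dpow Y n ⊗ tpow X n ⟶ 𝟙_ C
  | 0 => (λ_ (𝟙_ C)).hom
  | n + 1 => nested (ExactPairing.evaluation X Y) (evPow X Y n)

/-- The dual of an endomorphism of `X^{⊗n}`. -/
def dualPow (X Y : C) [ExactPairing X Y] (n : ℕ) (f : tpow X n ⟶ tpow X n) :
    dpow Y n ⟶ dpow Y n :=
  (ρ_ (dpow Y n)).inv ≫ dpow Y n ◁ (coevPow X Y n ≫ f ▷ dpow Y n) ≫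
    (α_ (dpow Y n) (tpow X n) (dpow Y n)).inv ≫ evPow X Y n ▷ dpow Y n ≫ (λ_ (dpow Y n)).hom

/-- The braid equation for `R` on `X ⊗ X`. -/
def BraidEquation {X : C} (R : X ⊗ X ⟶ X ⊗ X) : Prop :=
  (α_ X X X).hom ≫ X ◁ R ≫ (α_ X X X).inv ≫ R ▷ X ≫ (α_ X X X).hom ≫ X ◁ R ≫ (α_ X X X).inv =
    R ▷ X ≫ (α_ X X X).hom ≫ X ◁ R ≫ (α_ X X X).inv ≫ R ▷ X

/-- `R_{X^{⊗m}, X}`, from the first hexagon identity. -/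
def RPowOne {X : C} (R : X ⊗ X ⟶ X ⊗ X) : ∀ m, tpow X m ⊗ X ⟶ X ⊗ tpow X m
  | 0 => (λ_ X).hom ≫ (ρ_ X).inv
  | m + 1 => (α_ (tpow X m) X X).hom ≫ tpow X m ◁ R ≫ (α_ (tpow X m) X X).inv ≫
      RPowOne R m ▷ X ≫ (α_ X (tpow X m) X).hom

/-- `R_{X^{⊗m}, X^{⊗n}}`, from the second hexagon identity. -/
def RPow {X : C} (R : X ⊗ X ⟶ X ⊗ X) (m : ℕ) : ∀ n, tpow X m ⊗ tpow X n ⟶ tpow X n ⊗ tpow X m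
  | 0 => (ρ_ (tpow X m)).hom ≫ (λ_ (tpow X m)).inv
  | n + 1 => (α_ (tpow X m) (tpow X n) X).inv ≫ RPow R m n ▷ X ≫
      (α_ (tpow X n) (tpow X m) X).hom ≫ tpow X n ◁ RPowOne R m ≫
      (α_ (tpow X n) X (tpow X m)).inv

/-- `X ⊗ X` as the second tensor power. -/
def twoPow (X : C) : X ⊗ X ≅ tpow X 2 := whiskerRightIso (λ_ X).symm X

end Powers

/-! ## Quotients of graded algebras by ideals -/

section Ideals

variable {C : Type u} [Category.{v} C] [MonoidalCategory C] [Abelian C]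

/-- The component of degree `n` of the ideal generated by `r : P ⟶ G k` in a graded algebra: the
sum of the images of `G a ⊗ P ⊗ G b ⟶ G n` over all `a + k + b = n`. -/
def idealGen (G : ℕ → C) (mul : ∀ m n, G m ⊗ G n ⟶ G (m + n)) (k : ℕ) {P : C} (r : P ⟶ G k)
    (n : ℕ) : Subobject (G n) :=
  Finset.univ.sup fun p : {p : Fin (n + 1) × Fin (n + 1) // p.1.val + k + p.2.val = n} =>
    imageSubobject ((G p.1.1 ◁ r ≫ mul p.1.1 k) ▷ G p.1.2 ≫ mul (p.1.1 + k) p.1.2 ≫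
      eqToHom (congrArg G p.2))

end Ideals

/-! ## The bialgebras `A(X)`, `A(X, R)` and the braided vectors `V(X, R)` -/

section FRT

variable {C : Type u} [Category.{v} C] [MonoidalCategory C] [BraidedCategory C]

/-- The component `A_n(X) = Y^{⊗n} ⊗ X^{⊗n}` of `A(X)`, where `Y` is the left dual of `X`. -/
def freeObj (X Y : C) (n : ℕ) : C := dpow Y n ⊗ tpow X n

/-- The multiplication `A_m(X) ⊗ A_n(X) ⟶ A_{m+n}(X)` given by an interchange `ψ`. -/
def freeMulVia (X Y : C) (m n : ℕ)
    (ψ : (dpow Y m ⊗ tpow X m) ⊗ dpow Y n ⟶ dpow Y n ⊗ (dpow Y m ⊗ tpow X m)) :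
    freeObj X Y m ⊗ freeObj X Y n ⟶ freeObj X Y (m + n) :=
  (α_ (dpow Y m ⊗ tpow X m) (dpow Y n) (tpow X n)).inv ≫ ψ ▷ tpow X n ≫
    (α_ (dpow Y n) (dpow Y m ⊗ tpow X m) (tpow X n)).hom ≫
    dpow Y n ◁ (α_ (dpow Y m) (tpow X m) (tpow X n)).hom ≫
    (α_ (dpow Y n) (dpow Y m) (tpow X m ⊗ tpow X n)).inv ≫ (dmul Y m n ⊗ₘ tmul X m n)

/-- The multiplication of `A(X)`. -/
def freeMul (X Y : C) (m n : ℕ) : freeObj X Y m ⊗ freeObj X Y n ⟶ freeObj X Y (m + n) :=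
  freeMulVia X Y m n (β_ (dpow Y m ⊗ tpow X m) (dpow Y n)).hom

/-- The multiplication of `Ā(X)`: the braiding is replaced by its inverse. -/
def freeMulBar (X Y : C) (m n : ℕ) : freeObj X Y m ⊗ freeObj X Y n ⟶ freeObj X Y (m + n) :=
  freeMulVia X Y m n (β_ (dpow Y n) (dpow Y m ⊗ tpow X m)).inv

/-- The comultiplication `Y^{⊗n} ⊗ coev ⊗ X^{⊗n}` of `A_n(X)`. -/
def freeComul (X Y : C) [ExactPairing X Y] (n : ℕ) :
    freeObj X Y n ⟶ freeObj X Y n ⊗ freeObj X Y n :=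
  dpow Y n ◁ ((λ_ (tpow X n)).inv ≫ coevPow X Y n ▷ tpow X n ≫
      (α_ (tpow X n) (dpow Y n) (tpow X n)).hom) ≫
    (α_ (dpow Y n) (tpow X n) (dpow Y n ⊗ tpow X n)).inv

/-- The pairing `A_m(X) ⊗ A_n(X) ⟶ 𝟙`: braid `X^{⊗m}` past `Y^{⊗n}`, apply
`R_{X^{⊗m}, X^{⊗n}}`, and evaluate. -/
def freePairing (X Y : C) [ExactPairing X Y] (R : X ⊗ X ⟶ X ⊗ X) (m n : ℕ) :
    freeObj X Y m ⊗ freeObj X Y n ⟶ 𝟙_ C :=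
  middle (dpow Y m) (β_ (tpow X m) (dpow Y n)).hom (tpow X n) ≫
    (dpow Y m ⊗ dpow Y n) ◁ RPow R m n ≫ nested (evPow X Y m) (evPow X Y n)

/-- The coaction `coev ⊗ X^{⊗n} : X^{⊗n} ⟶ X^{⊗n} ⊗ A_n(X)`. -/
def freeCoaction (X Y : C) [ExactPairing X Y] (n : ℕ) : tpow X n ⟶ tpow X n ⊗ freeObj X Y n :=
  (λ_ (tpow X n)).inv ≫ coevPow X Y n ▷ tpow X n ≫ (α_ (tpow X n) (dpow Y n) (tpow X n)).hom

variable [Abelian C]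

/-- The difference of the two sides of the FRT relation, `∨R ⊗ id - id ⊗ R` on `A_2(X)`. -/
def frtRelation (X Y : C) [ExactPairing X Y] (R : X ⊗ X ⟶ X ⊗ X) :
    freeObj X Y 2 ⟶ freeObj X Y 2 :=
  dualPow X Y 2 ((twoPow X).inv ≫ R ≫ (twoPow X).hom) ▷ tpow X 2 -
    dpow Y 2 ◁ ((twoPow X).inv ≫ R ≫ (twoPow X).hom)

/-- The ideal of `A(X)` generated by the FRT relation for `R`. -/
def frtIdeal (X Y : C) [ExactPairing X Y] (R : X ⊗ X ⟶ X ⊗ X) (n : ℕ) :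
    Subobject (freeObj X Y n) :=
  idealGen (freeObj X Y) (freeMul X Y) 2 (frtRelation X Y R) n

/-- The ideal of `Ā(X)` generated by the FRT relation for `R`. -/
def frtIdealBar (X Y : C) [ExactPairing X Y] (R : X ⊗ X ⟶ X ⊗ X) (n : ℕ) :
    Subobject (freeObj X Y n) :=
  idealGen (freeObj X Y) (freeMulBar X Y) 2 (frtRelation X Y R) n

/-- The component `A_n(X, R)` of the quotient `A(X, R)` of `A(X)`. -/
def frtObj (X Y : C) [ExactPairing X Y] (R : X ⊗ X ⟶ X ⊗ X) (n : ℕ) : C :=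
  cokernel (frtIdeal X Y R n).arrow

/-- The ideal of the tensor algebra of `X` generated by the kernel of `R + id` on `X ⊗ X`. -/
def vecIdeal {X : C} (R : X ⊗ X ⟶ X ⊗ X) (n : ℕ) : Subobject (tpow X n) :=
  idealGen (tpow X) (tmul X) 2 (kernel.ι (R + 𝟙 (X ⊗ X)) ≫ (twoPow X).hom) n

/-- The component `V_n(X, R)` of the quotient `V(X, R)` of the tensor algebra. -/
def vecObj {X : C} (R : X ⊗ X ⟶ X ⊗ X) (n : ℕ) : C := cokernel (vecIdeal R n).arrow

/-- The graded space `A(X)`. -/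
def FreeFRT (X Y : C) : Gr C := ⟨ℕ, freeObj X Y⟩

/-- The graded space `A(X, R)`. -/
def FRT (X Y : C) [ExactPairing X Y] (R : X ⊗ X ⟶ X ⊗ X) : Gr C := ⟨ℕ, frtObj X Y R⟩

/-- The projection `A(X) ⟶ A(X, R)`. -/
def frtProj (X Y : C) [ExactPairing X Y] (R : X ⊗ X ⟶ X ⊗ X) : FreeFRT X Y ⟶ FRT X Y R :=
  Gr.ofMap (A := FreeFRT X Y) (B := FRT X Y R) (fun n => n) (fun n => cokernel.π (frtIdeal X Y R n).arrow)

/-- The graded space underlying the tensor algebra of `X`. -/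
def TensorPow (X : C) : Gr C := ⟨ℕ, tpow X⟩

/-- The graded space `V(X, R)`. -/
def BraidedVec {X : C} (R : X ⊗ X ⟶ X ⊗ X) : Gr C := ⟨ℕ, vecObj R⟩

/-- The projection of the tensor algebra onto `V(X, R)`. -/
def vecProj {X : C} (R : X ⊗ X ⟶ X ⊗ X) : TensorPow X ⟶ BraidedVec R :=
  Gr.ofMap (A := TensorPow X) (B := BraidedVec R) (fun n => n) (fun n => cokernel.π (vecIdeal R n).arrow)

variable [MonoidalPreadditive C]

/-- The structure morphisms of `A(X)`, the multiplication of `Ā(X)`, and the pairing built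
from `R`. -/
def freePair (X Y : C) [ExactPairing X Y] (R : X ⊗ X ⟶ X ⊗ X) : PairData (FreeFRT X Y) where
  one := Gr.ofMap (A := Gr.unit) (B := FreeFRT X Y) (fun _ => Nat.zero) (fun _ => (λ_ (𝟙_ C)).inv)
  mul := Gr.ofMap (A := Gr.tens (FreeFRT X Y) (FreeFRT X Y)) (B := FreeFRT X Y)
    (fun p => Nat.add p.1 p.2) (fun p => freeMul X Y p.1 p.2)
  mulBar := Gr.ofMap (A := Gr.tens (FreeFRT X Y) (FreeFRT X Y)) (B := FreeFRT X Y)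
    (fun p => Nat.add p.1 p.2) (fun p => freeMulBar X Y p.1 p.2)
  counit := Gr.ofMap (A := FreeFRT X Y) (B := Gr.unit) (fun _ => ()) (fun n => evPow X Y n)
  comul := Gr.ofMap (A := FreeFRT X Y) (B := Gr.tens (FreeFRT X Y) (FreeFRT X Y))
    (fun n => (n, n)) (fun n => freeComul X Y n)
  pairing := Gr.ofMap (A := Gr.tens (FreeFRT X Y) (FreeFRT X Y)) (B := Gr.unit)
    (fun _ => ()) (fun p => freePairing X Y R p.1 p.2)

/-- Extend `f : W ⟶ U ⊗ V` by putting one more factor `X` on the right-hand side. -/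
def putRight {W U V X : C} : (W ⟶ U ⊗ V) →+ (W ⊗ X ⟶ U ⊗ (V ⊗ X)) :=
  AddMonoidHom.mk' (fun f => f ▷ X ≫ (α_ U V X).hom)
    (fun f g => by rw [MonoidalPreadditive.add_whiskerRight, Preadditive.add_comp])

/-- Extend `f : W ⟶ U ⊗ V` by putting one more factor `X` on the left-hand side, across `V`. -/
def putLeft {W U V X : C} (t : V ⊗ X ⟶ X ⊗ V) : (W ⟶ U ⊗ V) →+ (W ⊗ X ⟶ (U ⊗ X) ⊗ V) :=
  AddMonoidHom.mk' (fun f => f ▷ X ≫ (α_ U V X).hom ≫ U ◁ t ≫ (α_ U X V).inv)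
    (fun f g => by rw [MonoidalPreadditive.add_whiskerRight, Preadditive.add_comp])

/-- The row of the comultiplication of the tensor algebra that starts at `X^{⊗n}`.  Its entry
`X^{⊗n} ⟶ X^{⊗a} ⊗ X^{⊗b}`, `a + b = n`, is the braided binomial coefficient, the sum over all
`(a, b)`-shuffles of the braids (with `R` at each crossing) that lift them.  The recursion
distributes the factors of `X^{⊗n}` over the two sides from left to right: the last factor goes to
the right-hand side, or else to the left-hand side, crossing the factors already on the right. -/
def shuffleRow {X : C} (R : X ⊗ X ⟶ X ⊗ X) :
    ∀ n, Gr.Row (tpow X n) (Gr.tens (TensorPow X) (TensorPow X))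
  | 0 => Gr.single (B := Gr.tens (TensorPow X) (TensorPow X)) (Nat.zero, Nat.zero) (λ_ (𝟙_ C)).inv
  | n + 1 => Gr.sumHom (B := Gr.tens (TensorPow X) (TensorPow X)) (fun p =>
      (Gr.single (B := Gr.tens (TensorPow X) (TensorPow X)) (p.1, Nat.succ p.2)).comp putRight +
      (Gr.single (B := Gr.tens (TensorPow X) (TensorPow X)) (Nat.succ p.1, p.2)).comp (putLeft (RPowOne R p.2)))
      (shuffleRow R n)

/-- The counit of the tensor algebra: the identity in degree `0` and zero in all other degrees. -/
def tensorCounit (X : C) : ∀ n, tpow X n ⟶ 𝟙_ C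
  | 0 => 𝟙 (𝟙_ C)
  | _ + 1 => 0

/-- The structure morphisms of the tensor algebra `T(X, R)`. -/
def tensorData {X : C} (R : X ⊗ X ⟶ X ⊗ X) : BialgData (TensorPow X) where
  one := Gr.ofMap (A := Gr.unit) (B := TensorPow X) (fun _ => Nat.zero) (fun _ => 𝟙 (𝟙_ C))
  mul := Gr.ofMap (A := Gr.tens (TensorPow X) (TensorPow X)) (B := TensorPow X)
    (fun p => Nat.add p.1 p.2) (fun p => tmul X p.1 p.2)
  counit := Gr.ofMap (A := TensorPow X) (B := Gr.unit) (fun _ => ()) (fun n => tensorCounit X n)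
  comul := Gr.Hom.mk fun n => shuffleRow R n

/-- The coaction of `A(X)` on the tensor algebra. -/
def tensorAlgebraCoaction (X Y : C) [ExactPairing X Y] : TensorPow X ⟶ TensorPow X ⊗ FreeFRT X Y :=
  Gr.ofMap (A := TensorPow X) (B := Gr.tens (TensorPow X) (FreeFRT X Y))
    (fun n => (n, n)) (fun n => freeCoaction X Y n)

end FRT

end

end BraidedFRT

open BraidedFRT

/-!
The theorem rests on three arguments of different nature.

*Calculus with tails.*  An identity of morphisms in a monoidal category holds as soon as it holds
after tensoring with every object `Z` on the right (`tail_ext`).  With such a tail, every operation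
acts on the leading factors of a right-nested tensor product (`o21`, `o12`, `o22`, …), and the
associators disappear: composites of structure morphisms become words that are rewritten with the
interchange law (`nats`) and the naturality of the braiding (`cross_left12`, `cross_right21`, …).
All axioms of comodules, bialgebras and pairings are translated into this form first.

*The bialgebra `A(X, R)`.*  The coefficients of the tensor powers `X^{⊗n}` separate the morphisms out
of `A(X, R)` (`Separates`): such a morphism is determined by its action on the comodules `X^{⊗n}`.
A morphism out of `A_n(X)` kills the ideal of FRT relations exactly when this action commutes with
`R` in all places (`frtIdeal_kills_iff`), a condition that is the same for `R` and for `R⁻¹`; hence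
the two ideals coincide.  All structure morphisms descend for the same reason, the braid equation
being used for the pairing.  Reconstruction then gives the axioms: the coquasitriangular bialgebra
axioms for `A` follow from the fact that the tensor powers, with the braidings `R_{X^{⊗m}, X^{⊗n}}`,
form a braided family of comodules with separating coefficients (`Separates.isCoquasitriangular`).

*The Hopf algebra `V(X, R)`.*  The tensor algebra of the comodule `X` is generated by `X`: a morphism
out of it is determined by its value on `1` and by a recursion for the multiplication by a generator
(`IsTensorBialgebra.ext`).  Multiplicativity, coassociativity and equivariance of the coproduct that
makes the generators primitive follow by this uniqueness.  On `ker (R + id)` the braiding is `-1`, so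
that these relations are primitive (`IsTensorBialgebra.relation_comul`), the ideal they generate is a
biideal, and the structure descends to the quotient (`IsTensorBialgebra.exists_quotient`).  As the
quotient is graded and trivial in degree `0`, the geometric series `∑ (ηε - id)^{*k}` is finite in
each degree and yields the antipode (`exists_antipode`).

Finally, the bosonization of any bialgebra in `C^{O(A, Ā)}` is a coquasitriangular bialgebra
(`bosonization_isCoquasitriangular`).  Its product and coproduct are twisted by the comodule braiding
of `V` with `A` and by the coaction of `V`, which are distributive laws; `Ā ⋉ V^op` is the same
construction for `(Ā, A, ρ̄)` and the inverse braiding.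
-/

set_option linter.unusedSimpArgs false
set_option linter.unusedSectionVars false
set_option linter.defProp false


namespace BraidedFRT
open Category
/-! ### Operations with a tail -/

section Tail
variable {M : Type u} [Category.{v} M] [MonoidalCategory M]

/-- A morphism of two factors into one, with a tail `Z`. In the names below the digits count the
factors before and after the operation. -/
def o21 {A B D : M} (f : A ⊗ B ⟶ D) (Z : M) : A ⊗ (B ⊗ Z) ⟶ D ⊗ Z := (α_ A B Z).inv ≫ f ▷ Z
/-- A morphism of one factor into two, with a tail. -/
def o12 {A B D : M} (f : A ⟶ B ⊗ D) (Z : M) : A ⊗ Z ⟶ B ⊗ (D ⊗ Z) := f ▷ Z ≫ (α_ B D Z).hom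
/-- A morphism of two factors into two, with a tail. -/
def o22 {A B D E : M} (f : A ⊗ B ⟶ D ⊗ E) (Z : M) : A ⊗ (B ⊗ Z) ⟶ D ⊗ (E ⊗ Z) :=
  (α_ A B Z).inv ≫ f ▷ Z ≫ (α_ D E Z).hom
/-- A pairing of two factors, with a tail; the unit object is absorbed. -/
def o20 {A B : M} (f : A ⊗ B ⟶ 𝟙_ M) (Z : M) : A ⊗ (B ⊗ Z) ⟶ Z :=
  (α_ A B Z).inv ≫ f ▷ Z ≫ (λ_ Z).hom
/-- A morphism to the unit object, with a tail. -/
def o10 {A : M} (f : A ⟶ 𝟙_ M) (Z : M) : A ⊗ Z ⟶ Z := f ▷ Z ≫ (λ_ Z).hom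
/-- A morphism from the unit object, with a tail. -/
def o01 {A : M} (f : 𝟙_ M ⟶ A) (Z : M) : Z ⟶ A ⊗ Z := (λ_ Z).inv ≫ f ▷ Z

theorem o21_nat {A B D Z Z' : M} (f : A ⊗ B ⟶ D) (h : Z ⟶ Z') :
    A ◁ B ◁ h ≫ o21 f Z' = o21 f Z ≫ D ◁ h := by
  rw [o21, o21, associator_inv_naturality_right_assoc, whisker_exchange, assoc]
theorem o12_nat {A B D Z Z' : M} (f : A ⟶ B ⊗ D) (h : Z ⟶ Z') :
    A ◁ h ≫ o12 f Z' = o12 f Z ≫ B ◁ D ◁ h := by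
  simp [o12, whisker_exchange_assoc]
theorem o22_nat {A B D E Z Z' : M} (f : A ⊗ B ⟶ D ⊗ E) (h : Z ⟶ Z') :
    A ◁ B ◁ h ≫ o22 f Z' = o22 f Z ≫ D ◁ E ◁ h := by
  rw [o22, o22, associator_inv_naturality_right_assoc, whisker_exchange_assoc]; simp
theorem o20_nat {A B Z Z' : M} (f : A ⊗ B ⟶ 𝟙_ M) (h : Z ⟶ Z') :
    A ◁ B ◁ h ≫ o20 f Z' = o20 f Z ≫ h := by
  rw [o20, o20, associator_inv_naturality_right_assoc, whisker_exchange_assoc]; simp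
theorem o10_nat {A Z Z' : M} (f : A ⟶ 𝟙_ M) (h : Z ⟶ Z') :
    A ◁ h ≫ o10 f Z' = o10 f Z ≫ h := by
  simp [o10, whisker_exchange_assoc]
theorem o01_nat {A Z Z' : M} (f : 𝟙_ M ⟶ A) (h : Z ⟶ Z') :
    h ≫ o01 f Z' = o01 f Z ≫ A ◁ h := by
  simp [o01, ← whisker_exchange]

theorem r21 {A B D : M} (f : A ⊗ B ⟶ D) (Z : M) : f ▷ Z = (α_ A B Z).hom ≫ o21 f Z := by simp [o21]
theorem r12 {A B D : M} (f : A ⟶ B ⊗ D) (Z : M) : f ▷ Z = o12 f Z ≫ (α_ B D Z).inv := by simp [o12]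
theorem r22 {A B D E : M} (f : A ⊗ B ⟶ D ⊗ E) (Z : M) :
    f ▷ Z = (α_ A B Z).hom ≫ o22 f Z ≫ (α_ D E Z).inv := by simp [o22]
theorem r20 {A B : M} (f : A ⊗ B ⟶ 𝟙_ M) (Z : M) :
    f ▷ Z = (α_ A B Z).hom ≫ o20 f Z ≫ (λ_ Z).inv := by simp [o20]
theorem r10 {A : M} (f : A ⟶ 𝟙_ M) (Z : M) : f ▷ Z = o10 f Z ≫ (λ_ Z).inv := by simp [o10]
theorem r01 {A : M} (f : 𝟙_ M ⟶ A) (Z : M) : f ▷ Z = (λ_ Z).hom ≫ o01 f Z := by simp [o01]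

theorem whiskerRight_whiskerRight {A B : M} (f : A ⟶ B) (W Z : M) :
    f ▷ W ▷ Z = (α_ A W Z).hom ≫ f ▷ (W ⊗ Z) ≫ (α_ B W Z).inv := by simp
theorem assoc_hom_whiskerRight (A B D Z : M) : (α_ A B D).hom ▷ Z =
    (α_ (A ⊗ B) D Z).hom ≫ (α_ A B (D ⊗ Z)).hom ≫ A ◁ (α_ B D Z).inv ≫ (α_ A (B ⊗ D) Z).inv := by
  simp
theorem assoc_inv_whiskerRight (A B D Z : M) : (α_ A B D).inv ▷ Z =
    (α_ A (B ⊗ D) Z).hom ≫ A ◁ (α_ B D Z).hom ≫ (α_ A B (D ⊗ Z)).inv ≫ (α_ (A ⊗ B) D Z).inv := by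
  simp
theorem left_hom_whiskerRight (A Z : M) : (λ_ A).hom ▷ Z = (α_ (𝟙_ M) A Z).hom ≫ (λ_ (A ⊗ Z)).hom := by simp
theorem left_inv_whiskerRight (A Z : M) : (λ_ A).inv ▷ Z = (λ_ (A ⊗ Z)).inv ≫ (α_ (𝟙_ M) A Z).inv := by simp
theorem right_hom_whiskerRight (A Z : M) : (ρ_ A).hom ▷ Z = (α_ A (𝟙_ M) Z).hom ≫ A ◁ (λ_ Z).hom := by simp
theorem right_inv_whiskerRight (A Z : M) : (ρ_ A).inv ▷ Z = A ◁ (λ_ Z).inv ≫ (α_ A (𝟙_ M) Z).inv := by simp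

theorem tensor_def {A B D E : M} (f : A ⟶ B) (g : D ⟶ E) : f ⊗ₘ g = f ▷ D ≫ B ◁ g :=
  MonoidalCategory.tensorHom_def f g

/-- An identity may be checked with every tail: the tail `𝟙` suffices. -/
theorem tail_ext {A B : M} {f g : A ⟶ B} (h : ∀ Z, f ▷ Z = g ▷ Z) : f = g :=
  (whiskerRight_iff f g).1 (h _)

theorem o21_w {A B D : M} (f : A ⊗ B ⟶ D) (W Z : M) : o21 f W ▷ Z =
    (α_ A (B ⊗ W) Z).hom ≫ A ◁ (α_ B W Z).hom ≫ o21 f (W ⊗ Z) ≫ (α_ D W Z).inv := by simp [o21]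
theorem o12_w {A B D : M} (f : A ⟶ B ⊗ D) (W Z : M) : o12 f W ▷ Z =
    (α_ A W Z).hom ≫ o12 f (W ⊗ Z) ≫ B ◁ (α_ D W Z).inv ≫ (α_ B (D ⊗ W) Z).inv := by simp [o12]
theorem o22_w {A B D E : M} (f : A ⊗ B ⟶ D ⊗ E) (W Z : M) : o22 f W ▷ Z =
    (α_ A (B ⊗ W) Z).hom ≫ A ◁ (α_ B W Z).hom ≫ o22 f (W ⊗ Z) ≫ D ◁ (α_ E W Z).inv ≫
      (α_ D (E ⊗ W) Z).inv := by simp [o22]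
theorem o20_w {A B : M} (f : A ⊗ B ⟶ 𝟙_ M) (W Z : M) : o20 f W ▷ Z =
    (α_ A (B ⊗ W) Z).hom ≫ A ◁ (α_ B W Z).hom ≫ o20 f (W ⊗ Z) := by simp [o20]
theorem o10_w {A : M} (f : A ⟶ 𝟙_ M) (W Z : M) : o10 f W ▷ Z =
    (α_ A W Z).hom ≫ o10 f (W ⊗ Z) := by simp [o10]
theorem o01_w {A : M} (f : 𝟙_ M ⟶ A) (W Z : M) : o01 f W ▷ Z =
    o01 f (W ⊗ Z) ≫ (α_ A W Z).inv := by simp [o01]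

theorem wl2_hom_inv (A B : M) {X Y : M} (f : X ≅ Y) : A ◁ B ◁ f.hom ≫ A ◁ B ◁ f.inv = 𝟙 _ := by
  simp only [← whiskerLeft_comp, Iso.hom_inv_id, whiskerLeft_id]
theorem wl2_inv_hom (A B : M) {X Y : M} (f : X ≅ Y) : A ◁ B ◁ f.inv ≫ A ◁ B ◁ f.hom = 𝟙 _ := by
  simp only [← whiskerLeft_comp, Iso.inv_hom_id, whiskerLeft_id]
theorem wl3_hom_inv (A B D : M) {X Y : M} (f : X ≅ Y) :
    A ◁ B ◁ D ◁ f.hom ≫ A ◁ B ◁ D ◁ f.inv = 𝟙 _ := by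
  simp only [← whiskerLeft_comp, Iso.hom_inv_id, whiskerLeft_id]
theorem wl3_inv_hom (A B D : M) {X Y : M} (f : X ≅ Y) :
    A ◁ B ◁ D ◁ f.inv ≫ A ◁ B ◁ D ◁ f.hom = 𝟙 _ := by
  simp only [← whiskerLeft_comp, Iso.inv_hom_id, whiskerLeft_id]

theorem o21_nat_assoc : type_of% (reassoc_of% (@o21_nat M _ _)) := @(reassoc_of% (@o21_nat M _ _))
theorem o12_nat_assoc : type_of% (reassoc_of% (@o12_nat M _ _)) := @(reassoc_of% (@o12_nat M _ _))
theorem o22_nat_assoc : type_of% (reassoc_of% (@o22_nat M _ _)) := @(reassoc_of% (@o22_nat M _ _))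
theorem o20_nat_assoc : type_of% (reassoc_of% (@o20_nat M _ _)) := @(reassoc_of% (@o20_nat M _ _))
theorem o10_nat_assoc : type_of% (reassoc_of% (@o10_nat M _ _)) := @(reassoc_of% (@o10_nat M _ _))
theorem o01_nat_assoc : type_of% (reassoc_of% (@o01_nat M _ _)) := @(reassoc_of% (@o01_nat M _ _))
theorem wl2_hom_inv_assoc : type_of% (reassoc_of% (@wl2_hom_inv M _ _)) := @(reassoc_of% (@wl2_hom_inv M _ _))
theorem wl2_inv_hom_assoc : type_of% (reassoc_of% (@wl2_inv_hom M _ _)) := @(reassoc_of% (@wl2_inv_hom M _ _))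
theorem wl3_hom_inv_assoc : type_of% (reassoc_of% (@wl3_hom_inv M _ _)) := @(reassoc_of% (@wl3_hom_inv M _ _))
theorem wl3_inv_hom_assoc : type_of% (reassoc_of% (@wl3_inv_hom M _ _)) := @(reassoc_of% (@wl3_inv_hom M _ _))

/-- The interchange law, oriented so that operations on the left come first. -/
def nat_rules (M : Type u) [Category.{v} M] [MonoidalCategory M] :=
  And.intro (@o21_nat M _ _) <| And.intro (@o12_nat M _ _) <| And.intro (@o22_nat M _ _) <|
    And.intro (@o20_nat M _ _) <| And.intro (@o10_nat M _ _) <|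
    And.intro (@whisker_exchange M _ _) <| And.intro (@o21_nat_assoc M _ _) <|
    And.intro (@o12_nat_assoc M _ _) <| And.intro (@o22_nat_assoc M _ _) <|
    And.intro (@o20_nat_assoc M _ _) <| And.intro (@o10_nat_assoc M _ _)
    (@whisker_exchange_assoc M _ _)


theorem wl_sq (W : M) {A B B' D : M} {a : A ⟶ B} {b : B ⟶ D} {c : A ⟶ B'} {d : B' ⟶ D}
    (h : a ≫ b = c ≫ d) : W ◁ a ≫ W ◁ b = W ◁ c ≫ W ◁ d := by
  rw [← whiskerLeft_comp, h, whiskerLeft_comp]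
theorem wl_sq_assoc (W : M) {A B B' D : M} {a : A ⟶ B} {b : B ⟶ D} {c : A ⟶ B'} {d : B' ⟶ D}
    (h : a ≫ b = c ≫ d) {E : M} (k : W ⊗ D ⟶ E) :
    W ◁ a ≫ W ◁ b ≫ k = W ◁ c ≫ W ◁ d ≫ k := by
  rw [← whiskerLeft_comp_assoc, h, whiskerLeft_comp_assoc]

/-- The interchange law below one whiskering on the left. -/
def nat_rules1 (M : Type u) [Category.{v} M] [MonoidalCategory M] :=
  And.intro (fun W {A B D Z Z' : M} (f : A ⊗ B ⟶ D) (h : Z ⟶ Z') => wl_sq W (o21_nat f h)) <|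
  And.intro (fun W {A B D Z Z' : M} (f : A ⟶ B ⊗ D) (h : Z ⟶ Z') => wl_sq W (o12_nat f h)) <|
  And.intro (fun W {A B D E Z Z' : M} (f : A ⊗ B ⟶ D ⊗ E) (h : Z ⟶ Z') => wl_sq W (o22_nat f h)) <|
  And.intro (fun W {A B Z Z' : M} (f : A ⊗ B ⟶ 𝟙_ M) (h : Z ⟶ Z') => wl_sq W (o20_nat f h)) <|
  And.intro (fun W {A Z Z' : M} (f : A ⟶ 𝟙_ M) (h : Z ⟶ Z') => wl_sq W (o10_nat f h)) <|
  And.intro (fun W {A B Z Z' : M} (f : A ⟶ B) (h : Z ⟶ Z') => wl_sq W (whisker_exchange f h)) <|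
  And.intro (fun W {A B D Z Z' : M} (f : A ⊗ B ⟶ D) (h : Z ⟶ Z') {F : M} =>
      wl_sq_assoc W (E := F) (o21_nat f h)) <|
  And.intro (fun W {A B D Z Z' : M} (f : A ⟶ B ⊗ D) (h : Z ⟶ Z') {F : M} =>
      wl_sq_assoc W (E := F) (o12_nat f h)) <|
  And.intro (fun W {A B D E Z Z' : M} (f : A ⊗ B ⟶ D ⊗ E) (h : Z ⟶ Z') {F : M} =>
      wl_sq_assoc W (E := F) (o22_nat f h)) <|
  And.intro (fun W {A B Z Z' : M} (f : A ⊗ B ⟶ 𝟙_ M) (h : Z ⟶ Z') {F : M} =>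
      wl_sq_assoc W (E := F) (o20_nat f h)) <|
  And.intro (fun W {A Z Z' : M} (f : A ⟶ 𝟙_ M) (h : Z ⟶ Z') {F : M} =>
      wl_sq_assoc W (E := F) (o10_nat f h))
    (fun W {A B Z Z' : M} (f : A ⟶ B) (h : Z ⟶ Z') {F : M} =>
      wl_sq_assoc W (E := F) (whisker_exchange f h))

/-- The interchange law below two whiskerings on the left. -/
def nat_rules2 (M : Type u) [Category.{v} M] [MonoidalCategory M] :=
  And.intro (fun W W' {A B D Z Z' : M} (f : A ⊗ B ⟶ D) (h : Z ⟶ Z') =>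
      wl_sq W (wl_sq W' (o21_nat f h))) <|
  And.intro (fun W W' {A B D Z Z' : M} (f : A ⟶ B ⊗ D) (h : Z ⟶ Z') =>
      wl_sq W (wl_sq W' (o12_nat f h))) <|
  And.intro (fun W W' {A B D E Z Z' : M} (f : A ⊗ B ⟶ D ⊗ E) (h : Z ⟶ Z') =>
      wl_sq W (wl_sq W' (o22_nat f h))) <|
  And.intro (fun W W' {A B Z Z' : M} (f : A ⊗ B ⟶ 𝟙_ M) (h : Z ⟶ Z') =>
      wl_sq W (wl_sq W' (o20_nat f h))) <|
  And.intro (fun W W' {A Z Z' : M} (f : A ⟶ 𝟙_ M) (h : Z ⟶ Z') =>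
      wl_sq W (wl_sq W' (o10_nat f h))) <|
  And.intro (fun W W' {A B Z Z' : M} (f : A ⟶ B) (h : Z ⟶ Z') =>
      wl_sq W (wl_sq W' (whisker_exchange f h))) <|
  And.intro (fun W W' {A B D Z Z' : M} (f : A ⊗ B ⟶ D) (h : Z ⟶ Z') {F : M} =>
      wl_sq_assoc W (E := F) (wl_sq W' (o21_nat f h))) <|
  And.intro (fun W W' {A B D Z Z' : M} (f : A ⟶ B ⊗ D) (h : Z ⟶ Z') {F : M} =>
      wl_sq_assoc W (E := F) (wl_sq W' (o12_nat f h))) <|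
  And.intro (fun W W' {A B D E Z Z' : M} (f : A ⊗ B ⟶ D ⊗ E) (h : Z ⟶ Z') {F : M} =>
      wl_sq_assoc W (E := F) (wl_sq W' (o22_nat f h))) <|
  And.intro (fun W W' {A B Z Z' : M} (f : A ⊗ B ⟶ 𝟙_ M) (h : Z ⟶ Z') {F : M} =>
      wl_sq_assoc W (E := F) (wl_sq W' (o20_nat f h))) <|
  And.intro (fun W W' {A Z Z' : M} (f : A ⟶ 𝟙_ M) (h : Z ⟶ Z') {F : M} =>
      wl_sq_assoc W (E := F) (wl_sq W' (o10_nat f h)))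
    (fun W W' {A B Z Z' : M} (f : A ⟶ B) (h : Z ⟶ Z') {F : M} =>
      wl_sq_assoc W (E := F) (wl_sq W' (whisker_exchange f h)))

/-- The interchange law below three whiskerings on the left. -/
def nat_rules3 (M : Type u) [Category.{v} M] [MonoidalCategory M] :=
  And.intro (fun W W' W₃ {A B D Z Z' : M} (f : A ⊗ B ⟶ D) (h : Z ⟶ Z') =>
      wl_sq W (wl_sq W' (wl_sq W₃ (o21_nat f h)))) <|
  And.intro (fun W W' W₃ {A B D Z Z' : M} (f : A ⟶ B ⊗ D) (h : Z ⟶ Z') =>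
      wl_sq W (wl_sq W' (wl_sq W₃ (o12_nat f h)))) <|
  And.intro (fun W W' W₃ {A B D E Z Z' : M} (f : A ⊗ B ⟶ D ⊗ E) (h : Z ⟶ Z') =>
      wl_sq W (wl_sq W' (wl_sq W₃ (o22_nat f h)))) <|
  And.intro (fun W W' W₃ {A B Z Z' : M} (f : A ⊗ B ⟶ 𝟙_ M) (h : Z ⟶ Z') =>
      wl_sq W (wl_sq W' (wl_sq W₃ (o20_nat f h)))) <|
  And.intro (fun W W' W₃ {A Z Z' : M} (f : A ⟶ 𝟙_ M) (h : Z ⟶ Z') =>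
      wl_sq W (wl_sq W' (wl_sq W₃ (o10_nat f h)))) <|
  And.intro (fun W W' W₃ {A B Z Z' : M} (f : A ⟶ B) (h : Z ⟶ Z') =>
      wl_sq W (wl_sq W' (wl_sq W₃ (whisker_exchange f h)))) <|
  And.intro (fun W W' W₃ {A B D Z Z' : M} (f : A ⊗ B ⟶ D) (h : Z ⟶ Z') {F : M} =>
      wl_sq_assoc W (E := F) (wl_sq W' (wl_sq W₃ (o21_nat f h)))) <|
  And.intro (fun W W' W₃ {A B D Z Z' : M} (f : A ⟶ B ⊗ D) (h : Z ⟶ Z') {F : M} =>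
      wl_sq_assoc W (E := F) (wl_sq W' (wl_sq W₃ (o12_nat f h)))) <|
  And.intro (fun W W' W₃ {A B D E Z Z' : M} (f : A ⊗ B ⟶ D ⊗ E) (h : Z ⟶ Z') {F : M} =>
      wl_sq_assoc W (E := F) (wl_sq W' (wl_sq W₃ (o22_nat f h)))) <|
  And.intro (fun W W' W₃ {A B Z Z' : M} (f : A ⊗ B ⟶ 𝟙_ M) (h : Z ⟶ Z') {F : M} =>
      wl_sq_assoc W (E := F) (wl_sq W' (wl_sq W₃ (o20_nat f h)))) <|
  And.intro (fun W W' W₃ {A Z Z' : M} (f : A ⟶ 𝟙_ M) (h : Z ⟶ Z') {F : M} =>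
      wl_sq_assoc W (E := F) (wl_sq W' (wl_sq W₃ (o10_nat f h))))
    (fun W W' W₃ {A B Z Z' : M} (f : A ⟶ B) (h : Z ⟶ Z') {F : M} =>
      wl_sq_assoc W (E := F) (wl_sq W' (wl_sq W₃ (whisker_exchange f h))))

/-- The interchange law below four whiskerings on the left. -/
def nat_rules4 (M : Type u) [Category.{v} M] [MonoidalCategory M] :=
  And.intro (fun W W' W₃ W₄ {A B D Z Z' : M} (f : A ⊗ B ⟶ D) (h : Z ⟶ Z') =>
      wl_sq W (wl_sq W' (wl_sq W₃ (wl_sq W₄ (o21_nat f h))))) <|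
  And.intro (fun W W' W₃ W₄ {A B D Z Z' : M} (f : A ⟶ B ⊗ D) (h : Z ⟶ Z') =>
      wl_sq W (wl_sq W' (wl_sq W₃ (wl_sq W₄ (o12_nat f h))))) <|
  And.intro (fun W W' W₃ W₄ {A B D E Z Z' : M} (f : A ⊗ B ⟶ D ⊗ E) (h : Z ⟶ Z') =>
      wl_sq W (wl_sq W' (wl_sq W₃ (wl_sq W₄ (o22_nat f h))))) <|
  And.intro (fun W W' W₃ W₄ {A B Z Z' : M} (f : A ⊗ B ⟶ 𝟙_ M) (h : Z ⟶ Z') =>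
      wl_sq W (wl_sq W' (wl_sq W₃ (wl_sq W₄ (o20_nat f h))))) <|
  And.intro (fun W W' W₃ W₄ {A Z Z' : M} (f : A ⟶ 𝟙_ M) (h : Z ⟶ Z') =>
      wl_sq W (wl_sq W' (wl_sq W₃ (wl_sq W₄ (o10_nat f h))))) <|
  And.intro (fun W W' W₃ W₄ {A B Z Z' : M} (f : A ⟶ B) (h : Z ⟶ Z') =>
      wl_sq W (wl_sq W' (wl_sq W₃ (wl_sq W₄ (whisker_exchange f h))))) <|
  And.intro (fun W W' W₃ W₄ {A B D Z Z' : M} (f : A ⊗ B ⟶ D) (h : Z ⟶ Z') {F : M} =>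
      wl_sq_assoc W (E := F) (wl_sq W' (wl_sq W₃ (wl_sq W₄ (o21_nat f h))))) <|
  And.intro (fun W W' W₃ W₄ {A B D Z Z' : M} (f : A ⟶ B ⊗ D) (h : Z ⟶ Z') {F : M} =>
      wl_sq_assoc W (E := F) (wl_sq W' (wl_sq W₃ (wl_sq W₄ (o12_nat f h))))) <|
  And.intro (fun W W' W₃ W₄ {A B D E Z Z' : M} (f : A ⊗ B ⟶ D ⊗ E) (h : Z ⟶ Z') {F : M} =>
      wl_sq_assoc W (E := F) (wl_sq W' (wl_sq W₃ (wl_sq W₄ (o22_nat f h))))) <|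
  And.intro (fun W W' W₃ W₄ {A B Z Z' : M} (f : A ⊗ B ⟶ 𝟙_ M) (h : Z ⟶ Z') {F : M} =>
      wl_sq_assoc W (E := F) (wl_sq W' (wl_sq W₃ (wl_sq W₄ (o20_nat f h))))) <|
  And.intro (fun W W' W₃ W₄ {A Z Z' : M} (f : A ⟶ 𝟙_ M) (h : Z ⟶ Z') {F : M} =>
      wl_sq_assoc W (E := F) (wl_sq W' (wl_sq W₃ (wl_sq W₄ (o10_nat f h)))))
    (fun W W' W₃ W₄ {A B Z Z' : M} (f : A ⟶ B) (h : Z ⟶ Z') {F : M} =>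
      wl_sq_assoc W (E := F) (wl_sq W' (wl_sq W₃ (wl_sq W₄ (whisker_exchange f h)))))

/-- Whiskering on the right, expressed by tails; the associators are moved to the ends. -/
def fans (M : Type u) [Category.{v} M] [MonoidalCategory M] :=
  And.intro (@comp_whiskerRight M _ _) <| And.intro (@whiskerLeft_comp M _ _) <|
    And.intro (@whisker_assoc M _ _) <| And.intro (@tensor_whiskerLeft M _ _) <|
    And.intro (@whiskerRight_whiskerRight M _ _) <| And.intro (@id_whiskerRight M _ _) <|
    And.intro (@whiskerLeft_id M _ _) <| And.intro (@assoc_hom_whiskerRight M _ _) <|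
    And.intro (@assoc_inv_whiskerRight M _ _) <| And.intro (@left_hom_whiskerRight M _ _) <|
    And.intro (@left_inv_whiskerRight M _ _) <| And.intro (@right_hom_whiskerRight M _ _) <|
    And.intro (@right_inv_whiskerRight M _ _) <| And.intro (@o21_w M _ _) <|
    And.intro (@o12_w M _ _) <| And.intro (@o22_w M _ _) <| And.intro (@o20_w M _ _) <|
    And.intro (@o10_w M _ _) (@o01_w M _ _)

/-- Cancellation of isomorphisms in right-associated composites. -/
def cancels (M : Type u) [Category.{v} M] [MonoidalCategory M] :=
  And.intro (@assoc M _) <| And.intro (@id_comp M _) <|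
    And.intro (@comp_id M _) <| And.intro (@Iso.hom_inv_id M _) <|
    And.intro (@Iso.inv_hom_id M _) <| And.intro (@Iso.hom_inv_id_assoc M _) <|
    And.intro (@Iso.inv_hom_id_assoc M _) <| And.intro (@whiskerLeft_hom_inv M _ _) <|
    And.intro (@whiskerLeft_inv_hom M _ _) <| And.intro (@whiskerLeft_hom_inv_assoc M _ _) <|
    And.intro (@whiskerLeft_inv_hom_assoc M _ _) <| And.intro (@wl2_hom_inv M _ _) <|
    And.intro (@wl2_inv_hom M _ _) <| And.intro (@wl3_hom_inv M _ _) <|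
    And.intro (@wl3_inv_hom M _ _) <| And.intro (@wl2_hom_inv_assoc M _ _) <|
    And.intro (@wl2_inv_hom_assoc M _ _) <| And.intro (@wl3_hom_inv_assoc M _ _)
    (@wl3_inv_hom_assoc M _ _)

theorem tail_middle {P Q S S' Q' T : M} (f : Q ⊗ S ⟶ S' ⊗ Q') (Z : M) :
    middle P f T ▷ Z = (α_ _ _ _).hom ≫ (α_ P Q _).hom ≫ P ◁ Q ◁ (α_ S T Z).hom ≫
      P ◁ o22 f (T ⊗ Z) ≫ P ◁ S' ◁ (α_ _ _ _).inv ≫ (α_ _ _ _).inv ≫ (α_ _ _ _).inv := by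
  simp only [middle, fans, cancels, r22 f]

theorem tail_nested {P P' Q Q' : M} (ρ : P ⊗ P' ⟶ 𝟙_ M) (σ : Q ⊗ Q' ⟶ 𝟙_ M) (Z : M) :
    nested ρ σ ▷ Z = (α_ _ _ _).hom ≫ (α_ P Q _).hom ≫ P ◁ Q ◁ (α_ Q' P' Z).hom ≫
      P ◁ o20 σ (P' ⊗ Z) ≫ o20 ρ Z ≫ (λ_ Z).inv := by
  simp only [nested, fans, cancels, r20 σ, r20 ρ]


section Braided
variable [BraidedCategory M]

/-- The braiding, as an operation on the two leading factors. -/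
abbrev cross (A B Z : M) : A ⊗ (B ⊗ Z) ⟶ B ⊗ (A ⊗ Z) := o22 (β_ A B).hom Z

/-- The inverse braiding, as an operation on the two leading factors. -/
abbrev crossInv (A B Z : M) : A ⊗ (B ⊗ Z) ⟶ B ⊗ (A ⊗ Z) := o22 (β_ B A).inv Z

theorem cross_crossInv (A B Z : M) : cross A B Z ≫ crossInv B A Z = 𝟙 _ := by
  simp [o22]
theorem crossInv_cross (A B Z : M) : crossInv A B Z ≫ cross B A Z = 𝟙 _ := by
  simp [o22]

theorem cross_tensor_left (A B W Z : M) : cross (A ⊗ B) W Z =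
    (α_ A B (W ⊗ Z)).hom ≫ A ◁ cross B W Z ≫ cross A W (B ⊗ Z) ≫ W ◁ (α_ A B Z).inv := by
  simp only [cross, BraidedCategory.braiding_tensor_left_hom, o22, fans, cancels]
theorem cross_tensor_right (A B W Z : M) : cross W (A ⊗ B) Z =
    W ◁ (α_ A B Z).hom ≫ cross W A (B ⊗ Z) ≫ A ◁ cross W B Z ≫ (α_ A B (W ⊗ Z)).inv := by
  simp only [cross, BraidedCategory.braiding_tensor_right_hom, o22, fans, cancels]
theorem cross_unit_left (W Z : M) : cross (𝟙_ M) W Z = (λ_ (W ⊗ Z)).hom ≫ W ◁ (λ_ Z).inv := by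
  simp [cross, o22, braiding_tensorUnit_left]
theorem cross_unit_right (W Z : M) : cross W (𝟙_ M) Z = W ◁ (λ_ Z).hom ≫ (λ_ (W ⊗ Z)).inv := by
  simp [cross, o22, braiding_tensorUnit_right]

theorem cross_left11 {A B : M} (f : A ⟶ B) (W Z : M) :
    f ▷ (W ⊗ Z) ≫ cross B W Z = cross A W Z ≫ W ◁ f ▷ Z := by
  simp only [cross, o22, whiskerRight_tensor, assoc, Iso.hom_inv_id_assoc]
  rw [← comp_whiskerRight_assoc, BraidedCategory.braiding_naturality_left]; simp
theorem cross_right11 {A B : M} (f : A ⟶ B) (W Z : M) :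
    W ◁ f ▷ Z ≫ cross W B Z = cross W A Z ≫ f ▷ (W ⊗ Z) := by
  simp only [cross, o22, whiskerRight_tensor, associator_inv_naturality_middle_assoc]
  rw [← comp_whiskerRight_assoc, BraidedCategory.braiding_naturality_right]; simp

theorem cross_left12 {A B D : M} (f : A ⟶ B ⊗ D) (W Z : M) :
    o12 f (W ⊗ Z) ≫ B ◁ cross D W Z ≫ cross B W (D ⊗ Z) = cross A W Z ≫ W ◁ o12 f Z := by
  have := cross_left11 f W Z
  rw [cross_tensor_left] at this
  simp only [o12, whiskerLeft_comp, ← reassoc_of% this, cancels]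
theorem cross_right12 {A B D : M} (f : A ⟶ B ⊗ D) (W Z : M) :
    W ◁ o12 f Z ≫ cross W B (D ⊗ Z) ≫ B ◁ cross W D Z = cross W A Z ≫ o12 f (W ⊗ Z) := by
  have := cross_right11 f W Z
  rw [cross_tensor_right] at this
  simp only [o12, whiskerLeft_comp, ← reassoc_of% this, cancels]
theorem cross_left21 {A B D : M} (f : A ⊗ B ⟶ D) (W Z : M) :
    o21 f (W ⊗ Z) ≫ cross D W Z = A ◁ cross B W Z ≫ cross A W (B ⊗ Z) ≫ W ◁ o21 f Z := by
  have := cross_left11 f W Z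
  rw [cross_tensor_left] at this
  simp only [o21, whiskerLeft_comp, this, cancels]
theorem cross_left20 {A B : M} (f : A ⊗ B ⟶ 𝟙_ M) (W Z : M) :
    A ◁ cross B W Z ≫ cross A W (B ⊗ Z) ≫ W ◁ o20 f Z = o20 f (W ⊗ Z) := by
  have := cross_left11 f W Z
  rw [cross_tensor_left, cross_unit_left] at this
  have h2 := (α_ A B (W ⊗ Z)).inv ≫= this =≫ W ◁ (λ_ Z).hom
  simp only [cancels] at h2
  simpa only [o20, whiskerLeft_comp, cancels] using h2.symm
theorem cross_right20 {A B : M} (f : A ⊗ B ⟶ 𝟙_ M) (W Z : M) :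
    cross W A (B ⊗ Z) ≫ A ◁ cross W B Z ≫ o20 f (W ⊗ Z) = W ◁ o20 f Z := by
  have := cross_right11 f W Z
  rw [cross_tensor_right, cross_unit_right] at this
  have h2 := W ◁ (α_ A B Z).inv ≫= this =≫ (λ_ (W ⊗ Z)).hom
  simp only [cancels] at h2
  simpa only [o20, whiskerLeft_comp, cancels] using h2.symm
theorem cross_left10 {A : M} (f : A ⟶ 𝟙_ M) (W Z : M) :
    cross A W Z ≫ W ◁ o10 f Z = o10 f (W ⊗ Z) := by
  have := cross_left11 f W Z =≫ W ◁ (λ_ Z).hom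
  rw [cross_unit_left] at this
  simp only [cancels] at this
  simpa only [o10, whiskerLeft_comp, cancels] using this.symm
theorem cross_right10 {A : M} (f : A ⟶ 𝟙_ M) (W Z : M) :
    cross W A Z ≫ o10 f (W ⊗ Z) = W ◁ o10 f Z := by
  have := cross_right11 f W Z =≫ (λ_ (W ⊗ Z)).hom
  rw [cross_unit_right] at this
  simp only [cancels] at this
  simpa only [o10, whiskerLeft_comp, cancels] using this.symm
theorem cross_left01 {A : M} (f : 𝟙_ M ⟶ A) (W Z : M) :
    o01 f (W ⊗ Z) ≫ cross A W Z = W ◁ o01 f Z := by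
  have := (λ_ _).inv ≫= cross_left11 f W Z
  rw [cross_unit_left] at this
  simp only [cancels] at this
  simpa only [o01, whiskerLeft_comp, cancels] using this
theorem cross_right01 {A : M} (f : 𝟙_ M ⟶ A) (W Z : M) :
    W ◁ o01 f Z ≫ cross W A Z = o01 f (W ⊗ Z) := by
  have := W ◁ (λ_ Z).inv ≫= cross_right11 f W Z
  rw [cross_unit_right] at this
  simp only [cancels] at this
  simpa only [o01, whiskerLeft_comp, cancels] using this

end Braided
end Tail

/-! ### The axioms in terms of tails -/

section Comodules
variable {M : Type u} [Category.{v} M] [MonoidalCategory M]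

theorem wl (W : M) {A B : M} {f g : A ⟶ B} (h : f = g) : W ◁ f = W ◁ g := h ▸ rfl

theorem whisk {A B : M} {f g : A ⟶ B} (h : f = g) (Z : M) : f ▷ Z = g ▷ Z := h ▸ rfl

theorem o22_ext {A B D E : M} {f g : A ⊗ B ⟶ D ⊗ E} (h : ∀ Z, o22 f Z = o22 g Z) : f = g :=
  tail_ext fun Z => by rw [r22, r22, h]
theorem o21_ext {A B D : M} {f g : A ⊗ B ⟶ D} (h : ∀ Z, o21 f Z = o21 g Z) : f = g :=
  tail_ext fun Z => by rw [r21, r21, h]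
theorem o12_ext {A B D : M} {f g : A ⟶ B ⊗ D} (h : ∀ Z, o12 f Z = o12 g Z) : f = g :=
  tail_ext fun Z => by rw [r12, r12, h]
theorem o20_ext {A B : M} {f g : A ⊗ B ⟶ 𝟙_ M} (h : ∀ Z, o20 f Z = o20 g Z) : f = g :=
  tail_ext fun Z => by rw [r20, r20, h]

/-- Coassociativity of a coaction. -/
theorem tail_coassoc_iff {A V : M} (δ : V ⟶ V ⊗ A) (Δ : A ⟶ A ⊗ A) :
    δ ≫ V ◁ Δ = δ ≫ δ ▷ A ≫ (α_ V A A).hom ↔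
      ∀ Z, o12 δ Z ≫ V ◁ o12 Δ Z = o12 δ Z ≫ o12 δ (A ⊗ Z) := by
  constructor
  · intro h Z
    have := whisk h Z =≫ ((α_ V (A ⊗ A) Z).hom ≫ V ◁ (α_ A A Z).hom)
    simpa only [fans, cancels, r12 δ, r12 Δ, nat_rules] using this
  · intro h
    refine tail_ext fun Z => ?_
    simp only [fans, cancels, r12 δ, r12 Δ, nat_rules]
    rw [reassoc_of% h]

theorem tail_counit_iff {A V : M} (δ : V ⟶ V ⊗ A) (ε : A ⟶ 𝟙_ M) :
    δ ≫ V ◁ ε = (ρ_ V).inv ↔ ∀ Z, o12 δ Z ≫ V ◁ o10 ε Z = 𝟙 _ := by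
  constructor
  · intro h Z
    have := whisk h Z =≫ ((α_ V (𝟙_ M) Z).hom ≫ V ◁ (λ_ Z).hom)
    simpa only [fans, cancels, r12 δ, r10 ε, nat_rules] using this
  · intro h
    refine tail_ext fun Z => ?_
    simp only [fans, cancels, r12 δ, r10 ε, nat_rules]
    rw [reassoc_of% h]

theorem tail_counit_left_iff {A V : M} (δ : V ⟶ A ⊗ V) (ε : A ⟶ 𝟙_ M) :
    δ ≫ ε ▷ V = (λ_ V).inv ↔ ∀ Z, o12 δ Z ≫ o10 ε (V ⊗ Z) = 𝟙 _ := by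
  constructor
  · intro h Z
    have := whisk h Z =≫ ((α_ (𝟙_ M) V Z).hom ≫ (λ_ (V ⊗ Z)).hom)
    simpa only [fans, cancels, r12 δ, r10 ε, nat_rules] using this
  · intro h
    refine tail_ext fun Z => ?_
    simp only [fans, cancels, r12 δ, r10 ε, nat_rules]
    rw [reassoc_of% h]

theorem tail_assoc_iff {A : M} (μ : A ⊗ A ⟶ A) :
    μ ▷ A ≫ μ = (α_ A A A).hom ≫ A ◁ μ ≫ μ ↔
      ∀ Z, o21 μ (A ⊗ Z) ≫ o21 μ Z = A ◁ o21 μ Z ≫ o21 μ Z := by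
  constructor
  · intro h Z
    have := ((α_ A A (A ⊗ Z)).inv ≫ (α_ (A ⊗ A) A Z).inv) ≫= whisk h Z
    simpa only [fans, cancels, r21 μ, nat_rules] using this
  · intro h
    refine tail_ext fun Z => ?_
    simp only [fans, cancels, r21 μ, nat_rules]
    rw [h]

theorem tail_one_mul_iff {A : M} (η : 𝟙_ M ⟶ A) (μ : A ⊗ A ⟶ A) :
    η ▷ A ≫ μ = (λ_ A).hom ↔ ∀ Z, o01 η (A ⊗ Z) ≫ o21 μ Z = 𝟙 _ := by
  constructor
  · intro h Z
    have := ((λ_ (A ⊗ Z)).inv ≫ (α_ (𝟙_ M) A Z).inv) ≫= whisk h Z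
    simpa only [fans, cancels, r21 μ, r01 η, nat_rules] using this
  · intro h
    refine tail_ext fun Z => ?_
    simp only [fans, cancels, r21 μ, r01 η, nat_rules]
    rw [h, comp_id]

theorem tail_mul_one_iff {A : M} (η : 𝟙_ M ⟶ A) (μ : A ⊗ A ⟶ A) :
    A ◁ η ≫ μ = (ρ_ A).hom ↔ ∀ Z, A ◁ o01 η Z ≫ o21 μ Z = 𝟙 _ := by
  constructor
  · intro h Z
    have := (A ◁ (λ_ Z).inv ≫ (α_ A (𝟙_ M) Z).inv) ≫= whisk h Z
    simpa only [fans, cancels, r21 μ, r01 η, nat_rules] using this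
  · intro h
    refine tail_ext fun Z => ?_
    simp only [fans, cancels, r21 μ, r01 η, nat_rules]
    rw [h, comp_id]

theorem isAlgebra_iff {A : M} (η : 𝟙_ M ⟶ A) (μ : A ⊗ A ⟶ A) : IsAlgebra η μ ↔
    (∀ Z, o01 η (A ⊗ Z) ≫ o21 μ Z = 𝟙 _) ∧ (∀ Z, A ◁ o01 η Z ≫ o21 μ Z = 𝟙 _) ∧
      ∀ Z, o21 μ (A ⊗ Z) ≫ o21 μ Z = A ◁ o21 μ Z ≫ o21 μ Z := by
  rw [← tail_one_mul_iff, ← tail_mul_one_iff, ← tail_assoc_iff]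
  constructor
  · rintro ⟨h, rfl, rfl⟩
    exact ⟨h.one_mul, h.mul_one, h.mul_assoc⟩
  · rintro ⟨h1, h2, h3⟩
    exact ⟨{ one := η, mul := μ, one_mul := h1, mul_one := h2, mul_assoc := h3 }, rfl, rfl⟩

theorem isCoalgebra_iff {A : M} (ε : A ⟶ 𝟙_ M) (Δ : A ⟶ A ⊗ A) : IsCoalgebra ε Δ ↔
    (∀ Z, o12 Δ Z ≫ o10 ε (A ⊗ Z) = 𝟙 _) ∧ (∀ Z, o12 Δ Z ≫ A ◁ o10 ε Z = 𝟙 _) ∧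
      ∀ Z, o12 Δ Z ≫ A ◁ o12 Δ Z = o12 Δ Z ≫ o12 Δ (A ⊗ Z) := by
  rw [← tail_counit_left_iff, ← tail_counit_iff, ← tail_coassoc_iff]
  constructor
  · rintro ⟨h, rfl, rfl⟩
    exact ⟨h.counit_comul, h.comul_counit, h.comul_assoc⟩
  · rintro ⟨h1, h2, h3⟩
    exact ⟨{ counit := ε, comul := Δ, counit_comul := h1, comul_counit := h2,
             comul_assoc := h3 }, rfl, rfl⟩

/-- Multiplicativity of the comultiplication. -/
theorem tail_mul_comul_iff {A : M} (c : A ⊗ A ⟶ A ⊗ A) (μ : A ⊗ A ⟶ A) (Δ : A ⟶ A ⊗ A) :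
    μ ≫ Δ = (Δ ⊗ₘ Δ) ≫ middle A c A ≫ (μ ⊗ₘ μ) ↔
    ∀ Z, o21 μ Z ≫ o12 Δ Z = o12 Δ (A ⊗ Z) ≫ A ◁ A ◁ o12 Δ Z ≫ A ◁ o22 c (A ⊗ Z) ≫
      o21 μ (A ⊗ (A ⊗ Z)) ≫ A ◁ o21 μ Z := by
  constructor
  · intro h Z
    have := (α_ _ _ _).inv ≫= whisk h Z =≫ (α_ _ _ _).hom
    simpa only [tensorHom_def', fans, cancels, tail_middle, nat_rules, r21 μ, r12 Δ]
      using this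
  · intro h
    refine tail_ext fun Z => ?_
    simp only [tensorHom_def', fans, cancels, tail_middle, nat_rules, r21 μ, r12 Δ]
    rw [reassoc_of% h]

theorem tail_mul_counit_iff {A : M} (μ : A ⊗ A ⟶ A) (ε : A ⟶ 𝟙_ M) :
    μ ≫ ε = (ε ⊗ₘ ε) ≫ (λ_ (𝟙_ M)).hom ↔
      ∀ Z, o21 μ Z ≫ o10 ε Z = o10 ε (A ⊗ Z) ≫ o10 ε Z := by
  constructor
  · intro h Z
    have := (α_ _ _ _).inv ≫= whisk h Z =≫ (λ_ _).hom
    rw [tensor_def] at this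
    simp only [fans, cancels, nat_rules, r21 μ, r10 ε] at this
    simpa [o10_nat] using this
  · intro h
    refine tail_ext fun Z => ?_
    rw [tensor_def]
    simp only [fans, cancels, nat_rules, r21 μ, r10 ε]
    rw [reassoc_of% h]
    simp [o10_nat]


theorem tail_one_comul_iff {A : M} (η : 𝟙_ M ⟶ A) (Δ : A ⟶ A ⊗ A) :
    η ≫ Δ = (λ_ (𝟙_ M)).inv ≫ (η ⊗ₘ η) ↔
      ∀ Z, o01 η Z ≫ o12 Δ Z = o01 η Z ≫ A ◁ o01 η Z := by
  constructor
  · intro h Z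
    have := (λ_ _).inv ≫= whisk h Z =≫ (α_ _ _ _).hom
    rw [tensor_def] at this
    simp only [fans, cancels, nat_rules, r01 η, r12 Δ] at this
    simpa only [o01_nat_assoc, cancels] using this
  · intro h
    refine tail_ext fun Z => ?_
    rw [tensor_def]
    simp only [fans, cancels, nat_rules, r01 η, r12 Δ]
    rw [reassoc_of% h]
    simp only [o01_nat_assoc, cancels]

theorem tail_one_counit_iff {A : M} (η : 𝟙_ M ⟶ A) (ε : A ⟶ 𝟙_ M) :
    η ≫ ε = 𝟙 (𝟙_ M) ↔ ∀ Z, o01 η Z ≫ o10 ε Z = 𝟙 Z := by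
  constructor
  · intro h Z
    have := (λ_ _).inv ≫= whisk h Z =≫ (λ_ _).hom
    simpa only [fans, cancels, nat_rules, r01 η, r10 ε] using this
  · intro h
    refine tail_ext fun Z => ?_
    simp only [fans, cancels, nat_rules, r01 η, r10 ε]
    rw [reassoc_of% h, Iso.hom_inv_id]

theorem isBialgebra_iff {A : M} (c : A ⊗ A ⟶ A ⊗ A) (H : BialgData A) : IsBialgebra c H ↔
    IsAlgebra H.one H.mul ∧ IsCoalgebra H.counit H.comul ∧
    (∀ Z, o21 H.mul Z ≫ o12 H.comul Z = o12 H.comul (A ⊗ Z) ≫ A ◁ A ◁ o12 H.comul Z ≫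
      A ◁ o22 c (A ⊗ Z) ≫ o21 H.mul (A ⊗ (A ⊗ Z)) ≫ A ◁ o21 H.mul Z) ∧
    (∀ Z, o01 H.one Z ≫ o12 H.comul Z = o01 H.one Z ≫ A ◁ o01 H.one Z) ∧
    (∀ Z, o21 H.mul Z ≫ o10 H.counit Z = o10 H.counit (A ⊗ Z) ≫ o10 H.counit Z) ∧
    (∀ Z, o01 H.one Z ≫ o10 H.counit Z = 𝟙 Z) := by
  rw [← tail_mul_comul_iff, ← tail_one_comul_iff, ← tail_mul_counit_iff, ← tail_one_counit_iff]
  exact ⟨fun ⟨a, b, c, d, e, f⟩ => ⟨a, b, c, d, e, f⟩, fun ⟨a, b, c, d, e, f⟩ => ⟨a, b, c, d, e, f⟩⟩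

theorem tail_pairing_mul_left_iff {A H : M} (μ : A ⊗ A ⟶ A) (Δ : H ⟶ H ⊗ H) (ρ : A ⊗ H ⟶ 𝟙_ M) :
    μ ▷ H ≫ ρ = (A ⊗ A) ◁ Δ ≫ nested ρ ρ ↔ ∀ Z, o21 μ (H ⊗ Z) ≫ o20 ρ Z =
      A ◁ A ◁ o12 Δ Z ≫ A ◁ o20 ρ (H ⊗ Z) ≫ o20 ρ Z := by
  constructor
  · intro h Z
    have := ((α_ _ _ _).inv ≫ (α_ _ _ _).inv) ≫= whisk h Z =≫ (λ_ _).hom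
    simpa only [tail_nested, fans, cancels, nat_rules, r21 μ, r12 Δ, r20 ρ] using this
  · intro h
    refine tail_ext fun Z => ?_
    simp only [tail_nested, fans, cancels, nat_rules, r21 μ, r12 Δ, r20 ρ]
    rw [reassoc_of% h]

theorem tail_pairing_mul_right_iff {A H : M} (μ : H ⊗ H ⟶ H) (Δ : A ⟶ A ⊗ A) (ρ : A ⊗ H ⟶ 𝟙_ M) :
    A ◁ μ ≫ ρ = Δ ▷ (H ⊗ H) ≫ nested ρ ρ ↔ ∀ Z, A ◁ o21 μ Z ≫ o20 ρ Z =
      o12 Δ (H ⊗ H ⊗ Z) ≫ A ◁ o20 ρ (H ⊗ Z) ≫ o20 ρ Z := by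
  constructor
  · intro h Z
    have := (A ◁ (α_ _ _ _).inv ≫ (α_ _ _ _).inv) ≫= whisk h Z =≫ (λ_ _).hom
    simpa only [tail_nested, fans, cancels, nat_rules, r21 μ, r12 Δ, r20 ρ] using this
  · intro h
    refine tail_ext fun Z => ?_
    simp only [tail_nested, fans, cancels, nat_rules, r21 μ, r12 Δ, r20 ρ]
    rw [reassoc_of% h, o12_nat_assoc]

theorem tail_pairing_one_left_iff {A H : M} (η : 𝟙_ M ⟶ A) (ε : H ⟶ 𝟙_ M) (ρ : A ⊗ H ⟶ 𝟙_ M) :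
    η ▷ H ≫ ρ = (λ_ H).hom ≫ ε ↔ ∀ Z, o01 η (H ⊗ Z) ≫ o20 ρ Z = o10 ε Z := by
  constructor
  · intro h Z
    have := ((λ_ _).inv ≫ (α_ _ _ _).inv) ≫= whisk h Z =≫ (λ_ _).hom
    simpa only [fans, cancels, nat_rules, r01 η, r10 ε, r20 ρ] using this
  · intro h
    refine tail_ext fun Z => ?_
    simp only [fans, cancels, nat_rules, r01 η, r10 ε, r20 ρ]
    rw [reassoc_of% h]

theorem tail_pairing_one_right_iff {A H : M} (η : 𝟙_ M ⟶ H) (ε : A ⟶ 𝟙_ M) (ρ : A ⊗ H ⟶ 𝟙_ M) :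
    A ◁ η ≫ ρ = (ρ_ A).hom ≫ ε ↔ ∀ Z, A ◁ o01 η Z ≫ o20 ρ Z = o10 ε Z := by
  constructor
  · intro h Z
    have := (A ◁ (λ_ _).inv ≫ (α_ _ _ _).inv) ≫= whisk h Z =≫ (λ_ _).hom
    simpa only [fans, cancels, nat_rules, r01 η, r10 ε, r20 ρ] using this
  · intro h
    refine tail_ext fun Z => ?_
    simp only [fans, cancels, nat_rules, r01 η, r10 ε, r20 ρ]
    rw [reassoc_of% h, o10_nat_assoc, Iso.hom_inv_id, comp_id]

theorem isBialgebraPairing_iff {A H : M} (a : BialgData A) (h : BialgData H) (ρ : A ⊗ H ⟶ 𝟙_ M) :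
    IsBialgebraPairing a h ρ ↔
    (∀ Z, o21 a.mul (H ⊗ Z) ≫ o20 ρ Z = A ◁ A ◁ o12 h.comul Z ≫ A ◁ o20 ρ (H ⊗ Z) ≫ o20 ρ Z) ∧
    (∀ Z, A ◁ o21 h.mul Z ≫ o20 ρ Z = o12 a.comul (H ⊗ H ⊗ Z) ≫ A ◁ o20 ρ (H ⊗ Z) ≫ o20 ρ Z) ∧
    (∀ Z, o01 a.one (H ⊗ Z) ≫ o20 ρ Z = o10 h.counit Z) ∧
    (∀ Z, A ◁ o01 h.one Z ≫ o20 ρ Z = o10 a.counit Z) := by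
  rw [← tail_pairing_mul_left_iff, ← tail_pairing_mul_right_iff, ← tail_pairing_one_left_iff,
    ← tail_pairing_one_right_iff]
  exact ⟨fun ⟨a, b, c, d⟩ => ⟨a, b, c, d⟩, fun ⟨a, b, c, d⟩ => ⟨a, b, c, d⟩⟩

theorem tail_convolution {A : M} (c : A ⊗ A ⟶ A ⊗ A) (Δ : A ⟶ A ⊗ A) (ρ σ : A ⊗ A ⟶ 𝟙_ M)
    (Z : M) : o20 (convolution c Δ ρ σ) Z = o12 Δ (A ⊗ Z) ≫ A ◁ A ◁ o12 Δ Z ≫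
      A ◁ o22 c (A ⊗ Z) ≫ o20 ρ (A ⊗ A ⊗ Z) ≫ o20 σ Z := by
  rw [o20, convolution, tensor_def ρ σ]
  simp only [tensorHom_def', fans, cancels, tail_middle, nat_rules, r20 ρ, r20 σ, r12 Δ]
  simp [o20_nat_assoc]

theorem tail_counit_counit {A H : M} (ε : A ⟶ 𝟙_ M) (ε' : H ⟶ 𝟙_ M) (Z : M) :
    o20 ((ε ⊗ₘ ε') ≫ (λ_ (𝟙_ M)).hom) Z = o10 ε (H ⊗ Z) ≫ o10 ε' Z := by
  rw [o20, tensor_def]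
  simp only [fans, cancels, nat_rules, r10 ε, r10 ε']
  simp [o10_nat_assoc]

theorem tail_convolution_eq_iff {A : M} (c : A ⊗ A ⟶ A ⊗ A) (Δ : A ⟶ A ⊗ A) (ε : A ⟶ 𝟙_ M)
    (ρ σ : A ⊗ A ⟶ 𝟙_ M) : convolution c Δ ρ σ = (ε ⊗ₘ ε) ≫ (λ_ (𝟙_ M)).hom ↔
      ∀ Z, o12 Δ (A ⊗ Z) ≫ A ◁ A ◁ o12 Δ Z ≫ A ◁ o22 c (A ⊗ Z) ≫ o20 ρ (A ⊗ A ⊗ Z) ≫ o20 σ Z =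
        o10 ε (A ⊗ Z) ≫ o10 ε Z := by
  constructor
  · intro h Z
    rw [← tail_convolution, h, tail_counit_counit]
  · intro h
    refine o20_ext fun Z => ?_
    rw [tail_convolution, h, tail_counit_counit]

/-- The quasi-commutativity axiom; `ν` is the multiplication opposite to that of `Ā`. -/
theorem tail_quasi_comm_iff {A : M} (c : A ⊗ A ⟶ A ⊗ A) (Δ : A ⟶ A ⊗ A) (ρ : A ⊗ A ⟶ 𝟙_ M)
    (ν μ : A ⊗ A ⟶ A) :
    (Δ ⊗ₘ Δ) ≫ middle A c A ≫ (ν ⊗ₘ ρ) ≫ (ρ_ A).hom =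
      (Δ ⊗ₘ Δ) ≫ middle A c A ≫ (ρ ⊗ₘ μ) ≫ (λ_ A).hom ↔
    ∀ Z, o12 Δ (A ⊗ Z) ≫ A ◁ A ◁ o12 Δ Z ≫ A ◁ o22 c (A ⊗ Z) ≫ o21 ν (A ⊗ A ⊗ Z) ≫
        A ◁ o20 ρ Z =
      o12 Δ (A ⊗ Z) ≫ A ◁ A ◁ o12 Δ Z ≫ A ◁ o22 c (A ⊗ Z) ≫ o20 ρ (A ⊗ A ⊗ Z) ≫ o21 μ Z := by
  have h1 : ∀ Z, o21 ((Δ ⊗ₘ Δ) ≫ middle A c A ≫ (ν ⊗ₘ ρ) ≫ (ρ_ A).hom) Z =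
      o12 Δ (A ⊗ Z) ≫ A ◁ A ◁ o12 Δ Z ≫ A ◁ o22 c (A ⊗ Z) ≫ o21 ν (A ⊗ A ⊗ Z) ≫
        A ◁ o20 ρ Z := by
    intro Z
    rw [o21]
    simp only [tensorHom_def', fans, cancels, tail_middle, nat_rules, r20 ρ, r21 ν, r12 Δ]
  have h2 : ∀ Z, o21 ((Δ ⊗ₘ Δ) ≫ middle A c A ≫ (ρ ⊗ₘ μ) ≫ (λ_ A).hom) Z =
      o12 Δ (A ⊗ Z) ≫ A ◁ A ◁ o12 Δ Z ≫ A ◁ o22 c (A ⊗ Z) ≫ o20 ρ (A ⊗ A ⊗ Z) ≫ o21 μ Z := by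
    intro Z
    rw [o21, tensor_def ρ μ]
    simp only [tensorHom_def', fans, cancels, tail_middle, nat_rules, r20 ρ, r21 μ, r12 Δ]
    simp [o20_nat_assoc]
  constructor
  · intro h Z
    rw [← h1, h, h2]
  · intro h
    refine o21_ext fun Z => ?_
    rw [h1, h2, h]

theorem tail_action {A V : M} (δ : V ⟶ V ⊗ A) (ρ : A ⊗ A ⟶ 𝟙_ M) (Z : M) :
    o21 (action δ ρ) Z = o12 δ (A ⊗ Z) ≫ V ◁ o20 ρ Z := by
  rw [o21, action]
  simp only [fans, cancels, nat_rules, r20 ρ, r12 δ]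

theorem tail_comoduleHom_iff {A V W : M} (δ : V ⟶ V ⊗ A) (δ' : W ⟶ W ⊗ A) (f : V ⟶ W) :
    IsComoduleHom δ δ' f ↔ ∀ Z, f ▷ Z ≫ o12 δ' Z = o12 δ Z ≫ f ▷ (A ⊗ Z) := by
  constructor
  · intro h Z
    have := whisk h Z =≫ (α_ _ _ _).hom
    simpa only [fans, cancels, nat_rules, r12 δ, r12 δ'] using this
  · intro h
    refine tail_ext fun Z => ?_
    simp only [fans, cancels, nat_rules, r12 δ, r12 δ']
    rw [reassoc_of% h]

/-- `A ⊗ V ⟶ V ⊗ A`: coact on `V`, and multiply `A` from the left, by `μ`, after moving it past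
`V` by `ψ`. -/
def coactMul {A V : M} (ψ : A ⊗ V ⟶ V ⊗ A) (μ : A ⊗ A ⟶ A) (δ : V ⟶ V ⊗ A) : A ⊗ V ⟶ V ⊗ A :=
  A ◁ δ ≫ (α_ A V A).inv ≫ ψ ▷ A ≫ (α_ V A A).hom ≫ V ◁ μ

theorem tail_coactMul {A V : M} (ψ : A ⊗ V ⟶ V ⊗ A) (μ : A ⊗ A ⟶ A) (δ : V ⟶ V ⊗ A) (Z : M) :
    o22 (coactMul ψ μ δ) Z = A ◁ o12 δ Z ≫ o22 ψ (A ⊗ Z) ≫ V ◁ o21 μ Z := by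
  rw [o22, coactMul]
  simp only [fans, cancels, nat_rules, r12 δ, r22 ψ, r21 μ]

section Braided
variable [BraidedCategory M]

/-- Coact on both of the leading factors, and move the first `A` past the second factor. -/
def bothCoact {A V W : M} (δ : V ⟶ V ⊗ A) (δ' : W ⟶ W ⊗ A) (Z : M) :
    V ⊗ (W ⊗ Z) ⟶ V ⊗ (W ⊗ (A ⊗ (A ⊗ Z))) :=
  o12 δ (W ⊗ Z) ≫ V ◁ A ◁ o12 δ' Z ≫ V ◁ cross A W (A ⊗ Z)

theorem bothCoact_nat {A V W Z Z' : M} (δ : V ⟶ V ⊗ A) (δ' : W ⟶ W ⊗ A) (h : Z ⟶ Z') :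
    V ◁ W ◁ h ≫ bothCoact δ δ' Z' = bothCoact δ δ' Z ≫ V ◁ W ◁ A ◁ A ◁ h := by
  simp only [bothCoact, assoc, nat_rules, nat_rules1, nat_rules2]

theorem tail_tensorCoaction {A V W : M} (B : PairData A) (δ : V ⟶ V ⊗ A) (δ' : W ⟶ W ⊗ A) (Z : M) :
    o12 (tensorCoaction B δ δ') Z = (α_ V W Z).hom ≫ bothCoact δ δ' Z ≫ V ◁ W ◁ o21 B.mul Z ≫
      (α_ V W (A ⊗ Z)).inv := by
  rw [o12, tensorCoaction, bothCoact]
  simp only [tensorHom_def', fans, cancels, tail_middle, nat_rules, r21 B.mul, r12 δ, r12 δ']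

theorem tail_comoduleBraiding {A V W : M} (ρ : A ⊗ A ⟶ 𝟙_ M) (δ : V ⟶ V ⊗ A) (δ' : W ⟶ W ⊗ A)
    (Z : M) : o22 (comoduleBraiding ρ δ δ') Z =
      V ◁ o12 δ' Z ≫ cross V W (A ⊗ Z) ≫ W ◁ o12 δ (A ⊗ Z) ≫ W ◁ V ◁ o20 ρ Z := by
  rw [o22, comoduleBraiding]
  simp only [fans, cancels, nat_rules, r12 δ', r22 (β_ V W).hom, r21 (action δ ρ),
    tail_action]

end Braided
end Comodules

/-! ### Comodules with separating coefficients -/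

section CrossInv
variable {M : Type u} [Category.{v} M] [MonoidalCategory M] [BraidedCategory M]
theorem crossInv_left11 {A B : M} (f : A ⟶ B) (W Z : M) :
    f ▷ (W ⊗ Z) ≫ crossInv B W Z = crossInv A W Z ≫ W ◁ f ▷ Z :=
  letI := reverseBraiding M; cross_left11 f W Z
theorem crossInv_right11 {A B : M} (f : A ⟶ B) (W Z : M) :
    W ◁ f ▷ Z ≫ crossInv W B Z = crossInv W A Z ≫ f ▷ (W ⊗ Z) :=
  letI := reverseBraiding M; cross_right11 f W Z
theorem crossInv_left12 {A B D : M} (f : A ⟶ B ⊗ D) (W Z : M) :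
    o12 f (W ⊗ Z) ≫ B ◁ crossInv D W Z ≫ crossInv B W (D ⊗ Z) = crossInv A W Z ≫ W ◁ o12 f Z :=
  letI := reverseBraiding M; cross_left12 f W Z
theorem crossInv_right12 {A B D : M} (f : A ⟶ B ⊗ D) (W Z : M) :
    W ◁ o12 f Z ≫ crossInv W B (D ⊗ Z) ≫ B ◁ crossInv W D Z = crossInv W A Z ≫ o12 f (W ⊗ Z) :=
  letI := reverseBraiding M; cross_right12 f W Z
theorem crossInv_left20 {A B : M} (f : A ⊗ B ⟶ 𝟙_ M) (W Z : M) :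
    A ◁ crossInv B W Z ≫ crossInv A W (B ⊗ Z) ≫ W ◁ o20 f Z = o20 f (W ⊗ Z) :=
  letI := reverseBraiding M; cross_left20 f W Z
end CrossInv
section Separation
variable {M : Type u} [Category.{v} M] [MonoidalCategory M] [BraidedCategory M]

/-- Morphisms out of `A ⊗ W` are determined by their values on the coefficients of `T`. -/
def Separates {T A : M} (δ : T ⟶ T ⊗ A) : Prop :=
  ∀ ⦃W Z : M⦄ (f g : A ⊗ W ⟶ Z), o12 δ W ≫ T ◁ f = o12 δ W ≫ T ◁ g → f = g

variable {T A : M} {δ : T ⟶ T ⊗ A}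

theorem Separates.under (h : Separates δ) {U W Z : M} (f g : U ⊗ (A ⊗ W) ⟶ Z)
    (e : U ◁ o12 δ W ≫ cross U T (A ⊗ W) ≫ T ◁ f = U ◁ o12 δ W ≫ cross U T (A ⊗ W) ≫ T ◁ g) :
    f = g := by
  have key : o12 δ (U ⊗ W) ≫ T ◁ crossInv A U W =
      crossInv T U W ≫ U ◁ o12 δ W ≫ cross U T (A ⊗ W) := by
    have h1 := cross_right12 δ U W
    have h2 := crossInv T U W ≫= h1 =≫ T ◁ crossInv A U W
    simp only [assoc] at h2
    rw [reassoc_of% (crossInv_cross T U W)] at h2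
    simpa only [assoc, ← whiskerLeft_comp, cross_crossInv, whiskerLeft_id,
      comp_id] using h2.symm
  have h3 : crossInv A U W ≫ f = crossInv A U W ≫ g := by
    apply h
    simp only [whiskerLeft_comp, reassoc_of% key, e]
  have h4 := cross U A W ≫= h3
  rwa [reassoc_of% (cross_crossInv U A W), reassoc_of% (cross_crossInv U A W)] at h4

theorem Separates.under_inv (h : Separates δ) {U W Z : M} (f g : U ⊗ (A ⊗ W) ⟶ Z)
    (e : U ◁ o12 δ W ≫ crossInv U T (A ⊗ W) ≫ T ◁ f =
      U ◁ o12 δ W ≫ crossInv U T (A ⊗ W) ≫ T ◁ g) : f = g :=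
  @Separates.under M _ _ (reverseBraiding M) _ _ _ h _ _ _ f g e

theorem Separates.under₂ (h : Separates δ) {U U' W Z : M} (f g : U ⊗ (U' ⊗ (A ⊗ W)) ⟶ Z)
    (e : U ◁ U' ◁ o12 δ W ≫ U ◁ cross U' T (A ⊗ W) ≫ cross U T (U' ⊗ A ⊗ W) ≫ T ◁ f =
      U ◁ U' ◁ o12 δ W ≫ U ◁ cross U' T (A ⊗ W) ≫ cross U T (U' ⊗ A ⊗ W) ≫ T ◁ g) :
    f = g := by
  have := h.under ((α_ U U' _).hom ≫ f) ((α_ U U' _).hom ≫ g) (by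
    simp only [cross_tensor_left, fans, cancels, e])
  simpa using this

theorem Separates.two (h : Separates δ) {W Z : M} (f g : A ⊗ (A ⊗ W) ⟶ Z)
    (e : bothCoact δ δ W ≫ T ◁ T ◁ f = bothCoact δ δ W ≫ T ◁ T ◁ g) : f = g := by
  apply h.under
  apply h
  simpa only [bothCoact, assoc, whiskerLeft_comp] using e

theorem Separates.three (h : Separates δ) {W Z : M} (f g : A ⊗ (A ⊗ (A ⊗ W)) ⟶ Z)
    (e : bothCoact δ δ (T ⊗ W) ≫ T ◁ T ◁ A ◁ A ◁ o12 δ W ≫ T ◁ T ◁ A ◁ cross A T (A ⊗ W) ≫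
        T ◁ T ◁ cross A T (A ⊗ A ⊗ W) ≫ T ◁ T ◁ T ◁ f =
      bothCoact δ δ (T ⊗ W) ≫ T ◁ T ◁ A ◁ A ◁ o12 δ W ≫ T ◁ T ◁ A ◁ cross A T (A ⊗ W) ≫
        T ◁ T ◁ cross A T (A ⊗ A ⊗ W) ≫ T ◁ T ◁ T ◁ g) : f = g := by
  apply h.under₂
  apply h.two
  simpa only [assoc, whiskerLeft_comp] using e


/-- The defining condition of the objects of `C^{O(A, Ā)}`. -/
theorem IsOComodule.central_tail {B : PairData A} {V : M} {δV : V ⟶ V ⊗ A}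
    (hδ : IsOComodule B δV) (Z : M) :
    A ◁ o12 δV Z ≫ cross A V (A ⊗ Z) ≫ V ◁ o21 B.mul Z =
      A ◁ o12 δV Z ≫ crossInv A V (A ⊗ Z) ≫ V ◁ o21 B.mulBar Z := by
  have h : coactMul (β_ A V).hom B.mul δV = coactMul (β_ V A).inv B.mulBar δV := hδ.central
  rw [← tail_coactMul, h, tail_coactMul]

variable {V W : M} {δV : V ⟶ V ⊗ A} {δW : W ⟶ W ⊗ A} {Δ : A ⟶ A ⊗ A}

/-- Coacting twice on two factors. -/
theorem bothCoact_comul (hV : ∀ Z, o12 δV Z ≫ V ◁ o12 Δ Z = o12 δV Z ≫ o12 δV (A ⊗ Z))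
    (hW : ∀ Z, o12 δW Z ≫ W ◁ o12 Δ Z = o12 δW Z ≫ o12 δW (A ⊗ Z)) (Z : M) :
    bothCoact δV δW Z ≫ V ◁ W ◁ o12 Δ (A ⊗ Z) ≫ V ◁ W ◁ A ◁ A ◁ o12 Δ Z ≫
      V ◁ W ◁ A ◁ cross A A (A ⊗ Z) = bothCoact δV δW Z ≫ bothCoact δV δW (A ⊗ A ⊗ Z) := by
  have e1 := fun Z => wl V (cross_left12 Δ W Z)
  have e2 := fun Z => wl V (wl A (cross_right12 δW A Z))
  have e3 := fun Z => wl V (wl A (wl A (hW Z)))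
  simp only [whiskerLeft_comp] at e1 e2 e3
  simp only [bothCoact, assoc, reassoc_of% (fun Z => (e1 Z).symm)]
  simp only [nat_rules, nat_rules1, nat_rules2, nat_rules3, nat_rules4]
  rw [reassoc_of% (hV (W ⊗ Z))]
  have e4 := e3 Z =≫ (V ◁ A ◁ cross A W (A ⊗ A ⊗ Z) ≫ V ◁ cross A W (A ⊗ A ⊗ A ⊗ Z) ≫
    V ◁ W ◁ A ◁ cross A A (A ⊗ Z))
  have e5 := e2 (A ⊗ Z) =≫ V ◁ cross A W (A ⊗ A ⊗ A ⊗ Z)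
  simp only [assoc, nat_rules, nat_rules1, nat_rules2, nat_rules3, nat_rules4] at e4 e5
  rw [e4, e5]

theorem Separates.isCoalgebra (h : Separates δ) {ε : A ⟶ 𝟙_ M}
    (hΔ : δ ≫ T ◁ Δ = δ ≫ δ ▷ A ≫ (α_ T A A).hom) (hε : δ ≫ T ◁ ε = (ρ_ T).inv) :
    IsCoalgebra ε Δ := by
  rw [tail_coassoc_iff] at hΔ
  rw [tail_counit_iff] at hε
  rw [isCoalgebra_iff]
  refine ⟨fun Z => h _ _ ?_, fun Z => h _ _ ?_, fun Z => h _ _ ?_⟩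
  · simp only [whiskerLeft_comp, whiskerLeft_id, reassoc_of% hΔ, hε, comp_id]
  · simp only [whiskerLeft_comp, whiskerLeft_id, reassoc_of% hΔ, ← o12_nat, comp_id]
    rw [reassoc_of% hε]
  · simp only [whiskerLeft_comp, reassoc_of% hΔ, ← o12_nat]
    rw [← hΔ (A ⊗ Z)]

theorem tail_tensor_coassoc (B : PairData A)
    (hc : tensorCoaction B δV δW ≫ (V ⊗ W) ◁ Δ = tensorCoaction B δV δW ≫
      tensorCoaction B δV δW ▷ A ≫ (α_ _ A A).hom) (Z : M) :
    bothCoact δV δW Z ≫ V ◁ W ◁ o21 B.mul Z ≫ V ◁ W ◁ o12 Δ Z = bothCoact δV δW Z ≫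
      bothCoact δV δW (A ⊗ A ⊗ Z) ≫ V ◁ W ◁ o21 B.mul (A ⊗ A ⊗ Z) ≫ V ◁ W ◁ A ◁ o21 B.mul Z := by
  rw [tail_coassoc_iff] at hc
  have := (α_ _ _ _).inv ≫= hc Z =≫ (α_ _ _ _).hom
  simp only [tail_tensorCoaction, fans, cancels] at this
  rw [this, reassoc_of% (bothCoact_nat δV δW (o21 B.mul Z))]
  simp only [nat_rules2]

theorem tail_tensor_counit (B : PairData A) {ε : A ⟶ 𝟙_ M}
    (hc : tensorCoaction B δV δW ≫ (V ⊗ W) ◁ ε = (ρ_ _).inv) (Z : M) :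
    bothCoact δV δW Z ≫ V ◁ W ◁ o21 B.mul Z ≫ V ◁ W ◁ o10 ε Z = 𝟙 _ := by
  rw [tail_counit_iff] at hc
  have := (α_ _ _ _).inv ≫= hc Z =≫ (α_ _ _ _).hom
  simpa only [tail_tensorCoaction, fans, cancels] using this

/-- If the tensor square of a separating comodule is a comodule, then `A` is a bialgebra. -/
theorem Separates.mul_comul (h : Separates δ) (B : PairData A)
    (hΔ : δ ≫ T ◁ B.comul = δ ≫ δ ▷ A ≫ (α_ T A A).hom)
    (hc : tensorCoaction B δ δ ≫ (T ⊗ T) ◁ B.comul = tensorCoaction B δ δ ≫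
      tensorCoaction B δ δ ▷ A ≫ (α_ _ A A).hom) :
    B.mul ≫ B.comul = (B.comul ⊗ₘ B.comul) ≫ middle A (β_ A A).hom A ≫ (B.mul ⊗ₘ B.mul) := by
  rw [tail_coassoc_iff] at hΔ
  rw [tail_mul_comul_iff]
  intro Z
  apply h.two
  simp only [whiskerLeft_comp]
  rw [tail_tensor_coassoc B hc, reassoc_of% (bothCoact_comul hΔ hΔ Z)]

theorem bothCoact_counit {ε : A ⟶ 𝟙_ M} (hV : ∀ Z, o12 δV Z ≫ V ◁ o10 ε Z = 𝟙 _)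
    (hW : ∀ Z, o12 δW Z ≫ W ◁ o10 ε Z = 𝟙 _) (Z : M) :
    bothCoact δV δW Z ≫ V ◁ W ◁ o10 ε (A ⊗ Z) ≫ V ◁ W ◁ o10 ε Z = 𝟙 _ := by
  have e1 := fun Z => wl V (cross_left10 ε W Z)
  have e2 := fun Z => wl V (hW Z)
  simp only [whiskerLeft_comp] at e1 e2
  simp only [bothCoact, assoc, reassoc_of% e1, nat_rules, nat_rules1]
  rw [reassoc_of% hV, e2, whiskerLeft_id]

theorem Separates.mul_counit (h : Separates δ) (B : PairData A)
    (hε : δ ≫ T ◁ B.counit = (ρ_ T).inv)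
    (hc : tensorCoaction B δ δ ≫ (T ⊗ T) ◁ B.counit = (ρ_ _).inv) :
    B.mul ≫ B.counit = (B.counit ⊗ₘ B.counit) ≫ (λ_ (𝟙_ M)).hom := by
  rw [tail_counit_iff] at hε
  rw [tail_mul_counit_iff]
  intro Z
  apply h.two
  simp only [whiskerLeft_comp]
  rw [tail_tensor_counit B hc, bothCoact_counit hε hε Z]

theorem tail_unitCoaction (B : PairData A) (Z : M) :
    o12 (unitCoaction B) Z = (𝟙_ M) ◁ o01 B.one Z := by
  rw [o12, unitCoaction]
  simp only [fans, cancels, r01 B.one]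
  simp

theorem one_comul_of_unitCoaction (B : PairData A)
    (hc : unitCoaction B ≫ 𝟙_ M ◁ B.comul = unitCoaction B ≫ unitCoaction B ▷ A ≫ (α_ _ A A).hom) :
    B.one ≫ B.comul = (λ_ (𝟙_ M)).inv ≫ (B.one ⊗ₘ B.one) := by
  rw [tail_coassoc_iff] at hc
  rw [tail_one_comul_iff]
  intro Z
  have := hc Z
  simp only [tail_unitCoaction, ← whiskerLeft_comp] at this
  rw [whiskerLeft_iff] at this
  rw [this, o01_nat]

theorem one_counit_of_unitCoaction (B : PairData A)
    (hc : unitCoaction B ≫ 𝟙_ M ◁ B.counit = (ρ_ _).inv) : B.one ≫ B.counit = 𝟙 _ := by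
  rw [tail_counit_iff] at hc
  rw [tail_one_counit_iff]
  intro Z
  have := hc Z
  rw [tail_unitCoaction, ← whiskerLeft_comp, ← whiskerLeft_id, whiskerLeft_iff] at this
  exact this

theorem Separates.mul_assoc (h : Separates δ) (B : PairData A)
    (hc : IsComoduleHom (tensorCoaction B (tensorCoaction B δ δ) δ)
      (tensorCoaction B δ (tensorCoaction B δ δ)) (α_ T T T).hom) (Z : M) :
    o21 B.mul (A ⊗ Z) ≫ o21 B.mul Z = A ◁ o21 B.mul Z ≫ o21 B.mul Z := by
  rw [tail_comoduleHom_iff] at hc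
  apply h.three
  have := ((α_ T T _).inv ≫ (α_ (T ⊗ T) T Z).inv) ≫= hc Z =≫ ((α_ T (T ⊗ T) _).hom ≫
    T ◁ (α_ T T _).hom)
  have e := fun Z => wl T (wl T (cross_left21 B.mul T Z))
  simp only [whiskerLeft_comp] at e
  simp only [bothCoact, tail_tensorCoaction, fans, cancels, cross_tensor_right,
    nat_rules, nat_rules1, nat_rules2, nat_rules3, nat_rules4] at this ⊢
  rw [← reassoc_of% (e (A ⊗ Z))]
  simp only [nat_rules2]
  exact this.symm

theorem Separates.one_mul (h : Separates δ) (B : PairData A)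
    (hc : IsComoduleHom (tensorCoaction B (unitCoaction B) δ) δ (λ_ T).hom) (Z : M) :
    o01 B.one (A ⊗ Z) ≫ o21 B.mul Z = 𝟙 _ := by
  rw [tail_comoduleHom_iff] at hc
  apply h
  have := ((λ_ _).inv ≫ (α_ (𝟙_ M) T Z).inv) ≫= hc Z
  simp only [bothCoact, tail_tensorCoaction, fans, cancels, tail_unitCoaction,
    nat_rules, nat_rules1, nat_rules2, nat_rules3, nat_rules4, id_whiskerLeft] at this ⊢
  rw [← o01_nat_assoc, reassoc_of% (cross_left01 B.one T (A ⊗ Z))] at this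
  exact this.symm
theorem Separates.mul_one (h : Separates δ) (B : PairData A)
    (hc : IsComoduleHom (tensorCoaction B δ (unitCoaction B)) δ (ρ_ T).hom) (Z : M) :
    A ◁ o01 B.one Z ≫ o21 B.mul Z = 𝟙 _ := by
  rw [tail_comoduleHom_iff] at hc
  apply h
  have := (T ◁ (λ_ _).inv ≫ (α_ T (𝟙_ M) Z).inv) ≫= hc Z
  simp only [bothCoact, tail_tensorCoaction, fans, cancels, tail_unitCoaction,
    nat_rules, nat_rules1, nat_rules2, nat_rules3, nat_rules4, cross_unit_right,
    id_whiskerLeft] at this ⊢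
  exact this.symm

/-- `ρ(a, bc) = ρ(a₁, c) ρ(a₂, b)` is the compatibility of the braiding of comodules with tensor
products in the second variable. -/
theorem Separates.pairing_mul_right (h : Separates δ) (B : PairData A)
    (hΔ : δ ≫ T ◁ B.comul = δ ≫ δ ▷ A ≫ (α_ T A A).hom)
    (hc : comoduleBraiding B.pairing δ (tensorCoaction B δ δ) =
      (α_ T T T).inv ≫ comoduleBraiding B.pairing δ δ ▷ T ≫ (α_ T T T).hom ≫
        T ◁ comoduleBraiding B.pairing δ δ ≫ (α_ T T T).inv) (Z : M) :
    A ◁ o21 B.mul Z ≫ o20 B.pairing Z =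
      o12 B.comul (A ⊗ A ⊗ Z) ≫ A ◁ o20 B.pairing (A ⊗ Z) ≫ o20 B.pairing Z := by
  rw [tail_coassoc_iff] at hΔ
  have e1 := T ◁ (α_ T T Z).inv ≫= congrArg (fun f => o22 f Z) hc =≫ (α_ _ _ _).hom
  rw [tail_comoduleBraiding] at e1
  have e2 : T ◁ (α_ T T Z).inv ≫ o22 ((α_ T T T).inv ≫ comoduleBraiding B.pairing δ δ ▷ T ≫
      (α_ T T T).hom ≫ T ◁ comoduleBraiding B.pairing δ δ ≫ (α_ T T T).inv) Z ≫ (α_ _ _ _).hom =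
      o22 (comoduleBraiding B.pairing δ δ) (T ⊗ Z) ≫ T ◁ o22 (comoduleBraiding B.pairing δ δ) Z := by
    rw [o22]
    simp only [fans, cancels, r22 (comoduleBraiding B.pairing δ δ)]
  simp only [assoc] at e1 
  rw [e2, tail_comoduleBraiding, tail_comoduleBraiding] at e1
  apply h
  apply h.under₂ (U := T) (U' := A)
  apply h.under (U := T)
  simp only [bothCoact, tail_tensorCoaction, fans, cancels,
    nat_rules, nat_rules1, nat_rules2, nat_rules3, nat_rules4, cross_tensor_right] at e1 ⊢
  have f1 := fun Z => wl T (wl T (hΔ Z))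
  have f2 := fun Z => wl T (cross_left12 δ T Z)
  have f3 := fun Z => wl T (wl T (cross_left20 B.pairing T Z))
  simp only [whiskerLeft_comp] at f1 f2 f3
  rw [e1, reassoc_of% f1, ← reassoc_of% (f2 (A ⊗ A ⊗ Z)),
    ← reassoc_of% (wl_sq T (wl_sq T (o12_nat δ (o20 B.pairing (A ⊗ Z))))),
    ← reassoc_of% (wl_sq T (o22_nat (β_ T T).hom (o20 B.pairing (A ⊗ Z))))]
  rw [reassoc_of% (wl_sq T (o12_nat δ (cross A T (A ⊗ Z)))),
    reassoc_of% (wl_sq T (o12_nat δ (A ◁ o12 δ Z))), reassoc_of% (f3 (A ⊗ Z))]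
  simp only [nat_rules, nat_rules1, nat_rules2, nat_rules3, nat_rules4]

/-- The comodule braiding, read off after the underlying crossing. -/
theorem tail_comoduleBraiding' {ρ : A ⊗ A ⟶ 𝟙_ M} (Z : M) :
    o22 (comoduleBraiding ρ δV δW) Z = cross V W Z ≫ o12 δW (V ⊗ Z) ≫ W ◁ crossInv A V Z ≫
      W ◁ o12 δV (A ⊗ Z) ≫ W ◁ V ◁ o20 ρ Z := by
  rw [tail_comoduleBraiding, ← reassoc_of% (cross_right12 δW V Z)]
  have e := wl W (cross_crossInv V A Z)
  simp only [whiskerLeft_comp, whiskerLeft_id] at e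
  rw [reassoc_of% e]

/-- Coacting on the second factor after the comodule braiding. -/
theorem comoduleBraiding_coact {ρ : A ⊗ A ⟶ 𝟙_ M} (Z : M) :
    o22 (comoduleBraiding ρ δV δW) Z ≫ o12 δW (V ⊗ Z) =
      V ◁ o12 δW Z ≫ V ◁ o12 δW (A ⊗ Z) ≫ cross V W (A ⊗ A ⊗ Z) ≫ W ◁ o12 δV (A ⊗ A ⊗ Z) ≫
        W ◁ V ◁ cross A A (A ⊗ Z) ≫ W ◁ V ◁ A ◁ o20 ρ Z ≫ W ◁ cross V A Z := by
  have e1 := fun Z => wl W (cross_left12 δV A Z)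
  simp only [whiskerLeft_comp] at e1
  rw [tail_comoduleBraiding]
  simp only [assoc, nat_rules, nat_rules1, nat_rules2, nat_rules3, nat_rules4]
  rw [← reassoc_of% (cross_right12 δW V (A ⊗ Z)), ← reassoc_of% e1]

theorem tail_comoduleBraidingInv' {ρ : A ⊗ A ⟶ 𝟙_ M} (Z : M) :
    o22 (comoduleBraidingInv ρ δW δV) Z = o12 δW (V ⊗ Z) ≫ W ◁ crossInv A V Z ≫
      W ◁ o12 δV (A ⊗ Z) ≫ W ◁ V ◁ o20 ρ Z ≫ crossInv W V Z := by
  have e0 : o22 (comoduleBraidingInv ρ δW δV) Z =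
      W ◁ o12 δV Z ≫ crossInv W V (A ⊗ Z) ≫ V ◁ o12 δW (A ⊗ Z) ≫ V ◁ W ◁ o20 (barPairing ρ) Z :=
    @tail_comoduleBraiding M _ _ (reverseBraiding M) _ _ _ (barPairing ρ) δW δV Z
  have e1 : o20 (barPairing ρ) Z = crossInv A A Z ≫ o20 ρ Z := by
    rw [o20, barPairing]; simp [o22, o20]
  have e2 := wl W (crossInv_right12 δV A Z)
  simp only [whiskerLeft_comp] at e2
  rw [e0, e1, ← reassoc_of% e2]
  simp only [nat_rules, nat_rules1, nat_rules2, nat_rules3, nat_rules4, whiskerLeft_comp]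
  rw [← reassoc_of% (o12_nat δW (o12 δV Z)), reassoc_of% (crossInv_left12 δW V (A ⊗ Z))]

/-- A relation between two pairings, read off from a composite of comodule braidings. -/
theorem Separates.convolution (h : Separates δ) {ε : A ⟶ 𝟙_ M} {ρ ρ' : A ⊗ A ⟶ 𝟙_ M} 
    (hΔ : ∀ Z, o12 δ Z ≫ T ◁ o12 Δ Z = o12 δ Z ≫ o12 δ (A ⊗ Z))
    (hε : ∀ Z, o12 δ Z ≫ T ◁ o10 ε Z = 𝟙 _)
    (hc : ∀ Z, o12 δ (T ⊗ Z) ≫ T ◁ crossInv A T Z ≫ T ◁ o12 δ (A ⊗ Z) ≫ T ◁ T ◁ o20 ρ Z ≫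
      o12 δ (T ⊗ Z) ≫ T ◁ crossInv A T Z ≫ T ◁ o12 δ (A ⊗ Z) ≫ T ◁ T ◁ o20 ρ' Z = 𝟙 _) (Z : M) :
    o12 Δ (A ⊗ Z) ≫ A ◁ A ◁ o12 Δ Z ≫ A ◁ cross A A (A ⊗ Z) ≫ o20 ρ' (A ⊗ A ⊗ Z) ≫ o20 ρ Z =
      o10 ε (A ⊗ Z) ≫ o10 ε Z := by
  have s1 : ∀ Z, o12 Δ (T ⊗ Z) ≫ A ◁ crossInv A T Z ≫ A ◁ o12 δ (A ⊗ Z) ≫ A ◁ T ◁ o20 ρ Z ≫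
      crossInv A T Z ≫ o12 δ (A ⊗ Z) ≫ T ◁ o20 ρ' Z = o10 ε (T ⊗ Z) := by
    intro Z
    apply h
    have e1 := hc Z
    simp only [nat_rules, nat_rules1, nat_rules2, nat_rules3, nat_rules4] at e1
    simp only [whiskerLeft_comp, hε, reassoc_of% hΔ, ← e1]
    simp only [nat_rules, nat_rules1, nat_rules2, nat_rules3, nat_rules4]
  have s2 := cross T A Z ≫= s1 Z
  rw [← reassoc_of% (cross_right12 Δ T Z), cross_right10] at s2
  have e2 := fun Z => wl A (cross_crossInv T A Z)
  have e3 := fun Z => cross_left12 δ A Z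
  simp only [whiskerLeft_comp, whiskerLeft_id] at e2
  rw [reassoc_of% e2, ← reassoc_of% e3 ] at s2
  simp only [nat_rules, nat_rules1, nat_rules2, nat_rules3, nat_rules4, reassoc_of% cross_crossInv T A] at s2
  apply h
  simp only [whiskerLeft_comp, reassoc_of% hε, reassoc_of% hΔ]
  exact s2

/-- If the braiding of a separating comodule with itself is a morphism of comodules, then `A` is
quasi-commutative. -/
theorem Separates.quasi_comm (h : Separates δ) (B : PairData A)
    (hΔ : ∀ Z, o12 δ Z ≫ T ◁ o12 B.comul Z = o12 δ Z ≫ o12 δ (A ⊗ Z))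
    (hcent : ∀ Z, A ◁ o12 δ Z ≫ cross A T (A ⊗ Z) ≫ T ◁ o21 B.mul Z =
      A ◁ o12 δ Z ≫ crossInv A T (A ⊗ Z) ≫ T ◁ o21 B.mulBar Z)
    (hc : IsComoduleHom (tensorCoaction B δ δ) (tensorCoaction B δ δ)
      (comoduleBraiding B.pairing δ δ)) (Z : M) :
    o12 B.comul (A ⊗ Z) ≫ A ◁ A ◁ o12 B.comul Z ≫ A ◁ cross A A (A ⊗ Z) ≫
        cross A A (A ⊗ A ⊗ Z) ≫ o21 B.mulBar (A ⊗ A ⊗ Z) ≫ A ◁ o20 B.pairing Z =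
      o12 B.comul (A ⊗ Z) ≫ A ◁ A ◁ o12 B.comul Z ≫ A ◁ cross A A (A ⊗ Z) ≫
        o20 B.pairing (A ⊗ A ⊗ Z) ≫ o21 B.mul Z := by
  rw [tail_comoduleHom_iff] at hc
  have e1 := (α_ _ _ _).inv ≫= hc Z =≫ (α_ _ _ _).hom
  simp only [tail_tensorCoaction, fans, cancels,
    r22 (comoduleBraiding B.pairing δ δ)] at e1
  have f1 := fun Z => wl T (hcent Z)
  have f2 := wl T (cross_right12 δ A (A ⊗ Z))
  have f3 := fun Z => wl T (hΔ Z)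
  have f4 := fun Z => wl T (cross_crossInv T A Z)
  simp only [whiskerLeft_comp, whiskerLeft_id] at f1 f2 f3 f4
  apply h
  apply h.under (U := T)
  simp only [bothCoact, assoc, f1, reassoc_of% comoduleBraiding_coact] at e1
  rw [tail_comoduleBraiding] at e1
  simp only [nat_rules, nat_rules1, nat_rules2, nat_rules3, nat_rules4] at e1
  have f5 := wl T (cross_left12 δ A (A ⊗ A ⊗ Z))
  simp only [whiskerLeft_comp] at f5
  rw [← reassoc_of% f5, reassoc_of% f4, ← reassoc_of% f2] at e1
  simp only [nat_rules, nat_rules1, nat_rules2, nat_rules3, nat_rules4] at e1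
  rw [← reassoc_of% (o12_nat δ (o12 δ Z)), ← reassoc_of% (o12_nat δ (o12 δ (A ⊗ Z))),
    reassoc_of% (cross_left12 δ T (A ⊗ A ⊗ Z))] at e1
  simp only [nat_rules, nat_rules1, nat_rules2, nat_rules3, nat_rules4, ← reassoc_of% f3,
    whiskerLeft_comp] at e1 ⊢
  exact e1

theorem Separates.pairing_mul_left (h : Separates δ) (B : PairData A)
    (hΔ : ∀ Z, o12 δ Z ≫ T ◁ o12 B.comul Z = o12 δ Z ≫ o12 δ (A ⊗ Z))
    (hcent : ∀ Z, A ◁ o12 δ Z ≫ cross A T (A ⊗ Z) ≫ T ◁ o21 B.mul Z =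
      A ◁ o12 δ Z ≫ crossInv A T (A ⊗ Z) ≫ T ◁ o21 B.mulBar Z)
    (hc : comoduleBraiding B.pairing (tensorCoaction B δ δ) δ =
      (α_ T T T).hom ≫ T ◁ comoduleBraiding B.pairing δ δ ≫ (α_ T T T).inv ≫
        comoduleBraiding B.pairing δ δ ▷ T ≫ (α_ T T T).hom) (Z : M) :
    o21 B.mulBar (A ⊗ Z) ≫ o20 B.pairing Z = A ◁ A ◁ o12 B.comul Z ≫ A ◁ cross A A (A ⊗ Z) ≫
      A ◁ A ◁ o20 B.pairing Z ≫ o20 B.pairing Z := by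
  have e1 := (α_ T T (T ⊗ Z)).inv ≫= congrArg (fun f => o22 f Z) hc =≫ T ◁ (α_ _ _ _).hom
  have e2 : (α_ T T (T ⊗ Z)).inv ≫ o22 ((α_ T T T).hom ≫ T ◁ comoduleBraiding B.pairing δ δ ≫
      (α_ T T T).inv ≫ comoduleBraiding B.pairing δ δ ▷ T ≫ (α_ T T T).hom) Z ≫ T ◁ (α_ _ _ _).hom =
      T ◁ o22 (comoduleBraiding B.pairing δ δ) Z ≫ o22 (comoduleBraiding B.pairing δ δ) (T ⊗ Z) := by
    rw [o22]
    simp only [fans, cancels, r22 (comoduleBraiding B.pairing δ δ)]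
  rw [tail_comoduleBraiding, e2, tail_comoduleBraiding _ _ _ (T ⊗ Z)] at e1
  have f0 := wl T (comoduleBraiding_coact (δV := δ) (δW := δ) (ρ := B.pairing) Z)
  have f1 := fun Z => wl T (wl T (hcent Z))
  have f2 := fun Z => wl T (wl T (crossInv_left20 B.pairing T Z))
  have f3 := fun Z => wl T (wl T (hΔ Z))
  have f4 := fun Z => wl T (wl T (wl A (cross_crossInv T A Z)))
  simp only [whiskerLeft_comp, whiskerLeft_id] at f0 f1 f2 f3 f4
  rw [reassoc_of% f0, ← reassoc_of% f3, ← f2] at e1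
  simp only [bothCoact, tail_tensorCoaction, fans, cancels,
    nat_rules, nat_rules1, nat_rules2, nat_rules3, nat_rules4, cross_tensor_left, f1] at e1
  rw [reassoc_of% f1, reassoc_of% f4] at e1
  apply h.under_inv (U := A)
  apply h
  apply h.under₂ (U := T) (U' := T)
  simp only [nat_rules, nat_rules1, nat_rules2, nat_rules3, nat_rules4, whiskerLeft_comp] at e1 ⊢
  exact e1

theorem Separates.pairing_one_left (h : Separates δ) (B : PairData A)
    (hε : ∀ Z, o12 δ Z ≫ T ◁ o10 B.counit Z = 𝟙 _)
    (hc : comoduleBraiding B.pairing (unitCoaction B) δ = (λ_ T).hom ≫ (ρ_ T).inv) (Z : M) :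
    o01 B.one (A ⊗ Z) ≫ o20 B.pairing Z = o10 B.counit Z := by
  have e1 := (λ_ _).inv ≫= congrArg (fun f => o22 f Z) hc =≫ T ◁ (λ_ _).hom
  simp only [tail_comoduleBraiding, tail_unitCoaction, assoc] at e1
  apply h
  simp only [o22, fans, cancels, cross_unit_left, id_whiskerLeft] at e1
  simp only [whiskerLeft_comp, hε, ← o12_nat_assoc]
  exact e1
theorem Separates.pairing_one_right (h : Separates δ) (B : PairData A)
    (hε : ∀ Z, o12 δ Z ≫ T ◁ o10 B.counit Z = 𝟙 _)
    (hc : comoduleBraiding B.pairing δ (unitCoaction B) = (ρ_ T).hom ≫ (λ_ T).inv) (Z : M) :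
    A ◁ o01 B.one Z ≫ o20 B.pairing Z = o10 B.counit Z := by
  have e1 := T ◁ (λ_ _).inv ≫= congrArg (fun f => o22 f Z) hc =≫ (λ_ _).hom
  simp only [tail_comoduleBraiding, tail_unitCoaction, assoc] at e1
  apply h
  simp only [o22, fans, cancels, cross_unit_right, id_whiskerLeft] at e1
  simp only [whiskerLeft_comp, hε, ← o12_nat_assoc]
  exact e1

/-- If the two tensor squares of a separating comodule agree, it is central. -/
theorem Separates.central (h : Separates δ) (B : PairData A)
    (hc : ∀ Z, bothCoact δ δ Z ≫ T ◁ T ◁ o21 B.mul Z =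
      o12 δ (T ⊗ Z) ≫ T ◁ A ◁ o12 δ Z ≫ T ◁ crossInv A T (A ⊗ Z) ≫ T ◁ T ◁ o21 B.mulBar Z) (Z : M) :
    A ◁ o12 δ Z ≫ cross A T (A ⊗ Z) ≫ T ◁ o21 B.mul Z =
      A ◁ o12 δ Z ≫ crossInv A T (A ⊗ Z) ≫ T ◁ o21 B.mulBar Z := by
  apply h
  simpa only [bothCoact, assoc, whiskerLeft_comp] using hc Z

/-- A separating comodule whose tensor powers are comodules, compatibly with the associativity and
unit constraints, makes `A` a bialgebra. -/
theorem Separates.isBialgebra (h : Separates δ) (B : PairData A)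
    (hΔ : δ ≫ T ◁ B.comul = δ ≫ δ ▷ A ≫ (α_ T A A).hom) (hε : δ ≫ T ◁ B.counit = (ρ_ T).inv)
    (htΔ : tensorCoaction B δ δ ≫ (T ⊗ T) ◁ B.comul = tensorCoaction B δ δ ≫
      tensorCoaction B δ δ ▷ A ≫ (α_ _ A A).hom)
    (htε : tensorCoaction B δ δ ≫ (T ⊗ T) ◁ B.counit = (ρ_ _).inv)
    (huΔ : unitCoaction B ≫ 𝟙_ M ◁ B.comul =
      unitCoaction B ≫ unitCoaction B ▷ A ≫ (α_ _ A A).hom)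
    (huε : unitCoaction B ≫ 𝟙_ M ◁ B.counit = (ρ_ _).inv)
    (ha : IsComoduleHom (tensorCoaction B (tensorCoaction B δ δ) δ)
      (tensorCoaction B δ (tensorCoaction B δ δ)) (α_ T T T).hom)
    (hl : IsComoduleHom (tensorCoaction B (unitCoaction B) δ) δ (λ_ T).hom)
    (hr : IsComoduleHom (tensorCoaction B δ (unitCoaction B)) δ (ρ_ T).hom) :
    IsBialgebra (β_ A A).hom B.toBialgData where
  algebra := (isAlgebra_iff _ _).2 ⟨h.one_mul B hl, h.mul_one B hr, h.mul_assoc B ha⟩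
  coalgebra := h.isCoalgebra hΔ hε
  mul_comul := h.mul_comul B hΔ htΔ
  one_comul := one_comul_of_unitCoaction B huΔ
  mul_counit := h.mul_counit B hε htε
  one_counit := one_counit_of_unitCoaction B huε

/-- If the comodule braidings given by `ρ` and `ρ'` are mutually inverse on a separating comodule,
then `ρ` and `ρ'` are mutually inverse for convolution. -/
theorem Separates.isConvolutionInverse (h : Separates δ) (B : PairData A) {ρ' : A ⊗ A ⟶ 𝟙_ M}
    (hΔ : δ ≫ T ◁ B.comul = δ ≫ δ ▷ A ≫ (α_ T A A).hom) (hε : δ ≫ T ◁ B.counit = (ρ_ T).inv)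
    (h1 : comoduleBraiding B.pairing δ δ ≫ comoduleBraidingInv ρ' δ δ = 𝟙 _)
    (h2 : comoduleBraidingInv ρ' δ δ ≫ comoduleBraiding B.pairing δ δ = 𝟙 _) :
    IsConvolutionInverse (β_ A A).hom B.toBialgData B.pairing ρ' := by
  rw [tail_coassoc_iff] at hΔ
  rw [tail_counit_iff] at hε
  have comp : ∀ (f g : T ⊗ T ⟶ T ⊗ T), f ≫ g = 𝟙 _ → ∀ Z, o22 f Z ≫ o22 g Z = 𝟙 _ := by
    intro f g hfg Z
    rw [o22, o22]
    simp only [cancels]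
    rw [← comp_whiskerRight_assoc, hfg, id_whiskerRight, id_comp, Iso.inv_hom_id]
  constructor
  · rw [tail_convolution_eq_iff]
    refine h.convolution hΔ hε fun Z => ?_
    have e := comp _ _ h2 Z
    rw [tail_comoduleBraiding', tail_comoduleBraidingInv'] at e
    simpa only [assoc, reassoc_of% crossInv_cross] using e
  · rw [tail_convolution_eq_iff]
    refine h.convolution hΔ hε fun Z => ?_
    have e := crossInv T T Z ≫= comp _ _ h1 Z =≫ cross T T Z
    rw [tail_comoduleBraiding', tail_comoduleBraidingInv'] at e
    simpa only [assoc, reassoc_of% crossInv_cross, crossInv_cross, comp_id,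
      id_comp] using e

/-- If the comodule braiding of a separating comodule satisfies the hexagon identities and is an
isomorphism of comodules, then `A` is coquasitriangular. -/
theorem Separates.isCoquasitriangular (h : Separates δ) (B : PairData A) {ρ' : A ⊗ A ⟶ 𝟙_ M}
    (hb : IsBialgebra (β_ A A).hom B.toBialgData) (hb' : IsBialgebra (β_ A A).inv B.bar)
    (hδ : IsOComodule B δ)
    (hx1 : comoduleBraiding B.pairing (tensorCoaction B δ δ) δ =
      (α_ T T T).hom ≫ T ◁ comoduleBraiding B.pairing δ δ ≫ (α_ T T T).inv ≫
        comoduleBraiding B.pairing δ δ ▷ T ≫ (α_ T T T).hom)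
    (hx2 : comoduleBraiding B.pairing δ (tensorCoaction B δ δ) =
      (α_ T T T).inv ≫ comoduleBraiding B.pairing δ δ ▷ T ≫ (α_ T T T).hom ≫
        T ◁ comoduleBraiding B.pairing δ δ ≫ (α_ T T T).inv)
    (hu1 : comoduleBraiding B.pairing (unitCoaction B) δ = (λ_ T).hom ≫ (ρ_ T).inv)
    (hu2 : comoduleBraiding B.pairing δ (unitCoaction B) = (ρ_ T).hom ≫ (λ_ T).inv)
    (hc : IsComoduleHom (tensorCoaction B δ δ) (tensorCoaction B δ δ)
      (comoduleBraiding B.pairing δ δ))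
    (hρ : IsConvolutionInverse (β_ A A).hom B.toBialgData B.pairing ρ') :
    IsCoquasitriangular (β_ A A) B := by
  have hΔ := hδ.coassoc
  have hε := hδ.counit
  have hcent := hδ.central_tail
  rw [tail_coassoc_iff] at hΔ
  rw [tail_counit_iff] at hε
  have hop : ∀ Z, o21 ((β_ A A).hom ≫ B.mulBar) Z = cross A A Z ≫ o21 B.mulBar Z := by
    intro Z
    rw [o21, o21]; simp [o22]
  refine ⟨hb, hb', ?_, ⟨ρ', hρ⟩, ?_⟩
  · rw [isBialgebraPairing_iff]
    refine ⟨fun Z => ?_, h.pairing_mul_right B hδ.coassoc hx2, h.pairing_one_left B hε hu1,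
      h.pairing_one_right B hε hu2⟩
    simp only [PairData.barOp]
    rw [hop, assoc, h.pairing_mul_left B hΔ hcent hx1]
    rw [← o22_nat_assoc, o20_nat, ← reassoc_of% (cross_right20 B.pairing A (A ⊗ Z))]
  · rw [tail_quasi_comm_iff]
    intro Z
    simp only [hop, assoc]
    exact h.quasi_comm B hΔ hcent hc Z

end Separation


/-! ### The braiding of comodules -/

/-- The interchange law below up to four whiskerings on the left. -/
def nats (M : Type u) [Category.{v} M] [MonoidalCategory M] :=
  And.intro (nat_rules M) <| And.intro (nat_rules1 M) <| And.intro (nat_rules2 M) <|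
    And.intro (nat_rules3 M) (nat_rules4 M)

/-- The braiding of comodules that is defined by the pairing of `B`. -/
notation:max "Ψ[" B "]" => comoduleBraiding (PairData.pairing B)

section ComoduleBraiding
variable {M : Type u} [Category.{v} M] [MonoidalCategory M] [BraidedCategory M]
variable {A U V W V' W' : M} {δU : U ⟶ U ⊗ A} {δV : V ⟶ V ⊗ A} {δW : W ⟶ W ⊗ A}
  {δV' : V' ⟶ V' ⊗ A} {δW' : W' ⟶ W' ⊗ A} {B : PairData A}

theorem cross_cancel (A B : M) {X Z : M} {f g : B ⊗ A ⊗ Z ⟶ X}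
    (h : cross A B Z ≫ f = cross A B Z ≫ g) : f = g := by
  have := crossInv B A Z ≫= h
  rwa [reassoc_of% (crossInv_cross B A Z), reassoc_of% (crossInv_cross B A Z)] at this

theorem tail_comp {X Y X' Y' : M} (f : V ⊗ W ⟶ X ⊗ Y) (g : X ⊗ Y ⟶ X' ⊗ Y') (Z : M) :
    o22 (f ≫ g) Z = o22 f Z ≫ o22 g Z := by
  simp [o22]

theorem tail_tensorHom_comp {X Y : M} (f : V ⟶ V') (g : W ⟶ W') (h : V' ⊗ W' ⟶ X ⊗ Y) (Z : M) :
    o22 ((f ⊗ₘ g) ≫ h) Z = V ◁ g ▷ Z ≫ f ▷ (W' ⊗ Z) ≫ o22 h Z := by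
  rw [o22, tensorHom_def']
  simp only [fans, cancels, r22 h]

theorem tail_comp_tensorHom {X Y : M} (f : V ⟶ V') (g : W ⟶ W') (h : X ⊗ Y ⟶ V ⊗ W) (Z : M) :
    o22 (h ≫ (f ⊗ₘ g)) Z = o22 h Z ≫ f ▷ (W ⊗ Z) ≫ V' ◁ g ▷ Z := by
  rw [o22, tensor_def]
  simp only [fans, cancels, r22 h]

/-- The comodule braiding is natural in both variables. -/
theorem comoduleBraiding_natural {f : V ⟶ V'} {g : W ⟶ W'} (hf : IsComoduleHom δV δV' f)
    (hg : IsComoduleHom δW δW' g) (ρ : A ⊗ A ⟶ 𝟙_ M) :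
    (f ⊗ₘ g) ≫ comoduleBraiding ρ δV' δW' = comoduleBraiding ρ δV δW ≫ (g ⊗ₘ f) := by
  rw [tail_comoduleHom_iff] at hf hg
  refine o22_ext fun Z => ?_
  have f1 := fun Z => wl W' (hf Z)
  have f2 := fun Z => wl V' (hg Z)
  simp only [whiskerLeft_comp] at f1 f2
  rw [tail_tensorHom_comp, tail_comp_tensorHom, tail_comoduleBraiding, tail_comoduleBraiding]
  simp only [assoc, nat_rules]
  rw [reassoc_of% f2, reassoc_of% (cross_right11 g V' (A ⊗ Z)), ← whisker_exchange_assoc,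
    reassoc_of% (cross_left11 f W (A ⊗ Z)), whisker_exchange_assoc, reassoc_of% f1]
  simp only [nats]

/-- First hexagon. -/
theorem comoduleBraiding_tensor_left (hB : IsBialgebraPairing (B.barOp (β_ A A).hom) B.toBialgData B.pairing)
    (hW : ∀ Z, o12 δW Z ≫ W ◁ o12 B.comul Z = o12 δW Z ≫ o12 δW (A ⊗ Z))
    (hV : IsOComodule B δV) :
    Ψ[B] (tensorCoaction B δU δV) δW =
      (α_ U V W).hom ≫ U ◁ Ψ[B] δV δW ≫ (α_ U W V).inv ≫
        Ψ[B] δU δW ▷ V ≫ (α_ W U V).hom := by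
  have hm := ((isBialgebraPairing_iff _ _ _).1 hB).1
  refine o22_ext fun Z => ?_
  rw [← cancel_epi (α_ U V (W ⊗ Z)).inv, ← cancel_mono (W ◁ (α_ U V Z).hom)]
  have e2 : (α_ U V (W ⊗ Z)).inv ≫ o22 ((α_ U V W).hom ≫ U ◁ Ψ[B] δV δW ≫
      (α_ U W V).inv ≫ Ψ[B] δU δW ▷ V ≫ (α_ W U V).hom) Z ≫
        W ◁ (α_ _ _ _).hom =
      U ◁ o22 (Ψ[B] δV δW) Z ≫
        o22 (Ψ[B] δU δW) (V ⊗ Z) := by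
    rw [o22]
    simp only [fans, cancels, r22 (Ψ[B] δU δW),
      r22 (Ψ[B] δV δW)]
  simp only [assoc]
  rw [tail_comoduleBraiding, e2, tail_comoduleBraiding _ _ _ (V ⊗ Z)]
  have hm' : ∀ Z, o21 B.mulBar (A ⊗ Z) ≫ o20 B.pairing Z = A ◁ A ◁ o12 B.comul Z ≫
      A ◁ cross A A (A ⊗ Z) ≫ A ◁ A ◁ o20 B.pairing Z ≫ o20 B.pairing Z := by
    intro Z
    have e := crossInv A A _ ≫= hm Z
    have hop : o21 (B.barOp (β_ A A).hom).mul (A ⊗ Z) = cross A A (A ⊗ Z) ≫ o21 B.mulBar (A ⊗ Z) := by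
      rw [o21, o21]; simp [o22, PairData.barOp]
    rw [hop, assoc, reassoc_of% crossInv_cross] at e
    rw [e, ← o22_nat_assoc]
    have e3 := crossInv A A (A ⊗ A ⊗ Z) ≫= cross_right20 B.pairing A (A ⊗ Z)
    rw [reassoc_of% crossInv_cross] at e3
    rw [← reassoc_of% e3]
    simp only [nat_rules]
  have f0 := wl U (comoduleBraiding_coact (δV := δV) (δW := δW) (ρ := B.pairing) Z)
  have f1 := fun Z => wl W (wl U (hV.central_tail Z))
  have f2 := fun Z => wl W (wl U (crossInv_left20 B.pairing V Z))
  have f3 := fun Z => wl U (wl V (hW Z))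
  have f4 := fun Z => wl W (wl U (wl A (cross_crossInv V A Z)))
  have f5 := fun Z => wl W (wl U (wl V (hm' Z)))
  simp only [whiskerLeft_comp, whiskerLeft_id] at f0 f1 f2 f3 f4 f5
  rw [reassoc_of% f0, ← reassoc_of% f3, ← f2]
  simp only [bothCoact, tail_tensorCoaction, fans, cancels,
    nats, cross_tensor_left]
  rw [reassoc_of% f1, reassoc_of% f4, f5]
  simp only [nats]

/-- Second hexagon. -/
theorem comoduleBraiding_tensor_right (hB : IsBialgebraPairing (B.barOp (β_ A A).hom) B.toBialgData B.pairing)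
    (hU : ∀ Z, o12 δU Z ≫ U ◁ o12 B.comul Z = o12 δU Z ≫ o12 δU (A ⊗ Z)) :
    Ψ[B] δU (tensorCoaction B δV δW) =
      (α_ U V W).inv ≫ Ψ[B] δU δV ▷ W ≫ (α_ V U W).hom ≫
        V ◁ Ψ[B] δU δW ≫ (α_ V W U).inv := by
  have hm : ∀ Z, A ◁ o21 B.mul Z ≫ o20 B.pairing Z = _ := ((isBialgebraPairing_iff _ _ _).1 hB).2.1
  simp only [PairData.barOp] at hm
  refine o22_ext fun Z => ?_
  rw [← cancel_epi (U ◁ (α_ V W Z).inv), ← cancel_mono (α_ V W (U ⊗ Z)).hom]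
  have e2 : U ◁ (α_ V W Z).inv ≫ o22 ((α_ U V W).inv ≫ Ψ[B] δU δV ▷ W ≫
      (α_ V U W).hom ≫ V ◁ Ψ[B] δU δW ≫ (α_ V W U).inv) Z ≫ (α_ _ _ _).hom =
      o22 (Ψ[B] δU δV) (W ⊗ Z) ≫
        V ◁ o22 (Ψ[B] δU δW) Z := by
    rw [o22]
    simp only [fans, cancels, r22 (Ψ[B] δU δV),
      r22 (Ψ[B] δU δW)]
  simp only [assoc]
  rw [tail_comoduleBraiding, e2, tail_comoduleBraiding,
    tail_comoduleBraiding]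
  have f1 := fun Z => wl V (wl W (hU Z))
  have f2 := fun Z => wl V (cross_left12 δU W Z)
  have f3 := fun Z => wl V (wl U (cross_left20 B.pairing W Z))
  have f4 := fun Z => wl V (wl W (wl U (hm Z)))
  simp only [whiskerLeft_comp] at f1 f2 f3 f4
  simp only [bothCoact, tail_tensorCoaction, fans, cancels,
    nats, cross_tensor_right]
  rw [f4, reassoc_of% f1, ← reassoc_of% (f2 (A ⊗ A ⊗ Z)),
    ← reassoc_of% (wl_sq V (wl_sq W (o12_nat δU (o20 B.pairing (A ⊗ Z))))),
    ← reassoc_of% (wl_sq V (o22_nat (β_ U W).hom (o20 B.pairing (A ⊗ Z)))),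
    reassoc_of% (wl_sq V (o12_nat δU (cross A W (A ⊗ Z)))),
    reassoc_of% (wl_sq V (o12_nat δU (A ◁ o12 δW Z))), reassoc_of% (f3 (A ⊗ Z))]
  simp only [nats]

theorem comoduleBraiding_unit_left (hB : IsBialgebraPairing (B.barOp (β_ A A).hom) B.toBialgData B.pairing)
    (hε : ∀ Z, o12 δW Z ≫ W ◁ o10 B.counit Z = 𝟙 _) :
    Ψ[B] (unitCoaction B) δW = (λ_ W).hom ≫ (ρ_ W).inv := by
  have hm : ∀ Z, o01 B.one (A ⊗ Z) ≫ o20 B.pairing Z = o10 B.counit Z := ((isBialgebraPairing_iff _ _ _).1 hB).2.2.1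
  refine o22_ext fun Z => ?_
  rw [← cancel_epi (λ_ _).inv, ← cancel_mono (W ◁ (λ_ _).hom)]
  have e : (λ_ _).inv ≫ o22 ((λ_ W).hom ≫ (ρ_ W).inv) Z ≫ W ◁ (λ_ _).hom = 𝟙 _ := by
    rw [o22]; simp only [fans, cancels]
  have f := fun Z => wl W (hm Z)
  simp only [whiskerLeft_comp] at f
  rw [assoc, assoc, e, ← hε, ← f]
  simp only [tail_comoduleBraiding, tail_unitCoaction, assoc]
  simp only [fans, cancels, cross_unit_left, id_whiskerLeft]

theorem comoduleBraiding_unit_right (hB : IsBialgebraPairing (B.barOp (β_ A A).hom) B.toBialgData B.pairing)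
    (hε : ∀ Z, o12 δW Z ≫ W ◁ o10 B.counit Z = 𝟙 _) :
    Ψ[B] δW (unitCoaction B) = (ρ_ W).hom ≫ (λ_ W).inv := by
  have hm : ∀ Z, A ◁ o01 B.one Z ≫ o20 B.pairing Z = o10 B.counit Z := ((isBialgebraPairing_iff _ _ _).1 hB).2.2.2
  refine o22_ext fun Z => ?_
  rw [← cancel_epi (W ◁ (λ_ _).inv), ← cancel_mono (λ_ _).hom]
  have e : W ◁ (λ_ _).inv ≫ o22 ((ρ_ W).hom ≫ (λ_ W).inv) Z ≫ (λ_ _).hom = 𝟙 _ := by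
    rw [o22]; simp only [fans, cancels]
  have f := fun Z => wl W (hm Z)
  simp only [whiskerLeft_comp] at f
  rw [assoc, assoc, e, ← hε, ← f]
  simp only [tail_comoduleBraiding, tail_unitCoaction, assoc]
  simp only [fans, cancels, cross_unit_right, id_whiskerLeft, ← o12_nat_assoc]

theorem comoduleBraiding_comp_inv {ρ' : A ⊗ A ⟶ 𝟙_ M} {ρ : A ⊗ A ⟶ 𝟙_ M} {Δ : A ⟶ A ⊗ A} {ε : A ⟶ 𝟙_ M}
    (hV : ∀ Z, o12 δV Z ≫ V ◁ o12 Δ Z = o12 δV Z ≫ o12 δV (A ⊗ Z))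
    (hVε : ∀ Z, o12 δV Z ≫ V ◁ o10 ε Z = 𝟙 _)
    (hW : ∀ Z, o12 δW Z ≫ W ◁ o12 Δ Z = o12 δW Z ≫ o12 δW (A ⊗ Z))
    (hWε : ∀ Z, o12 δW Z ≫ W ◁ o10 ε Z = 𝟙 _)
    (hρ : ∀ Z, o12 Δ (A ⊗ Z) ≫ A ◁ A ◁ o12 Δ Z ≫ A ◁ cross A A (A ⊗ Z) ≫ o20 ρ' (A ⊗ A ⊗ Z) ≫
      o20 ρ Z = o10 ε (A ⊗ Z) ≫ o10 ε Z) (Z : M) :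
    o12 δW (V ⊗ Z) ≫ W ◁ crossInv A V Z ≫ W ◁ o12 δV (A ⊗ Z) ≫ W ◁ V ◁ o20 ρ Z ≫
      o12 δW (V ⊗ Z) ≫ W ◁ crossInv A V Z ≫ W ◁ o12 δV (A ⊗ Z) ≫ W ◁ V ◁ o20 ρ' Z = 𝟙 _ := by
  have key : ∀ Z, o12 Δ (V ⊗ Z) ≫ A ◁ crossInv A V Z ≫ A ◁ o12 δV (A ⊗ Z) ≫ A ◁ V ◁ o20 ρ Z ≫
      crossInv A V Z ≫ o12 δV (A ⊗ Z) ≫ V ◁ o20 ρ' Z = o10 ε (V ⊗ Z) := by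
    intro Z
    apply cross_cancel V A
    rw [← reassoc_of% (cross_right12 Δ V Z), cross_right10]
    have e2 := fun Z => wl A (cross_crossInv V A Z)
    have e3 := fun Z => cross_left12 δV A Z
    have e4 := wl V (hρ Z)
    simp only [whiskerLeft_comp, whiskerLeft_id] at e2 e4
    rw [reassoc_of% e2, ← reassoc_of% e3]
    simp only [nats,
      reassoc_of% cross_crossInv V A]
    rw [← reassoc_of% hV]
    simp only [nats, e4, reassoc_of% hVε]
  have e1 := wl W (key Z)
  simp only [whiskerLeft_comp] at e1
  simp only [nats]
  rw [← reassoc_of% hW]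
  simp only [nats] at e1
  rw [e1, hWε]

/-- The comodule axioms, in terms of tails. -/
structure IsTailComodule (H : BialgData A) (δ : V ⟶ V ⊗ A) : Prop where
  coassoc : ∀ Z, o12 δ Z ≫ V ◁ o12 H.comul Z = o12 δ Z ≫ o12 δ (A ⊗ Z)
  counit : ∀ Z, o12 δ Z ≫ V ◁ o10 H.counit Z = 𝟙 _

theorem IsOComodule.tail (h : IsOComodule B δV) : IsTailComodule B.toBialgData δV :=
  ⟨(tail_coassoc_iff _ _).1 h.coassoc, (tail_counit_iff _ _).1 h.counit⟩

theorem IsBialgebra.tailComodule {H : BialgData A} {c : A ⊗ A ⟶ A ⊗ A} (h : IsBialgebra c H) :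
    IsTailComodule H H.comul :=
  have := (isCoalgebra_iff _ _).1 h.coalgebra
  ⟨this.2.2, this.2.1⟩

variable {ρ' : A ⊗ A ⟶ 𝟙_ M}

theorem comoduleBraiding_hom_inv (hV : IsTailComodule B.toBialgData δV)
    (hW : IsTailComodule B.toBialgData δW)
    (hρ : IsConvolutionInverse (β_ A A).hom B.toBialgData B.pairing ρ') :
    Ψ[B] δV δW ≫ comoduleBraidingInv ρ' δW δV = 𝟙 _ := by
  refine o22_ext fun Z => ?_
  have e' := comoduleBraiding_comp_inv hV.coassoc hV.counit hW.coassoc hW.counit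
    ((tail_convolution_eq_iff _ _ _ _ _).1 hρ.left) Z =≫ crossInv W V Z
  rw [tail_comp, tail_comoduleBraiding', tail_comoduleBraidingInv']
  simp only [assoc, id_comp] at e'
  simp only [assoc, e', cross_crossInv]
  simp [o22]

theorem comoduleBraiding_inv_hom (hV : IsTailComodule B.toBialgData δV)
    (hW : IsTailComodule B.toBialgData δW)
    (hρ : IsConvolutionInverse (β_ A A).hom B.toBialgData B.pairing ρ') :
    comoduleBraidingInv ρ' δW δV ≫ Ψ[B] δV δW = 𝟙 _ := by
  refine o22_ext fun Z => ?_
  have e' := comoduleBraiding_comp_inv hV.coassoc hV.counit hW.coassoc hW.counit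
    ((tail_convolution_eq_iff _ _ _ _ _).1 hρ.right) Z
  rw [tail_comp, tail_comoduleBraiding', tail_comoduleBraidingInv']
  simp only [assoc, reassoc_of% crossInv_cross, e']
  simp [o22]

end ComoduleBraiding

/-! ### Twisted tensor products of algebras and of coalgebras -/

section Flat
variable {M : Type u} [Category.{v} M] [MonoidalCategory M]

theorem o21_conj {A B D : M} (f : A ⊗ B ⟶ D) {Z Z' : M} (e : Z ≅ Z') :
    o21 f Z = A ◁ B ◁ e.hom ≫ o21 f Z' ≫ D ◁ e.inv := by
  rw [← o21_nat]; simp only [cancels]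
theorem o12_conj {A B D : M} (f : A ⟶ B ⊗ D) {Z Z' : M} (e : Z ≅ Z') :
    o12 f Z = A ◁ e.hom ≫ o12 f Z' ≫ B ◁ D ◁ e.inv := by
  rw [← o12_nat]; simp only [cancels]
theorem o22_conj {A B D E : M} (f : A ⊗ B ⟶ D ⊗ E) {Z Z' : M} (e : Z ≅ Z') :
    o22 f Z = A ◁ B ◁ e.hom ≫ o22 f Z' ≫ D ◁ E ◁ e.inv := by
  rw [← o22_nat]; simp only [cancels]
theorem o20_conj {A B : M} (f : A ⊗ B ⟶ 𝟙_ M) {Z Z' : M} (e : Z ≅ Z') :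
    o20 f Z = A ◁ B ◁ e.hom ≫ o20 f Z' ≫ e.inv := by
  rw [← o20_nat]; simp only [cancels]
theorem o10_conj {A : M} (f : A ⟶ 𝟙_ M) {Z Z' : M} (e : Z ≅ Z') :
    o10 f Z = A ◁ e.hom ≫ o10 f Z' ≫ e.inv := by
  rw [← o10_nat]; simp only [cancels]
theorem o01_conj {A : M} (f : 𝟙_ M ⟶ A) {Z Z' : M} (e : Z ≅ Z') :
    o01 f Z = e.hom ≫ o01 f Z' ≫ A ◁ e.inv := by
  rw [← o01_nat]; simp only [cancels]

/-- Flattening of the tail: parenthesized pairs of strands in the tail are opened. -/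
def flats (M : Type u) [Category.{v} M] [MonoidalCategory M] :=
  And.intro (fun P Q Z {A B D : M} (f : A ⊗ B ⟶ D) => o21_conj f (α_ P Q Z)) <|
  And.intro (fun P Q Z {A B D : M} (f : A ⟶ B ⊗ D) => o12_conj f (α_ P Q Z)) <|
  And.intro (fun P Q Z {A B D E : M} (f : A ⊗ B ⟶ D ⊗ E) => o22_conj f (α_ P Q Z)) <|
  And.intro (fun P Q Z {A B : M} (f : A ⊗ B ⟶ 𝟙_ M) => o20_conj f (α_ P Q Z)) <|
  And.intro (fun P Q Z {A : M} (f : A ⟶ 𝟙_ M) => o10_conj f (α_ P Q Z)) <|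
  And.intro (fun P Q Z {A : M} (f : 𝟙_ M ⟶ A) => o01_conj f (α_ P Q Z)) <|
  And.intro (fun X₁ P Q Z {A B D : M} (f : A ⊗ B ⟶ D) => o21_conj f (whiskerLeftIso X₁ (α_ P Q Z))) <|
  And.intro (fun X₁ P Q Z {A B D : M} (f : A ⟶ B ⊗ D) => o12_conj f (whiskerLeftIso X₁ (α_ P Q Z))) <|
  And.intro (fun X₁ P Q Z {A B D E : M} (f : A ⊗ B ⟶ D ⊗ E) => o22_conj f (whiskerLeftIso X₁ (α_ P Q Z))) <|
  And.intro (fun X₁ P Q Z {A B : M} (f : A ⊗ B ⟶ 𝟙_ M) => o20_conj f (whiskerLeftIso X₁ (α_ P Q Z))) <|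
  And.intro (fun X₁ P Q Z {A : M} (f : A ⟶ 𝟙_ M) => o10_conj f (whiskerLeftIso X₁ (α_ P Q Z))) <|
  And.intro (fun X₁ P Q Z {A : M} (f : 𝟙_ M ⟶ A) => o01_conj f (whiskerLeftIso X₁ (α_ P Q Z))) <|
  And.intro (fun X₁ X₂ P Q Z {A B D : M} (f : A ⊗ B ⟶ D) => o21_conj f (whiskerLeftIso X₁ (whiskerLeftIso X₂ (α_ P Q Z)))) <|
  And.intro (fun X₁ X₂ P Q Z {A B D : M} (f : A ⟶ B ⊗ D) => o12_conj f (whiskerLeftIso X₁ (whiskerLeftIso X₂ (α_ P Q Z)))) <|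
  And.intro (fun X₁ X₂ P Q Z {A B D E : M} (f : A ⊗ B ⟶ D ⊗ E) => o22_conj f (whiskerLeftIso X₁ (whiskerLeftIso X₂ (α_ P Q Z)))) <|
  And.intro (fun X₁ X₂ P Q Z {A B : M} (f : A ⊗ B ⟶ 𝟙_ M) => o20_conj f (whiskerLeftIso X₁ (whiskerLeftIso X₂ (α_ P Q Z)))) <|
  And.intro (fun X₁ X₂ P Q Z {A : M} (f : A ⟶ 𝟙_ M) => o10_conj f (whiskerLeftIso X₁ (whiskerLeftIso X₂ (α_ P Q Z)))) <|
  And.intro (fun X₁ X₂ P Q Z {A : M} (f : 𝟙_ M ⟶ A) => o01_conj f (whiskerLeftIso X₁ (whiskerLeftIso X₂ (α_ P Q Z)))) <|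
  And.intro (@whiskerLeftIso_hom M _ _)
    (@whiskerLeftIso_inv M _ _)

theorem wl4_hom_inv (A B D E : M) {X Y : M} (f : X ≅ Y) :
    A ◁ B ◁ D ◁ E ◁ f.hom ≫ A ◁ B ◁ D ◁ E ◁ f.inv = 𝟙 _ := by
  simp only [← whiskerLeft_comp, Iso.hom_inv_id, whiskerLeft_id]
theorem wl4_inv_hom (A B D E : M) {X Y : M} (f : X ≅ Y) :
    A ◁ B ◁ D ◁ E ◁ f.inv ≫ A ◁ B ◁ D ◁ E ◁ f.hom = 𝟙 _ := by
  simp only [← whiskerLeft_comp, Iso.inv_hom_id, whiskerLeft_id]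
theorem wl4_hom_inv_assoc : type_of% (reassoc_of% (@wl4_hom_inv M _ _)) :=
  @(reassoc_of% (@wl4_hom_inv M _ _))
theorem wl4_inv_hom_assoc : type_of% (reassoc_of% (@wl4_inv_hom M _ _)) :=
  @(reassoc_of% (@wl4_inv_hom M _ _))

/-- Cancellation below four whiskerings. -/
def cancels4 (M : Type u) [Category.{v} M] [MonoidalCategory M] :=
  And.intro (@wl4_hom_inv M _ _) <| And.intro (@wl4_inv_hom M _ _) <|
    And.intro (@wl4_hom_inv_assoc M _ _) (@wl4_inv_hom_assoc M _ _)

end Flat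

section Twist
variable {M : Type u} [Category.{v} M] [MonoidalCategory M] {A V : M}

/-- The product of the twisted tensor product of two algebras, with interchange `χ`. -/
def twistMul (χ : V ⊗ A ⟶ A ⊗ V) (μ : A ⊗ A ⟶ A) (ν : V ⊗ V ⟶ V) :
    (A ⊗ V) ⊗ (A ⊗ V) ⟶ A ⊗ V := middle A χ V ≫ (μ ⊗ₘ ν)

/-- The coproduct of the twisted tensor product of two coalgebras, with interchange `ω`. -/
def twistComul (ω : A ⊗ V ⟶ V ⊗ A) (Δ : A ⟶ A ⊗ A) (D : V ⟶ V ⊗ V) :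
    A ⊗ V ⟶ (A ⊗ V) ⊗ (A ⊗ V) := (Δ ⊗ₘ D) ≫ middle A ω V

theorem tail_twistMul (χ : V ⊗ A ⟶ A ⊗ V) (μ : A ⊗ A ⟶ A) (ν : V ⊗ V ⟶ V) (Z : M) :
    o21 (twistMul χ μ ν) Z = (α_ A V _).hom ≫ A ◁ V ◁ (α_ A V Z).hom ≫ A ◁ o22 χ (V ⊗ Z) ≫
      o21 μ (V ⊗ V ⊗ Z) ≫ A ◁ o21 ν Z ≫ (α_ A V Z).inv := by
  rw [o21, twistMul, tensor_def]
  simp only [fans, cancels, tail_middle, nats, r21 μ, r21 ν]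

theorem tail_twistComul (ω : A ⊗ V ⟶ V ⊗ A) (Δ : A ⟶ A ⊗ A) (D : V ⟶ V ⊗ V) (Z : M) :
    o12 (twistComul ω Δ D) Z = (α_ A V Z).hom ≫ o12 Δ (V ⊗ Z) ≫ A ◁ A ◁ o12 D Z ≫
      A ◁ o22 ω (V ⊗ Z) ≫ A ◁ V ◁ (α_ A V Z).inv ≫ (α_ A V _).inv := by
  rw [o12, twistComul, tensor_def]
  simp only [fans, cancels, tail_middle, nats, r12 Δ, r12 D]

theorem tail_tensor_one (η : 𝟙_ M ⟶ A) (ζ : 𝟙_ M ⟶ V) (Z : M) :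
    o01 ((λ_ (𝟙_ M)).inv ≫ (η ⊗ₘ ζ)) Z = o01 ζ Z ≫ o01 η (V ⊗ Z) ≫ (α_ A V Z).inv := by
  rw [o01, tensorHom_def']
  simp only [fans, cancels, nats, r01 η, r01 ζ, id_whiskerLeft]

theorem tail_tensor_counit' (ε : A ⟶ 𝟙_ M) (ζ : V ⟶ 𝟙_ M) (Z : M) :
    o10 ((ε ⊗ₘ ζ) ≫ (λ_ (𝟙_ M)).hom) Z = (α_ A V Z).hom ≫ o10 ε (V ⊗ Z) ≫ o10 ζ Z := by
  rw [o10, tensor_def]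
  simp only [fans, cancels, nats, r10 ε, r10 ζ, id_whiskerLeft]

/-- `χ` is a distributive law between two algebras. -/
structure IsDistrib (χ : V ⊗ A ⟶ A ⊗ V) (η : 𝟙_ M ⟶ A) (μ : A ⊗ A ⟶ A) (ζ : 𝟙_ M ⟶ V)
    (ν : V ⊗ V ⟶ V) : Prop where
  mul_left : ∀ Z, V ◁ o21 μ Z ≫ o22 χ Z = o22 χ (A ⊗ Z) ≫ A ◁ o22 χ Z ≫ o21 μ (V ⊗ Z)
  mul_right : ∀ Z, o21 ν (A ⊗ Z) ≫ o22 χ Z = V ◁ o22 χ Z ≫ o22 χ (V ⊗ Z) ≫ A ◁ o21 ν Z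
  one_left : ∀ Z, V ◁ o01 η Z ≫ o22 χ Z = o01 η (V ⊗ Z)
  one_right : ∀ Z, o01 ζ (A ⊗ Z) ≫ o22 χ Z = A ◁ o01 ζ Z

/-- `ω` is a distributive law between two coalgebras. -/
structure IsCodistrib (ω : A ⊗ V ⟶ V ⊗ A) (ε : A ⟶ 𝟙_ M) (Δ : A ⟶ A ⊗ A) (ζ : V ⟶ 𝟙_ M)
    (D : V ⟶ V ⊗ V) : Prop where
  comul_left : ∀ Z, o22 ω Z ≫ V ◁ o12 Δ Z = o12 Δ (V ⊗ Z) ≫ A ◁ o22 ω Z ≫ o22 ω (A ⊗ Z)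
  comul_right : ∀ Z, o22 ω Z ≫ o12 D (A ⊗ Z) = A ◁ o12 D Z ≫ o22 ω (V ⊗ Z) ≫ V ◁ o22 ω Z
  counit_left : ∀ Z, o22 ω Z ≫ V ◁ o10 ε Z = o10 ε (V ⊗ Z)
  counit_right : ∀ Z, o22 ω Z ≫ o10 ζ (A ⊗ Z) = A ◁ o10 ζ Z

theorem IsDistrib.isAlgebra {χ : V ⊗ A ⟶ A ⊗ V} {η : 𝟙_ M ⟶ A} {μ : A ⊗ A ⟶ A} {ζ : 𝟙_ M ⟶ V}
    {ν : V ⊗ V ⟶ V} (h : IsDistrib χ η μ ζ ν) (hA : IsAlgebra η μ) (hV : IsAlgebra ζ ν) :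
    IsAlgebra ((λ_ (𝟙_ M)).inv ≫ (η ⊗ₘ ζ)) (twistMul χ μ ν) := by
  rw [isAlgebra_iff] at hA hV ⊢
  obtain ⟨a1, a2, a3⟩ := hA
  obtain ⟨b1, b2, b3⟩ := hV
  refine ⟨fun Z => ?_, fun Z => ?_, fun Z => ?_⟩
  · have e1 := h.one_right (V ⊗ Z)
    have e2 := wl A (b1 Z)
    simp only [whiskerLeft_comp, whiskerLeft_id] at e2
    rw [tail_tensor_one, tail_twistMul]
    simp only [cancels, ← o01_nat_assoc, reassoc_of% a1, reassoc_of% e1, reassoc_of% e2]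
  · have e1 := wl A (h.one_left Z)
    have e2 := wl A (b2 Z)
    simp only [whiskerLeft_comp, whiskerLeft_id] at e1 e2
    rw [tail_tensor_one, tail_twistMul]
    simp only [fans, cancels]
    rw [wl_sq_assoc A (show V ◁ o01 η (V ⊗ Z) ≫ o22 χ (V ⊗ Z) = o01 η (V ⊗ V ⊗ Z) ≫ 𝟙 _ from by rw [h.one_left, comp_id])]
    simp only [fans, cancels]
    rw [reassoc_of% a2, reassoc_of% e2]
    simp only [cancels]
  · have e1 := wl A (h.mul_left (V ⊗ V ⊗ Z))
    have e2 := wl A (h.mul_right (V ⊗ Z))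
    have e3 := wl A (b3 Z)
    simp only [whiskerLeft_comp] at e1 e2 e3
    simp only [tail_twistMul, fans, cancels]
    simp only [flats, fans, cancels, cancels4]
    rw [cancel_epi, cancel_epi, cancel_epi, reassoc_of% e2]
    simp only [nats]
    rw [reassoc_of% e1, reassoc_of% e3]
    simp only [nats]
    rw [← reassoc_of% a3]
    simp only [nats]

theorem IsCodistrib.isCoalgebra {ω : A ⊗ V ⟶ V ⊗ A} {ε : A ⟶ 𝟙_ M} {Δ : A ⟶ A ⊗ A} {ζ : V ⟶ 𝟙_ M}
    {D : V ⟶ V ⊗ V} (h : IsCodistrib ω ε Δ ζ D) (hA : IsCoalgebra ε Δ) (hV : IsCoalgebra ζ D) :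
    IsCoalgebra ((ε ⊗ₘ ζ) ≫ (λ_ (𝟙_ M)).hom) (twistComul ω Δ D) := by
  rw [isCoalgebra_iff] at hA hV ⊢
  obtain ⟨a1, a2, a3⟩ := hA
  obtain ⟨b1, b2, b3⟩ := hV
  refine ⟨fun Z => ?_, fun Z => ?_, fun Z => ?_⟩
  · have e1 := h.counit_right (V ⊗ Z)
    have e2 := b1 Z
    rw [tail_tensor_counit', tail_twistComul]
    simp only [fans, cancels]
    simp only [flats, fans, cancels, cancels4]
    simp only [nats]
    rw [reassoc_of% a1, reassoc_of% e1, ← whiskerLeft_comp_assoc, e2, whiskerLeft_id]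
    simp only [cancels]
  · have e1 := wl A (h.counit_left (V ⊗ Z))
    simp only [whiskerLeft_comp, whiskerLeft_id] at e1
    rw [tail_tensor_counit', tail_twistComul]
    simp only [fans, cancels]
    rw [reassoc_of% e1]
    simp only [nats]
    have e3 := wl A (b2 Z)
    simp only [whiskerLeft_comp, whiskerLeft_id] at e3
    rw [reassoc_of% a2, reassoc_of% e3]
    simp only [cancels]
  · have e1 := wl A (h.comul_left (V ⊗ Z))
    have e2 := wl A (wl A (h.comul_right (V ⊗ Z)))
    have e3 := wl A (wl A (wl A (b3 Z)))
    simp only [whiskerLeft_comp] at e1 e2 e3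
    simp only [tail_twistComul, fans, cancels]
    simp only [flats, fans, cancels, cancels4]
    rw [cancel_epi]
    rw [reassoc_of% e1]
    simp only [nats]
    rw [reassoc_of% e2, ← reassoc_of% e3]
    simp only [nats]
    rw [reassoc_of% a3]
end Twist

/-! ### Equivariance of the comodule braiding -/

section ComoduleBraiding
variable {M : Type u} [Category.{v} M] [MonoidalCategory M] [BraidedCategory M]
variable {A U V W V' W' : M} {δU : U ⟶ U ⊗ A} {δV : V ⟶ V ⊗ A} {δW : W ⟶ W ⊗ A}
  {δV' : V' ⟶ V' ⊗ A} {δW' : W' ⟶ W' ⊗ A} {B : PairData A}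

theorem IsCoquasitriangular.quasi_comm_tail (h : IsCoquasitriangular (β_ A A) B) (Z : M) :
    o12 B.comul (A ⊗ Z) ≫ A ◁ A ◁ o12 B.comul Z ≫ A ◁ cross A A (A ⊗ Z) ≫
        cross A A (A ⊗ A ⊗ Z) ≫ o21 B.mulBar (A ⊗ A ⊗ Z) ≫ A ◁ o20 B.pairing Z =
      o12 B.comul (A ⊗ Z) ≫ A ◁ A ◁ o12 B.comul Z ≫ A ◁ cross A A (A ⊗ Z) ≫
        o20 B.pairing (A ⊗ A ⊗ Z) ≫ o21 B.mul Z := by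
  have hop : ∀ Z, o21 ((β_ A A).hom ≫ B.mulBar) Z = cross A A Z ≫ o21 B.mulBar Z := by
    intro Z
    rw [o21, o21]; simp [o22]
  have := (tail_quasi_comm_iff _ _ _ _ _).1 h.quasi_comm Z
  simpa only [hop, assoc] using this

/-- The comodule braiding is a morphism of comodules. -/
theorem comoduleBraiding_isComoduleHom (hB : IsCoquasitriangular (β_ A A) B)
    (hV : IsOComodule B δV) (hW : IsTailComodule B.toBialgData δW) :
    IsComoduleHom (tensorCoaction B δV δW) (tensorCoaction B δW δV)
      (Ψ[B] δV δW) := by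
  rw [tail_comoduleHom_iff]
  intro Z
  rw [← cancel_epi (α_ _ _ _).inv, ← cancel_mono (α_ _ _ _).hom]
  simp only [tail_tensorCoaction, fans, cancels,
    r22 (Ψ[B] δV δW)]
  have f1 := fun Z => wl W (hV.central_tail Z)
  have f2 := wl V (cross_right12 δW A (A ⊗ Z))
  have f3 := fun Z => wl W (hV.tail.coassoc Z)
  have f4 := fun Z => wl V (cross_crossInv W A Z)
  have f5 := wl W (cross_left12 δV A (A ⊗ A ⊗ Z))
  have f6 := fun Z => wl V (hW.coassoc Z)
  have q := wl W (wl V (hB.quasi_comm_tail Z))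
  simp only [whiskerLeft_comp, whiskerLeft_id] at f1 f2 f3 f4 f5 f6 q
  simp only [bothCoact, assoc, f1, reassoc_of% comoduleBraiding_coact]
  rw [tail_comoduleBraiding]
  simp only [nats]
  have f7 := fun Z => wl W (cross_crossInv V A Z)
  simp only [whiskerLeft_comp, whiskerLeft_id] at f7
  rw [← reassoc_of% f5, ← reassoc_of% f2, reassoc_of% f7]
  simp only [nats]
  rw [← reassoc_of% (o12_nat δV (o12 δW Z)), ← reassoc_of% (o12_nat δV (o12 δW (A ⊗ Z))),
    reassoc_of% (cross_left12 δV W (A ⊗ A ⊗ Z)), ← reassoc_of% f6]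
  rw [← reassoc_of% f6]
  simp only [nats]
  rw [← reassoc_of% f3, ← reassoc_of% f3, q]
end ComoduleBraiding

/-! ### Tensor products and corestriction of comodules -/

section Comodules
variable {M : Type u} [Category.{v} M] [MonoidalCategory M] [BraidedCategory M]
variable {A U V W V' W' : M} {δU : U ⟶ U ⊗ A} {δV : V ⟶ V ⊗ A} {δW : W ⟶ W ⊗ A}
  {δV' : V' ⟶ V' ⊗ A} {δW' : W' ⟶ W' ⊗ A} {B : PairData A}

theorem IsComoduleHom.comp {f : U ⟶ V} {g : V ⟶ W} (hf : IsComoduleHom δU δV f)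
    (hg : IsComoduleHom δV δW g) : IsComoduleHom δU δW (f ≫ g) := by
  simp only [IsComoduleHom] at *
  rw [assoc, hg, reassoc_of% hf, comp_whiskerRight]

theorem isComoduleHom_id (δ : V ⟶ V ⊗ A) : IsComoduleHom δ δ (𝟙 V) := by
  simp [IsComoduleHom]

theorem IsComoduleHom.inv {f : V ≅ W} (hf : IsComoduleHom δV δW f.hom) :
    IsComoduleHom δW δV f.inv := by
  simp only [IsComoduleHom] at *
  rw [Iso.inv_comp_eq, ← assoc, hf, assoc, hom_inv_whiskerRight, comp_id]

theorem IsComoduleHom.tensorHom {f : V ⟶ V'} {g : W ⟶ W'} (hf : IsComoduleHom δV δV' f)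
    (hg : IsComoduleHom δW δW' g) :
    IsComoduleHom (tensorCoaction B δV δW) (tensorCoaction B δV' δW') (f ⊗ₘ g) := by
  rw [tail_comoduleHom_iff] at hf hg
  refine (tail_comoduleHom_iff _ _ _).2 fun Z => ?_
  rw [← cancel_epi (α_ _ _ _).inv, ← cancel_mono (α_ _ _ _).hom]
  have f1 := fun Z => wl V' (hg Z)
  have f2 := fun Z => wl V' (wl A (hg Z))
  have f3 := fun Z => wl V' (cross_right11 g A Z)
  simp only [whiskerLeft_comp] at f1 f2 f3
  rw [tensor_def]
  simp only [tail_tensorCoaction, bothCoact, fans, cancels]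
  simp only [nats]
  rw [reassoc_of% hf, reassoc_of% f2, reassoc_of% f3]

theorem isComoduleHom_associator (hB : IsAlgebra B.one B.mul) :
    IsComoduleHom (tensorCoaction B (tensorCoaction B δU δV) δW)
      (tensorCoaction B δU (tensorCoaction B δV δW)) (α_ U V W).hom := by
  have ha := ((isAlgebra_iff _ _).1 hB).2.2
  refine (tail_comoduleHom_iff _ _ _).2 fun Z => ?_
  rw [← cancel_epi (α_ _ _ _).inv]
  have f1 := fun Z => wl U (wl V (cross_left21 B.mul W Z))
  have f2 := fun Z => wl U (wl V (wl W (ha Z)))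
  simp only [whiskerLeft_comp] at f1 f2
  simp only [tail_tensorCoaction, bothCoact, fans, cancels, cross_tensor_left, cross_tensor_right]
  simp only [flats, fans, cancels, cancels4]
  simp only [nats]
  rw [← reassoc_of% f2, ← reassoc_of% f1]
  simp only [nats]

theorem isComoduleHom_leftUnitor (hB : IsAlgebra B.one B.mul) :
    IsComoduleHom (tensorCoaction B (unitCoaction B) δV) δV (λ_ V).hom := by
  refine (tail_comoduleHom_iff _ _ _).2 fun Z => ?_
  have f1 := wl V (((isAlgebra_iff _ _).1 hB).1 Z)
  simp only [whiskerLeft_comp, whiskerLeft_id] at f1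
  simp only [tail_tensorCoaction, tail_unitCoaction, bothCoact, fans, cancels,
    id_whiskerLeft]
  rw [← o01_nat_assoc, reassoc_of% (cross_left01 B.one V (A ⊗ Z)), f1, comp_id]

theorem IsTailComodule.tensor (hB : IsBialgebra (β_ A A).hom B.toBialgData)
    (hV : IsTailComodule B.toBialgData δV) (hW : IsTailComodule B.toBialgData δW) :
    IsTailComodule B.toBialgData (tensorCoaction B δV δW) := by
  have hm := (tail_mul_comul_iff _ _ _).1 hB.mul_comul
  have hc := (tail_mul_counit_iff _ _).1 hB.mul_counit
  constructor
  · intro Z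
    have f1 := fun Z => wl V (wl W (hm Z))
    simp only [whiskerLeft_comp] at f1
    rw [← cancel_epi (α_ _ _ _).inv, ← cancel_mono (α_ _ _ _).hom]
    simp only [tail_tensorCoaction, fans, cancels]
    rw [f1, reassoc_of% (bothCoact_comul hV.coassoc hW.coassoc Z),
      reassoc_of% (bothCoact_nat δV δW (o21 B.mul Z))]
    simp only [nats]
  · intro Z
    have f1 := fun Z => wl V (wl W (hc Z))
    simp only [whiskerLeft_comp] at f1
    rw [← cancel_epi (α_ _ _ _).inv, ← cancel_mono (α_ _ _ _).hom]
    simp only [tail_tensorCoaction, fans, cancels]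
    rw [f1, bothCoact_counit hV.counit hW.counit]

end Comodules

/-! ### Algebras in the category of comodules -/

section ComoduleAlgebra
variable {M : Type u} [Category.{v} M] [MonoidalCategory M] [BraidedCategory M]
variable {A P V : M} {δP : P ⟶ P ⊗ A} {δV : V ⟶ V ⊗ A} {B : PairData A}

/-- An algebra in the category of comodules. -/
structure IsComoduleAlgebra (B : PairData A) (δ : V ⟶ V ⊗ A) (ζ : 𝟙_ M ⟶ V) (ν : V ⊗ V ⟶ V) :
    Prop where
  comodule : IsTailComodule B.toBialgData δ
  algebra : IsAlgebra ζ ν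
  one_hom : IsComoduleHom (unitCoaction B) δ ζ
  mul_hom : IsComoduleHom (tensorCoaction B δ δ) δ ν

theorem tail_hexagon_right {U V W : M} (f : U ⊗ V ⟶ V ⊗ U) (g : U ⊗ W ⟶ W ⊗ U) (Z : M) :
    o22 ((α_ U V W).inv ≫ f ▷ W ≫ (α_ V U W).hom ≫ V ◁ g ≫ (α_ V W U).inv) Z =
      U ◁ (α_ V W Z).hom ≫ o22 f (W ⊗ Z) ≫ V ◁ o22 g Z ≫ (α_ _ _ _).inv := by
  rw [o22]
  simp only [fans, cancels, r22 f, r22 g]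

theorem tail_hexagon_left {U V W : M} (f : U ⊗ W ⟶ W ⊗ U) (g : V ⊗ W ⟶ W ⊗ V) (Z : M) :
    o22 ((α_ U V W).hom ≫ U ◁ g ≫ (α_ U W V).inv ≫ f ▷ V ≫ (α_ W U V).hom) Z =
      (α_ U V (W ⊗ Z)).hom ≫ U ◁ o22 g Z ≫ o22 f (V ⊗ Z) ≫ W ◁ (α_ _ _ _).inv := by
  rw [o22]
  simp only [fans, cancels, r22 f, r22 g]

/-- The comodule braiding of two comodule algebras is a distributive law. -/
theorem IsComoduleAlgebra.isDistrib (hB : IsCoquasitriangular (β_ A A) B)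
    {η : 𝟙_ M ⟶ P} {μ : P ⊗ P ⟶ P} {ζ : 𝟙_ M ⟶ V} {ν : V ⊗ V ⟶ V}
    (hP : IsComoduleAlgebra B δP η μ) (hO : IsOComodule B δV) (hV : IsComoduleAlgebra B δV ζ ν) :
    IsDistrib (Ψ[B] δV δP) η μ ζ ν where
  mul_left Z := by
    have e := comoduleBraiding_natural (isComoduleHom_id δV) hP.mul_hom B.pairing
    rw [comoduleBraiding_tensor_right hB.pairing hV.comodule.coassoc] at e
    have e' := (V ◁ (α_ P P Z).inv ≫ (α_ _ _ _).inv) ≫= whisk e Z =≫ (α_ _ _ _).hom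
    rw [tensor_def, tensor_def] at e'
    simp only [fans, cancels, nats, r22 (Ψ[B] δV δP), r21 μ] at e'
    exact e'
  mul_right Z := by
    have e := comoduleBraiding_natural hV.mul_hom (isComoduleHom_id δP) B.pairing
    rw [comoduleBraiding_tensor_left hB.pairing hP.comodule.coassoc hO] at e
    have e' := ((α_ V V _).inv ≫ (α_ _ _ _).inv) ≫= whisk e Z =≫ (α_ _ _ _).hom
    rw [tensor_def, tensor_def] at e'
    simp only [fans, cancels, nats, r22 (Ψ[B] δV δP), r21 ν] at e'
    exact e'
  one_left Z := by
    have e := comoduleBraiding_natural (isComoduleHom_id δV) hP.one_hom B.pairing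
    rw [comoduleBraiding_unit_right hB.pairing hV.comodule.counit] at e
    have e' := (V ◁ (λ_ Z).inv ≫ (α_ _ _ _).inv) ≫= whisk e Z =≫ (α_ _ _ _).hom
    rw [tensor_def, tensor_def] at e'
    simp only [fans, cancels, nats, r22 (Ψ[B] δV δP), r01 η] at e'
    exact e'
  one_right Z := by
    have e := comoduleBraiding_natural hV.one_hom (isComoduleHom_id δP) B.pairing
    rw [comoduleBraiding_unit_left hB.pairing hP.comodule.counit] at e
    have e' := ((λ_ (P ⊗ Z)).inv ≫ (α_ _ _ _).inv) ≫= whisk e Z =≫ (α_ _ _ _).hom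
    rw [tensor_def, tensor_def] at e'
    simp only [fans, cancels, nats, r22 (Ψ[B] δV δP), r01 ζ] at e'
    exact e'

theorem isComoduleHom_middle {Q S T : M} {δQ : Q ⟶ Q ⊗ A} {δS : S ⟶ S ⊗ A} {δT : T ⟶ T ⊗ A}
    (hB : IsAlgebra B.one B.mul) {f : Q ⊗ S ⟶ S ⊗ Q}
    (hf : IsComoduleHom (tensorCoaction B δQ δS) (tensorCoaction B δS δQ) f) :
    IsComoduleHom (tensorCoaction B (tensorCoaction B δP δQ) (tensorCoaction B δS δT))
      (tensorCoaction B (tensorCoaction B δP δS) (tensorCoaction B δQ δT)) (middle P f T) := by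
  have w1 : ∀ {X Y Z : M} {δX : X ⟶ X ⊗ A} {δY : Y ⟶ Y ⊗ A} {δZ : Z ⟶ Z ⊗ A} {g : Y ⟶ Z},
      IsComoduleHom δY δZ g → IsComoduleHom (tensorCoaction B δX δY) (tensorCoaction B δX δZ) (X ◁ g) := by
    intro X Y Z δX δY δZ g hg
    rw [← id_tensorHom]
    exact (isComoduleHom_id δX).tensorHom hg
  have w2 : IsComoduleHom (tensorCoaction B (tensorCoaction B δQ δS) δT)
      (tensorCoaction B (tensorCoaction B δS δQ) δT) (f ▷ T) := by
    rw [← tensorHom_id]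
    exact hf.tensorHom (isComoduleHom_id δT)
  exact (isComoduleHom_associator hB).comp ((w1 ((IsComoduleHom.inv (isComoduleHom_associator hB)).comp
    (w2.comp (isComoduleHom_associator hB)))).comp (IsComoduleHom.inv (isComoduleHom_associator hB)))

/-- The braided tensor product of two comodule algebras. -/
theorem IsComoduleAlgebra.tensor (hB : IsCoquasitriangular (β_ A A) B)
    {η : 𝟙_ M ⟶ P} {μ : P ⊗ P ⟶ P} {ζ : 𝟙_ M ⟶ V} {ν : V ⊗ V ⟶ V}
    (hP : IsComoduleAlgebra B δP η μ) (hO : IsOComodule B δV) (hV : IsComoduleAlgebra B δV ζ ν) :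
    IsComoduleAlgebra B (tensorCoaction B δP δV) ((λ_ (𝟙_ M)).inv ≫ (η ⊗ₘ ζ))
      (twistMul (Ψ[B] δV δP) μ ν) where
  comodule := hP.comodule.tensor hB.bialgebra hV.comodule
  algebra := (hP.isDistrib hB hO hV).isAlgebra hP.algebra hV.algebra
  one_hom := (IsComoduleHom.inv (isComoduleHom_leftUnitor hB.bialgebra.algebra)).comp
    (hP.one_hom.tensorHom hV.one_hom)
  mul_hom := (isComoduleHom_middle hB.bialgebra.algebra
    (comoduleBraiding_isComoduleHom hB hO hP.comodule)).comp (hP.mul_hom.tensorHom hV.mul_hom)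

/-- The twisted tensor product is functorial in the second factor. -/
theorem twistMul_natural {V' : M} {χ : V ⊗ P ⟶ P ⊗ V} {χ' : V' ⊗ P ⟶ P ⊗ V'} {μ : P ⊗ P ⟶ P}
    {ν : V ⊗ V ⟶ V} {ν' : V' ⊗ V' ⟶ V'} {f : V ⟶ V'} (hf : ν ≫ f = (f ⊗ₘ f) ≫ ν')
    (hχ : f ▷ P ≫ χ' = χ ≫ P ◁ f) :
    twistMul χ μ ν ≫ P ◁ f = (P ◁ f ⊗ₘ P ◁ f) ≫ twistMul χ' μ ν' := by
  have e : (P ◁ f ⊗ₘ P ◁ f) ≫ middle P χ' V' = middle P χ V ≫ ((P ⊗ P) ◁ (f ⊗ₘ f)) := by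
    refine tail_ext fun Z => ?_
    have e1 : ∀ Z, f ▷ (P ⊗ Z) ≫ o22 χ' Z = o22 χ Z ≫ P ◁ f ▷ Z := by
      intro Z
      have := (α_ _ _ _).inv ≫= whisk hχ Z =≫ (α_ _ _ _).hom
      simpa only [fans, cancels, r22 χ, r22 χ'] using this
    have e2 := fun Z => wl P (e1 Z)
    simp only [whiskerLeft_comp] at e2
    rw [tensorHom_def', tensor_def]
    simp only [fans, cancels, tail_middle]
    simp only [nats, cancels]
    rw [← wl_sq_assoc P (whisker_exchange f (α_ P V Z).hom), reassoc_of% e2]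
  rw [twistMul, twistMul, reassoc_of% e, assoc, ← id_tensorHom, ← id_tensorHom,
    tensorHom_comp_tensorHom, tensorHom_comp_tensorHom, hf, comp_id, id_comp]

/-- Associativity of the twisted tensor product of three algebras. -/
theorem twistMul_assoc {V W : M} {χV : V ⊗ P ⟶ P ⊗ V} {χW : W ⊗ P ⟶ P ⊗ W} {c : W ⊗ V ⟶ V ⊗ W}
    {μ : P ⊗ P ⟶ P} {ν : V ⊗ V ⟶ V} {ξ : W ⊗ W ⟶ W} :
    twistMul ((α_ V W P).hom ≫ V ◁ χW ≫ (α_ V P W).inv ≫ χV ▷ W ≫ (α_ P V W).hom) μ (twistMul c ν ξ) ≫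
        (α_ P V W).inv =
      ((α_ P V W).inv ⊗ₘ (α_ P V W).inv) ≫
        twistMul ((α_ W P V).inv ≫ χW ▷ V ≫ (α_ P W V).hom ≫ P ◁ c ≫ (α_ P V W).inv)
          (twistMul χV μ ν) ξ := by
  refine tail_ext fun Z => ?_
  rw [← cancel_epi (α_ _ _ _).inv, tensorHom_def']
  simp only [fans, r21 (twistMul _ _ _), tail_twistMul, tail_hexagon_left, tail_hexagon_right, cancels]
  simp only [flats, fans, cancels, cancels4]
  simp only [nats]

theorem comoduleBraiding_coact' {ρ : A ⊗ A ⟶ 𝟙_ M} {Δ : A ⟶ A ⊗ A}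
    (hP : ∀ Z, o12 δP Z ≫ P ◁ o12 Δ Z = o12 δP Z ≫ o12 δP (A ⊗ Z)) (Z : M) :
    o22 (comoduleBraiding ρ δV δP) Z ≫ o12 δP (V ⊗ Z) =
      V ◁ o12 δP Z ≫ cross V P (A ⊗ Z) ≫ P ◁ o22 (comoduleBraiding ρ δV Δ) Z := by
  have f := wl V (hP Z)
  simp only [whiskerLeft_comp] at f
  rw [tail_comoduleBraiding, tail_comoduleBraiding]
  simp only [nats, fans, cancels]
  rw [← reassoc_of% (cross_right12 δP V (A ⊗ Z)), ← reassoc_of% f]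
  simp only [nats]

/-- Coaction on the first factor of the braided tensor product. -/
theorem twistMul_coaction {μ : P ⊗ P ⟶ P} {ν : V ⊗ V ⟶ V} (hP : IsTailComodule B.toBialgData δP)
    (hμ : IsComoduleHom (tensorCoaction B δP δP) δP μ) :
    twistMul (Ψ[B] δV δP) μ ν ≫ δP ▷ V ≫ (α_ P A V).hom =
      ((δP ▷ V ≫ (α_ P A V).hom) ⊗ₘ (δP ▷ V ≫ (α_ P A V).hom)) ≫ middle P (β_ (A ⊗ V) P).hom (A ⊗ V) ≫
        (μ ⊗ₘ twistMul (Ψ[B] δV B.comul) B.mul ν) := by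
  have key := fun Z => wl P (wl A (comoduleBraiding_coact' (δV := δV) (ρ := B.pairing) hP.coassoc Z))
  have e1 : ∀ Z, o21 μ Z ≫ o12 δP Z = bothCoact δP δP Z ≫ P ◁ P ◁ o21 B.mul Z ≫ o21 μ (A ⊗ Z) := by
    intro Z
    have := (α_ _ _ _).inv ≫= (tail_comoduleHom_iff _ _ _).1 hμ Z
    simpa only [tail_tensorCoaction, fans, cancels, r21 μ] using this
  simp only [whiskerLeft_comp] at key
  refine tail_ext fun Z => ?_
  rw [← cancel_epi (α_ _ _ _).inv, tensorHom_def', tensor_def]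
  simp only [fans, r21 (twistMul _ _ _), tail_twistMul, tail_middle, cancels, r12 δP,
    r21 μ]
  simp only [flats, fans, cancels, cancels4]
  rw [cancel_epi, cancel_epi]
  simp only [nats]
  rw [reassoc_of% e1]
  simp only [bothCoact, assoc, nats, cross_tensor_left, cancels]
  rw [reassoc_of% key]
  simp only [fans, cancels, nats]

end ComoduleAlgebra

/-! ### The bosonization as a bialgebra -/

section Bosonization
variable {M : Type u} [Category.{v} M] [MonoidalCategory M] [BraidedCategory M]
variable {A V : M} {δ : V ⟶ V ⊗ A} {B : PairData A} {H : BialgData V}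

/-- A bialgebra in the category of `O`-comodules. -/
structure IsBialgebraOver (B : PairData A) (δ : V ⟶ V ⊗ A) (H : BialgData V) : Prop where
  base : IsCoquasitriangular (β_ A A) B
  comodule : IsOComodule B δ
  one_hom : IsComoduleHom (unitCoaction B) δ H.one
  mul_hom : IsComoduleHom (tensorCoaction B δ δ) δ H.mul
  counit_hom : IsComoduleHom δ (unitCoaction B) H.counit
  comul_hom : IsComoduleHom δ (tensorCoaction B δ δ) H.comul
  bialgebra : IsBialgebra (Ψ[B] δ δ) H

theorem IsBialgebraOver.comoduleAlgebra (h : IsBialgebraOver B δ H) :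
    IsComoduleAlgebra B δ H.one H.mul :=
  ⟨h.comodule.tail, h.bialgebra.algebra, h.one_hom, h.mul_hom⟩

theorem IsCoquasitriangular.comoduleAlgebra (h : IsCoquasitriangular (β_ A A) B) :
    IsComoduleAlgebra B B.comul B.one B.mul where
  comodule := h.bialgebra.tailComodule
  algebra := h.bialgebra.algebra
  one_hom := by
    have := h.bialgebra.one_comul
    rw [IsComoduleHom, this, unitCoaction, tensorHom_def']
    simp
  mul_hom := by
    have := h.bialgebra.mul_comul
    rw [IsComoduleHom, this, tensorCoaction, tensorHom_def' B.mul]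
    simp only [assoc]

theorem crossMul_eq_twistMul (μ : A ⊗ A ⟶ A) (Δ : A ⟶ A ⊗ A) (ρ : A ⊗ A ⟶ 𝟙_ M) (ν : V ⊗ V ⟶ V) :
    crossMul (β_ V A).hom μ Δ (action δ ρ) ν = twistMul (comoduleBraiding ρ δ Δ) μ ν := by
  refine tail_ext fun Z => ?_
  rw [crossMul, tensor_def]
  simp only [r21 (twistMul _ _ _), tail_twistMul, tail_comoduleBraiding, ← cross.eq_1, fans, cancels,
    tail_middle, r21 μ, r21 (action _ _), tail_action, r21 ν, r12 Δ]
  simp only [flats, fans, cancels, cancels4]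
  simp only [nats]

theorem crossComul_eq_twistComul (φ : A ⊗ V ⟶ V ⊗ A) (μ : A ⊗ A ⟶ A) (Δ : A ⟶ A ⊗ A) (D : V ⟶ V ⊗ V) :
    crossComul φ μ Δ δ D = twistComul (coactMul φ μ δ) Δ D := by
  refine tail_ext fun Z => ?_
  rw [crossComul, tensor_def]
  simp only [r12 (twistComul _ _ _), tail_twistComul, tail_coactMul, fans, cancels,
    tail_middle, r21 μ, r12 D, r12 δ, r12 Δ]
  simp only [flats, fans, cancels, cancels4]

theorem twistComul_eq_coaction (D : V ⟶ V ⊗ V) :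
    twistComul (coactMul (β_ A V).hom B.mul δ) B.comul D =
      A ◁ D ≫ (α_ A V V).inv ≫ tensorCoaction B B.comul δ ▷ V ≫ (α_ (A ⊗ V) A V).hom := by
  refine tail_ext fun Z => ?_
  simp only [r12 (twistComul _ _ _), tail_twistComul, tail_coactMul, fans, cancels,
    r12 (tensorCoaction _ _ _), tail_tensorCoaction, r12 D, bothCoact]
  simp only [flats, fans, cancels, cancels4]
  simp only [nats]

/-- The distributive law of the crossed coproduct. -/
theorem IsBialgebraOver.isCodistrib (h : IsBialgebraOver B δ H) :
    IsCodistrib (coactMul (β_ A V).hom B.mul δ) B.counit B.comul H.counit H.comul where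
  comul_left Z := by
    have e1 := wl A (h.comodule.tail.coassoc Z)
    have e2 := wl V ((tail_mul_comul_iff _ _ _).1 h.base.bialgebra.mul_comul Z)
    simp only [whiskerLeft_comp] at e1 e2
    simp only [tail_coactMul, fans, cancels]
    have f := wl A (cross_right12 δ A (A ⊗ Z))
    simp only [whiskerLeft_comp] at f
    have e1' := wl A e1
    simp only [whiskerLeft_comp] at e1'
    rw [e2, ← reassoc_of% (cross_left12 B.comul V (A ⊗ Z))]
    simp only [nats]
    rw [← reassoc_of% f, ← reassoc_of% e1']
    simp only [nats]
  comul_right Z := by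
    have e1 := (tail_comoduleHom_iff _ _ _).1 h.comul_hom Z =≫ (α_ _ _ _).hom
    have e3 := wl V (wl V (((isAlgebra_iff _ _).1 h.base.bialgebra.algebra).2.2 Z))
    have e4 := wl V (cross_left21 B.mul V (A ⊗ Z))
    simp only [tail_tensorCoaction, fans, cancels, r12 H.comul] at e1
    have e2 := wl A e1
    simp only [bothCoact, whiskerLeft_comp, assoc] at e2 e3 e4
    simp only [tail_coactMul, fans, cancels]
    simp only [nats]
    rw [← reassoc_of% (cross_right12 H.comul A), ← reassoc_of% e2]
    simp only [nats]
    rw [← e3, ← reassoc_of% e4]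
    simp only [nats]
  counit_left Z := by
    have e1 := wl V ((tail_mul_counit_iff _ _).1 h.base.bialgebra.mul_counit Z)
    have e2 := h.comodule.tail.counit Z
    simp only [whiskerLeft_comp] at e1 e2
    simp only [tail_coactMul, fans, cancels]
    rw [e1, reassoc_of% (cross_left10 B.counit V (A ⊗ Z)), o10_nat_assoc, e2, comp_id]
  counit_right Z := by
    have e1 := (tail_comoduleHom_iff _ _ _).1 h.counit_hom Z =≫ (λ_ _).hom
    simp only [tail_unitCoaction, fans, cancels, r10 H.counit] at e1
    have e2 := wl A e1
    have e3 := ((isAlgebra_iff _ _).1 h.base.bialgebra.algebra).2.1 Z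
    simp only [whiskerLeft_comp, id_whiskerLeft, cancels] at e2
    simp only [tail_coactMul, fans, cancels]
    simp only [nats]
    rw [reassoc_of% (cross_right10 H.counit A), ← reassoc_of% e2, e3, comp_id]

/-- The braiding of `V` with `A`, followed by the counit of `V`. -/
theorem IsBialgebraOver.braiding_counit (h : IsBialgebraOver B δ H) (Z : M) :
    o22 (Ψ[B] δ B.comul) Z ≫ A ◁ o10 H.counit Z = o10 H.counit (A ⊗ Z) := by
  have := comoduleBraiding_natural h.counit_hom (isComoduleHom_id B.comul) B.pairing
  rw [comoduleBraiding_unit_left h.base.pairing h.base.bialgebra.tailComodule.counit, tensor_def,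
    tensorHom_def'] at this
  have := (α_ _ _ _).inv ≫= whisk this Z =≫ (α_ _ _ _).hom
  simp only [whiskerLeft_id, id_whiskerRight, fans, cancels, r22 (Ψ[B] δ B.comul), r10 H.counit] at this
  rw [← cancel_mono (A ◁ (λ_ Z).inv), this, assoc]

/-- The bosonization of a bialgebra in the category of comodules is a bialgebra. -/
theorem IsBialgebraOver.bosonization (h : IsBialgebraOver B δ H) :
    IsBialgebra (β_ (A ⊗ V) (A ⊗ V)).hom
      ⟨(λ_ (𝟙_ M)).inv ≫ (B.one ⊗ₘ H.one),
        crossMul (β_ V A).hom B.mul B.comul (action δ B.pairing) H.mul,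
        (B.counit ⊗ₘ H.counit) ≫ (λ_ (𝟙_ M)).hom,
        crossComul (β_ A V).hom B.mul B.comul δ H.comul⟩ := by
  rw [crossMul_eq_twistMul, crossComul_eq_twistComul]
  have hV := h.comoduleAlgebra
  have hA := h.base.comoduleAlgebra
  have hE := hA.tensor h.base h.comodule hV
  refine ⟨hE.algebra, h.isCodistrib.isCoalgebra h.base.bialgebra.coalgebra h.bialgebra.coalgebra,
    ?_, ?_, ?_, ?_⟩
  · have e1 : H.mul ≫ H.comul = (H.comul ⊗ₘ H.comul) ≫
      twistMul (Ψ[B] δ δ) H.mul H.mul := h.bialgebra.mul_comul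
    have e2 := twistMul_natural (μ := B.mul) e1 (χ := Ψ[B] δ B.comul)
      (χ' := Ψ[B] (tensorCoaction B δ δ) B.comul) (by
        have := comoduleBraiding_natural h.comul_hom (isComoduleHom_id B.comul) B.pairing
        rwa [tensorHom_id, id_tensorHom] at this)
    have e3 := twistMul_assoc (χV := Ψ[B] δ B.comul)
      (χW := Ψ[B] δ B.comul) (c := Ψ[B] δ δ) (μ := B.mul)
      (ν := H.mul) (ξ := H.mul)
    have e4 := twistMul_coaction (B := B) (δV := δ) (ν := H.mul) hE.comodule hE.mul_hom
    rw [← comoduleBraiding_tensor_left h.base.pairing hA.comodule.coassoc h.comodule,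
      ← comoduleBraiding_tensor_right h.base.pairing h.comodule.tail.coassoc] at e3
    have e5 := twistComul_eq_coaction (B := B) (δ := δ) H.comul
    dsimp only
    rw [e5, reassoc_of% e2, reassoc_of% e3, e4]
    simp only [tensorHom_comp_tensorHom_assoc]
  · have k1 := (tail_one_comul_iff _ _).1 h.base.bialgebra.one_comul
    have k2 := (tail_one_comul_iff _ _).1 h.bialgebra.one_comul
    have k3 : ∀ Z, o01 H.one Z ≫ o12 δ Z = o01 H.one Z ≫ V ◁ o01 B.one Z := by
      intro Z
      have := (λ_ _).inv ≫= (tail_comoduleHom_iff _ _ _).1 h.one_hom Z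
      rw [← o01_nat]
      simpa only [tail_unitCoaction, r01 H.one, fans, cancels, id_whiskerLeft] using this
    have k4 := fun Z => wl V (((isAlgebra_iff _ _).1 h.base.bialgebra.algebra).1 Z)
    simp only [whiskerLeft_comp, whiskerLeft_id] at k4
    refine (tail_one_comul_iff _ _).2 fun Z => ?_
    have k : o01 H.one Z ≫ o01 B.one (V ⊗ Z) ≫ A ◁ o12 H.comul Z ≫ A ◁ o12 δ (V ⊗ Z) ≫
        cross A V (A ⊗ V ⊗ Z) ≫ V ◁ o21 B.mul (V ⊗ Z) =
        o01 H.one Z ≫ V ◁ o01 H.one Z ≫ V ◁ o01 B.one (V ⊗ Z) := by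
      rw [← o01_nat_assoc, ← o01_nat_assoc, reassoc_of% (cross_left01 B.one V), reassoc_of% k2]
      rw [k4, comp_id, o12_nat, reassoc_of% k3, wl_sq V (o01_nat _ _)]
    have k' := wl A k
    simp only [whiskerLeft_comp] at k'
    simp only [tail_tensor_one, tail_twistComul, tail_coactMul, fans, cancels]
    rw [reassoc_of% k1, o01_nat_assoc, reassoc_of% k', o01_nat_assoc B.one (o01 H.one Z)]
  · have k1 := (tail_mul_counit_iff _ _).1 h.base.bialgebra.mul_counit
    have k2 := (tail_mul_counit_iff _ _).1 h.bialgebra.mul_counit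
    have k3 := h.braiding_counit
    refine (tail_mul_counit_iff _ _).2 fun Z => ?_
    simp only [tail_tensor_counit', tail_twistMul, fans, cancels]
    simp only [flats, fans, cancels, cancels4]
    rw [cancel_epi, cancel_epi]
    simp only [nats]
    rw [reassoc_of% k1, k2]
    simp only [nats]
    rw [← o10_nat_assoc B.counit (o10 H.counit (V ⊗ Z))]
    rw [reassoc_of% k3]
  · have k1 := (tail_one_counit_iff _ _).1 h.base.bialgebra.one_counit
    have k2 := (tail_one_counit_iff _ _).1 h.bialgebra.one_counit
    refine (tail_one_counit_iff _ _).2 fun Z => ?_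
    rw [tail_tensor_one, tail_tensor_counit']
    simp only [cancels]
    rw [reassoc_of% k1, k2]
end Bosonization

/-! ### The pairing of the bosonization -/

section Comap
variable {M : Type u} [Category.{v} M] [MonoidalCategory M]

theorem nested_comap {P P' Q Q' S S' T T' : M} (a : S ⟶ P) (a' : S' ⟶ P') (b : T ⟶ Q) (b' : T' ⟶ Q')
    (ρ : P ⊗ P' ⟶ 𝟙_ M) (σ : Q ⊗ Q' ⟶ 𝟙_ M) :
    nested ((a ⊗ₘ a') ≫ ρ) ((b ⊗ₘ b') ≫ σ) = ((a ⊗ₘ b) ⊗ₘ (b' ⊗ₘ a')) ≫ nested ρ σ := by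
  have h : (b ⊗ₘ (b' ⊗ₘ a')) ≫ (α_ Q Q' P').inv ≫ σ ▷ P' ≫ (λ_ P').hom =
      ((α_ T T' S').inv ≫ ((b ⊗ₘ b') ≫ σ) ▷ S' ≫ (λ_ S').hom) ≫ a' := by
    rw [associator_inv_naturality_assoc, assoc, assoc, ← leftUnitor_naturality,
      ← whisker_exchange_assoc, comp_whiskerRight, tensor_def (b ⊗ₘ b') a']
    simp only [assoc, whisker_exchange_assoc]
  rw [nested, nested, associator_naturality_assoc, ← id_tensorHom, ← id_tensorHom,
    tensorHom_comp_tensorHom_assoc, tensorHom_comp_tensorHom_assoc, h, comp_id, id_comp]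

theorem o21_comp {A B D E : M} (f : A ⊗ B ⟶ D) (g : D ⟶ E) (Z : M) : o21 (f ≫ g) Z = o21 f Z ≫ g ▷ Z := by
  simp [o21]

theorem tail_comp_mul {A B A' B' D : M} (f : A ⊗ B ⟶ A' ⊗ B') (g : A' ⊗ B' ⟶ D) (Z : M) :
    o21 (f ≫ g) Z = o22 f Z ≫ o21 g Z := by
  simp [o21, o22]

theorem o12_comp {A B D E : M} (f : A ⟶ B) (g : B ⟶ D ⊗ E) (Z : M) : o12 (f ≫ g) Z = f ▷ Z ≫ o12 g Z := by
  simp [o12]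

theorem tail_tensorHom_mul {A A' B B' D : M} (f : A ⟶ A') (g : B ⟶ B') (h : A' ⊗ B' ⟶ D) (Z : M) :
    o21 ((f ⊗ₘ g) ≫ h) Z = A ◁ g ▷ Z ≫ f ▷ (B' ⊗ Z) ≫ o21 h Z := by
  rw [o21, tensorHom_def']
  simp only [fans, cancels, r21 h]

theorem tail_comul_tensorHom {A A' B B' D : M} (f : A ⟶ A') (g : B ⟶ B') (h : D ⟶ A ⊗ B) (Z : M) :
    o12 (h ≫ (f ⊗ₘ g)) Z = o12 h Z ≫ f ▷ (B ⊗ Z) ≫ A' ◁ g ▷ Z := by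
  rw [o12, tensor_def]
  simp only [fans, cancels, r12 h]

variable [BraidedCategory M] {A E : M} {BE : PairData E} {B : PairData A} {p : E ⟶ A}

theorem middle_braiding_comap : ((p ⊗ₘ p) ⊗ₘ (p ⊗ₘ p)) ≫ middle A (β_ A A).hom A =
    middle E (β_ E E).hom E ≫ ((p ⊗ₘ p) ⊗ₘ (p ⊗ₘ p)) := by
  have h := tensorμ_natural p p p p
  simpa only [tensorμ, middle, whiskerLeft_comp, assoc] using h

theorem IsBialgebraPairing.comap (hp : IsBialgHom p BE.toBialgData B.toBialgData)
    (hp' : BE.mulBar ≫ p = (p ⊗ₘ p) ≫ B.mulBar)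
    (h : IsBialgebraPairing (B.barOp (β_ A A).hom) B.toBialgData B.pairing)
    (hρ : BE.pairing = (p ⊗ₘ p) ≫ B.pairing) :
    IsBialgebraPairing (BE.barOp (β_ E E).hom) BE.toBialgData BE.pairing where
  mul_left := by
    have h1 := ((p ⊗ₘ p) ⊗ₘ p) ≫= h.mul_left
    rw [hρ, nested_comap]
    dsimp only [PairData.barOp] at h1 ⊢
    simp only [← tensorHom_id, ← id_tensorHom, tensorHom_comp_tensorHom_assoc, comp_id, id_comp,
      hp.comul, hp', assoc] at h1 ⊢
    rw [← BraidedCategory.braiding_naturality_assoc]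
    exact h1
  mul_right := by
    have h1 := (p ⊗ₘ (p ⊗ₘ p)) ≫= h.mul_right
    rw [hρ, nested_comap]
    dsimp only [PairData.barOp] at h1 ⊢
    simp only [← tensorHom_id, ← id_tensorHom, tensorHom_comp_tensorHom_assoc, comp_id, id_comp,
      hp.comul, hp.mul] at h1 ⊢
    exact h1
  one_left := by
    have h1 := 𝟙_ M ◁ p ≫= h.one_left
    rw [hρ]
    dsimp only [PairData.barOp] at h1 ⊢
    rw [← hp.counit, ← leftUnitor_naturality_assoc, ← h1, ← hp.one]
    simp only [← tensorHom_id, ← id_tensorHom, tensorHom_comp_tensorHom_assoc, comp_id, id_comp]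
  one_right := by
    have h1 := p ▷ 𝟙_ M ≫= h.one_right
    rw [hρ]
    dsimp only [PairData.barOp] at h1 ⊢
    rw [← hp.counit, ← rightUnitor_naturality_assoc, ← h1, ← hp.one]
    simp only [← tensorHom_id, ← id_tensorHom, tensorHom_comp_tensorHom_assoc, comp_id, id_comp]

theorem convolution_comap (hp : BE.comul ≫ (p ⊗ₘ p) = p ≫ B.comul) (ρ σ : A ⊗ A ⟶ 𝟙_ M) :
    convolution (β_ E E).hom BE.comul ((p ⊗ₘ p) ≫ ρ) ((p ⊗ₘ p) ≫ σ) =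
      (p ⊗ₘ p) ≫ convolution (β_ A A).hom B.comul ρ σ := by
  rw [convolution, convolution, ← tensorHom_comp_tensorHom_assoc,
    ← reassoc_of% (@middle_braiding_comap M _ _ _ A E p), tensorHom_comp_tensorHom_assoc,
    tensorHom_comp_tensorHom_assoc, hp]

theorem IsConvolutionInverse.comap (hp : IsBialgHom p BE.toBialgData B.toBialgData) {ρ ρ' : A ⊗ A ⟶ 𝟙_ M}
    (h : IsConvolutionInverse (β_ A A).hom B.toBialgData ρ ρ') :
    IsConvolutionInverse (β_ E E).hom BE.toBialgData ((p ⊗ₘ p) ≫ ρ) ((p ⊗ₘ p) ≫ ρ') where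
  right := by
    rw [convolution_comap hp.comul.symm, h.right, tensorHom_comp_tensorHom_assoc, hp.counit]
  left := by
    rw [convolution_comap hp.comul.symm, h.left, tensorHom_comp_tensorHom_assoc, hp.counit]

end Comap
section Bosonization
variable {M : Type u} [Category.{v} M] [MonoidalCategory M] [BraidedCategory M]
variable {A V : M} {δ : V ⟶ V ⊗ A} {B : PairData A} {H : BialgData V}

/-- The projection `A ⊗ ε` of the bosonization onto `A`. -/
def bosonProj (A : M) (ζ : V ⟶ 𝟙_ M) : A ⊗ V ⟶ A := A ◁ ζ ≫ (ρ_ A).hom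

theorem tail_bosonProj (ζ : V ⟶ 𝟙_ M) (Z : M) : bosonProj A ζ ▷ Z = (α_ A V Z).hom ≫ A ◁ o10 ζ Z := by
  rw [bosonProj]
  simp only [fans, cancels, r10 ζ]

theorem IsBialgebraOver.isBialgHom_proj (h : IsBialgebraOver B δ H) :
    IsBialgHom (bosonProj A H.counit)
      ⟨(λ_ (𝟙_ M)).inv ≫ (B.one ⊗ₘ H.one),
        crossMul (β_ V A).hom B.mul B.comul (action δ B.pairing) H.mul,
        (B.counit ⊗ₘ H.counit) ≫ (λ_ (𝟙_ M)).hom,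
        crossComul (β_ A V).hom B.mul B.comul δ H.comul⟩ B.toBialgData where
  one := by
    have k2 := (tail_one_counit_iff _ _).1 h.bialgebra.one_counit
    refine tail_ext fun Z => ?_
    rw [comp_whiskerRight, r01 (_ ≫ (B.one ⊗ₘ H.one)), tail_tensor_one, tail_bosonProj, r01 B.one]
    simp only [cancels]
    rw [← o01_nat, reassoc_of% k2]
  mul := by
    have k2 := fun Z => wl A ((tail_mul_counit_iff _ _).1 h.bialgebra.mul_counit Z)
    have k3 := fun Z => wl A (h.braiding_counit Z)
    simp only [whiskerLeft_comp] at k2 k3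
    rw [crossMul_eq_twistMul]
    refine o21_ext fun Z => ?_
    dsimp only
    rw [o21_comp, tail_tensorHom_mul]
    simp only [tail_bosonProj, tail_twistMul]
    simp only [fans, cancels]
    rw [cancel_epi]
    rw [k2, ← o21_nat_assoc, reassoc_of% k3]
    simp only [nats]
  counit := by
    refine tail_ext fun Z => ?_
    rw [r10 (_ ≫ (λ_ (𝟙_ M)).hom), tail_tensor_counit']
    simp only [fans, cancels, tail_bosonProj, r10 B.counit]
    simp only [nats]
  comul := by
    have k2 := fun Z => wl A (wl A (((isCoalgebra_iff _ _).1 h.bialgebra.coalgebra).1 Z))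
    have k3 := fun Z => wl A (h.isCodistrib.counit_right Z)
    simp only [whiskerLeft_comp, whiskerLeft_id] at k2 k3
    rw [crossComul_eq_twistComul]
    refine o12_ext fun Z => ?_
    dsimp only
    rw [o12_comp, tail_comul_tensorHom]
    simp only [tail_bosonProj, tail_twistComul]
    simp only [fans, cancels]
    simp only [flats, fans, cancels, cancels4]
    rw [cancel_epi]
    simp only [nats]
    rw [reassoc_of% k3, reassoc_of% k2]

/-- The comodule braiding of the coaction `(A ⊗ V ⊗ p) ∘ Δ` of the bosonization on itself. -/
theorem comoduleBraiding_boson {δP : A ⟶ A ⊗ A} (hB : IsBialgebraPairing (B.barOp (β_ A A).hom) B.toBialgData B.pairing)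
    (hΔ : IsTailComodule B.toBialgData δP)  (hb : IsBialgebra (β_ A A).hom B.toBialgData) (hV : IsOComodule B δ) (Z : M) :
    o22 (Ψ[B] (tensorCoaction B δP δ) (tensorCoaction B δP δ)) Z =
      (α_ A V _).hom ≫ A ◁ V ◁ (α_ A V Z).hom ≫ A ◁ o22 (Ψ[B] δ δP) (V ⊗ Z) ≫
        o22 (Ψ[B] δP δP) (V ⊗ V ⊗ Z) ≫ A ◁ A ◁ o22 (Ψ[B] δ δ) Z ≫
        A ◁ o22 (Ψ[B] δP δ) (V ⊗ Z) ≫ A ◁ V ◁ (α_ A V Z).inv ≫ (α_ A V _).inv := by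
  rw [comoduleBraiding_tensor_left hB (hΔ.tensor hb hV.tail).coassoc hV, tail_hexagon_left,
    comoduleBraiding_tensor_right hB hΔ.coassoc, comoduleBraiding_tensor_right hB hV.tail.coassoc]
  simp only [tail_hexagon_right, fans, cancels]
  rw [cancel_epi]
  simp only [nats]

theorem convolve_right {E : M} {Δ : E ⟶ E ⊗ E} {κ : E ⟶ E ⊗ A} {p : E ⟶ A} (ρ : A ⊗ A ⟶ 𝟙_ M)
    (ν : E ⊗ E ⟶ E) (hκ : ∀ Z, o12 Δ Z ≫ E ◁ p ▷ Z = o12 κ Z) (Z : M) :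
    o12 Δ (E ⊗ Z) ≫ E ◁ E ◁ o12 Δ Z ≫ E ◁ cross E E (E ⊗ Z) ≫ cross E E (E ⊗ E ⊗ Z) ≫
      o21 ν (E ⊗ E ⊗ Z) ≫ E ◁ (E ◁ p ▷ Z ≫ p ▷ (A ⊗ Z) ≫ o20 ρ Z) =
    o22 (comoduleBraiding ρ κ κ) Z ≫ o21 ν Z := by
  have e1 := fun Z => wl E (hκ Z)
  simp only [whiskerLeft_comp] at e1
  rw [tail_comoduleBraiding]
  simp only [← e1, ← hκ, whiskerLeft_comp, assoc]
  rw [← o12_nat_assoc Δ (o12 Δ Z), reassoc_of% (cross_left12 Δ E (E ⊗ Z))]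
  simp only [nats]

theorem convolve_left {E : M} {Δ : E ⟶ E ⊗ E} {κ : E ⟶ A ⊗ E} {p : E ⟶ A} (ρ : A ⊗ A ⟶ 𝟙_ M)
    (hκ : ∀ Z, o12 Δ Z ≫ p ▷ (E ⊗ Z) = o12 κ Z) (Z : M) :
    o12 Δ (E ⊗ Z) ≫ E ◁ E ◁ o12 Δ Z ≫ E ◁ cross E E (E ⊗ Z) ≫
      E ◁ p ▷ (E ⊗ E ⊗ Z) ≫ p ▷ (A ⊗ E ⊗ E ⊗ Z) ≫ o20 ρ (E ⊗ E ⊗ Z) =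
    o12 κ (E ⊗ Z) ≫ A ◁ E ◁ o12 κ Z ≫ A ◁ cross E A (E ⊗ Z) ≫ o20 ρ (E ⊗ E ⊗ Z) := by
  have e1 := fun Z => wl A (wl E (hκ Z))
  have e2 := fun Z => wl E (cross_right11 p E Z)
  simp only [whiskerLeft_comp] at e1 e2
  rw [← reassoc_of% e2]
  simp only [nats]
  rw [reassoc_of% e1, reassoc_of% hκ]

/-- The quasi-commutativity of the bosonization.  The pairing factors through the projection onto `A`, so that
both sides are twisted by the braiding of the coaction `(A ⊗ V ⊗ p) ∘ Δ`; the two factors `V` are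
interchanged by `c` and `c⁻¹`, and there remains the quasi-commutativity of `A`. -/
theorem bosonization_quasi_comm {ρ' : A ⊗ A ⟶ 𝟙_ M} {c : V ⊗ V ≅ V ⊗ V} (h : IsBialgebraOver B δ H)
    (hρ : IsConvolutionInverse (β_ A A).hom B.toBialgData B.pairing ρ')
    (hc : c.hom = Ψ[B] δ δ) :
    let E := bosonization B ρ' δ (trivialPair c H)
    (E.comul ⊗ₘ E.comul) ≫ middle (A ⊗ V) (β_ (A ⊗ V) (A ⊗ V)).hom (A ⊗ V) ≫
        (((β_ (A ⊗ V) (A ⊗ V)).hom ≫ E.mulBar) ⊗ₘ E.pairing) ≫ (ρ_ (A ⊗ V)).hom =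
      (E.comul ⊗ₘ E.comul) ≫ middle (A ⊗ V) (β_ (A ⊗ V) (A ⊗ V)).hom (A ⊗ V) ≫
        (E.pairing ⊗ₘ E.mul) ≫ (λ_ (A ⊗ V)).hom := by
  intro E
  have hA := h.base.bialgebra.tailComodule
  -- The crossed product and coproduct as twisted tensor products.
  have E1 : E.comul = twistComul (coactMul (β_ A V).hom B.mul δ) B.comul H.comul := crossComul_eq_twistComul _ _ _ _
  have E1' := E1.trans (twistComul_eq_coaction H.comul)
  have E2 : E.mul = twistMul (Ψ[B] δ B.comul) B.mul H.mul := crossMul_eq_twistMul _ _ _ _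
  have E3 : E.mulBar = twistMul (comoduleBraidingInv ρ' δ B.comul) B.mulBar (c.inv ≫ H.mul) :=
    @crossMul_eq_twistMul M _ _ (reverseBraiding M) _ _ _ _ _ _ _
  have p1 : ∀ Z, o12 E.comul Z ≫ (A ⊗ V) ◁ bosonProj A H.counit ▷ Z = o12 (tensorCoaction B B.comul δ) Z := by
    intro Z
    have k := wl A (((isCoalgebra_iff _ _).1 h.bialgebra.coalgebra).2.1 Z)
    simp only [whiskerLeft_comp, whiskerLeft_id] at k
    rw [E1', o12]
    simp only [tail_bosonProj, fans, cancels, r12 H.comul, r12 (tensorCoaction _ _ _)]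
    rw [← tensor_whiskerLeft, ← o12_nat, tensor_whiskerLeft]
    simp only [cancels]
    rw [reassoc_of% k, Iso.hom_inv_id_assoc]
  have k : ∀ Z, o12 (B.comul ▷ V ≫ (α_ A A V).hom) Z =
      (α_ A V Z).hom ≫ o12 B.comul (V ⊗ Z) ≫ A ◁ (α_ A V Z).inv := by
    intro Z
    rw [o12]
    simp only [whiskerLeft_id, fans, cancels, r12 B.comul (V ⊗ Z)]
  have p2 : ∀ Z, o12 E.comul Z ≫ bosonProj A H.counit ▷ ((A ⊗ V) ⊗ Z) = o12 (B.comul ▷ V ≫ (α_ A A V).hom) Z := by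
    intro Z
    rw [E1]
    have k2 := fun Z => wl A (wl A (((isCoalgebra_iff _ _).1 h.bialgebra.coalgebra).1 Z))
    have k3 := fun Z => wl A (h.isCodistrib.counit_right Z)
    simp only [whiskerLeft_comp, whiskerLeft_id] at k2 k3
    simp only [tail_bosonProj, tail_twistComul, fans, cancels]
    rw [wl_sq A (o10_nat _ _), reassoc_of% k3, reassoc_of% k2, k]
  have g0 : ∀ {U U' W W' : M} {f : U ⊗ U' ⟶ W ⊗ W'} {g : W ⊗ W' ⟶ U ⊗ U'}, f ≫ g = 𝟙 _ → ∀ Z,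
      o22 f Z ≫ o22 g Z = 𝟙 _ := by
    intro U U' W W' f g hfg Z
    rw [← tail_comp, hfg]
    simp [o22]
  have p3 : E.pairing = (bosonProj A H.counit ⊗ₘ bosonProj A H.counit) ≫ B.pairing := rfl
  have hop : ∀ Z, o21 ((β_ (A ⊗ V) (A ⊗ V)).hom ≫ E.mulBar) Z = cross (A ⊗ V) (A ⊗ V) Z ≫ o21 E.mulBar Z := by
    intro Z
    rw [o21, o21]; simp [o22]
  have hp : ∀ Z, o20 E.pairing Z = (A ⊗ V) ◁ bosonProj A H.counit ▷ Z ≫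
      bosonProj A H.counit ▷ (A ⊗ Z) ≫ o20 B.pairing Z := by
    intro Z
    rw [p3, o20, tensorHom_def']
    simp only [fans, cancels, r20 B.pairing]
  rw [tail_quasi_comm_iff]
  intro Z
  -- `l` and `r` are the two sides of the axiom, after evaluation of the pairing.
  have l : o12 E.comul ((A ⊗ V) ⊗ Z) ≫ (A ⊗ V) ◁ (A ⊗ V) ◁ o12 E.comul Z ≫
      (A ⊗ V) ◁ o22 (β_ (A ⊗ V) (A ⊗ V)).hom ((A ⊗ V) ⊗ Z) ≫
      o21 ((β_ (A ⊗ V) (A ⊗ V)).hom ≫ E.mulBar) ((A ⊗ V) ⊗ (A ⊗ V) ⊗ Z) ≫ (A ⊗ V) ◁ o20 E.pairing Z =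
      o22 (Ψ[B] (tensorCoaction B B.comul δ) (tensorCoaction B B.comul δ)) Z ≫
        o21 E.mulBar Z := by
    simp only [hp, hop, assoc]
    exact convolve_right B.pairing E.mulBar p1 Z
  have r : o12 E.comul ((A ⊗ V) ⊗ Z) ≫ (A ⊗ V) ◁ (A ⊗ V) ◁ o12 E.comul Z ≫
      (A ⊗ V) ◁ o22 (β_ (A ⊗ V) (A ⊗ V)).hom ((A ⊗ V) ⊗ Z) ≫
      o20 E.pairing ((A ⊗ V) ⊗ (A ⊗ V) ⊗ Z) ≫ o21 E.mul Z =
      (α_ A V _).hom ≫ A ◁ V ◁ (α_ A V Z).hom ≫ A ◁ o22 (Ψ[B] δ B.comul) (V ⊗ Z) ≫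
        o12 B.comul (A ⊗ V ⊗ V ⊗ Z) ≫ A ◁ A ◁ o12 B.comul (V ⊗ V ⊗ Z) ≫ A ◁ cross A A (A ⊗ V ⊗ V ⊗ Z) ≫ 
        o20 B.pairing (A ⊗ A ⊗ V ⊗ V ⊗ Z) ≫ o21 B.mul (V ⊗ V ⊗ Z) ≫ A ◁ o21 H.mul Z ≫ (α_ A V Z).inv := by
    simp only [hp, assoc]
    rw [reassoc_of% (convolve_left B.pairing p2 Z), E2]
    simp only [k, cross_tensor_left, tail_twistMul, fans, cancels]
    simp only [flats, fans, cancels, cancels4]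
    rw [cancel_epi, cancel_epi]
    simp only [nats]
    have f := fun Z => wl A (wl A (comoduleBraiding_coact' (δV := δ) (ρ := B.pairing) hA.coassoc Z))
    simp only [whiskerLeft_comp] at f
    rw [reassoc_of% f]
    simp only [nats]
  have g1 := fun Z => wl A (g0 (comoduleBraiding_hom_inv hA h.comodule.tail hρ) Z)
  have g2 := fun Z => wl A (g0 c.hom_inv_id Z)
  simp only [whiskerLeft_comp, whiskerLeft_id] at g1 g2
  have q := fun Z => h.base.quasi_comm_tail Z
  rw [l, r, E3, comoduleBraiding_boson h.base.pairing hA h.base.bialgebra h.comodule, ← hc]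
  simp only [tail_twistMul, fans, cancels]
  rw [cancel_epi, cancel_epi, reassoc_of% g1, tail_comp_mul, ← reassoc_of% q]
  simp only [whiskerLeft_comp, assoc]
  simp only [nats]
  rw [reassoc_of% g2, tail_comoduleBraiding B.pairing B.comul B.comul]
  simp only [assoc]
  rw [← o12_nat_assoc B.comul (o22 (Ψ[B] δ B.comul) (V ⊗ Z)),
    ← o12_nat_assoc B.comul (o12 B.comul (V ⊗ V ⊗ Z)), reassoc_of% (cross_left12 B.comul A (A ⊗ V ⊗ V ⊗ Z))]
  simp only [nats]
end Bosonization

/-! ### The bosonization as a coquasitriangular bialgebra -/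

section Bosonization
variable {M : Type u} [Category.{v} M] [MonoidalCategory M] [BraidedCategory M]
variable {A V W : M} {δ : V ⟶ V ⊗ A} {δ' : W ⟶ W ⊗ A} {B : PairData A} {H : BialgData V}

/-- The coquasitriangular bialgebra `(Ā, A, ρ̄)` in the category with the inverse braiding. -/
abbrev PairData.swap (B : PairData A) (ρ' : A ⊗ A ⟶ 𝟙_ M) : PairData A where
  toBialgData := B.bar
  mulBar := B.mul
  pairing := barPairing ρ'

theorem IsOComodule.tensorCoaction_swap (h : IsOComodule B δ') (ρ' : A ⊗ A ⟶ 𝟙_ M) :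
    @tensorCoaction M _ _ (reverseBraiding M) _ _ _ (B.swap ρ') δ δ' = tensorCoaction B δ δ' := by
  refine o12_ext fun Z => ?_
  have k := fun Z => wl V (h.central_tail Z)
  simp only [whiskerLeft_comp] at k
  refine (@tail_tensorCoaction M _ _ (reverseBraiding M) _ _ _ (B.swap ρ') δ δ' Z).trans ?_
  rw [tail_tensorCoaction]
  change (α_ V W Z).hom ≫ (o12 δ (W ⊗ Z) ≫ V ◁ A ◁ o12 δ' Z ≫ V ◁ crossInv A W (A ⊗ Z)) ≫
    V ◁ W ◁ o21 B.mulBar Z ≫ (α_ V W (A ⊗ Z)).inv = _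
  simp only [bothCoact, assoc]
  rw [reassoc_of% k]

theorem IsOComodule.swap (h : IsOComodule B δ) (ρ' : A ⊗ A ⟶ 𝟙_ M) :
    @IsOComodule M _ _ (reverseBraiding M) _ _ (B.swap ρ') δ :=
  @IsOComodule.mk M _ _ (reverseBraiding M) _ _ _ _ h.coassoc h.counit h.central.symm

variable {ρ' : A ⊗ A ⟶ 𝟙_ M} {c : V ⊗ V ≅ V ⊗ V}

theorem IsDualQuantumBraidedGroupOver.isBialgebraOver (hB : IsCoquasitriangular (β_ A A) B)
    (h : IsDualQuantumBraidedGroupOver B δ c (trivialPair c H))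
    (hc : c.hom = Ψ[B] δ δ) : IsBialgebraOver B δ H :=
  ⟨hB, h.comodule, h.one_hom, h.mul_hom, h.counit_hom, h.comul_hom, hc ▸ h.coquasitriangular.bialgebra⟩

theorem IsDualQuantumBraidedGroupOver.isBialgebraOver_swap
    (hB : @IsCoquasitriangular M _ _ A (@BraidedCategory.braiding M _ _ (reverseBraiding M) A A) (B.swap ρ'))
    (h : IsDualQuantumBraidedGroupOver B δ c (trivialPair c H))
    (hc : c.inv = comoduleBraidingInv ρ' δ δ) :
    @IsBialgebraOver M _ _ (reverseBraiding M) _ _ (B.swap ρ') δ (trivialPair c H).bar := by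
  refine @IsBialgebraOver.mk M _ _ (reverseBraiding M) _ _ _ _ _ hB (h.comodule.swap ρ') h.one_hom
    ?_ h.counit_hom ?_ ?_
  · rw [h.comodule.tensorCoaction_swap]
    exact h.mulBar_hom
  · rw [h.comodule.tensorCoaction_swap]
    exact h.comul_hom
  · have := h.coquasitriangular.bialgebra_bar
    rw [hc] at this
    exact this

theorem IsOComodule.bosonizationComulBar (h : IsOComodule B δ) (W : PairData V) :
    bosonizationComulBar B δ W = (bosonization B ρ' δ W).comul := by
  rw [BraidedFRT.bosonizationComulBar, bosonization]
  dsimp only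
  rw [crossComul_eq_twistComul, crossComul_eq_twistComul]
  congr 1
  exact h.central.symm

/-- The bosonization of a dual quantum braided group with the trivial coquasitriangular structure
is coquasitriangular: its pairing is the pullback of `ρ` along the bialgebra map
`A ⊗ ε : A ⊗ V ⟶ A`. -/
theorem bosonization_isCoquasitriangular (hB : IsCoquasitriangular (β_ A A) B)
    (hρ : IsConvolutionInverse (β_ A A).hom B.toBialgData B.pairing ρ')
    (hB' : @IsCoquasitriangular M _ _ A (@BraidedCategory.braiding M _ _ (reverseBraiding M) A A) (B.swap ρ'))
    (h : IsDualQuantumBraidedGroupOver B δ c (trivialPair c H))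
    (hc : c.hom = Ψ[B] δ δ) (hc' : c.inv = comoduleBraidingInv ρ' δ δ) :
    IsCoquasitriangular (β_ (A ⊗ V) (A ⊗ V)) (bosonization B ρ' δ (trivialPair c H)) := by
  have h1 := h.isBialgebraOver hB hc
  have h2 := h.isBialgebraOver_swap hB' hc'
  have e : (bosonization B ρ' δ (trivialPair c H)).bar = ⟨(λ_ (𝟙_ M)).inv ≫ (B.one ⊗ₘ H.one),
        crossMul (β_ A V).inv B.mulBar B.comul (action δ (barPairing ρ')) (c.inv ≫ H.mul),
        (B.counit ⊗ₘ H.counit) ≫ (λ_ (𝟙_ M)).hom,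
        crossComul (β_ V A).inv B.mulBar B.comul δ H.comul⟩ := by
    rw [PairData.bar, ← h.comodule.bosonizationComulBar]
    rfl
  have p1 := h1.isBialgHom_proj
  have p2 := @IsBialgebraOver.isBialgHom_proj M _ _ (reverseBraiding M) _ _ _ _ _ h2
  refine ⟨h1.bosonization, ?_, ?_, ⟨_, hρ.comap (BE := bosonization B ρ' δ (trivialPair c H)) p1⟩,
    bosonization_quasi_comm h1 hρ hc⟩
  · rw [e]
    exact @IsBialgebraOver.bosonization M _ _ (reverseBraiding M) _ _ _ _ _ h2
  · exact IsBialgebraPairing.comap (BE := bosonization B ρ' δ (trivialPair c H)) p1 p2.mul hB.pairing rfl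

end Bosonization

noncomputable section
/-! ### Tensor powers -/

section Powers
variable {C : Type u} [Category.{v} C] [MonoidalCategory C]

/-- `X^{⊗0} ⊗ Z ≅ Z` -/
def tzero (X Z : C) : tpow X 0 ⊗ Z ≅ Z := λ_ Z
/-- `X^{⊗(n+1)} ⊗ Z ≅ X^{⊗n} ⊗ (X ⊗ Z)` -/
def tsucc (X : C) (n : ℕ) (Z : C) : tpow X (n + 1) ⊗ Z ≅ tpow X n ⊗ (X ⊗ Z) := α_ (tpow X n) X Z

theorem tzero_nat (X : C) {Z Z' : C} (h : Z ⟶ Z') :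
    tpow X 0 ◁ h ≫ (tzero X Z').hom = (tzero X Z).hom ≫ h := leftUnitor_naturality h
theorem tsucc_nat (X : C) (n : ℕ) {Z Z' : C} (h : Z ⟶ Z') :
    tpow X (n + 1) ◁ h ≫ (tsucc X n Z').hom = (tsucc X n Z).hom ≫ tpow X n ◁ X ◁ h :=
  associator_naturality_right _ _ _
theorem tail_tmul_zero (X : C) (m : ℕ) (Z : C) : o21 (tmul X m 0) Z = tpow X m ◁ (tzero X Z).hom := by
  change (α_ _ (𝟙_ C) Z).inv ≫ (ρ_ (tpow X m)).hom ▷ Z = _ ◁ (λ_ Z).hom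
  simp
theorem tail_tmul_succ (X : C) (m n : ℕ) (Z : C) : o21 (tmul X m (n + 1)) Z =
    tpow X m ◁ (tsucc X n Z).hom ≫ o21 (tmul X m n) (X ⊗ Z) ≫ (tsucc X (m + n) Z).inv := by
  change (α_ _ (tpow X n ⊗ X) Z).inv ≫ ((α_ (tpow X m) (tpow X n) X).inv ≫ tmul X m n ▷ X) ▷ Z =
    tpow X m ◁ (α_ (tpow X n) X Z).hom ≫ o21 (tmul X m n) (X ⊗ Z) ≫ (α_ (tpow X (m + n)) X Z).inv
  simp only [fans, cancels, r21 (tmul X m n)]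

theorem tail_RPowOne_zero {X : C} (R : X ⊗ X ⟶ X ⊗ X) (Z : C) :
    o22 (RPowOne R 0) Z = (tzero X (X ⊗ Z)).hom ≫ X ◁ (tzero X Z).inv := by
  change (α_ (𝟙_ C) X Z).inv ≫ ((λ_ X).hom ≫ (ρ_ X).inv) ▷ Z ≫ (α_ X (𝟙_ C) Z).hom =
    (λ_ (X ⊗ Z)).hom ≫ X ◁ (λ_ Z).inv
  simp
theorem tail_RPowOne_succ {X : C} (R : X ⊗ X ⟶ X ⊗ X) (m : ℕ) (Z : C) :
    o22 (RPowOne R (m + 1)) Z = (tsucc X m (X ⊗ Z)).hom ≫ tpow X m ◁ o22 R Z ≫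
      o22 (RPowOne R m) (X ⊗ Z) ≫ X ◁ (tsucc X m Z).inv := by
  change (α_ (tpow X m ⊗ X) X Z).inv ≫ ((α_ (tpow X m) X X).hom ≫ tpow X m ◁ R ≫ (α_ (tpow X m) X X).inv ≫
      RPowOne R m ▷ X ≫ (α_ X (tpow X m) X).hom) ▷ Z ≫ (α_ X (tpow X m ⊗ X) Z).hom =
    (α_ (tpow X m) X (X ⊗ Z)).hom ≫ tpow X m ◁ o22 R Z ≫
      o22 (RPowOne R m) (X ⊗ Z) ≫ X ◁ (α_ (tpow X m) X Z).inv
  simp only [fans, cancels, r22 R, r22 (RPowOne R m)]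
theorem tail_RPow_zero {X : C} (R : X ⊗ X ⟶ X ⊗ X) (m : ℕ) (Z : C) :
    o22 (RPow R m 0) Z = tpow X m ◁ (tzero X Z).hom ≫ (tzero X (tpow X m ⊗ Z)).inv := by
  change (α_ (tpow X m) (𝟙_ C) Z).inv ≫ ((ρ_ (tpow X m)).hom ≫ (λ_ (tpow X m)).inv) ▷ Z ≫
    (α_ (𝟙_ C) (tpow X m) Z).hom = tpow X m ◁ (λ_ Z).hom ≫ (λ_ (tpow X m ⊗ Z)).inv
  simp
theorem tail_RPow_succ {X : C} (R : X ⊗ X ⟶ X ⊗ X) (m n : ℕ) (Z : C) :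
    o22 (RPow R m (n + 1)) Z = tpow X m ◁ (tsucc X n Z).hom ≫ o22 (RPow R m n) (X ⊗ Z) ≫
      tpow X n ◁ o22 (RPowOne R m) Z ≫ (tsucc X n (tpow X m ⊗ Z)).inv := by
  change (α_ (tpow X m) (tpow X n ⊗ X) Z).inv ≫ ((α_ (tpow X m) (tpow X n) X).inv ≫ RPow R m n ▷ X ≫
      (α_ (tpow X n) (tpow X m) X).hom ≫ tpow X n ◁ RPowOne R m ≫
      (α_ (tpow X n) X (tpow X m)).inv) ▷ Z ≫ (α_ (tpow X n ⊗ X) (tpow X m) Z).hom =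
    tpow X m ◁ (α_ (tpow X n) X Z).hom ≫ o22 (RPow R m n) (X ⊗ Z) ≫
      tpow X n ◁ o22 (RPowOne R m) Z ≫ (α_ (tpow X n) X (tpow X m ⊗ Z)).inv
  simp only [fans, cancels, r22 (RPow R m n), r22 (RPowOne R m)]

instance isIso_tmul (X : C) (m n : ℕ) : IsIso (tmul X m n) := by
  induction n with
  | zero => exact inferInstanceAs (IsIso (ρ_ (tpow X m)).hom)
  | succ n ih => exact inferInstanceAs (IsIso ((α_ (tpow X m) (tpow X n) X).inv ≫ tmul X m n ▷ X))

/-- The canonical isomorphism `X^{⊗m} ⊗ X^{⊗n} ≅ X^{⊗N}`, for `m + n = N`. -/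
def tpowIso (X : C) {m n N : ℕ} (h : m + n = N) : tpow X m ⊗ tpow X n ≅ tpow X N :=
  asIso (tmul X m n) ≪≫ eqToIso (congrArg (tpow X) h)

theorem tpowIso_hom (X : C) (m n : ℕ) (h : m + n = m + n) : (tpowIso X h).hom = tmul X m n := by
  simp [tpowIso]

theorem tail_tpowIso_zero (X : C) {m : ℕ} (h : m + 0 = m) (Z : C) :
    o21 (tpowIso X h).hom Z = tpow X m ◁ (tzero X Z).hom := by
  rw [← tail_tmul_zero, ← tpowIso_hom X m 0 rfl]

theorem tail_tpowIso_succ (X : C) {m n N : ℕ} (h : m + n = N) (h' : m + (n + 1) = N + 1) (Z : C) :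
    o21 (tpowIso X h').hom Z =
    tpow X m ◁ (tsucc X n Z).hom ≫ o21 (tpowIso X h).hom (X ⊗ Z) ≫ (tsucc X N Z).inv := by
  subst h
  rw [tpowIso_hom X m n, ← tail_tmul_succ, ← tpowIso_hom X m (n + 1) rfl]

theorem tail_tpowIso_assoc (X : C) {n : ℕ} : ∀ {l m lm mn N : ℕ} (h1 : l + m = lm) (h2 : lm + n = N)
    (h3 : m + n = mn) (h4 : l + mn = N) (Z : C),
    o21 (tpowIso X h1).hom (tpow X n ⊗ Z) ≫ o21 (tpowIso X h2).hom Z =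
      tpow X l ◁ o21 (tpowIso X h3).hom Z ≫ o21 (tpowIso X h4).hom Z := by
  induction n with
  | zero =>
    intro l m lm mn N h1 h2 h3 h4 Z
    obtain rfl : mn = m := h3.symm
    obtain rfl : lm = N := h2
    rw [tail_tpowIso_zero, tail_tpowIso_zero]
    exact (o21_nat _ _).symm
  | succ n ih =>
    intro l m lm mn N h1 h2 h3 h4 Z
    obtain rfl : m + n + 1 = mn := h3
    obtain rfl : lm + n + 1 = N := h2
    rw [tail_tpowIso_succ X (rfl : lm + n = _), tail_tpowIso_succ X (rfl : m + n = _),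
      tail_tpowIso_succ X (N := lm + n) (m := l) (n := m + n) (by omega)]
    have := ih h1 (rfl : lm + n = _) (rfl : m + n = _) (by omega) (X ⊗ Z)
    simp only [whiskerLeft_comp, assoc, cancels]
    rw [← reassoc_of% this, o21_nat_assoc]

theorem tail_tpowIso_zero_left (X : C) {n : ℕ} (h : 0 + n = n) (Z : C) :
    o21 (tpowIso X h).hom Z = (tzero X _).hom := by
  induction n generalizing Z with
  | zero => rw [tail_tpowIso_zero X h, ← cancel_mono (tzero X Z).hom, tzero_nat]
  | succ n ih =>
    rw [tail_tpowIso_succ X (Nat.zero_add n), ih, reassoc_of% (tzero_nat X (tsucc X n Z).hom), Iso.hom_inv_id, comp_id]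

/-- `R_{X^{⊗m}, X}` satisfies the first hexagon identity. -/
theorem tail_RPowOne_add {X : C} (R : X ⊗ X ⟶ X ⊗ X) {m n N : ℕ} (h : m + n = N) (Z : C) :
    o21 (tpowIso X h).hom (X ⊗ Z) ≫ o22 (RPowOne R N) Z =
      tpow X m ◁ o22 (RPowOne R n) Z ≫ o22 (RPowOne R m) (tpow X n ⊗ Z) ≫ X ◁ o21 (tpowIso X h).hom Z := by
  induction n generalizing N Z with
  | zero =>
    obtain rfl : m = N := h
    rw [tail_tpowIso_zero, tail_tpowIso_zero, tail_RPowOne_zero, ← o22_nat]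
    simp only [whiskerLeft_comp, cancels]
  | succ n ih =>
    obtain rfl : m + n + 1 = N := h
    rw [tail_tpowIso_succ X (rfl : m + n = _), tail_tpowIso_succ X (rfl : m + n = _), tail_RPowOne_succ,
      tail_RPowOne_succ]
    simp only [whiskerLeft_comp, cancels, ← o22_nat_assoc, ← o21_nat_assoc]
    rw [reassoc_of% (ih rfl (X ⊗ Z))]

/-- `R_{X^{⊗a}, X^{⊗n}}` satisfies the second hexagon identity. -/
theorem tail_RPow_add_right {X : C} (R : X ⊗ X ⟶ X ⊗ X) (a : ℕ) {m n N : ℕ} (h : m + n = N) (Z : C) :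
    tpow X a ◁ o21 (tpowIso X h).hom Z ≫ o22 (RPow R a N) Z =
      o22 (RPow R a m) (tpow X n ⊗ Z) ≫ tpow X m ◁ o22 (RPow R a n) Z ≫ o21 (tpowIso X h).hom (tpow X a ⊗ Z) := by
  induction n generalizing N Z with
  | zero =>
    obtain rfl : m = N := h
    rw [tail_tpowIso_zero, tail_tpowIso_zero, tail_RPow_zero, o22_nat]
    simp only [whiskerLeft_comp, cancels]
  | succ n ih =>
    obtain rfl : m + n + 1 = N := h
    rw [tail_tpowIso_succ X (rfl : m + n = _), tail_tpowIso_succ X (rfl : m + n = _), tail_RPow_succ,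
      tail_RPow_succ]
    simp only [whiskerLeft_comp, cancels]
    rw [reassoc_of% (ih rfl (X ⊗ Z)), ← o21_nat_assoc, o22_nat_assoc]

/-- `R_{X^{⊗m}, X^{⊗a}}` satisfies the first hexagon identity. -/
theorem tail_RPow_add_left {X : C} (R : X ⊗ X ⟶ X ⊗ X) {m n N : ℕ} (h : m + n = N) (a : ℕ) (Z : C) :
    o21 (tpowIso X h).hom (tpow X a ⊗ Z) ≫ o22 (RPow R N a) Z =
      tpow X m ◁ o22 (RPow R n a) Z ≫ o22 (RPow R m a) (tpow X n ⊗ Z) ≫ tpow X a ◁ o21 (tpowIso X h).hom Z := by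
  induction a generalizing Z with
  | zero =>
    rw [tail_RPow_zero, tail_RPow_zero, tail_RPow_zero, ← o21_nat_assoc]
    simp only [whiskerLeft_comp, cancels]
    rw [← cancel_mono (tzero X _).hom]
    simp only [cancels, tzero_nat]
  | succ a ih =>
    have t : ∀ {Z Z' : C} (h : Z ⟶ Z'), (tsucc X a Z).inv ≫ tpow X (a + 1) ◁ h =
        tpow X a ◁ X ◁ h ≫ (tsucc X a Z').inv := by
      intro Z Z' h
      rw [Iso.inv_comp_eq, ← reassoc_of% tsucc_nat, Iso.hom_inv_id, comp_id]
    rw [tail_RPow_succ, tail_RPow_succ, tail_RPow_succ, ← o21_nat_assoc]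
    simp only [whiskerLeft_comp, cancels]
    rw [reassoc_of% (ih (X ⊗ Z)), t]
    have k := wl (tpow X a) (tail_RPowOne_add R h Z)
    simp only [whiskerLeft_comp] at k
    rw [reassoc_of% k]
    simp only [nats]
end Powers
end

noncomputable section
/-! ### Families of braidings of tensor powers -/

section BraidFamily
variable {C : Type u} [Category.{v} C] [MonoidalCategory C] {X : C}

/-- A family of morphisms `X^{⊗m} ⊗ X^{⊗n} ⟶ X^{⊗n} ⊗ X^{⊗m}` that satisfies the hexagon
identities. -/
structure IsBraidFamily (X : C) (g : ∀ m n, tpow X m ⊗ tpow X n ⟶ tpow X n ⊗ tpow X m) : Prop where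
  zero_left : ∀ n Z, o22 (g 0 n) Z = (tzero X (tpow X n ⊗ Z)).hom ≫ tpow X n ◁ (tzero X Z).inv
  zero_right : ∀ m Z, o22 (g m 0) Z = tpow X m ◁ (tzero X Z).hom ≫ (tzero X (tpow X m ⊗ Z)).inv
  add_left : ∀ {m n N : ℕ} (h : m + n = N) (a : ℕ) (Z : C),
    o21 (tpowIso X h).hom (tpow X a ⊗ Z) ≫ o22 (g N a) Z =
      tpow X m ◁ o22 (g n a) Z ≫ o22 (g m a) (tpow X n ⊗ Z) ≫ tpow X a ◁ o21 (tpowIso X h).hom Z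
  add_right : ∀ (a : ℕ) {m n N : ℕ} (h : m + n = N) (Z : C),
    tpow X a ◁ o21 (tpowIso X h).hom Z ≫ o22 (g a N) Z =
      o22 (g a m) (tpow X n ⊗ Z) ≫ tpow X m ◁ o22 (g a n) Z ≫ o21 (tpowIso X h).hom (tpow X a ⊗ Z)

theorem tzero_self (X Z : C) : tpow X 0 ◁ (tzero X Z).hom = (tzero X (tpow X 0 ⊗ Z)).hom := by
  change 𝟙_ C ◁ (λ_ Z).hom = (λ_ (𝟙_ C ⊗ Z)).hom
  simp

theorem isBraidFamily_RPow (R : X ⊗ X ⟶ X ⊗ X) : IsBraidFamily X (RPow R) where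
  zero_left n Z := by
    induction n generalizing Z with
    | zero =>
      rw [tail_RPow_zero, ← cancel_mono (tzero X _).hom]
      simp only [cancels]
      rw [tzero_nat]; simp only [cancels, tzero_self]
    | succ n ih =>
      rw [tail_RPow_succ, ih, tail_RPowOne_zero, ← cancel_mono (tsucc X n _).hom]
      simp only [cancels, whiskerLeft_comp, tsucc_nat]
      rw [reassoc_of% (tzero_nat X (tsucc X n Z).hom)]
  zero_right := tail_RPow_zero R
  add_left := tail_RPow_add_left R
  add_right := tail_RPow_add_right R

instance isIso_RPowOne (R : X ⊗ X ⟶ X ⊗ X) [IsIso R] (m : ℕ) : IsIso (RPowOne R m) := by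
  induction m with
  | zero => exact inferInstanceAs (IsIso ((λ_ X).hom ≫ (ρ_ X).inv))
  | succ m ih => exact inferInstanceAs (IsIso ((α_ (tpow X m) X X).hom ≫ tpow X m ◁ R ≫
      (α_ (tpow X m) X X).inv ≫ RPowOne R m ▷ X ≫ (α_ X (tpow X m) X).hom))

instance isIso_RPow (R : X ⊗ X ⟶ X ⊗ X) [IsIso R] (m n : ℕ) : IsIso (RPow R m n) := by
  induction n with
  | zero => exact inferInstanceAs (IsIso ((ρ_ (tpow X m)).hom ≫ (λ_ (tpow X m)).inv))
  | succ n ih => exact inferInstanceAs (IsIso ((α_ (tpow X m) (tpow X n) X).inv ≫ RPow R m n ▷ X ≫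
      (α_ (tpow X n) (tpow X m) X).hom ≫ tpow X n ◁ RPowOne R m ≫
      (α_ (tpow X n) X (tpow X m)).inv))

/-- An isomorphism of pairs of strands, with a tail. -/
def o22Iso {A B D E : C} (f : A ⊗ B ≅ D ⊗ E) (Z : C) : A ⊗ (B ⊗ Z) ≅ D ⊗ (E ⊗ Z) :=
  (α_ A B Z).symm ≪≫ whiskerRightIso f Z ≪≫ α_ D E Z
theorem o22Iso_hom {A B D E : C} (f : A ⊗ B ≅ D ⊗ E) (Z : C) : (o22Iso f Z).hom = o22 f.hom Z := rfl
theorem o22Iso_inv {A B D E : C} (f : A ⊗ B ≅ D ⊗ E) (Z : C) : (o22Iso f Z).inv = o22 f.inv Z := by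
  simp [o22Iso, o22]

/-- The inverses of a family that satisfies the hexagon identities satisfy them as well. -/
theorem IsBraidFamily.inverse {g : ∀ m n, tpow X m ⊗ tpow X n ≅ tpow X n ⊗ tpow X m}
    (h : IsBraidFamily X fun m n => (g m n).hom) : IsBraidFamily X fun m n => (g n m).inv where
  zero_left n Z := by
    rw [← o22Iso_inv, ← cancel_mono (o22Iso (g n 0) Z).hom, Iso.inv_hom_id, o22Iso_hom, h.zero_right]
    simp only [cancels]
  zero_right n Z := by
    rw [← o22Iso_inv, ← cancel_mono (o22Iso (g 0 n) Z).hom, Iso.inv_hom_id, o22Iso_hom, h.zero_left]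
    simp only [cancels]
  add_left e a Z := by
    rw [← o22Iso_inv, ← o22Iso_inv, ← o22Iso_inv, Iso.comp_inv_eq, assoc, assoc, o22Iso_hom,
      h.add_right]
    simp only [← o22Iso_hom, cancels]
  add_right a _ _ _ e Z := by
    rw [← o22Iso_inv, ← o22Iso_inv, ← o22Iso_inv, Iso.comp_inv_eq, assoc, assoc, o22Iso_hom,
      h.add_left]
    simp only [← o22Iso_hom, cancels]

/-- `R` as an endomorphism of the second tensor power. -/
def RTwo (R : X ⊗ X ⟶ X ⊗ X) : tpow X 2 ⟶ tpow X 2 := (twoPow X).inv ≫ R ≫ (twoPow X).hom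

/-- `X^{⊗2} ⊗ Z ≅ X ⊗ (X ⊗ Z)` -/
def ttwo (X Z : C) : tpow X 2 ⊗ Z ≅ X ⊗ (X ⊗ Z) := tsucc X 1 Z ≪≫ tsucc X 0 (X ⊗ Z) ≪≫ tzero X (X ⊗ (X ⊗ Z))

theorem tail_RTwo (R : X ⊗ X ⟶ X ⊗ X) (Z : C) : RTwo R ▷ Z = (ttwo X Z).hom ≫ o22 R Z ≫ (ttwo X Z).inv := by
  have e1 : (twoPow X).hom ▷ Z = (α_ X X Z).hom ≫ (ttwo X Z).inv := by
    change ((λ_ X).inv ▷ X) ▷ Z = (α_ X X Z).hom ≫ ((λ_ (X ⊗ (X ⊗ Z))).inv ≫ (α_ (𝟙_ C) X (X ⊗ Z)).inv) ≫ (α_ (𝟙_ C ⊗ X) X Z).inv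
    rw [whiskerRight_whiskerRight, left_inv_whiskerRight]
  have e2 : (twoPow X).inv ▷ Z = (ttwo X Z).hom ≫ (α_ X X Z).inv := by
    rw [← cancel_epi ((twoPow X).hom ▷ Z), ← comp_whiskerRight, Iso.hom_inv_id, e1]
    simp only [cancels, id_whiskerRight]
  rw [RTwo, comp_whiskerRight, comp_whiskerRight, e1, e2, r22 R]
  simp only [cancels]
theorem tail_RPowOne_two (R : X ⊗ X ⟶ X ⊗ X) (Z : C) : o22 (RPowOne R 2) Z =
    (ttwo X (X ⊗ Z)).hom ≫ X ◁ o22 R Z ≫ o22 R (X ⊗ Z) ≫ X ◁ (ttwo X Z).inv := by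
  rw [tail_RPowOne_succ, tail_RPowOne_succ, tail_RPowOne_zero]
  simp only [ttwo, Iso.trans_hom, Iso.trans_inv, whiskerLeft_comp, cancels]
  rw [reassoc_of% (tsucc_nat X 0 (o22 R Z)), reassoc_of% (tzero_nat X (o22 R (X ⊗ Z))),
    reassoc_of% (tzero_nat X (X ◁ o22 R Z))]
theorem tail_RPow_two (R : X ⊗ X ⟶ X ⊗ X) (m : ℕ) (Z : C) : o22 (RPow R m 2) Z =
    tpow X m ◁ (ttwo X Z).hom ≫ o22 (RPowOne R m) (X ⊗ Z) ≫ X ◁ o22 (RPowOne R m) Z ≫ (ttwo X _).inv := by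
  rw [tail_RPow_succ, tail_RPow_succ, tail_RPow_zero]
  simp only [ttwo, Iso.trans_hom, Iso.trans_inv, whiskerLeft_comp, cancels]
  have t0 : ∀ {Z Z' : C} (h : Z ⟶ Z'), (tzero X Z).inv ≫ tpow X 0 ◁ h = h ≫ (tzero X Z').inv := by
    intro Z Z' h
    rw [Iso.inv_comp_eq, ← reassoc_of% tzero_nat, Iso.hom_inv_id, comp_id]
  have t1 : ∀ {Z Z' : C} (h : Z ⟶ Z'), (tsucc X 0 Z).inv ≫ tpow X 1 ◁ h = tpow X 0 ◁ X ◁ h ≫ (tsucc X 0 Z').inv := by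
    intro Z Z' h
    rw [Iso.inv_comp_eq, ← reassoc_of% (tsucc_nat X 0), Iso.hom_inv_id, comp_id]
  rw [reassoc_of% t1, reassoc_of% t0, reassoc_of% t0]

/-- The braid equation, with a tail. -/
theorem tail_braid {R : X ⊗ X ⟶ X ⊗ X} (hR : BraidEquation R) (Z : C) :
    X ◁ o22 R Z ≫ o22 R (X ⊗ Z) ≫ X ◁ o22 R Z = o22 R (X ⊗ Z) ≫ X ◁ o22 R Z ≫ o22 R (X ⊗ Z) := by
  have := ((α_ _ _ _).inv ≫ (α_ _ _ _).inv) ≫= whisk hR Z =≫ ((α_ _ _ _).hom ≫ (α_ _ _ _).hom)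
  simpa only [fans, cancels, r22 R] using this

/-- `e` commutes with the members of the family `g`. -/
structure Slides (g : ∀ m n, tpow X m ⊗ tpow X n ⟶ tpow X n ⊗ tpow X m) {N : ℕ} (e : tpow X N ⟶ tpow X N) : Prop where
  left : ∀ n Z, e ▷ (tpow X n ⊗ Z) ≫ o22 (g N n) Z = o22 (g N n) Z ≫ tpow X n ◁ e ▷ Z
  right : ∀ n Z, tpow X n ◁ e ▷ Z ≫ o22 (g n N) Z = o22 (g n N) Z ≫ e ▷ (tpow X n ⊗ Z)

theorem slides_RTwo {R : X ⊗ X ⟶ X ⊗ X} (hR : BraidEquation R) : Slides (RPow R) (RTwo R) where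
  left n Z := by
    induction n generalizing Z with
    | zero =>
      rw [tail_RPow_zero, ← whisker_exchange_assoc, ← cancel_mono (tzero X _).hom]
      simp only [cancels, tzero_nat]
    | succ n ih => 
      have t : ∀ {Z Z' : C} (h : Z ⟶ Z'), (tsucc X n Z).inv ≫ tpow X (n + 1) ◁ h =
        tpow X n ◁ X ◁ h ≫ (tsucc X n Z').inv := by
        intro Z Z' h
        rw [Iso.inv_comp_eq, ← reassoc_of% tsucc_nat, Iso.hom_inv_id, comp_id]
      have k : RTwo R ▷ (X ⊗ Z) ≫ o22 (RPowOne R 2) Z = o22 (RPowOne R 2) Z ≫ X ◁ RTwo R ▷ Z := by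
        rw [tail_RPowOne_two, tail_RTwo, tail_RTwo]
        simp only [whiskerLeft_comp, cancels]
        rw [← reassoc_of% (tail_braid hR Z)]
      have k' := wl (tpow X n) k
      simp only [whiskerLeft_comp] at k'
      rw [tail_RPow_succ, ← whisker_exchange_assoc, reassoc_of% (ih (X ⊗ Z))]
      simp only [assoc]
      rw [t, reassoc_of% k']
  right n Z := by
    have k : ∀ Z, tpow X n ◁ o22 R Z ≫ o22 (RPowOne R n) (X ⊗ Z) ≫ X ◁ o22 (RPowOne R n) Z =
        o22 (RPowOne R n) (X ⊗ Z) ≫ X ◁ o22 (RPowOne R n) Z ≫ o22 R (tpow X n ⊗ Z) := by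
      intro Z
      induction n generalizing Z with
      | zero =>
        simp only [tail_RPowOne_zero, whiskerLeft_comp, cancels]
        rw [reassoc_of% (tzero_nat X (o22 R Z)), o22_nat]
      | succ n ih =>
        have b := wl (tpow X n) (tail_braid hR Z)
        simp only [tail_RPowOne_succ, whiskerLeft_comp, cancels] at b ⊢
        rw [o22_nat, ← o22_nat_assoc, ← o22_nat_assoc, ← reassoc_of% (ih (X ⊗ Z)), reassoc_of% (tsucc_nat X n (o22 R Z)),
          reassoc_of% b]
    rw [tail_RPow_two, tail_RTwo, tail_RTwo]
    simp only [whiskerLeft_comp, cancels]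
    rw [← reassoc_of% (k Z)]

theorem Slides.inverse {g : ∀ m n, tpow X m ⊗ tpow X n ≅ tpow X n ⊗ tpow X m} {N : ℕ} {e : tpow X N ⟶ tpow X N}
    (h : Slides (fun m n => (g m n).hom) e) : Slides (fun m n => (g n m).inv) e where
  left n Z := by
    have := h.right n Z
    simp only [← o22Iso_inv, ← o22Iso_hom] at this ⊢
    rw [Iso.comp_inv_eq, assoc, this, Iso.inv_hom_id_assoc]
  right n Z := by
    have := h.left n Z
    simp only [← o22Iso_inv, ← o22Iso_hom] at this ⊢
    rw [Iso.comp_inv_eq, assoc, this, Iso.inv_hom_id_assoc]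
end BraidFamily
end

noncomputable section
/-! ### Padding, and duality of tensor powers -/

section Pad
variable {C : Type u} [Category.{v} C] [MonoidalCategory C] {X : C}

theorem o21_cancel {A B D : C} (e : A ⊗ B ≅ D) {Z W : C} {f g : D ⊗ Z ⟶ W}
    (h : o21 e.hom Z ≫ f = o21 e.hom Z ≫ g) : f = g := by
  rwa [o21, assoc, assoc, cancel_epi, cancel_epi] at h

instance isIso_o21 {A B D : C} (e : A ⊗ B ⟶ D) [IsIso e] (Z : C) : IsIso (o21 e Z) := by
  unfold o21; infer_instance

/-- The endomorphism `X^{⊗a} ⊗ e` of `X^{⊗(a+k)}`. -/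
def padLeft {a k m : ℕ} (h : a + k = m) (e : tpow X k ⟶ tpow X k) : tpow X m ⟶ tpow X m :=
  (tpowIso X h).inv ≫ tpow X a ◁ e ≫ (tpowIso X h).hom
/-- The endomorphism `e ⊗ X^{⊗b}` of `X^{⊗(k+b)}`. -/
def padRight {k b m : ℕ} (h : k + b = m) (e : tpow X k ⟶ tpow X k) : tpow X m ⟶ tpow X m :=
  (tpowIso X h).inv ≫ e ▷ tpow X b ≫ (tpowIso X h).hom

theorem tail_padLeft {a k m : ℕ} (h : a + k = m) (e : tpow X k ⟶ tpow X k) (Z : C) :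
    o21 (tpowIso X h).hom Z ≫ padLeft h e ▷ Z = tpow X a ◁ e ▷ Z ≫ o21 (tpowIso X h).hom Z := by
  simp only [o21, padLeft, comp_whiskerRight, assoc, hom_inv_whiskerRight_assoc, whisker_assoc,
    Iso.inv_hom_id_assoc]
theorem tail_padRight {k b m : ℕ} (h : k + b = m) (e : tpow X k ⟶ tpow X k) (Z : C) :
    o21 (tpowIso X h).hom Z ≫ padRight h e ▷ Z = e ▷ (tpow X b ⊗ Z) ≫ o21 (tpowIso X h).hom Z := by
  simp only [o21, padRight, comp_whiskerRight, assoc, hom_inv_whiskerRight_assoc, whiskerRight_tensor,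
    Iso.hom_inv_id_assoc, associator_inv_naturality_left_assoc]

theorem padRight_padRight {k b b' m n c : ℕ} (h : k + b = m) (h' : m + b' = n) (h1 : b + b' = c) (h2 : k + c = n)
    (e : tpow X k ⟶ tpow X k) : padRight h' (padRight h e) = padRight h2 e := by
  refine tail_ext fun Z => o21_cancel (tpowIso X h') (o21_cancel (tpowIso X h) ?_)
  rw [tail_padRight, reassoc_of% (tail_padRight h e), tail_tpowIso_assoc X h h' h1 h2,
    reassoc_of% (tail_tpowIso_assoc X h h' h1 h2), tail_padRight, whisker_exchange_assoc]
theorem padLeft_padLeft {k a a' m n c : ℕ} (h : a + k = m) (h' : a' + m = n) (h1 : a' + a = c) (h2 : c + k = n)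
    (e : tpow X k ⟶ tpow X k) : padLeft h' (padLeft h e) = padLeft h2 e := by
  refine tail_ext fun Z => o21_cancel (tpowIso X h2) (o21_cancel (tpowIso X h1) ?_)
  have k := wl (tpow X a') (tail_padLeft h e Z)
  simp only [whiskerLeft_comp] at k
  rw [reassoc_of% (tail_tpowIso_assoc X h1 h2 h h'), tail_padLeft, reassoc_of% k, tail_padLeft,
    ← o21_nat_assoc, tail_tpowIso_assoc X h1 h2 h h']
theorem padLeft_padRight {k a b m n m' : ℕ} (h : k + b = m) (h' : a + m = n) (h1 : a + k = m') (h2 : m' + b = n)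
    (e : tpow X k ⟶ tpow X k) : padLeft h' (padRight h e) = padRight h2 (padLeft h1 e) := by
  refine tail_ext fun Z => o21_cancel (tpowIso X h2) (o21_cancel (tpowIso X h1) ?_)
  have k := wl (tpow X a) (tail_padRight h e Z)
  simp only [whiskerLeft_comp] at k
  rw [reassoc_of% (tail_tpowIso_assoc X h1 h2 h h'), tail_padLeft, reassoc_of% k, tail_padRight,
    reassoc_of% (tail_padLeft h1 e), tail_tpowIso_assoc X h1 h2 h h']

/-- `e'` is of the form `X^{⊗a} ⊗ e ⊗ X^{⊗b}`. -/
def IsPad {k : ℕ} (e : tpow X k ⟶ tpow X k) {N : ℕ} (e' : tpow X N ⟶ tpow X N) : Prop :=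
  ∃ (a b m : ℕ) (h1 : a + k = m) (h2 : m + b = N), e' = padRight h2 (padLeft h1 e)

theorem IsPad.padRight {k : ℕ} {e : tpow X k ⟶ tpow X k} {N b N' : ℕ} {e' : tpow X N ⟶ tpow X N} (h : IsPad e e')
    (h' : N + b = N') : IsPad e (padRight h' e') := by
  obtain ⟨a, b', m, h1, h2, rfl⟩ := h
  exact ⟨a, b' + b, m, h1, by omega, padRight_padRight _ _ rfl _ _⟩
theorem IsPad.padLeft {k : ℕ} {e : tpow X k ⟶ tpow X k} {N a N' : ℕ} {e' : tpow X N ⟶ tpow X N} (h : IsPad e e')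
    (h' : a + N = N') : IsPad e (padLeft h' e') := by
  obtain ⟨a', b, m, h1, h2, rfl⟩ := h
  refine ⟨a + a', b, a + m, by omega, by omega, ?_⟩
  rw [padLeft_padRight h2 h' rfl (by omega), padLeft_padLeft h1 rfl rfl (by omega)]

theorem Slides.padRight {g : ∀ m n, tpow X m ⊗ tpow X n ⟶ tpow X n ⊗ tpow X m} (hg : IsBraidFamily X g)
    {k b m : ℕ} {e : tpow X k ⟶ tpow X k} (h : Slides g e) (h' : k + b = m) : Slides g (padRight h' e) where
  left n Z := by
    refine o21_cancel (tpowIso X h') ?_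
    have p := fun Z => wl (tpow X n) (tail_padRight h' e Z)
    simp only [whiskerLeft_comp] at p
    rw [reassoc_of% (tail_padRight h' e), hg.add_left h', reassoc_of% (hg.add_left h'), p, ← whisker_exchange_assoc,
      reassoc_of% (h.left n)]
  right n Z := by
    have p := fun Z => wl (tpow X n) (tail_padRight h' e Z)
    simp only [whiskerLeft_comp] at p
    rw [← cancel_epi (tpow X n ◁ o21 (tpowIso X h').hom Z), reassoc_of% p, hg.add_right n h', reassoc_of% (hg.add_right n h'),
      tail_padRight, reassoc_of% (h.right n), whisker_exchange_assoc]
theorem Slides.padLeft {g : ∀ m n, tpow X m ⊗ tpow X n ⟶ tpow X n ⊗ tpow X m} (hg : IsBraidFamily X g)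
    {k a m : ℕ} {e : tpow X k ⟶ tpow X k} (h : Slides g e) (h' : a + k = m) : Slides g (padLeft h' e) where
  left n Z := by
    refine o21_cancel (tpowIso X h') ?_
    have p := fun Z => wl (tpow X n) (tail_padLeft h' e Z)
    have q := fun Z => wl (tpow X a) (h.left n Z)
    simp only [whiskerLeft_comp] at p q
    rw [reassoc_of% (tail_padLeft h' e), hg.add_left h', reassoc_of% (hg.add_left h'), p, reassoc_of% q, ← o22_nat_assoc]
  right n Z := by
    have p := fun Z => wl (tpow X n) (tail_padLeft h' e Z)
    have q := fun Z => wl (tpow X a) (h.right n Z)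
    simp only [whiskerLeft_comp] at p q
    rw [← cancel_epi (tpow X n ◁ o21 (tpowIso X h').hom Z), reassoc_of% p, hg.add_right n h', reassoc_of% (hg.add_right n h'),
      tail_padLeft, o22_nat_assoc, reassoc_of% q]

theorem IsPad.slides {g : ∀ m n, tpow X m ⊗ tpow X n ⟶ tpow X n ⊗ tpow X m} (hg : IsBraidFamily X g)
    {k : ℕ} {e : tpow X k ⟶ tpow X k} (h : Slides g e) {N : ℕ} {e' : tpow X N ⟶ tpow X N} (h' : IsPad e e') :
    Slides g e' := by
  obtain ⟨a, b, m, h1, h2, rfl⟩ := h'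
  exact (h.padLeft hg h1).padRight hg h2
end Pad

section Duality
variable {C : Type u} [Category.{v} C] [MonoidalCategory C]

/-- `Y^{⊗0} ⊗ Z ≅ Z` -/
def dzero (Y Z : C) : dpow Y 0 ⊗ Z ≅ Z := λ_ Z
/-- `Y^{⊗(n+1)} ⊗ Z ≅ Y ⊗ (Y^{⊗n} ⊗ Z)` -/
def dsucc (Y : C) (n : ℕ) (Z : C) : dpow Y (n + 1) ⊗ Z ≅ Y ⊗ (dpow Y n ⊗ Z) := α_ Y (dpow Y n) Z

theorem dzero_nat (Y : C) {Z Z' : C} (h : Z ⟶ Z') :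
    dpow Y 0 ◁ h ≫ (dzero Y Z').hom = (dzero Y Z).hom ≫ h := leftUnitor_naturality h
theorem dsucc_nat (Y : C) (n : ℕ) {Z Z' : C} (h : Z ⟶ Z') :
    dpow Y (n + 1) ◁ h ≫ (dsucc Y n Z').hom = (dsucc Y n Z).hom ≫ Y ◁ dpow Y n ◁ h :=
  associator_naturality_right _ _ _

theorem tail_dmul_zero (Y : C) (m : ℕ) (Z : C) : o21 (dmul Y m 0) Z = (dzero Y (dpow Y m ⊗ Z)).hom := by
  change (α_ (𝟙_ C) _ Z).inv ≫ (λ_ (dpow Y m)).hom ▷ Z = (λ_ _).hom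
  simp
theorem tail_dmul_succ (Y : C) (m n : ℕ) (Z : C) : o21 (dmul Y m (n + 1)) Z =
    (dsucc Y n (dpow Y m ⊗ Z)).hom ≫ Y ◁ o21 (dmul Y m n) Z ≫ (dsucc Y (m + n) Z).inv := by
  change (α_ (Y ⊗ dpow Y n) _ Z).inv ≫ ((α_ Y (dpow Y n) (dpow Y m)).hom ≫ Y ◁ dmul Y m n) ▷ Z =
    (α_ Y (dpow Y n) (dpow Y m ⊗ Z)).hom ≫ Y ◁ o21 (dmul Y m n) Z ≫ (α_ Y (dpow Y (m + n)) Z).inv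
  simp only [fans, cancels, r21 (dmul Y m n)]

/-- The coevaluation of tensor powers, with a tail. -/
def coevTail (X Y : C) [ExactPairing X Y] (n : ℕ) (Z : C) : Z ⟶ tpow X n ⊗ (dpow Y n ⊗ Z) :=
  (λ_ Z).inv ≫ coevPow X Y n ▷ Z ≫ (α_ _ _ _).hom
/-- The coevaluation with a tail. -/
def coevOne (X Y : C) [ExactPairing X Y] (Z : C) : Z ⟶ X ⊗ (Y ⊗ Z) :=
  (λ_ Z).inv ≫ ExactPairing.coevaluation X Y ▷ Z ≫ (α_ _ _ _).hom

variable (X Y : C) [ExactPairing X Y]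

theorem coevTail_nat (n : ℕ) {Z Z' : C} (h : Z ⟶ Z') :
    h ≫ coevTail X Y n Z' = coevTail X Y n Z ≫ tpow X n ◁ dpow Y n ◁ h := by
  rw [coevTail, coevTail, leftUnitor_inv_naturality_assoc, whisker_exchange_assoc]; simp
theorem coevOne_nat {Z Z' : C} (h : Z ⟶ Z') :
    h ≫ coevOne X Y Z' = coevOne X Y Z ≫ X ◁ Y ◁ h := by
  rw [coevOne, coevOne, leftUnitor_inv_naturality_assoc, whisker_exchange_assoc]; simp

theorem coevTail_zero (Z : C) : coevTail X Y 0 Z = (dzero Y Z).inv ≫ (tzero X (dpow Y 0 ⊗ Z)).inv := by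
  change (λ_ Z).inv ≫ (λ_ (𝟙_ C)).inv ▷ Z ≫ (α_ (𝟙_ C) (𝟙_ C) _).hom = (λ_ Z).inv ≫ (λ_ (𝟙_ C ⊗ Z)).inv
  rw [left_inv_whiskerRight, assoc, Iso.inv_hom_id, comp_id]
theorem coevTail_succ (n : ℕ) (Z : C) : coevTail X Y (n + 1) Z =
    coevTail X Y n Z ≫ tpow X n ◁ coevOne X Y (dpow Y n ⊗ Z) ≫ tpow X n ◁ X ◁ (dsucc Y n Z).inv ≫
      (tsucc X n (dpow Y (n + 1) ⊗ Z)).inv := by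
  change (λ_ Z).inv ≫ (coevPow X Y n ≫
      tpow X n ◁ ((λ_ (dpow Y n)).inv ≫ ExactPairing.coevaluation X Y ▷ dpow Y n ≫
        (α_ X Y (dpow Y n)).hom) ≫ (α_ (tpow X n) X (Y ⊗ dpow Y n)).inv) ▷ Z ≫ (α_ (tpow X n ⊗ X) (Y ⊗ dpow Y n) Z).hom =
    coevTail X Y n Z ≫ tpow X n ◁ coevOne X Y (dpow Y n ⊗ Z) ≫ tpow X n ◁ X ◁ (α_ Y (dpow Y n) Z).inv ≫
      (α_ (tpow X n) X ((Y ⊗ dpow Y n) ⊗ Z)).inv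
  simp only [coevTail, coevOne, fans, cancels]

theorem tail_evPow_zero (Z : C) : o20 (evPow X Y 0) Z = (dzero Y _).hom ≫ (tzero X Z).hom := by
  change (α_ (𝟙_ C) (𝟙_ C) Z).inv ≫ (λ_ (𝟙_ C)).hom ▷ Z ≫ (λ_ Z).hom = (λ_ (𝟙_ C ⊗ Z)).hom ≫ (λ_ Z).hom
  simp
theorem tail_evPow_succ (n : ℕ) (Z : C) : o20 (evPow X Y (n + 1)) Z =
    (dsucc Y n _).hom ≫ Y ◁ dpow Y n ◁ (tsucc X n Z).hom ≫ Y ◁ o20 (evPow X Y n) (X ⊗ Z) ≫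
      o20 (ExactPairing.evaluation X Y) Z := by
  change (α_ (Y ⊗ dpow Y n) (tpow X n ⊗ X) Z).inv ≫ nested (ExactPairing.evaluation X Y) (evPow X Y n) ▷ Z ≫ (λ_ Z).hom =
    (α_ Y (dpow Y n) _).hom ≫ Y ◁ dpow Y n ◁ (α_ (tpow X n) X Z).hom ≫ Y ◁ o20 (evPow X Y n) (X ⊗ Z) ≫
      o20 (ExactPairing.evaluation X Y) Z
  rw [tail_nested]
  simp only [cancels]

theorem coevOne_ev (Z : C) : coevOne X Y (X ⊗ Z) ≫ X ◁ o20 (ExactPairing.evaluation X Y) Z = 𝟙 _ := by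
  have := ((λ_ (X ⊗ Z)).inv ≫ (α_ (𝟙_ C) X Z).inv) ≫= whisk (ExactPairing.evaluation_coevaluation X Y) Z =≫
    ((α_ X (𝟙_ C) Z).hom ≫ X ◁ (λ_ Z).hom)
  simpa only [coevOne, fans, cancels, r20 (ExactPairing.evaluation X Y)] using this
theorem ev_coevOne (Z : C) : Y ◁ coevOne X Y Z ≫ o20 (ExactPairing.evaluation X Y) (Y ⊗ Z) = 𝟙 _ := by
  have := (Y ◁ (λ_ Z).inv ≫ (α_ Y (𝟙_ C) Z).inv) ≫= whisk (ExactPairing.coevaluation_evaluation X Y) Z =≫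
    ((α_ (𝟙_ C) Y Z).hom ≫ (λ_ (Y ⊗ Z)).hom)
  simpa only [coevOne, fans, cancels, r20 (ExactPairing.evaluation X Y)] using this

variable {X Y}
theorem tzero_whisk {Z Z' : C} (h : Z ⟶ Z') : tpow X 0 ◁ h = (tzero X Z).hom ≫ h ≫ (tzero X Z').inv := by
  rw [← reassoc_of% tzero_nat, Iso.hom_inv_id, comp_id]
theorem dzero_whisk {Z Z' : C} (h : Z ⟶ Z') : dpow Y 0 ◁ h = (dzero Y Z).hom ≫ h ≫ (dzero Y Z').inv := by
  rw [← reassoc_of% dzero_nat, Iso.hom_inv_id, comp_id]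
theorem tsucc_whisk {n : ℕ} {Z Z' : C} (h : Z ⟶ Z') : tpow X (n + 1) ◁ h =
    (tsucc X n Z).hom ≫ tpow X n ◁ X ◁ h ≫ (tsucc X n Z').inv := by
  rw [← reassoc_of% tsucc_nat, Iso.hom_inv_id, comp_id]
theorem dsucc_whisk {n : ℕ} {Z Z' : C} (h : Z ⟶ Z') : dpow Y (n + 1) ◁ h =
    (dsucc Y n Z).hom ≫ Y ◁ dpow Y n ◁ h ≫ (dsucc Y n Z').inv := by
  rw [← reassoc_of% dsucc_nat, Iso.hom_inv_id, comp_id]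
variable (X Y)

/-- The first zigzag identity for tensor powers. -/
theorem coevTail_ev (n : ℕ) (Z : C) : coevTail X Y n (tpow X n ⊗ Z) ≫ tpow X n ◁ o20 (evPow X Y n) Z = 𝟙 _ := by
  induction n generalizing Z with
  | zero => simp only [coevTail_zero, tail_evPow_zero, whiskerLeft_comp, tzero_whisk, cancels]
  | succ n ih =>
    have k := wl (tpow X n) (coevOne_ev X Y Z)
    simp only [whiskerLeft_comp, whiskerLeft_id] at k
    rw [coevTail_succ, tail_evPow_succ, tsucc_whisk]
    simp only [whiskerLeft_comp, cancels]
    have p := fun {Z Z' : C} (h : Z ⟶ Z') => wl (tpow X n) (coevOne_nat X Y h)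
    simp only [whiskerLeft_comp] at p
    rw [← reassoc_of% p, ← reassoc_of% p, reassoc_of% k, ← reassoc_of% (coevTail_nat X Y n), reassoc_of% (ih (X ⊗ Z)),
      Iso.hom_inv_id]
/-- The second zigzag identity for tensor powers. -/
theorem ev_coevTail (n : ℕ) (Z : C) : dpow Y n ◁ coevTail X Y n Z ≫ o20 (evPow X Y n) (dpow Y n ⊗ Z) = 𝟙 _ := by
  induction n generalizing Z with
  | zero => simp only [coevTail_zero, tail_evPow_zero, whiskerLeft_comp, dzero_whisk, cancels]
  | succ n ih =>
    have k := wl Y (ih Z)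
    simp only [whiskerLeft_comp, whiskerLeft_id] at k
    rw [coevTail_succ, tail_evPow_succ, dsucc_whisk]
    simp only [whiskerLeft_comp, cancels]
    have p := fun {Z Z' : C} (h : Z ⟶ Z') => wl Y (o20_nat (evPow X Y n) h)
    simp only [whiskerLeft_comp] at p
    rw [reassoc_of% p, reassoc_of% p, reassoc_of% k, o20_nat, reassoc_of% (ev_coevOne X Y), Iso.hom_inv_id]

/-- The coevaluation of `X^{⊗(m+n)}` is the nested one. -/
theorem coevTail_add (m n : ℕ) (Z : C) : coevTail X Y (m + n) Z =
    coevTail X Y m Z ≫ tpow X m ◁ coevTail X Y n (dpow Y m ⊗ Z) ≫ o21 (tmul X m n) _ ≫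
      tpow X (m + n) ◁ o21 (dmul Y m n) Z := by
  induction n generalizing Z with
  | zero =>
    simp only [coevTail_zero, tail_tmul_zero, tail_dmul_zero, whiskerLeft_comp, cancels]
    change _ = _ ≫ tpow X m ◁ _ ≫ tpow X m ◁ (dzero Y (dpow Y m ⊗ Z)).hom
    simp only [cancels, Nat.add_zero]
  | succ n ih =>
    have p := fun {Z Z' : C} (h : Z ⟶ Z') => wl (tpow X (m + n)) (coevOne_nat X Y h)
    simp only [whiskerLeft_comp] at p
    refine (coevTail_succ X Y (m + n) Z).trans ?_
    have t2 : ∀ {Z Z' : C} (h : Z ⟶ Z'), tpow X (m + (n + 1)) ◁ h =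
      (tsucc X (m + n) Z).hom ≫ tpow X (m + n) ◁ X ◁ h ≫ (tsucc X (m + n) Z').inv := fun h => tsucc_whisk h
    rw [coevTail_succ X Y n, tail_tmul_succ, tail_dmul_succ, t2, ih]
    simp only [whiskerLeft_comp, cancels]
    simp only [nats]
    rw [reassoc_of% p]
    simp only [cancels]
    rfl
end Duality
end

noncomputable section
/-! ### The bialgebra `A(X)` -/

section Free
variable {C : Type u} [Category.{v} C] [MonoidalCategory C] (X Y : C)

/-- `A_n(X) ⊗ Z ≅ Y^{⊗n} ⊗ (X^{⊗n} ⊗ Z)` -/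
def fsplit (n : ℕ) (Z : C) : freeObj X Y n ⊗ Z ≅ dpow Y n ⊗ (tpow X n ⊗ Z) := α_ _ _ _

variable [ExactPairing X Y]

theorem tail_freeCoaction (n : ℕ) (Z : C) : o12 (freeCoaction X Y n) Z =
    coevTail X Y n (tpow X n ⊗ Z) ≫ tpow X n ◁ (fsplit X Y n Z).inv := by
  change ((λ_ (tpow X n)).inv ≫ coevPow X Y n ▷ tpow X n ≫ (α_ (tpow X n) (dpow Y n) (tpow X n)).hom) ▷ Z ≫
    (α_ (tpow X n) (dpow Y n ⊗ tpow X n) Z).hom = _ ≫ _ ◁ (α_ (dpow Y n) (tpow X n) Z).inv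
  simp only [coevTail, fans, cancels]

theorem tail_freeComul (n : ℕ) (Z : C) : o12 (freeComul X Y n) Z =
    (fsplit X Y n Z).hom ≫ dpow Y n ◁ coevTail X Y n (tpow X n ⊗ Z) ≫
      dpow Y n ◁ tpow X n ◁ (fsplit X Y n Z).inv ≫ (fsplit X Y n _).inv := by
  change (dpow Y n ◁ ((λ_ (tpow X n)).inv ≫ coevPow X Y n ▷ tpow X n ≫
      (α_ (tpow X n) (dpow Y n) (tpow X n)).hom) ≫
    (α_ (dpow Y n) (tpow X n) (dpow Y n ⊗ tpow X n)).inv) ▷ Z ≫ (α_ (dpow Y n ⊗ tpow X n) (dpow Y n ⊗ tpow X n) Z).hom =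
    (α_ (dpow Y n) (tpow X n) Z).hom ≫ _ ≫ _ ◁ _ ◁ (α_ (dpow Y n) (tpow X n) Z).inv ≫
      (α_ (dpow Y n) (tpow X n) ((dpow Y n ⊗ tpow X n) ⊗ Z)).inv
  simp only [coevTail, fans, cancels]

/-- The counit `A_n(X) ⟶ 𝟙`. -/
abbrev freeCounit (n : ℕ) : freeObj X Y n ⟶ 𝟙_ C := evPow X Y n

theorem tail_freeCounit (n : ℕ) (Z : C) : o10 (freeCounit X Y n) Z = (fsplit X Y n Z).hom ≫ o20 (evPow X Y n) Z := by
  change evPow X Y n ▷ Z ≫ (λ_ Z).hom = (α_ _ _ _).hom ≫ (α_ _ _ _).inv ≫ evPow X Y n ▷ Z ≫ (λ_ Z).hom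
  simp only [cancels]

theorem separates_freeCoaction (n : ℕ) : Separates (freeCoaction X Y n) := by
  intro W Z f g h
  have key : ∀ f : freeObj X Y n ⊗ W ⟶ Z, dpow Y n ◁ (o12 (freeCoaction X Y n) W ≫ tpow X n ◁ f) ≫
      o20 (evPow X Y n) Z = (fsplit X Y n W).inv ≫ f := by
    intro f
    have := ev_coevTail X Y n (tpow X n ⊗ W)
    simp only [tail_freeCoaction, whiskerLeft_comp, assoc]
    rw [o20_nat, o20_nat_assoc, reassoc_of% this]
  rw [← cancel_epi (fsplit X Y n W).inv, ← key, ← key, h]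

theorem tail_freeCoaction_comul (n : ℕ) (Z : C) : o12 (freeCoaction X Y n) Z ≫ tpow X n ◁ o12 (freeComul X Y n) Z =
    o12 (freeCoaction X Y n) Z ≫ o12 (freeCoaction X Y n) (freeObj X Y n ⊗ Z) := by
  rw [tail_freeCoaction, tail_freeComul, tail_freeCoaction]
  simp only [whiskerLeft_comp, cancels]
  have p := fun {Z Z' : C} (h : Z ⟶ Z') => coevTail_nat X Y n h
  rw [reassoc_of% p, reassoc_of% p]

theorem tail_freeCoaction_counit (n : ℕ) (Z : C) :
    o12 (freeCoaction X Y n) Z ≫ tpow X n ◁ o10 (freeCounit X Y n) Z = 𝟙 _ := by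
  rw [tail_freeCoaction, tail_freeCounit]
  simp only [whiskerLeft_comp, cancels, coevTail_ev]

theorem tail_dualPow (n : ℕ) (e : tpow X n ⟶ tpow X n) (Z : C) : dualPow X Y n e ▷ Z =
    dpow Y n ◁ coevTail X Y n Z ≫ dpow Y n ◁ e ▷ (dpow Y n ⊗ Z) ≫ o20 (evPow X Y n) (dpow Y n ⊗ Z) := by
  rw [dualPow, coevTail, o20]
  simp only [fans, cancels]

/-- The dual of `e` is determined by the coevaluation. -/
theorem coevTail_dualPow (n : ℕ) (e : tpow X n ⟶ tpow X n) (Z : C) :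
    coevTail X Y n Z ≫ tpow X n ◁ dualPow X Y n e ▷ Z = coevTail X Y n Z ≫ e ▷ (dpow Y n ⊗ Z) := by
  rw [tail_dualPow]
  simp only [whiskerLeft_comp]
  rw [← reassoc_of% (coevTail_nat X Y n), ← reassoc_of% (coevTail_nat X Y n), coevTail_ev, comp_id]

/-- The endomorphism `e^∨ ⊗ X^{⊗n}` of `A_n(X)`. -/
def freeDual (n : ℕ) (e : tpow X n ⟶ tpow X n) : freeObj X Y n ⟶ freeObj X Y n := dualPow X Y n e ▷ tpow X n
/-- The endomorphism `Y^{⊗n} ⊗ e` of `A_n(X)`. -/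
def freeRight (n : ℕ) (e : tpow X n ⟶ tpow X n) : freeObj X Y n ⟶ freeObj X Y n := dpow Y n ◁ e

theorem freeCoaction_freeDual (n : ℕ) (e : tpow X n ⟶ tpow X n) (Z : C) :
    o12 (freeCoaction X Y n) Z ≫ tpow X n ◁ freeDual X Y n e ▷ Z =
      o12 (freeCoaction X Y n) Z ≫ e ▷ (freeObj X Y n ⊗ Z) := by
  have h : freeDual X Y n e ▷ Z = (fsplit X Y n Z).hom ≫ dualPow X Y n e ▷ (tpow X n ⊗ Z) ≫ (fsplit X Y n Z).inv :=
    whiskerRight_whiskerRight _ _ _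
  rw [h, tail_freeCoaction]
  simp only [whiskerLeft_comp, cancels]
  rw [reassoc_of% coevTail_dualPow, whisker_exchange]

theorem freeCoaction_freeRight (n : ℕ) (e : tpow X n ⟶ tpow X n) (Z : C) :
    o12 (freeCoaction X Y n) Z ≫ tpow X n ◁ freeRight X Y n e ▷ Z = e ▷ Z ≫ o12 (freeCoaction X Y n) Z := by
  have h : freeRight X Y n e ▷ Z = (fsplit X Y n Z).hom ≫ dpow Y n ◁ e ▷ Z ≫ (fsplit X Y n Z).inv :=
    whisker_assoc _ _ _
  rw [h, tail_freeCoaction]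
  simp only [whiskerLeft_comp, cancels]
  rw [← reassoc_of% (coevTail_nat X Y n)]

variable [BraidedCategory C]

theorem tail_freeMul (m n : ℕ) (Z : C) : o21 (freeMul X Y m n) Z =
    freeObj X Y m ◁ (fsplit X Y n Z).hom ≫ cross (freeObj X Y m) (dpow Y n) (tpow X n ⊗ Z) ≫
      dpow Y n ◁ (fsplit X Y m _).hom ≫ o21 (dmul Y m n) _ ≫ dpow Y (m + n) ◁ o21 (tmul X m n) Z ≫
      (fsplit X Y (m + n) Z).inv := by
  change (α_ (dpow Y m ⊗ tpow X m) (dpow Y n ⊗ tpow X n) Z).inv ≫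
    ((α_ (dpow Y m ⊗ tpow X m) (dpow Y n) (tpow X n)).inv ≫ (β_ (dpow Y m ⊗ tpow X m) (dpow Y n)).hom ▷ tpow X n ≫
    (α_ (dpow Y n) (dpow Y m ⊗ tpow X m) (tpow X n)).hom ≫
    dpow Y n ◁ (α_ (dpow Y m) (tpow X m) (tpow X n)).hom ≫
    (α_ (dpow Y n) (dpow Y m) (tpow X m ⊗ tpow X n)).inv ≫ (dmul Y m n ⊗ₘ tmul X m n)) ▷ Z =
    _ ◁ (α_ (dpow Y n) (tpow X n) Z).hom ≫ cross (dpow Y m ⊗ tpow X m) (dpow Y n) (tpow X n ⊗ Z) ≫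
      dpow Y n ◁ (α_ (dpow Y m) (tpow X m) (tpow X n ⊗ Z)).hom ≫ o21 (dmul Y m n) (tpow X m ⊗ tpow X n ⊗ Z) ≫ dpow Y (m + n) ◁ o21 (tmul X m n) Z ≫
      (α_ (dpow Y (m + n)) (tpow X (m + n)) Z).inv
  rw [tensor_def]
  simp only [fans, cancels, r21 (tmul X m n), r21 (dmul Y m n), r22 (β_ (dpow Y m ⊗ tpow X m) (dpow Y n)).hom]
  rw [← o21_nat_assoc]
  simp only [cancels]

theorem cross_coevTail (n : ℕ) (W Z : C) :
    W ◁ coevTail X Y n Z ≫ cross W (tpow X n) (dpow Y n ⊗ Z) ≫ tpow X n ◁ cross W (dpow Y n) Z =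
      coevTail X Y n (W ⊗ Z) := by
  have e : ∀ Z, coevTail X Y n Z = o01 (coevPow X Y n) Z ≫ (α_ _ _ _).hom := fun Z => by simp [coevTail, o01]
  have h := cross_right01 (coevPow X Y n) W Z
  rw [cross_tensor_right] at h
  rw [e, e, whiskerLeft_comp, ← h]
  simp only [cancels]

/-- The tensor product of the coactions on `X^{⊗m}` and `X^{⊗n}` is the coaction on
`X^{⊗(m+n)}`. -/
theorem tail_freeCoaction_mul (m n : ℕ) (Z : C) :
    o12 (freeCoaction X Y m) (tpow X n ⊗ Z) ≫ tpow X m ◁ freeObj X Y m ◁ o12 (freeCoaction X Y n) Z ≫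
      tpow X m ◁ cross (freeObj X Y m) (tpow X n) (freeObj X Y n ⊗ Z) ≫
      tpow X m ◁ tpow X n ◁ o21 (freeMul X Y m n) Z ≫ o21 (tmul X m n) (freeObj X Y (m + n) ⊗ Z) =
    o21 (tmul X m n) Z ≫ o12 (freeCoaction X Y (m + n)) Z := by
  have k := wl (tpow X m) (cross_coevTail X Y n (freeObj X Y m) (tpow X n ⊗ Z))
  have p := fun {Z Z' : C} (h : Z ⟶ Z') => wl (tpow X m) (coevTail_nat X Y n h)
  simp only [whiskerLeft_comp] at k p
  simp only [tail_freeMul, tail_freeCoaction, whiskerLeft_comp, cancels]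
  rw [reassoc_of% (coevTail_nat X Y (m + n) (o21 (tmul X m n) Z)), coevTail_add]
  simp only [nats]
  simp only [cancels]
  rw [← o21_nat_assoc (tmul X m n) (cross (freeObj X Y m) (dpow Y n) (tpow X n ⊗ Z)), reassoc_of% k, reassoc_of% p]
  simp only [nats]
  simp only [cancels]

/-- The pairing of `A_m(X)` and `A_n(X)` given by a morphism
`X^{⊗m} ⊗ X^{⊗n} ⟶ X^{⊗n} ⊗ X^{⊗m}`. -/
def pairingVia {m n : ℕ} (g : tpow X m ⊗ tpow X n ⟶ tpow X n ⊗ tpow X m) : freeObj X Y m ⊗ freeObj X Y n ⟶ 𝟙_ C :=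
  middle (dpow Y m) (β_ (tpow X m) (dpow Y n)).hom (tpow X n) ≫
    (dpow Y m ⊗ dpow Y n) ◁ g ≫ nested (evPow X Y m) (evPow X Y n)

theorem tail_pairingVia {m n : ℕ} (g : tpow X m ⊗ tpow X n ⟶ tpow X n ⊗ tpow X m) (Z : C) : o20 (pairingVia X Y g) Z =
    (fsplit X Y m _).hom ≫ dpow Y m ◁ tpow X m ◁ (fsplit X Y n Z).hom ≫ dpow Y m ◁ cross (tpow X m) (dpow Y n) _ ≫
      dpow Y m ◁ dpow Y n ◁ o22 g Z ≫ dpow Y m ◁ o20 (evPow X Y n) _ ≫ o20 (evPow X Y m) Z := by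
  change (α_ (dpow Y m ⊗ tpow X m) (dpow Y n ⊗ tpow X n) Z).inv ≫ (middle (dpow Y m) (β_ (tpow X m) (dpow Y n)).hom (tpow X n) ≫
    (dpow Y m ⊗ dpow Y n) ◁ g ≫ nested (evPow X Y m) (evPow X Y n)) ▷ Z ≫ (λ_ Z).hom = 
    (α_ (dpow Y m) (tpow X m) ((dpow Y n ⊗ tpow X n) ⊗ Z)).hom ≫ dpow Y m ◁ tpow X m ◁ (α_ (dpow Y n) (tpow X n) Z).hom ≫ _
  simp only [comp_whiskerRight, tail_middle, tail_nested]
  simp only [fans, cancels, r22 g]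

/-- The pairing given by `g` induces the braiding `g` of the comodules `X^{⊗m}` and `X^{⊗n}`. -/
theorem tail_braiding_pairingVia {m n : ℕ} (g : tpow X m ⊗ tpow X n ⟶ tpow X n ⊗ tpow X m) (Z : C) :
    tpow X m ◁ o12 (freeCoaction X Y n) Z ≫ cross (tpow X m) (tpow X n) (freeObj X Y n ⊗ Z) ≫
      tpow X n ◁ o12 (freeCoaction X Y m) _ ≫ tpow X n ◁ tpow X m ◁ o20 (pairingVia X Y g) Z = o22 g Z := by
  have k := cross_coevTail X Y n (tpow X m) (tpow X n ⊗ Z)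
  have p := fun {Z Z' : C} (h : Z ⟶ Z') => wl (tpow X n) (coevTail_nat X Y m h)
  have q := fun Z => wl (tpow X n) (coevTail_ev X Y m Z)
  simp only [whiskerLeft_comp, whiskerLeft_id] at p q
  simp only [tail_pairingVia, tail_freeCoaction, whiskerLeft_comp, cancels]
  rw [← reassoc_of% p, ← reassoc_of% p, ← reassoc_of% p, ← reassoc_of% p, q, comp_id]
  rw [← o22_nat_assoc]
  simp only [cancels]
  rw [reassoc_of% k, ← reassoc_of% (coevTail_nat X Y n (o22 g Z)), coevTail_ev, comp_id]
end Free
end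

noncomputable section
/-! ### The ideal of FRT relations -/

section Subobjects
variable {C : Type u} [Category.{v} C] [Abelian C]

/-- In an abelian category a subobject is determined by the morphisms that vanish on it. -/
theorem subobject_le_of_kills {G : C} (S T : Subobject G)
    (h : ∀ {Z : C} (f : G ⟶ Z), T.arrow ≫ f = 0 → S.arrow ≫ f = 0) : S ≤ T := by
  have h1 := h (cokernel.π T.arrow) (cokernel.condition _)
  refine Subobject.le_of_comm (Abelian.monoLift T.arrow S.arrow h1) (Abelian.monoLift_comp _ _ _)

/-- The inclusions of two subobjects into their supremum are jointly epimorphic. -/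
instance epi_biprod_sup {G : C} (S T : Subobject G) :
    Epi (biprod.desc (Subobject.ofLE S (S ⊔ T) le_sup_left) (Subobject.ofLE T (S ⊔ T) le_sup_right)) := by
  refine Preadditive.epi_of_cancel_zero _ fun {Z} h hh => ?_
  have h1 := biprod.inl ≫= hh
  have h2 := biprod.inr ≫= hh
  simp only [biprod.inl_desc_assoc, biprod.inr_desc_assoc, comp_zero] at h1 h2
  have le : S ⊔ T ≤ Subobject.mk (kernel.ι h ≫ (S ⊔ T).arrow) := by
    refine sup_le ?_ ?_
    · exact Subobject.le_mk_of_comm (kernel.lift h _ h1) (by simp)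
    · exact Subobject.le_mk_of_comm (kernel.lift h _ h2) (by simp)
  have e : Subobject.ofLEMk _ _ le ≫ kernel.ι h = 𝟙 _ := by
    rw [← cancel_mono (S ⊔ T).arrow, assoc, Subobject.ofLEMk_comp, id_comp]
  rw [← id_comp h, ← e, assoc, kernel.condition, comp_zero]

variable [MonoidalCategory C] [MonoidalPreadditive C] [∀ Z : C, PreservesFiniteColimits (tensorRight Z)]

instance epi_whiskerRight {A B : C} (f : A ⟶ B) [Epi f] (Z : C) : Epi (f ▷ Z) :=
  inferInstanceAs (Epi ((tensorRight Z).map f))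

theorem arrow_bot_whiskerRight {G W Z : C} (f : G ⊗ W ⟶ Z) : (⊥ : Subobject G).arrow ▷ W ≫ f = 0 := by
  rw [Subobject.bot_arrow, MonoidalPreadditive.zero_whiskerRight, zero_comp]

theorem arrow_sup_whiskerRight {G W Z : C} (f : G ⊗ W ⟶ Z) (S T : Subobject G)
    (hS : S.arrow ▷ W ≫ f = 0) (hT : T.arrow ▷ W ≫ f = 0) : (S ⊔ T).arrow ▷ W ≫ f = 0 := by
  rw [← cancel_epi (biprod.desc (Subobject.ofLE S (S ⊔ T) le_sup_left)
    (Subobject.ofLE T (S ⊔ T) le_sup_right) ▷ W), biprod.desc_eq, ← comp_whiskerRight_assoc, Preadditive.add_comp,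
    assoc, assoc, Subobject.ofLE_arrow, Subobject.ofLE_arrow, comp_zero,
    MonoidalPreadditive.add_whiskerRight, Preadditive.add_comp, comp_whiskerRight_assoc, comp_whiskerRight_assoc,
    hS, hT, comp_zero, comp_zero, add_zero]

theorem arrow_imageSubobject_whiskerRight {P G W Z : C} (g : P ⟶ G) (f : G ⊗ W ⟶ Z) :
    (imageSubobject g).arrow ▷ W ≫ f = 0 ↔ g ▷ W ≫ f = 0 := by
  constructor
  · intro h
    rw [← imageSubobject_arrow_comp g, comp_whiskerRight_assoc, h, comp_zero]
  · intro h
    rw [← cancel_epi (factorThruImageSubobject g ▷ W), ← comp_whiskerRight_assoc, imageSubobject_arrow_comp, h,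
      comp_zero]

theorem le_whiskerRight {G W Z : C} (f : G ⊗ W ⟶ Z) {S T : Subobject G} (h : S ≤ T)
    (hT : T.arrow ▷ W ≫ f = 0) : S.arrow ▷ W ≫ f = 0 := by
  rw [← Subobject.ofLE_arrow h, comp_whiskerRight_assoc, hT, comp_zero]

/-- The generator of an ideal in the place `(a, b)`. -/
abbrev idealGenerator (G : ℕ → C) (mul : ∀ m n, G m ⊗ G n ⟶ G (m + n)) (k : ℕ) {P : C} (r : P ⟶ G k) (a b : ℕ) :
    (G a ⊗ P) ⊗ G b ⟶ G (a + k + b) := (G a ◁ r ≫ mul a k) ▷ G b ≫ mul (a + k) b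

/-- A morphism vanishes on an ideal if and only if it vanishes on the generators. -/
theorem idealGen_kills_iff (G : ℕ → C) (mul : ∀ m n, G m ⊗ G n ⟶ G (m + n)) (k : ℕ) {P : C} (r : P ⟶ G k) (n : ℕ)
    {W Z : C} (f : G n ⊗ W ⟶ Z) : (idealGen G mul k r n).arrow ▷ W ≫ f = 0 ↔
      ∀ (a b : ℕ) (h : a + k + b = n), (idealGenerator G mul k r a b ≫ eqToHom (congrArg G h)) ▷ W ≫ f = 0 := by
  constructor
  · intro hf a b h
    have := Finset.le_sup (f := fun p : {p : Fin (n + 1) × Fin (n + 1) // p.1.val + k + p.2.val = n} =>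
      imageSubobject ((G p.1.1 ◁ r ≫ mul p.1.1 k) ▷ G p.1.2 ≫ mul (p.1.1 + k) p.1.2 ≫
      eqToHom (congrArg G p.2))) (Finset.mem_univ ⟨(⟨a, by omega⟩, ⟨b, by omega⟩), h⟩)
    have := (arrow_imageSubobject_whiskerRight _ f).1 (le_whiskerRight f this hf)
    simpa only [idealGenerator, assoc] using this
  · intro hf
    unfold idealGen
    refine Finset.sup_induction (p := fun S : Subobject (G n) => S.arrow ▷ W ≫ f = 0) (arrow_bot_whiskerRight f)
      (fun S hS T hT => arrow_sup_whiskerRight f S T hS hT) fun p _ => ?_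
    rw [arrow_imageSubobject_whiskerRight]
    simpa only [idealGenerator, assoc] using hf p.1.1 p.1.2 p.2

theorem exists_cokernel_desc {G W Z : C} (S : Subobject G) (f : G ⊗ W ⟶ Z) (h : S.arrow ▷ W ≫ f = 0) :
    ∃ g, cokernel.π S.arrow ▷ W ≫ g = f := by
  have hc := isColimitOfHasCokernelOfPreservesColimit (tensorRight W) S.arrow
  refine ⟨hc.desc (CokernelCofork.ofπ f h), ?_⟩
  exact hc.fac (CokernelCofork.ofπ f h) WalkingParallelPair.one
end Subobjects

section FRTIdeal
section
variable {C : Type u} [Category.{v} C] [MonoidalCategory C] {X : C}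
theorem padLeft_comp {a k m : ℕ} (h : a + k = m) (e e' : tpow X k ⟶ tpow X k) :
    padLeft h (e ≫ e') = padLeft h e ≫ padLeft h e' := by simp [padLeft]
theorem padRight_comp {k b m : ℕ} (h : k + b = m) (e e' : tpow X k ⟶ tpow X k) :
    padRight h (e ≫ e') = padRight h e ≫ padRight h e' := by simp [padRight]
theorem padLeft_id {a k m : ℕ} (h : a + k = m) : padLeft h (𝟙 (tpow X k)) = 𝟙 _ := by simp [padLeft]
theorem padRight_id {k b m : ℕ} (h : k + b = m) : padRight h (𝟙 (tpow X k)) = 𝟙 _ := by simp [padRight]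
end
variable {C : Type u} [Category.{v} C] [MonoidalCategory C] {X Y : C} [ExactPairing X Y]

/-- `X^{⊗n} ⊗ W ⟶ X^{⊗n} ⊗ Z`, the action on the comodule `X^{⊗n}` of a morphism `A_n(X) ⊗ W ⟶ Z`. -/
def coact (n : ℕ) {W Z : C} (f : freeObj X Y n ⊗ W ⟶ Z) : tpow X n ⊗ W ⟶ tpow X n ⊗ Z :=
  o12 (freeCoaction X Y n) W ≫ tpow X n ◁ f

/-- The action of `f` on `X^{⊗n}` commutes with all endomorphisms `X^{⊗a} ⊗ e ⊗ X^{⊗b}`. -/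
def CommutesWithPads {k : ℕ} (e : tpow X k ⟶ tpow X k) {n : ℕ} {W Z : C} (f : freeObj X Y n ⊗ W ⟶ Z) : Prop :=
  ∀ e' : tpow X n ⟶ tpow X n, IsPad e e' → e' ▷ W ≫ coact n f = coact n f ≫ e' ▷ Z

theorem coact_comp (n : ℕ) {W Z Z' : C} (f : freeObj X Y n ⊗ W ⟶ Z) (h : Z ⟶ Z') :
    coact n (f ≫ h) = coact n f ≫ tpow X n ◁ h := by simp [coact]
theorem coact_pre (n : ℕ) {W W' Z : C} (h : W' ⟶ W) (f : freeObj X Y n ⊗ W ⟶ Z) :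
    coact n (freeObj X Y n ◁ h ≫ f) = tpow X n ◁ h ≫ coact n f := by
  rw [coact, coact, whiskerLeft_comp, o12_nat_assoc]

theorem coact_injective (n : ℕ) {W Z : C} {f g : freeObj X Y n ⊗ W ⟶ Z} (h : coact n f = coact n g) : f = g :=
  separates_freeCoaction X Y n f g h

variable [BraidedCategory C]

/-- `coact` with a spectator on the left. -/
def coactUnder (n : ℕ) {U W Z : C} (f : U ⊗ (freeObj X Y n ⊗ W) ⟶ Z) : U ⊗ (tpow X n ⊗ W) ⟶ tpow X n ⊗ Z :=
  U ◁ o12 (freeCoaction X Y n) W ≫ cross U (tpow X n) (freeObj X Y n ⊗ W) ≫ tpow X n ◁ f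

theorem coactUnder_injective (n : ℕ) {U W Z : C} {f g : U ⊗ (freeObj X Y n ⊗ W) ⟶ Z}
    (h : coactUnder n f = coactUnder n g) : f = g :=
  (separates_freeCoaction X Y n).under f g h

theorem coactUnder_pre (n : ℕ) {U U' W Z : C} (q : U' ⟶ U) (f : U ⊗ (freeObj X Y n ⊗ W) ⟶ Z) :
    coactUnder n (q ▷ _ ≫ f) = q ▷ _ ≫ coactUnder n f := by
  rw [coactUnder, coactUnder, whiskerLeft_comp, ← reassoc_of% (cross_left11 q), whisker_exchange_assoc]

theorem coactUnder_freeDual (n : ℕ) (e : tpow X n ⟶ tpow X n) {U W Z : C} (f : U ⊗ (freeObj X Y n ⊗ W) ⟶ Z) :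
    coactUnder n (U ◁ freeDual X Y n e ▷ W ≫ f) = coactUnder n f ≫ e ▷ Z := by
  have k := wl U (freeCoaction_freeDual X Y n e W)
  simp only [whiskerLeft_comp] at k
  rw [coactUnder, coactUnder, whiskerLeft_comp, ← o22_nat_assoc, reassoc_of% k, reassoc_of% (cross_right11 e)]
  simp only [assoc, whisker_exchange]
theorem coactUnder_freeRight (n : ℕ) (e : tpow X n ⟶ tpow X n) {U W Z : C} (f : U ⊗ (freeObj X Y n ⊗ W) ⟶ Z) :
    coactUnder n (U ◁ freeRight X Y n e ▷ W ≫ f) = U ◁ e ▷ W ≫ coactUnder n f := by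
  have k := wl U (freeCoaction_freeRight X Y n e W)
  simp only [whiskerLeft_comp] at k
  rw [coactUnder, coactUnder, whiskerLeft_comp, ← o22_nat_assoc, reassoc_of% k]

theorem coact_coactUnder (m n : ℕ) {W Z : C} (f : freeObj X Y (m + n) ⊗ W ⟶ Z) :
    coact m (coactUnder n (o21 (freeMul X Y m n) W ≫ f)) ≫ o21 (tmul X m n) Z =
      o21 (tmul X m n) W ≫ coact (m + n) f := by
  have := tail_freeCoaction_mul X Y m n W =≫ tpow X (m + n) ◁ f
  simp only [assoc] at this
  rw [coact, coact, coactUnder, ← this, ← o21_nat]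
  simp only [whiskerLeft_comp, assoc]

theorem idealGenerator_comp (a b : ℕ) {W Z : C} (f : freeObj X Y (a + 2 + b) ⊗ W ⟶ Z)
    (r : freeObj X Y 2 ⟶ freeObj X Y 2) :
    (α_ _ _ _).inv ≫ idealGenerator (freeObj X Y) (freeMul X Y) 2 r a b ▷ W ≫ f =
      (freeObj X Y a ◁ r ≫ freeMul X Y a 2) ▷ (freeObj X Y b ⊗ W) ≫ o21 (freeMul X Y (a + 2) b) W ≫ f := by
  simp only [idealGenerator, o21, comp_whiskerRight, assoc, whiskerRight_tensor, associator_inv_naturality_left_assoc,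
    Iso.hom_inv_id_assoc]

/-- The FRT relation in the place `(a, b)`, read on `X^{⊗n}`: on coefficients, `e^∨ ⊗ id` is
precomposition and `id ⊗ e` is postcomposition of the action with `e`. -/
theorem generator_equal_iff (e : tpow X 2 ⟶ tpow X 2) (a b : ℕ) {W Z : C} (f : freeObj X Y (a + 2 + b) ⊗ W ⟶ Z) :
    idealGenerator (freeObj X Y) (freeMul X Y) 2 (freeDual X Y 2 e) a b ▷ W ≫ f =
      idealGenerator (freeObj X Y) (freeMul X Y) 2 (freeRight X Y 2 e) a b ▷ W ≫ f ↔
    padRight (k := a + 2) (b := b) rfl (padLeft (a := a) rfl e) ▷ W ≫ coact (a + 2 + b) f =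
      coact (a + 2 + b) f ≫ padRight (k := a + 2) (b := b) rfl (padLeft (a := a) rfl e) ▷ Z := by
  rw [← cancel_epi (α_ _ _ _).inv, idealGenerator_comp, idealGenerator_comp]
  set f2 := o21 (freeMul X Y (a + 2) b) W ≫ f with hf2
  have i1 : ∀ r : freeObj X Y 2 ⟶ freeObj X Y 2, (freeObj X Y a ◁ r ≫ freeMul X Y a 2) ▷ (tpow X b ⊗ W) ≫ coactUnder b f2 =
      (α_ _ _ _).hom ≫ freeObj X Y a ◁ r ▷ (tpow X b ⊗ W) ≫ o21 (freeMul X Y a 2) _ ≫ coactUnder b f2 := by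
    intro r; simp [o21]
  have i2 := coact_coactUnder a 2 (coactUnder b f2)
  have i3 := coact_coactUnder (a + 2) b f
  rw [← hf2] at i3
  set u3 := o21 (freeMul X Y a 2) _ ≫ coactUnder b f2 with hu3
  have L := fun Z => tail_padLeft (X := X) (a := a) rfl e Z
  have P := fun Z => tail_padRight (X := X) (b := b) rfl (padLeft (a := a) rfl e) Z
  simp only [tpowIso_hom] at L P
  -- The action is spread over the three factors `X^{⊗b}`, `X^{⊗2}` and `X^{⊗a}` in turn; each of the
  -- three is injective in the morphism.
  calc _ ↔ (freeObj X Y a ◁ freeDual X Y 2 e ≫ freeMul X Y a 2) ▷ (tpow X b ⊗ W) ≫ coactUnder b f2 =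
        (freeObj X Y a ◁ freeRight X Y 2 e ≫ freeMul X Y a 2) ▷ (tpow X b ⊗ W) ≫ coactUnder b f2 := by
        rw [← coactUnder_pre, ← coactUnder_pre]
        exact ⟨congrArg _, coactUnder_injective b⟩
    _ ↔ freeObj X Y a ◁ freeDual X Y 2 e ▷ (tpow X b ⊗ W) ≫ u3 =
        freeObj X Y a ◁ freeRight X Y 2 e ▷ (tpow X b ⊗ W) ≫ u3 := by
        rw [i1, i1, cancel_epi]
    _ ↔ coactUnder 2 u3 ≫ e ▷ (tpow X b ⊗ Z) = freeObj X Y a ◁ e ▷ (tpow X b ⊗ W) ≫ coactUnder 2 u3 := by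
        rw [← coactUnder_freeDual, ← coactUnder_freeRight]
        exact ⟨congrArg _, coactUnder_injective 2⟩
    _ ↔ coact a (coactUnder 2 u3) ≫ tpow X a ◁ e ▷ (tpow X b ⊗ Z) =
        tpow X a ◁ e ▷ (tpow X b ⊗ W) ≫ coact a (coactUnder 2 u3) := by
        rw [← coact_comp, ← coact_pre]
        exact ⟨congrArg _, coact_injective a⟩
    _ ↔ coact (a + 2) (coactUnder b f2) ≫ padLeft (a := a) rfl e ▷ (tpow X b ⊗ Z) =
        padLeft (a := a) rfl e ▷ (tpow X b ⊗ W) ≫ coact (a + 2) (coactUnder b f2) := by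
        rw [← cancel_mono (o21 (tmul X a 2) (tpow X b ⊗ Z)), ← cancel_epi (o21 (tmul X a 2) (tpow X b ⊗ W)),
          assoc, assoc, ← L, i2, reassoc_of% i2, reassoc_of% L]
    _ ↔ coact (a + 2 + b) f ≫ padRight (k := a + 2) (b := b) rfl (padLeft (a := a) rfl e) ▷ Z =
        padRight (k := a + 2) (b := b) rfl (padLeft (a := a) rfl e) ▷ W ≫ coact (a + 2 + b) f := by
        rw [← cancel_mono (o21 (tmul X (a + 2) b) Z), ← cancel_epi (o21 (tmul X (a + 2) b) W),
          assoc, assoc, ← P, i3, reassoc_of% i3, reassoc_of% P]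
    _ ↔ _ := eq_comm

variable [Abelian C] [MonoidalPreadditive C]

theorem idealGenerator_sub (r r' : freeObj X Y 2 ⟶ freeObj X Y 2) (a b : ℕ) :
    idealGenerator (freeObj X Y) (freeMul X Y) 2 (r - r') a b =
      idealGenerator (freeObj X Y) (freeMul X Y) 2 r a b - idealGenerator (freeObj X Y) (freeMul X Y) 2 r' a b := by
  have h1 : freeObj X Y a ◁ (r - r') = freeObj X Y a ◁ r - freeObj X Y a ◁ r' := (tensorLeft (freeObj X Y a)).map_sub
  have h2 : ∀ f g : freeObj X Y a ⊗ freeObj X Y 2 ⟶ freeObj X Y (a + 2), (f - g) ▷ freeObj X Y b =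
    f ▷ freeObj X Y b - g ▷ freeObj X Y b := fun f g => (tensorRight (freeObj X Y b)).map_sub
  simp only [idealGenerator, h1, h2, Preadditive.sub_comp]

variable [∀ Z : C, PreservesFiniteColimits (tensorRight Z)]

/-- A morphism out of `A_n(X) ⊗ W` vanishes on the FRT ideal if and only if the corresponding
endomorphism of the comodule `X^{⊗n}` commutes with `R` in all places. -/
theorem frtIdeal_kills_iff (R : X ⊗ X ⟶ X ⊗ X) (n : ℕ) {W Z : C} (f : freeObj X Y n ⊗ W ⟶ Z) :
    (frtIdeal X Y R n).arrow ▷ W ≫ f = 0 ↔ CommutesWithPads (RTwo R) f := by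
  have hr : frtRelation X Y R = freeDual X Y 2 (RTwo R) - freeRight X Y 2 (RTwo R) := rfl
  have key : ∀ (a b : ℕ) (f : freeObj X Y (a + 2 + b) ⊗ W ⟶ Z),
      idealGenerator (freeObj X Y) (freeMul X Y) 2 (frtRelation X Y R) a b ▷ W ≫ f = 0 ↔
      padRight (k := a + 2) (b := b) rfl (padLeft (a := a) rfl (RTwo R)) ▷ W ≫ coact (a + 2 + b) f =
      coact (a + 2 + b) f ≫ padRight (k := a + 2) (b := b) rfl (padLeft (a := a) rfl (RTwo R)) ▷ Z := by
    intro a b f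
    have h2 : ∀ {A B : C} (f g : A ⟶ B), (f - g) ▷ W = f ▷ W - g ▷ W := fun f g => (tensorRight W).map_sub
    rw [hr, idealGenerator_sub, h2, Preadditive.sub_comp, sub_eq_zero, generator_equal_iff]
  rw [frtIdeal, idealGen_kills_iff]
  constructor
  · rintro h e' ⟨a, b, m, rfl, rfl, rfl⟩
    have := h a b rfl
    rw [eqToHom_refl, comp_id] at this
    exact (key a b f).1 this
  · rintro h a b rfl
    rw [eqToHom_refl, comp_id]
    exact (key a b f).2 (h _ ⟨a, b, a + 2, rfl, rfl, rfl⟩)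

theorem frtIdealBar_kills_iff (R : X ⊗ X ⟶ X ⊗ X) (n : ℕ) {W Z : C} (f : freeObj X Y n ⊗ W ⟶ Z) :
    (frtIdealBar X Y R n).arrow ▷ W ≫ f = 0 ↔ CommutesWithPads (RTwo R) f :=
  @frtIdeal_kills_iff C _ _ X Y _ (reverseBraiding C) _ _ _ R n W Z f

theorem commutesWithPads_inv (R : X ⊗ X ≅ X ⊗ X) {n : ℕ} {W Z : C} (f : freeObj X Y n ⊗ W ⟶ Z)
    (h : CommutesWithPads (RTwo R.hom) f) : CommutesWithPads (RTwo R.inv) f := by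
  rintro e' ⟨a, b, m, h1, h2, rfl⟩
  have k := h _ ⟨a, b, m, h1, h2, rfl⟩
  have e : (padRight h2 (padLeft h1 (RTwo R.hom))) ≫ padRight h2 (padLeft h1 (RTwo R.inv)) = 𝟙 _ := by
    rw [← padRight_comp, ← padLeft_comp]; simp [RTwo, padLeft_id, padRight_id]
  have e' : padRight h2 (padLeft h1 (RTwo R.inv)) ≫ (padRight h2 (padLeft h1 (RTwo R.hom))) = 𝟙 _ := by
    rw [← padRight_comp, ← padLeft_comp]; simp [RTwo, padLeft_id, padRight_id]
  have k2 := (padRight h2 (padLeft h1 (RTwo R.inv))) ▷ W ≫= k =≫ (padRight h2 (padLeft h1 (RTwo R.inv))) ▷ Z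
  simp only [assoc] at k2
  rw [← comp_whiskerRight_assoc, e', id_whiskerRight, id_comp, ← comp_whiskerRight, e, id_whiskerRight,
    comp_id] at k2
  exact k2.symm

/-- The two ideals coincide. -/
theorem frtIdealBar_eq (R : X ⊗ X ≅ X ⊗ X) (n : ℕ) : frtIdealBar X Y R.inv n = frtIdeal X Y R.hom n := by
  have unit : ∀ (S : Subobject (freeObj X Y n)) {Z : C} (f : freeObj X Y n ⟶ Z),
      S.arrow ▷ 𝟙_ C ≫ f ▷ 𝟙_ C = 0 ↔ S.arrow ≫ f = 0 := by
    intro S Z f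
    rw [← comp_whiskerRight, ← whiskerRight_iff (S.arrow ≫ f) 0, MonoidalPreadditive.zero_whiskerRight]
  refine le_antisymm (subobject_le_of_kills _ _ fun f hf => ?_) (subobject_le_of_kills _ _ fun f hf => ?_)
  · rw [← unit, frtIdealBar_kills_iff]
    rw [← unit, frtIdeal_kills_iff] at hf
    exact commutesWithPads_inv R _ hf
  · rw [← unit, frtIdeal_kills_iff]
    rw [← unit, frtIdealBar_kills_iff] at hf
    exact commutesWithPads_inv R.symm _ hf

/-- The projection `A_n(X) ⟶ A_n(X, R)`. -/
def frtπ (X Y : C) [ExactPairing X Y] (R : X ⊗ X ⟶ X ⊗ X) (n : ℕ) : freeObj X Y n ⟶ frtObj X Y R n :=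
  cokernel.π (frtIdeal X Y R n).arrow

instance (R : X ⊗ X ⟶ X ⊗ X) (n : ℕ) : Epi (frtπ X Y R n) := inferInstanceAs (Epi (cokernel.π _))

theorem exists_frt_desc (R : X ⊗ X ⟶ X ⊗ X) {n : ℕ} {W Z : C} (f : freeObj X Y n ⊗ W ⟶ Z)
    (h : CommutesWithPads (RTwo R) f) : ∃ g, frtπ X Y R n ▷ W ≫ g = f :=
  exists_cokernel_desc _ f ((frtIdeal_kills_iff R n f).2 h)

theorem commutesWithPads_frtπ (R : X ⊗ X ⟶ X ⊗ X) (n : ℕ) {W Z : C} (g : frtObj X Y R n ⊗ W ⟶ Z) :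
    CommutesWithPads (RTwo R) (frtπ X Y R n ▷ W ≫ g) := by
  have h : (frtIdeal X Y R n).arrow ≫ frtπ X Y R n = 0 := cokernel.condition _
  rw [← frtIdeal_kills_iff, ← comp_whiskerRight_assoc, h,
    MonoidalPreadditive.zero_whiskerRight, zero_comp]

/-- The quotients of the objects `A_n(X)` that are universal for the FRT relation.  The
definition does not refer to a braiding. -/
structure FRTQuotient (X Y : C) [ExactPairing X Y] (R : X ⊗ X ⟶ X ⊗ X) where
  /-- the quotient of `A_n(X)` -/
  obj : ℕ → C
  /-- the projection -/
  π : ∀ n, freeObj X Y n ⟶ obj n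
  epi : ∀ n, Epi (π n)
  exists_desc : ∀ {n : ℕ} {W Z : C} (f : freeObj X Y n ⊗ W ⟶ Z), CommutesWithPads (RTwo R) f →
    ∃ g, π n ▷ W ≫ g = f
  commutes : ∀ (n : ℕ) {W Z : C} (g : obj n ⊗ W ⟶ Z), CommutesWithPads (RTwo R) (π n ▷ W ≫ g)

attribute [instance] FRTQuotient.epi

/-- The components of `A(X, R)`. -/
def frtQuotient (X Y : C) [ExactPairing X Y] (R : X ⊗ X ⟶ X ⊗ X) : FRTQuotient X Y R where
  obj := frtObj X Y R
  π := frtπ X Y R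
  epi := inferInstance
  exists_desc := exists_frt_desc R
  commutes := commutesWithPads_frtπ R
end FRTIdeal
end

noncomputable section
/-! ### Descent to `A(X, R)` -/

section Descent
instance isIso_o22 {C : Type u} [Category.{v} C] [MonoidalCategory C] {A B D E : C} (f : A ⊗ B ⟶ D ⊗ E) [IsIso f]
    (Z : C) : IsIso (o22 f Z) := by
  unfold o22; infer_instance

variable {C : Type u} [Category.{v} C] [MonoidalCategory C] [BraidedCategory C] {X Y : C} [ExactPairing X Y]

theorem coact_crossInv (n : ℕ) {U W Z : C} (f : U ⊗ (freeObj X Y n ⊗ W) ⟶ Z) :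
    coact n (crossInv (freeObj X Y n) U W ≫ f) = crossInv (tpow X n) U W ≫ coactUnder n f := by
  have h1 := cross_right12 (freeCoaction X Y n) U W
  have h2 := wl (tpow X n) (cross_crossInv U (freeObj X Y n) W)
  simp only [whiskerLeft_comp, whiskerLeft_id] at h2
  rw [coact, coactUnder, whiskerLeft_comp, ← cancel_epi (cross U (tpow X n) W), ← reassoc_of% h1, reassoc_of% h2,
    reassoc_of% cross_crossInv]

theorem coactUnder_coact (m n : ℕ) {W Z : C} (f : freeObj X Y m ⊗ (freeObj X Y n ⊗ W) ⟶ Z) :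
    coactUnder n (coact m f) = coact m (coactUnder n f) ≫ cross (tpow X m) (tpow X n) Z := by
  have h := cross_left12 (freeCoaction X Y m) (tpow X n) (freeObj X Y n ⊗ W)
  simp only [coactUnder, coact, whiskerLeft_comp, assoc]
  rw [← reassoc_of% h]
  simp only [nats]

theorem coactUnder_comp (n : ℕ) {U W Z Z' : C} (f : U ⊗ (freeObj X Y n ⊗ W) ⟶ Z) (h : Z ⟶ Z') :
    coactUnder n (f ≫ h) = coactUnder n f ≫ tpow X n ◁ h := by simp [coactUnder]

variable [Abelian C] [MonoidalPreadditive C] [∀ Z : C, PreservesFiniteColimits (tensorRight Z)]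
  [∀ Z : C, PreservesFiniteColimits (tensorLeft Z)] {R : X ⊗ X ⟶ X ⊗ X} (Q : FRTQuotient X Y R)

instance epi_whiskerLeft {A B : C} (f : A ⟶ B) [Epi f] (Z : C) : Epi (Z ◁ f) :=
  inferInstanceAs (Epi ((tensorLeft Z).map f))

/-- A morphism out of `U ⊗ (A_n(X) ⊗ W)` that commutes with `R` in all places descends to
`A_n(X, R)`. -/
theorem exists_frt_desc_under {n : ℕ} {U W Z : C} (f : U ⊗ (freeObj X Y n ⊗ W) ⟶ Z)
    (h : ∀ e : tpow X n ⟶ tpow X n, IsPad (RTwo R) e → U ◁ e ▷ W ≫ coactUnder n f = coactUnder n f ≫ e ▷ Z) :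
    ∃ g, U ◁ Q.π n ▷ W ≫ g = f := by
  have hc : CommutesWithPads (RTwo R) (crossInv (freeObj X Y n) U W ≫ f) := by
    intro e he
    rw [coact_crossInv, assoc, ← h e he, reassoc_of% (crossInv_left11 e)]
  obtain ⟨g, hg⟩ := Q.exists_desc _ hc
  refine ⟨cross U (Q.obj n) W ≫ g, ?_⟩
  rw [reassoc_of% (cross_right11 (Q.π n)), hg, reassoc_of% cross_crossInv]

/-- A morphism out of `A_m(X) ⊗ (A_n(X) ⊗ W)` descends to `A_m(X, R) ⊗ (A_n(X, R) ⊗ W)` if the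
corresponding morphism on `X^{⊗m} ⊗ X^{⊗n}` commutes with `R` in all places. -/
theorem exists_frt_desc_two {m n : ℕ} {W Z : C} (f : freeObj X Y m ⊗ (freeObj X Y n ⊗ W) ⟶ Z)
    (hm : ∀ e : tpow X m ⟶ tpow X m, IsPad (RTwo R) e →
      e ▷ (tpow X n ⊗ W) ≫ coact m (coactUnder n f) = coact m (coactUnder n f) ≫ e ▷ (tpow X n ⊗ Z))
    (hn : ∀ e : tpow X n ⟶ tpow X n, IsPad (RTwo R) e →
      tpow X m ◁ e ▷ W ≫ coact m (coactUnder n f) = coact m (coactUnder n f) ≫ tpow X m ◁ e ▷ Z) :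
    ∃ g, Q.π m ▷ _ ≫ Q.obj m ◁ Q.π n ▷ W ≫ g = f := by
  have h1 : CommutesWithPads (RTwo R) f := by
    intro e he
    refine coactUnder_injective n ?_
    rw [coactUnder_pre, coactUnder_comp, coactUnder_coact, reassoc_of% (hm e he), assoc, cross_left11]
  obtain ⟨g, hg⟩ := Q.exists_desc f h1
  obtain ⟨k, hk⟩ := exists_frt_desc_under Q (n := n) g (by
    intro e he
    rw [← cancel_epi (Q.π m ▷ _), ← whisker_exchange_assoc, ← coactUnder_pre, hg,
      ← reassoc_of% (coactUnder_pre n (Q.π m) g), hg]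
    refine coact_injective m ?_
    rw [coact_pre, coact_comp, hn e he])
  exact ⟨k, by rw [hk, hg]⟩

/-- The coaction of `A_n(X, R)` on `X^{⊗n}`. -/
def frtCoaction {R : X ⊗ X ⟶ X ⊗ X} (Q : FRTQuotient X Y R) (n : ℕ) : tpow X n ⟶ tpow X n ⊗ Q.obj n :=
  freeCoaction X Y n ≫ tpow X n ◁ Q.π n

theorem tail_frtCoaction (n : ℕ) (Z : C) : o12 (frtCoaction Q n) Z = coact n (Q.π n ▷ Z) := by
  simp [o12, frtCoaction, coact]

theorem frtCoaction_pad {n : ℕ} {e : tpow X n ⟶ tpow X n} (he : IsPad (RTwo R) e) (Z : C) :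
    e ▷ Z ≫ o12 (frtCoaction Q n) Z = o12 (frtCoaction Q n) Z ≫ e ▷ (Q.obj n ⊗ Z) := by
  have := Q.commutes n (𝟙 (Q.obj n ⊗ Z))
  rw [comp_id] at this
  rw [tail_frtCoaction, this e he]

theorem frtCoaction_injective {n : ℕ} {W Z : C} (f g : Q.obj n ⊗ W ⟶ Z)
    (h : o12 (frtCoaction Q n) W ≫ tpow X n ◁ f = o12 (frtCoaction Q n) W ≫ tpow X n ◁ g) : f = g := by
  rw [← cancel_epi (Q.π n ▷ W)]
  refine coact_injective n ?_
  rwa [coact_comp, coact_comp, ← tail_frtCoaction]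

theorem coact_freeComul (n : ℕ) (Z : C) : coact n (o12 (freeComul X Y n) Z ≫ Q.π n ▷ _ ≫
    Q.obj n ◁ Q.π n ▷ Z) = o12 (frtCoaction Q n) Z ≫ o12 (frtCoaction Q n) _ := by
  rw [tail_frtCoaction, tail_frtCoaction, coact, coact, coact]
  simp only [whiskerLeft_comp, reassoc_of% tail_freeCoaction_comul, assoc]
  rw [o12_nat_assoc]
  have e := wl (tpow X n) (whisker_exchange (Q.π n) (Q.π n ▷ Z))
  simp only [whiskerLeft_comp] at e
  rw [e]

theorem exists_frtComul (n : ℕ) : ∃ g, Q.π n ≫ g = freeComul X Y n ≫ (Q.π n ⊗ₘ Q.π n) := by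
  have hc : CommutesWithPads (RTwo R) (o12 (freeComul X Y n) (𝟙_ C) ≫ Q.π n ▷ _ ≫
      Q.obj n ◁ Q.π n ▷ 𝟙_ C) := by
    intro e he
    rw [coact_freeComul, reassoc_of% (frtCoaction_pad Q he), frtCoaction_pad Q he, assoc]
  obtain ⟨g, hg⟩ := Q.exists_desc _ hc
  refine ⟨(ρ_ _).inv ≫ g ≫ (α_ _ _ _).inv ≫ (ρ_ _).hom, ?_⟩
  rw [rightUnitor_inv_naturality_assoc, reassoc_of% hg]
  simp [o12, tensor_def]

theorem exists_frtCounit (n : ℕ) : ∃ g, Q.π n ≫ g = freeCounit X Y n := by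
  have hc : CommutesWithPads (RTwo R) (o10 (freeCounit X Y n) (𝟙_ C)) := by
    intro e he
    rw [coact, tail_freeCoaction_counit, comp_id, id_comp]
  obtain ⟨g, hg⟩ := Q.exists_desc _ hc
  refine ⟨(ρ_ _).inv ≫ g, ?_⟩
  rw [rightUnitor_inv_naturality_assoc, hg, o10, unitors_equal, rightUnitor_naturality, Iso.inv_hom_id_assoc]

theorem exists_frtMul (m n : ℕ) : ∃ g, (Q.π m ⊗ₘ Q.π n) ≫ g = freeMul X Y m n ≫ Q.π (m + n) := by
  have key := coact_coactUnder (X := X) (Y := Y) m n (Q.π (m + n) ▷ 𝟙_ C)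
  rw [← tail_frtCoaction] at key
  obtain ⟨g, hg⟩ := exists_frt_desc_two Q (m := m) (n := n) (W := 𝟙_ C) (o21 (freeMul X Y m n) _ ≫ Q.π (m + n) ▷ 𝟙_ C) (by
    intro e he
    have P := fun Z => tail_padRight (X := X) (b := n) rfl e Z
    simp only [tpowIso_hom] at P
    rw [← cancel_mono (o21 (tmul X m n) _), assoc, assoc, key, ← P, reassoc_of% key, ← reassoc_of% P,
      frtCoaction_pad Q (he.padRight rfl)]) (by
    intro e he
    have P := fun Z => tail_padLeft (X := X) (a := m) rfl e Z
    simp only [tpowIso_hom] at P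
    rw [← cancel_mono (o21 (tmul X m n) _), assoc, assoc, key, ← P, reassoc_of% key, ← reassoc_of% P,
      frtCoaction_pad Q (he.padLeft rfl)])
  refine ⟨_ ◁ (ρ_ _).inv ≫ g ≫ (ρ_ _).hom, ?_⟩
  rw [tensor_def, assoc, ← whiskerLeft_comp_assoc, rightUnitor_inv_naturality,
    whiskerLeft_comp_assoc, ← whisker_exchange_assoc, reassoc_of% hg]
  simp [o21]

theorem exists_frtPairing {g : ∀ m n, tpow X m ⊗ tpow X n ⟶ tpow X n ⊗ tpow X m} (hg : IsBraidFamily X g)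
    (hs : Slides g (RTwo R)) (m n : ℕ) :
    ∃ p, (Q.π m ⊗ₘ Q.π n) ≫ p = pairingVia X Y (g m n) := by
  have key : coact m (coactUnder n (o20 (pairingVia X Y (g m n)) (𝟙_ C))) = o22 (g m n) _ ≫ crossInv _ _ _ := by
    have := tail_braiding_pairingVia X Y (g m n) (𝟙_ C)
    rw [← this, ← cancel_mono (cross (tpow X m) (tpow X n) (𝟙_ C)), ← coactUnder_coact]
    simp only [coactUnder, coact, whiskerLeft_comp, assoc, crossInv_cross, comp_id]
  obtain ⟨p, hp⟩ := exists_frt_desc_two Q (m := m) (n := n) (W := 𝟙_ C) (o20 (pairingVia X Y (g m n)) _) (by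
    intro e he
    rw [key, reassoc_of% ((he.slides hg hs).left n), assoc, crossInv_right11]) (by
    intro e he
    rw [key, reassoc_of% ((he.slides hg hs).right m), assoc, crossInv_left11])
  refine ⟨_ ◁ (ρ_ _).inv ≫ p, ?_⟩
  rw [tensor_def, assoc, ← whiskerLeft_comp_assoc, rightUnitor_inv_naturality,
    whiskerLeft_comp_assoc, ← whisker_exchange_assoc, hp]
  simp [o20, unitors_equal]
end Descent
end

noncomputable section
/-! ### The coefficients of the tensor powers -/

section Coefficients
variable {C : Type u} [Category.{v} C] [MonoidalCategory C] [BraidedCategory C]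

/-- The coaction on `V ⊗ W`, for coactions of different objects and a multiplication `μ`. -/
def tensorCoact {V W A A' D : C} (δ : V ⟶ V ⊗ A) (δ' : W ⟶ W ⊗ A') (μ : A ⊗ A' ⟶ D) : V ⊗ W ⟶ (V ⊗ W) ⊗ D :=
  (δ ⊗ₘ δ') ≫ middle V (β_ A W).hom A' ≫ (V ⊗ W) ◁ μ

/-- The braiding of comodules, for coactions of different objects and a pairing `ρ`. -/
def coactBraiding {V W A A' : C} (δ : V ⟶ V ⊗ A) (δ' : W ⟶ W ⊗ A') (ρ : A ⊗ A' ⟶ 𝟙_ C) : V ⊗ W ⟶ W ⊗ V :=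
  V ◁ δ' ≫ (α_ V W A').inv ≫ (β_ V W).hom ▷ A' ≫ (α_ W V A').hom ≫
    W ◁ (δ ▷ A' ≫ (α_ V A A').hom ≫ V ◁ ρ ≫ (ρ_ V).hom)

theorem tail_tensorCoact {V W A A' D : C} (δ : V ⟶ V ⊗ A) (δ' : W ⟶ W ⊗ A') (μ : A ⊗ A' ⟶ D) (Z : C) :
    o12 (tensorCoact δ δ' μ) Z = (α_ V W Z).hom ≫ o12 δ (W ⊗ Z) ≫ V ◁ A ◁ o12 δ' Z ≫ V ◁ cross A W (A' ⊗ Z) ≫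
      V ◁ W ◁ o21 μ Z ≫ (α_ V W (D ⊗ Z)).inv := by
  rw [o12, tensorCoact]
  simp only [tensorHom_def', fans, cancels, tail_middle, nat_rules, r21 μ, r12 δ, r12 δ']

theorem tail_coactBraiding {V W A A' : C} (δ : V ⟶ V ⊗ A) (δ' : W ⟶ W ⊗ A') (ρ : A ⊗ A' ⟶ 𝟙_ C) (Z : C) :
    o22 (coactBraiding δ δ' ρ) Z =
      V ◁ o12 δ' Z ≫ cross V W (A' ⊗ Z) ≫ W ◁ o12 δ (A' ⊗ Z) ≫ W ◁ V ◁ o20 ρ Z := by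
  rw [o22, coactBraiding]
  simp only [fans, cancels, nat_rules, r12 δ', r22 (β_ V W).hom, r12 δ, r20 ρ]

theorem tensorCoact_hom {V W V' W' A A' D : C} {δ : V ⟶ V ⊗ A} {δ' : W ⟶ W ⊗ A'} {γ : V' ⟶ V' ⊗ A}
    {γ' : W' ⟶ W' ⊗ A'} (μ : A ⊗ A' ⟶ D) {f : V ⟶ V'} {g : W ⟶ W'} (hf : IsComoduleHom δ γ f)
    (hg : IsComoduleHom δ' γ' g) : IsComoduleHom (tensorCoact δ δ' μ) (tensorCoact γ γ' μ) (f ⊗ₘ g) := by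
  rw [tail_comoduleHom_iff] at hf hg
  refine (tail_comoduleHom_iff _ _ _).2 fun Z => ?_
  rw [← cancel_epi (α_ _ _ _).inv, ← cancel_mono (α_ _ _ _).hom]
  have f2 := fun Z => wl V' (wl A (hg Z))
  have f3 := fun Z => wl V' (cross_right11 g A Z)
  simp only [whiskerLeft_comp] at f2 f3
  rw [tensor_def]
  simp only [tail_tensorCoact, fans, cancels]
  simp only [nats]
  rw [reassoc_of% hf, reassoc_of% f2, reassoc_of% f3]

theorem coactBraiding_natural {V W V' W' A A' : C} {δ : V ⟶ V ⊗ A} {δ' : W ⟶ W ⊗ A'} {γ : V' ⟶ V' ⊗ A}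
    {γ' : W' ⟶ W' ⊗ A'} (ρ : A ⊗ A' ⟶ 𝟙_ C) {f : V ⟶ V'} {g : W ⟶ W'} (hf : IsComoduleHom δ γ f)
    (hg : IsComoduleHom δ' γ' g) : (f ⊗ₘ g) ≫ coactBraiding γ γ' ρ = coactBraiding δ δ' ρ ≫ (g ⊗ₘ f) := by
  rw [tail_comoduleHom_iff] at hf hg
  have f2 := fun Z => wl V' (hg Z)
  have f3 := fun Z => wl W (hf Z)
  simp only [whiskerLeft_comp] at f2 f3
  refine o22_ext fun Z => ?_
  rw [tail_tensorHom_comp, tail_comp_tensorHom, tail_coactBraiding, tail_coactBraiding]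
  simp only [nats, assoc]
  rw [reassoc_of% f2, reassoc_of% (cross_right11 g), ← whisker_exchange_assoc f, reassoc_of% (cross_left11 f),
    ← whisker_exchange_assoc g, reassoc_of% f3]
  simp only [nats]

variable {X Y : C} [ExactPairing X Y] [Abelian C] [MonoidalPreadditive C]
  [∀ Z : C, PreservesFiniteColimits (tensorRight Z)]
  [∀ Z : C, PreservesFiniteColimits (tensorLeft Z)] {R : X ⊗ X ⟶ X ⊗ X} (Q : FRTQuotient X Y R)

/-- The comultiplication of `A(X, R)`. -/
def frtComul {R : X ⊗ X ⟶ X ⊗ X} (Q : FRTQuotient X Y R) (n : ℕ) :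
    Q.obj n ⟶ Q.obj n ⊗ Q.obj n := (exists_frtComul Q n).choose
theorem frtπ_comul (n : ℕ) : Q.π n ≫ frtComul Q n = freeComul X Y n ≫ (Q.π n ⊗ₘ Q.π n) :=
  (exists_frtComul Q n).choose_spec
/-- The counit of `A(X, R)`. -/
def frtCounit {R : X ⊗ X ⟶ X ⊗ X} (Q : FRTQuotient X Y R) (n : ℕ) : Q.obj n ⟶ 𝟙_ C :=
  (exists_frtCounit Q n).choose
theorem frtπ_counit (n : ℕ) : Q.π n ≫ frtCounit Q n = freeCounit X Y n := (exists_frtCounit Q n).choose_spec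
/-- The multiplication of `A(X, R)`. -/
def frtMul {R : X ⊗ X ⟶ X ⊗ X} (Q : FRTQuotient X Y R) (m n : ℕ) :
    Q.obj m ⊗ Q.obj n ⟶ Q.obj (m + n) := (exists_frtMul Q m n).choose
theorem frtπ_mul (m n : ℕ) :
    (Q.π m ⊗ₘ Q.π n) ≫ frtMul Q m n = freeMul X Y m n ≫ Q.π (m + n) :=
  (exists_frtMul Q m n).choose_spec
/-- The multiplication of `A(X, R)`, with values in degree `N = m + n`. -/
def frtMulTo {R : X ⊗ X ⟶ X ⊗ X} (Q : FRTQuotient X Y R) {m n N : ℕ} (h : m + n = N) :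
    Q.obj m ⊗ Q.obj n ⟶ Q.obj N := frtMul Q m n ≫ eqToHom (congrArg _ h)
/-- The unit of `A(X, R)`. -/
def frtOne {R : X ⊗ X ⟶ X ⊗ X} (Q : FRTQuotient X Y R) : 𝟙_ C ⟶ Q.obj 0 := (λ_ (𝟙_ C)).inv ≫ Q.π 0

theorem tail_pair {m n : ℕ} {D : C} {f : freeObj X Y m ⊗ freeObj X Y n ⟶ D} {p : Q.obj m ⊗ Q.obj n ⟶ D}
    (h : (Q.π m ⊗ₘ Q.π n) ≫ p = f) (Z : C) :
    Q.π m ▷ _ ≫ Q.obj m ◁ Q.π n ▷ Z ≫ o21 p Z = o21 f Z := by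
  rw [← h]
  simp [o21, tensor_def]

theorem isTailComodule_frtCoaction (n : ℕ) (Z : C) :
    o12 (frtCoaction Q n) Z ≫ tpow X n ◁ o12 (frtComul Q n) Z =
      o12 (frtCoaction Q n) Z ≫ o12 (frtCoaction Q n) _ ∧
    o12 (frtCoaction Q n) Z ≫ tpow X n ◁ o10 (frtCounit Q n) Z = 𝟙 _ := by
  constructor
  · rw [← coact_freeComul, tail_frtCoaction, ← coact_comp]
    congr 1
    have := whisk (frtπ_comul Q n) Z =≫ (α_ _ _ _).hom
    simpa [o12, tensor_def] using this
  · rw [tail_frtCoaction, ← coact_comp, o10, ← comp_whiskerRight_assoc, frtπ_counit]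
    exact tail_freeCoaction_counit X Y n Z

theorem isComoduleHom_coassoc {V : C} {n : ℕ} {δ : V ⟶ V ⊗ Q.obj n} {θ : V ≅ tpow X n}
    (h : IsComoduleHom δ (frtCoaction Q n) θ.hom) :
    δ ≫ V ◁ frtComul Q n = δ ≫ δ ▷ _ ≫ (α_ _ _ _).hom := by
  have k : frtCoaction Q n ≫ tpow X n ◁ frtComul Q n = frtCoaction Q n ≫ frtCoaction Q n ▷ _ ≫ (α_ _ _ _).hom :=
    (tail_coassoc_iff _ _).2 fun Z => (isTailComodule_frtCoaction Q n Z).1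
  rw [← cancel_mono (θ.hom ▷ _), assoc, whisker_exchange, ← reassoc_of% h, k, reassoc_of% h]
  have h' : θ.hom ▷ Q.obj n ≫ frtCoaction Q n ▷ _ = δ ▷ _ ≫ θ.hom ▷ _ ▷ _ := by
    rw [← comp_whiskerRight, h, comp_whiskerRight]
  rw [reassoc_of% h']
  simp

theorem isComoduleHom_counit {V : C} {n : ℕ} {δ : V ⟶ V ⊗ Q.obj n} {θ : V ≅ tpow X n}
    (h : IsComoduleHom δ (frtCoaction Q n) θ.hom) :
    δ ≫ V ◁ frtCounit Q n = (ρ_ V).inv := by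
  have k : frtCoaction Q n ≫ tpow X n ◁ frtCounit Q n = (ρ_ _).inv :=
    (tail_counit_iff _ _).2 fun Z => (isTailComodule_frtCoaction Q n Z).2
  rw [← cancel_mono (θ.hom ▷ _), assoc, whisker_exchange, ← reassoc_of% h, k]
  simp

theorem tail_frtCoaction_mul {m n N : ℕ} (h : m + n = N) (Z : C) :
    o12 (frtCoaction Q m) (tpow X n ⊗ Z) ≫ tpow X m ◁ Q.obj m ◁ o12 (frtCoaction Q n) Z ≫
      tpow X m ◁ cross (Q.obj m) (tpow X n) (Q.obj n ⊗ Z) ≫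
      tpow X m ◁ tpow X n ◁ o21 (frtMulTo Q h) Z ≫ o21 (tpowIso X h).hom (Q.obj N ⊗ Z) =
    o21 (tpowIso X h).hom Z ≫ o12 (frtCoaction Q N) Z := by
  subst h
  have k := fun Z => wl (tpow X m) (wl (tpow X n) (tail_pair Q (frtπ_mul Q m n) Z))
  have k2 := wl (tpow X m) (cross_left11 (Q.π m) (tpow X n) (freeObj X Y n ⊗ Z))
  have k3 := tail_freeCoaction_mul X Y m n Z =≫ (tpow X (m + n) ◁ Q.π (m + n) ▷ Z)
  simp only [whiskerLeft_comp] at k k2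
  simp only [assoc] at k3
  have e : frtMulTo Q (rfl : m + n = m + n) = frtMul Q m n := by simp [frtMulTo]
  rw [e, tpowIso_hom]
  simp only [tail_frtCoaction, coact, whiskerLeft_comp, assoc]
  rw [← k3, ← o21_nat]
  have k4 : o21 (freeMul X Y m n) Z ≫ Q.π (m + n) ▷ Z = o21 (freeMul X Y m n ≫ Q.π (m + n)) Z := by simp [o21]
  have k5 := wl (tpow X m) (wl (tpow X n) k4)
  simp only [whiskerLeft_comp] at k5
  rw [reassoc_of% k5, ← reassoc_of% k]
  simp only [nats]
  rw [← reassoc_of% (wl_sq (tpow X m) (whisker_exchange (Q.π m) (o12 (freeCoaction X Y n) Z))), reassoc_of% k2]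
  simp only [nats]

theorem isComoduleHom_tensor {V W : C} {m n N : ℕ} (hN : m + n = N) {δ : V ⟶ V ⊗ Q.obj m}
    {δ' : W ⟶ W ⊗ Q.obj n} {f : V ⟶ tpow X m} {f' : W ⟶ tpow X n}
    (h : IsComoduleHom δ (frtCoaction Q m) f) (h' : IsComoduleHom δ' (frtCoaction Q n) f') :
    IsComoduleHom (tensorCoact δ δ' (frtMulTo Q hN)) (frtCoaction Q N) ((f ⊗ₘ f') ≫ (tpowIso X hN).hom) := by
  refine (tensorCoact_hom _ h h').comp ((tail_comoduleHom_iff _ _ _).2 fun Z => ?_)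
  rw [tail_tensorCoact, ← cancel_epi (α_ _ _ _).inv]
  have := tail_frtCoaction_mul Q hN Z
  simp only [o21] at this ⊢
  simp only [assoc, Iso.inv_hom_id_assoc, this]

theorem isComoduleHom_unit : IsComoduleHom ((λ_ (𝟙_ C)).inv ≫ 𝟙_ C ◁ frtOne Q) (frtCoaction Q 0)
    (𝟙 (𝟙_ C) : 𝟙_ C ⟶ tpow X 0) := by
  have key : ∀ {G : C} (p : 𝟙_ C ⊗ 𝟙_ C ⟶ G), 𝟙 (𝟙_ C) ≫ ((λ_ (𝟙_ C)).inv ≫ (λ_ (𝟙_ C)).inv ▷ 𝟙_ C ≫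
      (α_ (𝟙_ C) (𝟙_ C) (𝟙_ C)).hom) ≫ 𝟙_ C ◁ p =
      ((λ_ (𝟙_ C)).inv ≫ 𝟙_ C ◁ ((λ_ (𝟙_ C)).inv ≫ p)) ≫ 𝟙 (𝟙_ C) ▷ G := by
    intro G p
    rw [id_whiskerRight, comp_id, id_comp, left_inv_whiskerRight, whiskerLeft_comp]
    simp
  exact key (Q.π 0)

section Pairing
variable {g : ∀ m n, tpow X m ⊗ tpow X n ⟶ tpow X n ⊗ tpow X m} (hg : IsBraidFamily X g) (hs : Slides g (RTwo R))

/-- The pairing of `A(X, R)` given by a family `g` of braidings. -/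
def frtPairing {R : X ⊗ X ⟶ X ⊗ X} (Q : FRTQuotient X Y R)
    {g : ∀ m n, tpow X m ⊗ tpow X n ⟶ tpow X n ⊗ tpow X m} (hg : IsBraidFamily X g) (hs : Slides g (RTwo R)) (m n : ℕ) :
    Q.obj m ⊗ Q.obj n ⟶ 𝟙_ C := (exists_frtPairing Q hg hs m n).choose
theorem frtπ_pairing (m n : ℕ) :
    (Q.π m ⊗ₘ Q.π n) ≫ frtPairing Q hg hs m n = pairingVia X Y (g m n) :=
  (exists_frtPairing Q hg hs m n).choose_spec

theorem coactBraiding_frtPairing (m n : ℕ) :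
    coactBraiding (frtCoaction Q m) (frtCoaction Q n) (frtPairing Q hg hs m n) = g m n := by
  refine o22_ext fun Z => ?_
  have k : Q.π m ▷ _ ≫ Q.obj m ◁ Q.π n ▷ Z ≫ o20 (frtPairing Q hg hs m n) Z =
      o20 (pairingVia X Y (g m n)) Z := by
    rw [← frtπ_pairing Q hg hs]
    simp [o20, tensor_def]
  have k' := wl (tpow X n) (wl (tpow X m) k)
  simp only [whiskerLeft_comp] at k'
  rw [tail_coactBraiding, ← tail_braiding_pairingVia X Y (g m n) Z, ← k']
  simp only [tail_frtCoaction, coact, whiskerLeft_comp, assoc]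
  simp only [nats]

theorem coactBraiding_eq {V W : C} {m n : ℕ} {δ : V ⟶ V ⊗ Q.obj m}
    {δ' : W ⟶ W ⊗ Q.obj n} {f : V ⟶ tpow X m} {f' : W ⟶ tpow X n}
    (h : IsComoduleHom δ (frtCoaction Q m) f) (h' : IsComoduleHom δ' (frtCoaction Q n) f') :
    coactBraiding δ δ' (frtPairing Q hg hs m n) ≫ (f' ⊗ₘ f) = (f ⊗ₘ f') ≫ g m n := by
  rw [← coactBraiding_natural _ h h', coactBraiding_frtPairing]
end Pairing

/-- Endomorphisms of the comodule `X^{⊗n}`. -/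
abbrev IsEndo (n : ℕ) (κ : tpow X n ⟶ tpow X n) : Prop :=
  IsComoduleHom (frtCoaction Q n) (frtCoaction Q n) κ

theorem isEndo_padRight {k b m : ℕ} (h : k + b = m) {κ : tpow X k ⟶ tpow X k} (hκ : IsEndo Q k κ) :
    IsEndo Q m (padRight h κ) := by
  have e := isComoduleHom_tensor Q h (isComoduleHom_id (frtCoaction Q k)) (isComoduleHom_id (frtCoaction Q b))
  rw [id_tensorHom_id, id_comp] at e
  have e2 := tensorCoact_hom (frtMulTo Q h) hκ (isComoduleHom_id (frtCoaction Q b))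
  rw [tensorHom_id] at e2
  exact e.inv.comp (e2.comp e)
theorem isEndo_padLeft {k a m : ℕ} (h : a + k = m) {κ : tpow X k ⟶ tpow X k} (hκ : IsEndo Q k κ) :
    IsEndo Q m (padLeft h κ) := by
  have e := isComoduleHom_tensor Q h (isComoduleHom_id (frtCoaction Q a)) (isComoduleHom_id (frtCoaction Q k))
  rw [id_tensorHom_id, id_comp] at e
  have e2 := tensorCoact_hom (frtMulTo Q h) (isComoduleHom_id (frtCoaction Q a)) hκ
  rw [id_tensorHom] at e2
  exact e.inv.comp (e2.comp e)

theorem isEndo_RTwo : IsEndo Q 2 (RTwo R) := by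
  refine (tail_comoduleHom_iff _ _ _).2 fun Z => ?_
  refine frtCoaction_pad Q ⟨0, 0, 2, rfl, rfl, ?_⟩ Z
  refine tail_ext fun Z => o21_cancel (tpowIso X (rfl : 2 + 0 = 2)) ?_
  have k : padLeft (rfl : 0 + 2 = 2) (RTwo R) = RTwo R := by
    refine tail_ext fun Z => o21_cancel (tpowIso X (rfl : 0 + 2 = 2)) ?_
    rw [tail_padLeft, tail_tpowIso_zero_left, tzero_nat]
  rw [k, tail_padRight, tail_tpowIso_zero, whisker_exchange]

/-- `R_{X^{⊗m}, X^{⊗n}}` as an endomorphism of `X^{⊗N}`, `N = m + n`. -/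
def swapEndo (g : ∀ m n, tpow X m ⊗ tpow X n ⟶ tpow X n ⊗ tpow X m) {m n N : ℕ} (h : m + n = N) (h' : n + m = N) :
    tpow X N ⟶ tpow X N := (tpowIso X h).inv ≫ g m n ≫ (tpowIso X h').hom

theorem tail_swapEndo (g : ∀ m n, tpow X m ⊗ tpow X n ⟶ tpow X n ⊗ tpow X m) {m n N : ℕ} (h : m + n = N) (h' : n + m = N)
    (Z : C) : o21 (tpowIso X h).hom Z ≫ swapEndo g h h' ▷ Z = o22 (g m n) Z ≫ o21 (tpowIso X h').hom Z := by
  simp [o21, o22, swapEndo]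

theorem swapEndo_add_left {g : ∀ m n, tpow X m ⊗ tpow X n ⟶ tpow X n ⊗ tpow X m} (hg : IsBraidFamily X g)
    {m n a mn ma na N : ℕ} (h1 : m + n = mn) (h2 : mn + a = N) (h2' : a + mn = N) (h3 : n + a = na) (h3' : a + n = na)
    (h4 : m + a = ma) (h4' : a + m = ma) (h5 : m + na = N) (h6 : ma + n = N) :
    swapEndo g h2 h2' = padLeft h5 (swapEndo g h3 h3') ≫ padRight h6 (swapEndo g h4 h4') := by
  refine tail_ext fun Z => o21_cancel (tpowIso X h2) (o21_cancel (tpowIso X h1) ?_)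
  have k := wl (tpow X m) (tail_swapEndo g h3 h3' Z)
  simp only [whiskerLeft_comp] at k
  rw [comp_whiskerRight, tail_swapEndo, reassoc_of% (hg.add_left h1), reassoc_of% (tail_tpowIso_assoc X h1 h2 h3 h5),
    reassoc_of% (tail_padLeft h5), reassoc_of% k, ← reassoc_of% (tail_tpowIso_assoc X h4 h6 h3' h5),
    tail_padRight, reassoc_of% (tail_swapEndo g h4 h4'), tail_tpowIso_assoc X h4' h6 h1 h2']

theorem swapEndo_add_right {g : ∀ m n, tpow X m ⊗ tpow X n ⟶ tpow X n ⊗ tpow X m} (hg : IsBraidFamily X g)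
    {m n a mn am an N : ℕ} (h1 : m + n = mn) (h2 : a + mn = N) (h2' : mn + a = N) (h3 : a + n = an) (h3' : n + a = an)
    (h4 : a + m = am) (h4' : m + a = am) (h5 : m + an = N) (h6 : am + n = N) :
    swapEndo g h2 h2' = padRight h6 (swapEndo g h4 h4') ≫ padLeft h5 (swapEndo g h3 h3') := by
  refine tail_ext fun Z => o21_cancel (tpowIso X h2) ?_
  rw [← cancel_epi (tpow X a ◁ o21 (tpowIso X h1).hom Z)]
  have k := wl (tpow X m) (tail_swapEndo g h3 h3' Z)
  simp only [whiskerLeft_comp] at k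
  rw [comp_whiskerRight, tail_swapEndo, reassoc_of% (hg.add_right a h1), ← reassoc_of% (tail_tpowIso_assoc X h4 h6 h1 h2),
    reassoc_of% (tail_padRight h6), reassoc_of% (tail_swapEndo g h4 h4'), reassoc_of% (tail_tpowIso_assoc X h4' h6 h3 h5),
    tail_padLeft, reassoc_of% k, tail_tpowIso_assoc X h1 h2' h3' h5]

theorem isEndo_swapEndo {m n N : ℕ} (h : m + n = N) (h' : n + m = N) :
    IsEndo Q N (swapEndo (RPow R) h h') := by
  have hg := isBraidFamily_RPow R
  have z1 : ∀ (n : ℕ) (h : 0 + n = n) (h' : n + 0 = n), swapEndo (RPow R) h h' = 𝟙 _ := by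
    intro n h h'
    refine tail_ext fun Z => o21_cancel (tpowIso X h) ?_
    rw [tail_swapEndo, hg.zero_left, tail_tpowIso_zero, tail_tpowIso_zero_left]
    simp only [cancels, id_whiskerRight, comp_id]
  have z2 : ∀ (n : ℕ) (h : n + 0 = n) (h' : 0 + n = n), swapEndo (RPow R) h h' = 𝟙 _ := by
    intro n h h'
    refine tail_ext fun Z => o21_cancel (tpowIso X h) ?_
    rw [tail_swapEndo, hg.zero_right, tail_tpowIso_zero, tail_tpowIso_zero_left]
    simp only [cancels, id_whiskerRight, comp_id]
  have base : ∀ (h : 1 + 1 = 2), swapEndo (RPow R) h h = RTwo R := by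
    intro h
    refine tail_ext fun Z => o21_cancel (tpowIso X h) ?_
    rw [tail_swapEndo, tail_RTwo, tail_tpowIso_succ X (rfl : 1 + 0 = 1) h, tail_tpowIso_zero,
      tail_RPow_succ, tail_RPow_zero, tail_RPowOne_succ, tail_RPowOne_zero]
    have t1 : ∀ {Z Z' : C} (h : Z ⟶ Z'), tpow X 1 ◁ h =
      (tsucc X 0 Z).hom ≫ tpow X 0 ◁ X ◁ h ≫ (tsucc X 0 Z').inv := fun h => tsucc_whisk h
    simp only [ttwo, Iso.trans_hom, Iso.trans_inv, t1, tzero_whisk, whiskerLeft_comp, cancels]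

  have one : ∀ (n N : ℕ) (h : 1 + n = N) (h' : n + 1 = N), IsEndo Q N (swapEndo (RPow R) h h') := by
    intro n
    induction n with
    | zero => rintro N rfl h'; rw [z2]; exact isComoduleHom_id _
    | succ n ih =>
      intro N h h'
      rw [swapEndo_add_right hg (rfl : n + 1 = n + 1) h h' (rfl : 1 + 1 = 2) rfl (rfl : 1 + n = 1 + n) (by omega)
        (by omega) (by omega), base]
      exact (isEndo_padRight Q _ (ih _ _ _)).comp (isEndo_padLeft Q _ (isEndo_RTwo Q))
  induction m generalizing n N with
  | zero => obtain rfl : n = N := by omega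
            rw [z1]; exact isComoduleHom_id _
  | succ m ih =>
    rw [swapEndo_add_left hg (rfl : m + 1 = m + 1) h h' (rfl : 1 + n = 1 + n) (by omega) (rfl : m + n = m + n) (by omega)
        (by omega) (by omega)]
    exact (isEndo_padLeft Q _ (one _ _ _ _)).comp (isEndo_padRight Q _ (ih _ _))
end Coefficients
end

noncomputable section
attribute [local instance 10] Gr.monoidalCategoryStruct
/-! ### Entries of morphisms of graded spaces -/

section Entries
variable {C : Type u} [Category.{v} C] [Preadditive C]

/-- The row `i` of the matrix `f` has the single entry `φ`, in column `j`. -/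
def HasEntry {A B : Gr C} (f : A ⟶ B) (i : A.ι) (j : B.ι) (φ : A.obj i ⟶ B.obj j) : Prop :=
  Gr.Hom.row f i = Gr.single j φ

theorem hasEntry_ofMap {A B : Gr C} (e : A.ι → B.ι) (φ : ∀ i, A.obj i ⟶ B.obj (e i)) (i : A.ι) :
    HasEntry (Gr.ofMap (A := A) (B := B) e φ) i (e i) (φ i) := rfl
theorem hasEntry_id (A : Gr C) (i : A.ι) : HasEntry (𝟙 A) i i (𝟙 _) := rfl
theorem HasEntry.comp {A B D : Gr C} {f : A ⟶ B} {g : B ⟶ D} {i : A.ι} {j : B.ι} {k : D.ι} {φ : A.obj i ⟶ B.obj j}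
    {ψ : B.obj j ⟶ D.obj k} (hf : HasEntry f i j φ) (hg : HasEntry g j k ψ) : HasEntry (f ≫ g) i k (φ ≫ ψ) := by
  unfold HasEntry at *
  rw [Gr.comp_row, hf, Gr.post_single, hg, Gr.pre_single]
theorem HasEntry.congr {A B : Gr C} {f : A ⟶ B} {i : A.ι} {j : B.ι} {φ ψ : A.obj i ⟶ B.obj j}
    (hf : HasEntry f i j φ) (h : φ = ψ) : HasEntry f i j ψ := h ▸ hf
theorem HasEntry.cast {A B : Gr C} {f : A ⟶ B} {i : A.ι} {j j' : B.ι} {φ : A.obj i ⟶ B.obj j}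
    (hf : HasEntry f i j φ) (h : j = j') : HasEntry f i j' (φ ≫ eqToHom (congrArg B.obj h)) := by
  subst h; simpa using hf
theorem eq_of_hasEntry {A B : Gr C} {f g : A ⟶ B} (h : ∀ i, ∃ j φ, HasEntry f i j φ ∧ HasEntry g i j φ) : f = g :=
  Gr.hom_ext fun i => by
    obtain ⟨j, φ, h1, h2⟩ := h i
    exact h1.trans h2.symm

variable [MonoidalCategory C] [MonoidalPreadditive C]

theorem HasEntry.tensor {A B A' B' : Gr C} {f : A ⟶ B} {g : A' ⟶ B'} {i : A.ι} {j : B.ι} {φ : A.obj i ⟶ B.obj j}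
    {i' : A'.ι} {j' : B'.ι} {ψ : A'.obj i' ⟶ B'.obj j'} (hf : HasEntry f i j φ) (hg : HasEntry g i' j' ψ) :
    HasEntry (A := A ⊗ A') (B := B ⊗ B') (f ⊗ₘ g) (i, i') (j, j') (φ ⊗ₘ ψ : A.obj i ⊗ A'.obj i' ⟶ B.obj j ⊗ B'.obj j') := by
  unfold HasEntry at *
  change Gr.tensRow (f.row i) (g.row i') = _
  rw [hf, hg]
  exact Gr.tensRow_single _ _ _ _
theorem HasEntry.whiskerLeft {B B' : Gr C} {g : B ⟶ B'} {i : B.ι} {j : B'.ι} {ψ : B.obj i ⟶ B'.obj j}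
    (hg : HasEntry g i j ψ) (A : Gr C) (a : A.ι) :
    HasEntry (A := A ⊗ B) (B := A ⊗ B') (A ◁ g) (a, i) (a, j) (A.obj a ◁ ψ : A.obj a ⊗ B.obj i ⟶ A.obj a ⊗ B'.obj j) := by
  have := (hasEntry_id A a).tensor hg
  rw [id_tensorHom, id_tensorHom] at this
  exact this
theorem HasEntry.whiskerRight {B B' : Gr C} {g : B ⟶ B'} {i : B.ι} {j : B'.ι} {ψ : B.obj i ⟶ B'.obj j}
    (hg : HasEntry g i j ψ) (A : Gr C) (a : A.ι) :
    HasEntry (A := B ⊗ A) (B := B' ⊗ A) (g ▷ A) (i, a) (j, a) (ψ ▷ A.obj a : B.obj i ⊗ A.obj a ⟶ B'.obj j ⊗ A.obj a) := by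
  have := hg.tensor (hasEntry_id A a)
  rw [tensorHom_id, tensorHom_id] at this
  exact this
theorem hasEntry_assoc_hom (A B D : Gr C) (a : A.ι) (b : B.ι) (d : D.ι) :
    HasEntry (A := (A ⊗ B) ⊗ D) (B := A ⊗ (B ⊗ D)) (α_ A B D).hom ((a, b), d) (a, (b, d))
      (α_ (A.obj a) (B.obj b) (D.obj d)).hom := rfl
theorem hasEntry_assoc_inv (A B D : Gr C) (a : A.ι) (b : B.ι) (d : D.ι) :
    HasEntry (A := A ⊗ (B ⊗ D)) (B := (A ⊗ B) ⊗ D) (α_ A B D).inv (a, (b, d)) ((a, b), d)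
      (α_ (A.obj a) (B.obj b) (D.obj d)).inv := rfl
theorem hasEntry_left_hom (A : Gr C) (a : A.ι) :
    HasEntry (A := 𝟙_ (Gr C) ⊗ A) (B := A) (λ_ A).hom ((), a) a (λ_ (A.obj a)).hom := rfl
theorem hasEntry_left_inv (A : Gr C) (a : A.ι) :
    HasEntry (A := A) (B := 𝟙_ (Gr C) ⊗ A) (λ_ A).inv a ((), a) (λ_ (A.obj a)).inv := rfl
theorem hasEntry_right_hom (A : Gr C) (a : A.ι) :
    HasEntry (A := A ⊗ 𝟙_ (Gr C)) (B := A) (ρ_ A).hom (a, ()) a (ρ_ (A.obj a)).hom := rfl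
theorem hasEntry_right_inv (A : Gr C) (a : A.ι) :
    HasEntry (A := A) (B := A ⊗ 𝟙_ (Gr C)) (ρ_ A).inv a (a, ()) (ρ_ (A.obj a)).inv := rfl

variable [BraidedCategory C]
theorem hasEntry_braid_hom (A B : Gr C) (a : A.ι) (b : B.ι) :
    HasEntry (A := A ⊗ B) (B := B ⊗ A) (β_ A B).hom (a, b) (b, a) (β_ (A.obj a) (B.obj b)).hom := rfl
theorem hasEntry_tensorCoaction {A V W : Gr C} {B : PairData A} {δ : V ⟶ V ⊗ A} {δ' : W ⟶ W ⊗ A} {v : V.ι} {w : W.ι}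
    {a a' d : A.ι} {φ : V.obj v ⟶ V.obj v ⊗ A.obj a} {φ' : W.obj w ⟶ W.obj w ⊗ A.obj a'}
    {μ : A.obj a ⊗ A.obj a' ⟶ A.obj d}
    (h : HasEntry (B := V ⊗ A) δ v (v, a) φ) (h' : HasEntry (B := W ⊗ A) δ' w (w, a') φ')
    (hμ : HasEntry (A := A ⊗ A) B.mul (a, a') d μ) :
    HasEntry (A := V ⊗ W) (B := (V ⊗ W) ⊗ A) (tensorCoaction B δ δ') (v, w) ((v, w), d) (tensorCoact φ φ' μ) := by
  unfold tensorCoaction middle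
  refine (h.tensor h').comp (((hasEntry_assoc_hom _ _ _ _ _ _).comp ((((hasEntry_assoc_inv _ _ _ _ _ _).comp
    (((hasEntry_braid_hom _ _ _ _).whiskerRight _ _).comp (hasEntry_assoc_hom _ _ _ _ _ _))).whiskerLeft _ _).comp
      (hasEntry_assoc_inv _ _ _ _ _ _))).comp (hμ.whiskerLeft _ _))

theorem hasEntry_comoduleBraiding {A V W : Gr C} {ρ : A ⊗ A ⟶ 𝟙_ (Gr C)} {δ : V ⟶ V ⊗ A} {δ' : W ⟶ W ⊗ A} {v : V.ι} {w : W.ι}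
    {a a' : A.ι} {φ : V.obj v ⟶ V.obj v ⊗ A.obj a} {φ' : W.obj w ⟶ W.obj w ⊗ A.obj a'}
    {μ : A.obj a ⊗ A.obj a' ⟶ 𝟙_ C}
    (h : HasEntry (B := V ⊗ A) δ v (v, a) φ) (h' : HasEntry (B := W ⊗ A) δ' w (w, a') φ')
    (hμ : HasEntry (A := A ⊗ A) (B := 𝟙_ (Gr C)) ρ (a, a') () μ) :
    HasEntry (A := V ⊗ W) (B := W ⊗ V) (comoduleBraiding ρ δ δ') (v, w) (w, v) (coactBraiding φ φ' μ) := by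
  unfold comoduleBraiding action
  exact (h'.whiskerLeft _ _).comp ((hasEntry_assoc_inv _ _ _ _ _ _).comp (((hasEntry_braid_hom _ _ _ _).whiskerRight _ _).comp
    ((hasEntry_assoc_hom _ _ _ _ _ _).comp (((h.whiskerRight _ _).comp ((hasEntry_assoc_hom _ _ _ _ _ _).comp
      ((hμ.whiskerLeft _ _).comp (hasEntry_right_hom _ _)))).whiskerLeft _ _))))
end Entries

section Graded
variable {C : Type u} [Category.{v} C] [MonoidalCategory C] [BraidedCategory C] [Abelian C] [MonoidalPreadditive C]
  [∀ Z : C, PreservesFiniteColimits (tensorRight Z)]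
  [∀ Z : C, PreservesFiniteColimits (tensorLeft Z)]
  {X Y : C} [ExactPairing X Y] {R : X ⊗ X ⟶ X ⊗ X} (Q : FRTQuotient X Y R)

/-- The graded space `A(X, R)`. -/
def FRTQuotient.gr : Gr C := ⟨ℕ, Q.obj⟩

/-- The bialgebra structure of `A(X, R)`. -/
def frtBialg : BialgData Q.gr where
  one := Gr.ofMap (A := Gr.unit) (B := Q.gr) (fun _ => Nat.zero) (fun _ => frtOne Q)
  mul := Gr.ofMap (A := Gr.tens Q.gr Q.gr) (B := Q.gr) (fun p => Nat.add p.1 p.2) (fun p => frtMul Q p.1 p.2)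
  counit := Gr.ofMap (A := Q.gr) (B := Gr.unit) (fun _ => ()) (fun n => frtCounit Q n)
  comul := Gr.ofMap (A := Q.gr) (B := Gr.tens Q.gr Q.gr) (fun n => (n, n)) (fun n => frtComul Q n)

/-- The coaction of `A(X, R)` on the tensor algebra. -/
def frtCoact : TensorPow X ⟶ TensorPow X ⊗ Q.gr :=
  Gr.ofMap (A := TensorPow X) (B := Gr.tens (TensorPow X) Q.gr) (fun n => (n, n)) (fun n => frtCoaction Q n)

theorem hasEntry_frtMul {m n N : ℕ} (h : m + n = N) :
    HasEntry (A := Q.gr ⊗ Q.gr) (frtBialg Q).mul (m, n) N (frtMulTo Q h) :=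
  (hasEntry_ofMap (A := Gr.tens Q.gr Q.gr) (B := Q.gr) (fun p => Nat.add p.1 p.2) (fun p => frtMul Q p.1 p.2) (m, n)).cast h
theorem hasEntry_frtCoact (n : ℕ) :
    HasEntry (A := TensorPow X) (B := TensorPow X ⊗ Q.gr) (frtCoact Q) n (n, n) (frtCoaction Q n) := rfl
theorem hasEntry_frtComul (n : ℕ) :
    HasEntry (A := Q.gr) (B := Q.gr ⊗ Q.gr) (frtBialg Q).comul n (n, n) (frtComul Q n) := rfl
theorem hasEntry_frtCounit (n : ℕ) :
    HasEntry (A := Q.gr) (B := 𝟙_ (Gr C)) (frtBialg Q).counit n () (frtCounit Q n) := rfl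
theorem hasEntry_frtOne : HasEntry (A := 𝟙_ (Gr C)) (B := Q.gr) (frtBialg Q).one () (0 : ℕ) (frtOne Q) := rfl

/-- The graded comodule `δ` is componentwise isomorphic to tensor powers of `X`. -/
structure IsPowerComodule {V : Gr C} (δ : V ⟶ V ⊗ Q.gr) where
  deg : V.ι → ℕ
  coaction : ∀ v, V.obj v ⟶ V.obj v ⊗ Q.obj (deg v)
  hasEntry : ∀ v, HasEntry (B := V ⊗ Q.gr) δ v (v, deg v) (coaction v)
  iso : ∀ v, V.obj v ≅ tpow X (deg v)
  hom : ∀ v, IsComoduleHom (coaction v) (frtCoaction Q (deg v)) (iso v).hom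

/-- The tensor algebra as a power comodule. -/
def powerFrt : IsPowerComodule Q (frtCoact Q) where
  deg n := n
  coaction n := frtCoaction Q n
  hasEntry n := hasEntry_frtCoact Q n
  iso n := Iso.refl (tpow X n)
  hom n := isComoduleHom_id _

variable {Q} {B : PairData Q.gr}
/-- Tensor products of power comodules are power comodules. -/
def IsPowerComodule.tensor (hB : B.toBialgData = frtBialg Q) {V W : Gr C} {δ : V ⟶ V ⊗ Q.gr} {δ' : W ⟶ W ⊗ Q.gr} (h : IsPowerComodule Q δ)
    (h' : IsPowerComodule Q δ') : IsPowerComodule (V := V ⊗ W) Q (tensorCoaction B δ δ') where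
  deg p := h.deg p.1 + h'.deg p.2
  coaction p := tensorCoact (h.coaction p.1) (h'.coaction p.2) (frtMulTo Q rfl)
  hasEntry p := hasEntry_tensorCoaction (h.hasEntry p.1) (h'.hasEntry p.2) (by rw [hB]; exact hasEntry_frtMul Q rfl)
  iso p := (h.iso p.1 ⊗ᵢ h'.iso p.2) ≪≫ tpowIso X rfl
  hom p := isComoduleHom_tensor Q rfl (h.hom p.1) (h'.hom p.2)

/-- The unit object as a power comodule. -/
def powerUnit (hB : B.toBialgData = frtBialg Q) : IsPowerComodule Q (unitCoaction B) where
  deg _ := 0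
  coaction _ := (λ_ (𝟙_ C)).inv ≫ 𝟙_ C ◁ frtOne Q
  hasEntry v := by
    unfold unitCoaction
    rw [hB]
    exact (hasEntry_left_inv (𝟙_ (Gr C)) ()).comp ((hasEntry_frtOne Q).whiskerLeft (𝟙_ (Gr C)) ())
  iso _ := Iso.refl (𝟙_ C)
  hom _ := isComoduleHom_unit Q

theorem IsPowerComodule.coassoc (hB : B.toBialgData = frtBialg Q) {V : Gr C} {δ : V ⟶ V ⊗ Q.gr} (h : IsPowerComodule Q δ) :
    δ ≫ V ◁ B.comul = δ ≫ δ ▷ Q.gr ≫ (α_ V Q.gr Q.gr).hom := by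
  rw [hB]
  refine eq_of_hasEntry fun v => ⟨_, _, (h.hasEntry v).comp ((hasEntry_frtComul Q (h.deg v)).whiskerLeft V v), ?_⟩
  refine ((h.hasEntry v).comp (((h.hasEntry v).whiskerRight Q.gr (h.deg v)).comp (hasEntry_assoc_hom _ _ _ _ _ _))).congr ?_
  exact (isComoduleHom_coassoc Q (h.hom v)).symm

theorem IsPowerComodule.counit (hB : B.toBialgData = frtBialg Q) {V : Gr C} {δ : V ⟶ V ⊗ Q.gr} (h : IsPowerComodule Q δ) :
    δ ≫ V ◁ B.counit = (ρ_ V).inv := by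
  rw [hB]
  refine eq_of_hasEntry fun v => ⟨_, _, (h.hasEntry v).comp ((hasEntry_frtCounit Q (h.deg v)).whiskerLeft V v), ?_⟩
  refine (hasEntry_right_inv V v).congr ?_
  exact (isComoduleHom_counit Q (h.hom v)).symm

/-- A criterion for morphisms between power comodules: in each row there is one entry, which
corresponds to an endomorphism of the comodule `X^{⊗N}`. -/
theorem IsPowerComodule.isComoduleHom {V W : Gr C} {δ : V ⟶ V ⊗ Q.gr} {δ' : W ⟶ W ⊗ Q.gr} (h : IsPowerComodule Q δ)
    (h' : IsPowerComodule Q δ') {f : V ⟶ W} (hf : ∀ v, ∃ (w : W.ι) (φ : V.obj v ⟶ W.obj w) (e : h'.deg w = h.deg v)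
      (κ : tpow X (h.deg v) ⟶ tpow X (h.deg v)), HasEntry f v w φ ∧ IsEndo Q _ κ ∧
        φ ≫ (h'.iso w).hom ≫ eqToHom (congrArg (tpow X) e) = (h.iso v).hom ≫ κ) :
    IsComoduleHom δ δ' f := by
  refine eq_of_hasEntry fun v => ?_
  obtain ⟨w, φ, e, κ, hφ, hκ, hc⟩ := hf v
  refine ⟨_, _, (hφ.comp (h'.hasEntry w)).cast (j' := (w, h.deg v)) (by rw [e]; rfl), ?_⟩
  refine ((h.hasEntry v).comp (hφ.whiskerRight Q.gr (h.deg v))).congr ?_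
  have key : ∀ {V W : C} {m n : ℕ} (e : m = n) (γ : V ⟶ V ⊗ Q.obj n) (γ' : W ⟶ W ⊗ Q.obj m) (θ : V ≅ tpow X n) (θ' : W ≅ tpow X m)
      (φ : V ⟶ W) (κ : tpow X n ⟶ tpow X n) (h1 : IsComoduleHom γ (frtCoaction Q n) θ.hom)
      (h2 : IsComoduleHom γ' (frtCoaction Q m) θ'.hom) (h3 : IsEndo Q _ κ)
      (h4 : φ ≫ θ'.hom ≫ eqToHom (congrArg (tpow X) e) = θ.hom ≫ κ),
      γ ≫ φ ▷ Q.obj n = (φ ≫ γ') ≫ W ◁ eqToHom (congrArg Q.obj e) := by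
    intro V W m n e γ γ' θ θ' φ κ h1 h2 h3 h4
    subst e
    simp only [eqToHom_refl, comp_id, whiskerLeft_id] at h4 ⊢
    have := (h1.comp h3)
    rw [← h4] at this
    have k := this.comp h2.inv
    rw [assoc, Iso.hom_inv_id, comp_id] at k
    exact k.symm
  refine (key e _ _ (h.iso v) (h'.iso w) φ κ (h.hom v) (h'.hom w) hκ hc).trans (congrArg _ ?_)
  have : ∀ (W : C) {m n : ℕ} (e : m = n), W ◁ eqToHom (congrArg Q.obj e) = eqToHom (congrArg (fun n => W ⊗ Q.obj n) e) := by
    intro W m n e; subst e; simp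
  exact this _ e
end Graded
/-! ### `A(X, R)` as a graded bialgebra -/

section Rows
variable {C : Type u} [Category.{v} C] [Preadditive C]

theorem pre_apply {P P' : C} {B : Gr C} (φ : P' ⟶ P) (r : Gr.Row P B) (j : B.ι) :
    Gr.pre φ r j = φ ≫ r j := by
  classical
  induction r using Gr.ind with
  | h0 => simp
  | hadd r s hr hs => simp [hr, hs]
  | hs k ψ =>
    rw [Gr.pre_single]
    by_cases h : k = j
    · subst h; simp [Gr.single]
    · simp [Gr.single, DFinsupp.single_apply, h]

variable [MonoidalCategory C] [MonoidalPreadditive C]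

theorem tensRow_single_apply {P Q : C} {A B : Gr C} (a : A.ι) (φ : P ⟶ A.obj a) (r : Gr.Row Q B) (j : B.ι) :
    Gr.tensRow (Gr.single a φ) r (a, j) = (φ ⊗ₘ r j) := by
  classical
  induction r using Gr.ind with
  | h0 => simp
  | hadd r s hr hs => rw [map_add, DFinsupp.add_apply, hr, hs, DFinsupp.add_apply, MonoidalPreadditive.tensor_add]
  | hs k ψ =>
    rw [Gr.tensRow_single]
    by_cases h : k = j
    · subst h; simp [Gr.single]
    · have h' : ¬ ((a, k) = (a, j)) := fun e => h (Prod.ext_iff.1 e).2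
      simp [Gr.single, DFinsupp.single_apply, h]

theorem row_comp_whiskerLeft {A B D S : Gr C} {u : S ⟶ A ⊗ B} {p : S.ι} {a : A.ι} {q : B.ι} {φ : S.obj p ⟶ A.obj a ⊗ B.obj q}
    (hu : HasEntry (A := S) (B := A ⊗ B) u p (a, q) φ) (f : B ⟶ D) (z : D.ι) :
    (Gr.Hom.row (u ≫ A ◁ f) p) (a, z) = φ ≫ A.obj a ◁ (f.row q z) := by
  have e : Gr.Hom.row (u ≫ A ◁ f) p = Gr.pre φ (Gr.tensRow (Gr.single a (𝟙 _)) (f.row q)) := by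
    rw [← id_tensorHom]
    change Gr.post _ (u.row p) = _
    rw [hu]
    exact Gr.post_single _ _ _
  rw [e, pre_apply, ← id_tensorHom]
  exact congrArg _ (tensRow_single_apply a _ _ z)
end Rows

section Family
variable {C : Type u} [Category.{v} C] [MonoidalCategory C] {X : C}
  {g : ∀ m n, tpow X m ⊗ tpow X n ⟶ tpow X n ⊗ tpow X m}

theorem IsBraidFamily.hexagon_left (hg : IsBraidFamily X g) {m n N : ℕ} (h : m + n = N) (a : ℕ) :
    (tpowIso X h).hom ▷ tpow X a ≫ g N a = ((α_ _ _ _).hom ≫ tpow X m ◁ g n a ≫ (α_ _ _ _).inv ≫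
      g m a ▷ tpow X n ≫ (α_ _ _ _).hom) ≫ tpow X a ◁ (tpowIso X h).hom := by
  refine o22_ext fun Z => ?_
  rw [← cancel_epi (α_ (tpow X m) (tpow X n) _).inv]
  have k := hg.add_left h a Z
  simp only [o21, o22] at k ⊢
  simp only [assoc] at k
  simp only [comp_whiskerRight, assoc]
  rw [← associator_inv_naturality_left_assoc, k]
  simp

theorem IsBraidFamily.hexagon_right (hg : IsBraidFamily X g) (a : ℕ) {m n N : ℕ} (h : m + n = N) :
    tpow X a ◁ (tpowIso X h).hom ≫ g a N = ((α_ _ _ _).inv ≫ g a m ▷ tpow X n ≫ (α_ _ _ _).hom ≫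
      tpow X m ◁ g a n ≫ (α_ _ _ _).inv) ≫ (tpowIso X h).hom ▷ tpow X a := by
  refine o22_ext fun Z => ?_
  rw [← cancel_epi (tpow X a ◁ (α_ (tpow X m) (tpow X n) Z).inv)]
  have k := hg.add_right a h Z
  simp only [o21, o22] at k ⊢
  simp only [whiskerLeft_comp, assoc] at k
  simp only [comp_whiskerRight, assoc]
  rw [← associator_inv_naturality_middle_assoc, k]
  simp

theorem IsBraidFamily.unit_left (hg : IsBraidFamily X g) (n : ℕ) :
    g 0 n = (λ_ (tpow X n)).hom ≫ (ρ_ (tpow X n)).inv := by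
  refine o22_ext fun Z => (hg.zero_left n Z).trans ?_
  have key : ∀ T : C, (λ_ (T ⊗ Z)).hom ≫ T ◁ (λ_ Z).inv = o22 ((λ_ T).hom ≫ (ρ_ T).inv) Z := by
    intro T; simp [o22]
  exact key _

theorem IsBraidFamily.unit_right (hg : IsBraidFamily X g) (n : ℕ) :
    g n 0 = (ρ_ (tpow X n)).hom ≫ (λ_ (tpow X n)).inv := by
  refine o22_ext fun Z => (hg.zero_right n Z).trans ?_
  have key : ∀ T : C, T ◁ (λ_ Z).hom ≫ (λ_ (T ⊗ Z)).inv = o22 ((ρ_ T).hom ≫ (λ_ T).inv) Z := by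
    intro T; simp [o22]
  exact key _

theorem tpowIso_assoc {l m n lm mn N : ℕ} (h1 : l + m = lm) (h2 : lm + n = N) (h3 : m + n = mn) (h4 : l + mn = N) :
    (tpowIso X h1).hom ▷ tpow X n ≫ (tpowIso X h2).hom =
      (α_ _ _ _).hom ≫ tpow X l ◁ (tpowIso X h3).hom ≫ (tpowIso X h4).hom := by
  refine tail_ext fun Z => ?_
  have k := tail_tpowIso_assoc X h1 h2 h3 h4 Z
  rw [← cancel_epi ((α_ (tpow X l ⊗ tpow X m) (tpow X n) Z).inv), ← cancel_epi (α_ (tpow X l) (tpow X m) _).inv]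
  simp only [o21, whiskerLeft_comp, assoc] at k
  simp only [comp_whiskerRight]
  rw [← associator_inv_naturality_left_assoc, k]
  simp

theorem tpowIso_unit_left {n : ℕ} (h : 0 + n = n) : (tpowIso X h).hom = (λ_ (tpow X n)).hom := by
  refine tail_ext fun Z => ?_
  have k := tail_tpowIso_zero_left X h Z
  rw [← cancel_epi (α_ _ _ _).inv]
  refine k.trans ?_
  have key : ∀ T : C, (λ_ (T ⊗ Z)).hom = (α_ (𝟙_ C) T Z).inv ≫ (λ_ T).hom ▷ Z := by intro T; simp
  exact key _
theorem tpowIso_unit_right {n : ℕ} (h : n + 0 = n) : (tpowIso X h).hom = (ρ_ (tpow X n)).hom :=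
  tpowIso_hom X n 0 rfl
theorem tpowIso_eqToHom {m n N N' : ℕ} (h : m + n = N) (h' : m + n = N') (e : N = N') :
    (tpowIso X h).hom ≫ eqToHom (congrArg (tpow X) e) = (tpowIso X h').hom := by
  subst e; simp
end Family

section Graded
variable {C : Type u} [Category.{v} C] [MonoidalCategory C] [BraidedCategory C] [Abelian C] [MonoidalPreadditive C]
  [∀ Z : C, PreservesFiniteColimits (tensorRight Z)]
  [∀ Z : C, PreservesFiniteColimits (tensorLeft Z)]
  {X Y : C} [ExactPairing X Y] {R : X ⊗ X ⟶ X ⊗ X} (Q : FRTQuotient X Y R)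

/-- The coefficients of the tensor powers of `X` generate `A(X, R)`. -/
theorem separates_frtCoact : Separates (frtCoact Q) := by
  intro W Z f g h
  refine Gr.hom_ext fun p => DFinsupp.ext fun z => ?_
  obtain ⟨n, w⟩ := p
  refine frtCoaction_injective Q _ _ ?_
  have key : ∀ f : Q.gr ⊗ W ⟶ Z, (Gr.Hom.row (o12 (frtCoact Q) W ≫ TensorPow X ◁ f) (n, w)) (n, z) =
      o12 (frtCoaction Q n) (W.obj w) ≫ tpow X n ◁ (f.row (n, w) z) := by
    intro f
    have h1 : HasEntry (A := TensorPow X ⊗ W) (B := TensorPow X ⊗ (Q.gr ⊗ W)) (o12 (frtCoact Q) W) (n, w) (n, (n, w))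
        (o12 (frtCoaction Q n) (W.obj w)) :=
      ((hasEntry_frtCoact Q n).whiskerRight W w).comp (hasEntry_assoc_hom _ _ _ _ _ _)
    exact row_comp_whiskerLeft (A := TensorPow X) h1 f z
  rw [← key, ← key, h]

variable {Q} {B : PairData Q.gr}

theorem isComoduleHom_power (hB : B.toBialgData = frtBialg Q) :
    IsComoduleHom (tensorCoaction B (tensorCoaction B (frtCoact Q) (frtCoact Q)) (frtCoact Q))
      (tensorCoaction B (frtCoact Q) (tensorCoaction B (frtCoact Q) (frtCoact Q))) (α_ _ _ _).hom ∧
    IsComoduleHom (tensorCoaction B (unitCoaction B) (frtCoact Q)) (frtCoact Q) (λ_ _).hom ∧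
    IsComoduleHom (tensorCoaction B (frtCoact Q) (unitCoaction B)) (frtCoact Q) (ρ_ _).hom := by
  refine ⟨IsPowerComodule.isComoduleHom (((powerFrt Q).tensor hB (powerFrt Q)).tensor hB (powerFrt Q))
      ((powerFrt Q).tensor hB ((powerFrt Q).tensor hB (powerFrt Q))) ?_,
    IsPowerComodule.isComoduleHom ((powerUnit hB).tensor hB (powerFrt Q)) (powerFrt Q) ?_,
    IsPowerComodule.isComoduleHom ((powerFrt Q).tensor hB (powerUnit hB)) (powerFrt Q) ?_⟩
  · rintro ⟨⟨a, b⟩, c⟩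
    refine ⟨(a, (b, c)), _, (Nat.add_assoc a b c).symm, 𝟙 _, hasEntry_assoc_hom _ _ _ _ _ _, isComoduleHom_id _, ?_⟩
    have key : ∀ (a b c : ℕ) (e : a + (b + c) = a + b + c), (α_ (tpow X a) (tpow X b) (tpow X c)).hom ≫
      ((Iso.refl (tpow X a) ⊗ᵢ ((Iso.refl (tpow X b) ⊗ᵢ Iso.refl (tpow X c)) ≪≫ tpowIso X (rfl : b + c = b + c))) ≪≫ tpowIso X rfl).hom ≫ eqToHom (congrArg (tpow X) e) =
       ((((Iso.refl (tpow X a) ⊗ᵢ Iso.refl (tpow X b)) ≪≫ tpowIso X (rfl : a + b = a + b)) ⊗ᵢ Iso.refl (tpow X c)) ≪≫ tpowIso X rfl).hom ≫ 𝟙 _ := by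
      intro a b c e
      simp only [Iso.trans_hom, tensorIso_hom, Iso.refl_hom, id_tensorHom_id, tensorHom_id, id_tensorHom, assoc,
        id_comp, comp_id, whiskerLeft_id, id_whiskerRight]
      rw [tpowIso_eqToHom rfl e.symm.symm e, ← tpowIso_assoc rfl rfl rfl e]
    exact key a b c (Nat.add_assoc a b c).symm
  · rintro ⟨⟨⟩, c⟩
    refine ⟨c, _, (Nat.zero_add c).symm, 𝟙 _, hasEntry_left_hom (TensorPow X) c, isComoduleHom_id _, ?_⟩
    have key : ∀ (c : ℕ) (e : c = 0 + c), (λ_ (tpow X c)).hom ≫ (Iso.refl (tpow X c)).hom ≫ eqToHom (congrArg (tpow X) e) =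
        ((Iso.refl (tpow X 0) ⊗ᵢ Iso.refl (tpow X c)) ≪≫ tpowIso X rfl).hom ≫ 𝟙 _ := by
      intro c e
      simp only [Iso.trans_hom, tensorIso_hom, Iso.refl_hom, id_tensorHom_id, id_comp, comp_id]
      rw [← tpowIso_eqToHom e.symm rfl e, tpowIso_unit_left]
      rfl
    exact key c (Nat.zero_add c).symm
  · rintro ⟨c, ⟨⟩⟩
    refine ⟨c, _, rfl, 𝟙 _, hasEntry_right_hom (TensorPow X) c, isComoduleHom_id _, ?_⟩
    have key : ∀ (c : ℕ), (ρ_ (tpow X c)).hom ≫ (Iso.refl (tpow X c)).hom ≫ eqToHom rfl =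
        ((Iso.refl (tpow X c) ⊗ᵢ Iso.refl (tpow X 0)) ≪≫ tpowIso X (rfl : c + 0 = c)).hom ≫ 𝟙 _ := by
      intro c
      simp only [Iso.trans_hom, tensorIso_hom, Iso.refl_hom, id_tensorHom_id, id_comp, comp_id,
        eqToHom_refl, tpowIso_unit_right]
      exact (id_comp _).symm
    exact key c

set_option maxHeartbeats 1000000 in
/-- `A(X, R)` is a bialgebra. -/
theorem isBialgebra_frt (hB : B.toBialgData = frtBialg Q) :
    IsBialgebra (β_ Q.gr Q.gr).hom B.toBialgData := by
  obtain ⟨ha, hl, hr⟩ := isComoduleHom_power hB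
  refine (separates_frtCoact Q).isBialgebra B ?_ ?_ ?_ ?_ ?_ ?_ ha hl hr
  · exact (powerFrt Q).coassoc hB
  · exact (powerFrt Q).counit hB
  · exact IsPowerComodule.coassoc hB ((powerFrt Q).tensor hB (powerFrt Q))
  · exact ((powerFrt Q).tensor hB (powerFrt Q)).counit hB
  · exact (powerUnit hB).coassoc hB
  · exact (powerUnit hB).counit hB

variable (Q) in
/-- An invertible family of braidings of the tensor powers of `X` by morphisms of
`A(X, R)`-comodules. -/
structure FRTBraiding where
  g : ∀ m n, tpow X m ⊗ tpow X n ≅ tpow X n ⊗ tpow X m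
  family : IsBraidFamily X fun m n => (g m n).hom
  slides : Slides (fun m n => (g m n).hom) (RTwo R)
  endo : ∀ {m n N : ℕ} (h : m + n = N) (h' : n + m = N), IsEndo Q N (swapEndo (fun m n => (g m n).hom) h h')

/-- The inverse family of braidings. -/
def FRTBraiding.inverse (D : FRTBraiding Q) : FRTBraiding Q where
  g m n := (D.g n m).symm
  family := D.family.inverse
  slides := D.slides.inverse
  endo {m n N} h h' := by
    have e : (⟨swapEndo (fun m n => (D.g m n).hom) h' h, swapEndo (fun m n => (D.g n m).symm.hom) h h', by simp [swapEndo],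
      by simp [swapEndo]⟩ : tpow X N ≅ tpow X N).inv = swapEndo (fun m n => (D.g n m).symm.hom) h h' := rfl
    rw [← e]
    exact IsComoduleHom.inv (D.endo h' h)

/-- The structure of `A(X, R)` and `Ā(X, R⁻¹)`, and the pairing given by the family `D`. -/
def frtPair (D : FRTBraiding Q) : PairData Q.gr where
  toBialgData := frtBialg Q
  mulBar := Gr.ofMap (A := Gr.tens Q.gr Q.gr) (B := Q.gr) (fun p => Nat.add p.1 p.2)
    (fun p => @frtMul C _ _ (reverseBraiding C) _ _ _ _ _ _ _ _ Q p.1 p.2)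
  pairing := Gr.ofMap (A := Gr.tens Q.gr Q.gr) (B := Gr.unit) (fun _ => ())
    (fun p => frtPairing Q D.family D.slides p.1 p.2)

/-- The convolution inverse of the pairing. -/
def frtPairingInv (D : FRTBraiding Q) : Q.gr ⊗ Q.gr ⟶ 𝟙_ (Gr C) :=
  (β_ Q.gr Q.gr).hom ≫ (@frtPair C _ _ (reverseBraiding C) _ _ _ _ _ _ _ _ _ D.inverse).pairing

theorem IsPowerComodule.braiding (D : FRTBraiding Q) {V W : Gr C} {δ : V ⟶ V ⊗ Q.gr} {δ' : W ⟶ W ⊗ Q.gr}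
    (h : IsPowerComodule Q δ) (h' : IsPowerComodule Q δ') (v : V.ι) (w : W.ι) :
    HasEntry (A := V ⊗ W) (B := W ⊗ V) (Ψ[frtPair D] δ δ') (v, w) (w, v)
      ((h.iso v ⊗ᵢ h'.iso w).hom ≫ (D.g (h.deg v) (h'.deg w)).hom ≫ (h'.iso w ⊗ᵢ h.iso v).inv) := by
  refine (hasEntry_comoduleBraiding (h.hasEntry v) (h'.hasEntry w)
    (μ := frtPairing Q D.family D.slides (h.deg v) (h'.deg w))
    (hasEntry_ofMap (A := Gr.tens Q.gr Q.gr) (B := Gr.unit) (fun _ => ()) _ (h.deg v, h'.deg w))).congr ?_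
  rw [← assoc, Iso.eq_comp_inv]
  exact coactBraiding_eq Q D.family D.slides (h.hom v) (h'.hom w)
end Graded
/-! ### `A(X, R)` as a coquasitriangular bialgebra -/

section Central
variable {M : Type u} [Category.{v} M] [MonoidalCategory M] [BraidedCategory M] {T A : M} {δ : T ⟶ T ⊗ A} {B : PairData A}

/-- A separating comodule is an object of `C^{O(A, Ā)}` if the coactions on its tensor square given by `A` and
by `Ā` agree. -/
theorem Separates.isOComodule (h : Separates δ) (hΔ : δ ≫ T ◁ B.comul = δ ≫ δ ▷ A ≫ (α_ T A A).hom)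
    (hε : δ ≫ T ◁ B.counit = (ρ_ T).inv) (ρ' : A ⊗ A ⟶ 𝟙_ M)
    (hc : tensorCoaction B δ δ = @tensorCoaction M _ _ (reverseBraiding M) _ _ _ (B.swap ρ') δ δ) :
    IsOComodule B δ where
  coassoc := hΔ
  counit := hε
  central := by
    have k := h.central B (fun Z => by
      have e := (tail_tensorCoaction B δ δ Z).symm.trans ((congrArg (fun f => o12 f Z) hc).trans
        (@tail_tensorCoaction M _ _ (reverseBraiding M) _ _ _ (B.swap ρ') δ δ Z))
      change (α_ T T Z).hom ≫ _ = (α_ T T Z).hom ≫ (o12 δ (T ⊗ Z) ≫ T ◁ A ◁ o12 δ Z ≫ T ◁ crossInv A T (A ⊗ Z)) ≫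
        T ◁ T ◁ o21 B.mulBar Z ≫ (α_ T T (A ⊗ Z)).inv at e
      rw [cancel_epi] at e
      simp only [← assoc] at e
      rw [cancel_mono] at e
      simpa only [assoc] using e)
    have key : ∀ (ψ : A ⊗ T ⟶ T ⊗ A) (μ : A ⊗ A ⟶ A) (Z : M),
        o22 (A ◁ δ ≫ (α_ A T A).inv ≫ ψ ▷ A ≫ (α_ T A A).hom ≫ T ◁ μ) Z =
        A ◁ o12 δ Z ≫ o22 ψ (A ⊗ Z) ≫ T ◁ o21 μ Z := by
      intro ψ μ Z
      rw [o22]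
      simp only [fans, cancels, r12 δ, r22 ψ, r21 μ]
    refine o22_ext fun Z => ?_
    rw [key, key]
    exact k Z
end Central

section Graded
variable {C : Type u} [Category.{v} C] [MonoidalCategory C] [BraidedCategory C] [Abelian C] [MonoidalPreadditive C]
  [∀ Z : C, PreservesFiniteColimits (tensorRight Z)]
  [∀ Z : C, PreservesFiniteColimits (tensorLeft Z)]
  {X Y : C} [ExactPairing X Y] {R : X ⊗ X ⟶ X ⊗ X} {Q : FRTQuotient X Y R} (D : FRTBraiding Q)

/-- `A(X, R)` and `Ā(X, R⁻¹)` coact in the same way on `X^{⊗m} ⊗ X^{⊗n}`. -/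
theorem tensorCoact_frtCoaction (m n : ℕ) :
    tensorCoact (frtCoaction Q m) (frtCoaction Q n) (frtMulTo Q (rfl : m + n = m + n)) =
      @tensorCoact C _ _ (reverseBraiding C) _ _ _ _ _ (frtCoaction Q m) (frtCoaction Q n)
        (@frtMulTo C _ _ (reverseBraiding C) _ _ _ _ _ _ _ _ Q _ _ _ (rfl : m + n = m + n)) := by
  have h1 := isComoduleHom_tensor Q (rfl : m + n = m + n) (isComoduleHom_id (frtCoaction Q m)) (isComoduleHom_id (frtCoaction Q n))
  have h2 := @isComoduleHom_tensor C _ _ (reverseBraiding C) _ _ _ _ _ _ _ _ Q _ _ _ _ _ (rfl : m + n = m + n) _ _ _ _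
    (isComoduleHom_id (frtCoaction Q m)) (isComoduleHom_id (frtCoaction Q n))
  rw [← cancel_mono (((𝟙 _ ⊗ₘ 𝟙 _) ≫ (tpowIso X (rfl : m + n = m + n)).hom) ▷ _)]
  exact h1.symm.trans h2

theorem tensorCoaction_frtCoact (ρ' : Q.gr ⊗ Q.gr ⟶ 𝟙_ (Gr C)) : tensorCoaction (frtPair D) (frtCoact Q) (frtCoact Q) =
    @tensorCoaction (Gr C) _ _ (reverseBraiding (Gr C)) _ _ _ ((frtPair D).swap ρ') (frtCoact Q) (frtCoact Q) := by
  refine eq_of_hasEntry fun p => ⟨_, _, hasEntry_tensorCoaction (hasEntry_frtCoact Q p.1) (hasEntry_frtCoact Q p.2)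
    (hasEntry_frtMul Q rfl), ?_⟩
  exact HasEntry.congr (@hasEntry_tensorCoaction C _ _ _ _ (reverseBraiding C) _ _ _ ((frtPair D).swap ρ') _ _ _ _ _ _ _ _ _ _
    (hasEntry_frtCoact Q p.1) (hasEntry_frtCoact Q p.2)
    (@hasEntry_frtMul C _ _ (reverseBraiding C) _ _ _ _ _ _ _ _ Q p.1 p.2 _ rfl)) (tensorCoact_frtCoaction p.1 p.2).symm

/-- The tensor algebra is an object of `C^{O(A(X, R), Ā(X, R⁻¹))}`. -/
theorem isOComodule_frtCoact : IsOComodule (frtPair D) (frtCoact Q) :=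
  (separates_frtCoact Q).isOComodule ((powerFrt Q).coassoc rfl) ((powerFrt Q).counit rfl) (frtPair D).pairing
    (tensorCoaction_frtCoact D _)

/-- The entry of the comodule braiding of tensor powers. -/
theorem IsPowerComodule.braiding' {V W : Gr C} {δ : V ⟶ V ⊗ Q.gr} {δ' : W ⟶ W ⊗ Q.gr}
    (h : IsPowerComodule Q δ) (h' : IsPowerComodule Q δ') (v : V.ι) (w : W.ι) {φ : V.obj v ⊗ W.obj w ⟶ W.obj w ⊗ V.obj v}
    (hφ : φ ≫ (h'.iso w ⊗ᵢ h.iso v).hom = (h.iso v ⊗ᵢ h'.iso w).hom ≫ (D.g (h.deg v) (h'.deg w)).hom) :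
    HasEntry (A := V ⊗ W) (B := W ⊗ V) (Ψ[frtPair D] δ δ') (v, w) (w, v) φ :=
  (h.braiding D h' v w).congr (by rw [← assoc, ← hφ, assoc, Iso.hom_inv_id, comp_id])

theorem hasEntry_braiding_frtCoact (m n : ℕ) :
    HasEntry (A := TensorPow X ⊗ TensorPow X) (B := TensorPow X ⊗ TensorPow X)
      (Ψ[frtPair D] (frtCoact Q) (frtCoact Q)) (m, n) (n, m) (D.g m n).hom :=
  (powerFrt Q).braiding' D (powerFrt Q) m n (by
    have key : ∀ {S S' : C} (g : S ⊗ S' ⟶ S' ⊗ S), g ≫ (Iso.refl S' ⊗ᵢ Iso.refl S).hom = (Iso.refl S ⊗ᵢ Iso.refl S').hom ≫ g := by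
      intro S S' g; simp
    exact key _)

theorem braiding_tensor_left : Ψ[frtPair D] (tensorCoaction (frtPair D) (frtCoact Q) (frtCoact Q)) (frtCoact Q) =
    (α_ _ _ _).hom ≫ TensorPow X ◁ Ψ[frtPair D] (frtCoact Q) (frtCoact Q) ≫ (α_ _ _ _).inv ≫
      Ψ[frtPair D] (frtCoact Q) (frtCoact Q) ▷ TensorPow X ≫ (α_ _ _ _).hom := by
  refine eq_of_hasEntry ?_
  rintro ⟨⟨a, b⟩, c⟩
  refine ⟨_, _, ((powerFrt Q).tensor (B := frtPair D) rfl (powerFrt Q)).braiding' D (powerFrt Q) (a, b) c ?_,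
    (hasEntry_assoc_hom _ _ _ _ _ _).comp (((hasEntry_braiding_frtCoact D b c).whiskerLeft _ _).comp
      ((hasEntry_assoc_inv _ _ _ _ _ _).comp (((hasEntry_braiding_frtCoact D a c).whiskerRight _ _).comp (hasEntry_assoc_hom _ _ _ _ _ _))))⟩
  have key : ∀ {S S' U P : C} (f : (S ⊗ S') ⊗ U ⟶ U ⊗ (S ⊗ S')) (t : S ⊗ S' ≅ P) (g : P ⊗ U ⟶ U ⊗ P),
      t.hom ▷ U ≫ g = f ≫ U ◁ t.hom →
      f ≫ (Iso.refl U ⊗ᵢ ((Iso.refl S ⊗ᵢ Iso.refl S') ≪≫ t)).hom = (((Iso.refl S ⊗ᵢ Iso.refl S') ≪≫ t) ⊗ᵢ Iso.refl U).hom ≫ g := by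
    intro S S' U P f t g h
    simp [h]
  exact key _ _ _ (D.family.hexagon_left (m := a) (n := b) rfl c)

theorem braiding_tensor_right : Ψ[frtPair D] (frtCoact Q) (tensorCoaction (frtPair D) (frtCoact Q) (frtCoact Q)) =
    (α_ _ _ _).inv ≫ Ψ[frtPair D] (frtCoact Q) (frtCoact Q) ▷ TensorPow X ≫ (α_ _ _ _).hom ≫
      TensorPow X ◁ Ψ[frtPair D] (frtCoact Q) (frtCoact Q) ≫ (α_ _ _ _).inv := by
  refine eq_of_hasEntry ?_
  rintro ⟨c, ⟨a, b⟩⟩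
  refine ⟨_, _, (powerFrt Q).braiding' D ((powerFrt Q).tensor (B := frtPair D) rfl (powerFrt Q)) c (a, b) ?_,
    (hasEntry_assoc_inv _ _ _ _ _ _).comp (((hasEntry_braiding_frtCoact D c a).whiskerRight _ _).comp
      ((hasEntry_assoc_hom _ _ _ _ _ _).comp (((hasEntry_braiding_frtCoact D c b).whiskerLeft _ _).comp (hasEntry_assoc_inv _ _ _ _ _ _))))⟩
  have key : ∀ {S S' U P : C} (f : U ⊗ (S ⊗ S') ⟶ (S ⊗ S') ⊗ U) (t : S ⊗ S' ≅ P) (g : U ⊗ P ⟶ P ⊗ U),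
      U ◁ t.hom ≫ g = f ≫ t.hom ▷ U →
      f ≫ (((Iso.refl S ⊗ᵢ Iso.refl S') ≪≫ t) ⊗ᵢ Iso.refl U).hom = (Iso.refl U ⊗ᵢ ((Iso.refl S ⊗ᵢ Iso.refl S') ≪≫ t)).hom ≫ g := by
    intro S S' U P f t g h
    simp [h]
  exact key _ _ _ (D.family.hexagon_right c (m := a) (n := b) rfl)

theorem braiding_unit_left : Ψ[frtPair D] (unitCoaction (frtPair D)) (frtCoact Q) =
    (λ_ _).hom ≫ (ρ_ _).inv := by
  refine eq_of_hasEntry ?_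
  rintro ⟨⟨⟩, c⟩
  refine ⟨_, _, (powerUnit (B := frtPair D) rfl).braiding' D (powerFrt Q) () c ?_,
    (hasEntry_left_hom (TensorPow X) c).comp (hasEntry_right_inv (TensorPow X) c)⟩
  have key : ∀ {S U : C} (f g : U ⊗ S ⟶ S ⊗ U) (_ : g = f), f ≫ (Iso.refl S ⊗ᵢ Iso.refl U).hom = (Iso.refl U ⊗ᵢ Iso.refl S).hom ≫ g := by
    rintro S U f g rfl; simp
  exact key _ _ (D.family.unit_left c)

theorem braiding_unit_right : Ψ[frtPair D] (frtCoact Q) (unitCoaction (frtPair D)) =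
    (ρ_ _).hom ≫ (λ_ _).inv := by
  refine eq_of_hasEntry ?_
  rintro ⟨c, ⟨⟩⟩
  refine ⟨_, _, (powerFrt Q).braiding' D (powerUnit (B := frtPair D) rfl) c () ?_,
    (hasEntry_right_hom (TensorPow X) c).comp (hasEntry_left_inv (TensorPow X) c)⟩
  have key : ∀ {S U : C} (f g : U ⊗ S ⟶ S ⊗ U) (_ : g = f), f ≫ (Iso.refl S ⊗ᵢ Iso.refl U).hom = (Iso.refl U ⊗ᵢ Iso.refl S).hom ≫ g := by
    rintro S U f g rfl; simp
  exact key _ _ (D.family.unit_right c)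

theorem isComoduleHom_braiding : IsComoduleHom (tensorCoaction (frtPair D) (frtCoact Q) (frtCoact Q))
    (tensorCoaction (frtPair D) (frtCoact Q) (frtCoact Q)) (Ψ[frtPair D] (frtCoact Q) (frtCoact Q)) := by
  refine IsPowerComodule.isComoduleHom ((powerFrt Q).tensor (B := frtPair D) rfl (powerFrt Q))
    ((powerFrt Q).tensor (B := frtPair D) rfl (powerFrt Q)) ?_
  rintro ⟨a, b⟩
  refine ⟨(b, a), _, Nat.add_comm b a, swapEndo (fun m n => (D.g m n).hom) rfl (Nat.add_comm b a), hasEntry_braiding_frtCoact D a b,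
    D.endo _ _, ?_⟩
  have key : ∀ (a b : ℕ) (e : b + a = a + b), (D.g a b).hom ≫
      ((Iso.refl (tpow X b) ⊗ᵢ Iso.refl (tpow X a)) ≪≫ tpowIso X (rfl : b + a = b + a)).hom ≫ eqToHom (congrArg (tpow X) e) =
      ((Iso.refl (tpow X a) ⊗ᵢ Iso.refl (tpow X b)) ≪≫ tpowIso X (rfl : a + b = a + b)).hom ≫ swapEndo (fun m n => (D.g m n).hom) rfl e := by
    intro a b e
    simp only [Iso.trans_hom, tensorIso_hom, Iso.refl_hom, id_tensorHom_id, id_comp, assoc,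
      tpowIso_eqToHom rfl e e, swapEndo, Iso.hom_inv_id_assoc]
  exact key a b _

theorem comoduleBraidingInv_frtPairingInv {V W : Gr C} (δ : V ⟶ V ⊗ Q.gr) (δ' : W ⟶ W ⊗ Q.gr) :
    comoduleBraidingInv (frtPairingInv D) δ δ' = @comoduleBraiding (Gr C) _ _ (reverseBraiding (Gr C)) _ _ _
      (@frtPair C _ _ (reverseBraiding C) _ _ _ _ _ _ _ _ _ D.inverse).pairing δ δ' := by
  have e : barPairing (frtPairingInv D) = (@frtPair C _ _ (reverseBraiding C) _ _ _ _ _ _ _ _ _ D.inverse).pairing := by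
    rw [barPairing, frtPairingInv, Iso.inv_hom_id_assoc]
  rw [← e]
  rfl

theorem hasEntry_braidingInv_frtCoact (m n : ℕ) :
    HasEntry (A := TensorPow X ⊗ TensorPow X) (B := TensorPow X ⊗ TensorPow X)
      (comoduleBraidingInv (frtPairingInv D) (frtCoact Q) (frtCoact Q)) (m, n) (n, m) (D.g n m).inv := by
  rw [comoduleBraidingInv_frtPairingInv]
  exact @hasEntry_braiding_frtCoact C _ _ (reverseBraiding C) _ _ _ _ _ _ _ _ _ D.inverse m n

theorem isConvolutionInverse_frt : IsConvolutionInverse (β_ Q.gr Q.gr).hom (frtBialg Q) (frtPair D).pairing (frtPairingInv D) := by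
  refine (separates_frtCoact Q).isConvolutionInverse (frtPair D) ((powerFrt Q).coassoc rfl) ((powerFrt Q).counit rfl) ?_ ?_
  · refine eq_of_hasEntry ?_
    rintro ⟨a, b⟩
    exact ⟨_, _, (hasEntry_braiding_frtCoact D a b).comp (hasEntry_braidingInv_frtCoact D b a),
      (hasEntry_id (TensorPow X ⊗ TensorPow X) (a, b)).congr (D.g a b).hom_inv_id.symm⟩
  · refine eq_of_hasEntry ?_
    rintro ⟨a, b⟩
    exact ⟨_, _, (hasEntry_braidingInv_frtCoact D a b).comp (hasEntry_braiding_frtCoact D b a),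
      (hasEntry_id (TensorPow X ⊗ TensorPow X) (a, b)).congr (D.g b a).inv_hom_id.symm⟩

/-- `(A(X, R), Ā(X, R⁻¹), ρ)` is a coquasitriangular bialgebra. -/
theorem isCoquasitriangular_frt : IsCoquasitriangular (β_ Q.gr Q.gr) (frtPair D) :=
  (separates_frtCoact Q).isCoquasitriangular (frtPair D) (isBialgebra_frt rfl)
    (@isBialgebra_frt C _ _ (reverseBraiding C) _ _ _ _ _ _ _ _ Q (@frtPair C _ _ (reverseBraiding C) _ _ _ _ _ _ _ _ _ D.inverse) rfl)
    (isOComodule_frtCoact D)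
    (braiding_tensor_left D) (braiding_tensor_right D) (braiding_unit_left D) (braiding_unit_right D)
    (isComoduleHom_braiding D) (isConvolutionInverse_frt D)

theorem isCoquasitriangular_frt_swap : @IsCoquasitriangular (Gr C) _ _ Q.gr
    (@BraidedCategory.braiding (Gr C) _ _ (reverseBraiding (Gr C)) Q.gr Q.gr) ((frtPair D).swap (frtPairingInv D)) := by
  have e : barPairing (frtPairingInv D) = (@frtPair C _ _ (reverseBraiding C) _ _ _ _ _ _ _ _ _ D.inverse).pairing := by
    rw [barPairing, frtPairingInv, Iso.inv_hom_id_assoc]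
  rw [PairData.swap, e]
  exact @isCoquasitriangular_frt C _ _ (reverseBraiding C) _ _ _ _ _ _ _ _ _ D.inverse

end Graded
end

/-! ### Opposites, and Hopf algebras with the trivial pairing -/

section Opposite
variable {M : Type u} [Category.{v} M] [MonoidalCategory M]
variable {V : M} {c : V ⊗ V ≅ V ⊗ V} {H : BialgData V}

theorem o22_hom_inv (c : V ⊗ V ≅ V ⊗ V) (Z : M) : o22 c.hom Z ≫ o22 c.inv Z = 𝟙 _ := by
  simp [o22]

theorem o22_inv_hom (c : V ⊗ V ≅ V ⊗ V) (Z : M) : o22 c.inv Z ≫ o22 c.hom Z = 𝟙 _ :=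
  o22_hom_inv c.symm Z

/-- The tail of a braiding as an isomorphism. -/
@[simps] def tailIso (c : V ⊗ V ≅ V ⊗ V) (Z : M) : V ⊗ V ⊗ Z ≅ V ⊗ V ⊗ Z where
  hom := o22 c.hom Z
  inv := o22 c.inv Z
  hom_inv_id := o22_hom_inv c Z
  inv_hom_id := o22_inv_hom c Z

/-- A Yang–Baxter operator with respect to which the structure morphisms of `H` are natural. -/
structure IsBraidedBy (c : V ⊗ V ≅ V ⊗ V) (H : BialgData V) : Prop where
  distrib : IsDistrib c.hom H.one H.mul H.one H.mul
  codistrib : IsCodistrib c.hom H.counit H.comul H.counit H.comul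
  braid : ∀ Z, o22 c.hom (V ⊗ Z) ≫ V ◁ o22 c.hom Z ≫ o22 c.hom (V ⊗ Z) =
    V ◁ o22 c.hom Z ≫ o22 c.hom (V ⊗ Z) ≫ V ◁ o22 c.hom Z

theorem IsBraidedBy.inv (h : IsBraidedBy c H) : IsBraidedBy c.symm H := by
  have key : ∀ {X Y : M} {f : X ≅ Y} {Z W : M} {g : Z ≅ W} {p : X ⟶ Z} {q : Y ⟶ W},
      f.hom ≫ q = p ≫ g.hom → f.inv ≫ p = q ≫ g.inv := by
    intro X Y f Z W g p q e
    rw [Iso.inv_comp_eq, ← assoc, e, assoc, g.hom_inv_id, comp_id]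
  let L := fun Z => tailIso c (V ⊗ Z) ≪≫ whiskerLeftIso V (tailIso c Z)
  let R := fun Z => whiskerLeftIso V (tailIso c Z) ≪≫ tailIso c (V ⊗ Z)
  refine ⟨⟨fun Z => ?_, fun Z => ?_, fun Z => ?_, fun Z => ?_⟩,
    ⟨fun Z => ?_, fun Z => ?_, fun Z => ?_, fun Z => ?_⟩, fun Z => ?_⟩
  · have := key (f := R Z) (g := tailIso c Z) (p := o21 H.mul (V ⊗ Z)) (q := V ◁ o21 H.mul Z)
      (by simpa [R] using (h.distrib.mul_right Z).symm)
    simpa [R] using this.symm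
  · have := key (f := L Z) (g := tailIso c Z) (p := V ◁ o21 H.mul Z) (q := o21 H.mul (V ⊗ Z))
      (by simpa [L] using (h.distrib.mul_left Z).symm)
    simpa [L] using this.symm
  · dsimp only [Iso.symm_hom]
    rw [← h.distrib.one_right, assoc, o22_hom_inv, comp_id]
  · dsimp only [Iso.symm_hom]
    rw [← h.distrib.one_left, assoc, o22_hom_inv, comp_id]
  · have := key (f := tailIso c Z) (g := L Z) (p := V ◁ o12 H.comul Z) (q := o12 H.comul (V ⊗ Z))
      (by simpa [L] using h.codistrib.comul_right Z)
    simpa [L] using this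
  · have := key (f := tailIso c Z) (g := R Z) (p := o12 H.comul (V ⊗ Z)) (q := V ◁ o12 H.comul Z)
      (by simpa [R] using h.codistrib.comul_left Z)
    simpa [R] using this
  · dsimp only [Iso.symm_hom]
    rw [← h.codistrib.counit_right, ← assoc, o22_inv_hom, id_comp]
  · dsimp only [Iso.symm_hom]
    rw [← h.codistrib.counit_left, ← assoc, o22_inv_hom, id_comp]
  · have := congrArg Iso.inv (Iso.ext (α := L Z ≪≫ tailIso c (V ⊗ Z))
      (β := whiskerLeftIso V (tailIso c Z) ≪≫ L Z) (by simpa [L] using h.braid Z))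
    simpa [L] using this

/-- The opposite of a bialgebra is a bialgebra for the inverse braiding. -/
theorem IsBialgebra.op (hc : IsBraidedBy c H) (h : IsBialgebra c.hom H) :
    IsBialgebra c.inv ⟨H.one, c.inv ≫ H.mul, H.counit, H.comul⟩ := by
  obtain ⟨⟨ml, mr, ol, or'⟩, ⟨cl, cr, tl, tr⟩, ybe⟩ := hc.inv
  dsimp only [Iso.symm_hom] at ml mr ol or' cl cr tl tr ybe
  rw [isBialgebra_iff, isAlgebra_iff] at h ⊢
  obtain ⟨⟨a1, a2, a3⟩, b, d1, d2, d3, d4⟩ := h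
  have m : ∀ Z, o21 (c.inv ≫ H.mul) Z = o22 c.inv Z ≫ o21 H.mul Z := fun Z => by simp [o21, o22]
  dsimp only
  refine ⟨⟨fun Z => ?_, fun Z => ?_, fun Z => ?_⟩, b, fun Z => ?_, d2, fun Z => ?_, d4⟩
  · rw [m, reassoc_of% or', a2]
  · rw [m, reassoc_of% ol, a1]
  · simp only [m, assoc, whiskerLeft_comp]
    rw [reassoc_of% mr, reassoc_of% ybe, ← a3, reassoc_of% ml]
  · have f2 := wl V (cl Z)
    have f3 := wl V (o22_inv_hom c (V ⊗ Z))
    simp only [whiskerLeft_comp, whiskerLeft_id] at f2 f3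
    simp only [m, assoc, whiskerLeft_comp]
    rw [d1, reassoc_of% cr, reassoc_of% f2, reassoc_of% f3, reassoc_of% cl]
    simp only [nats]
  · simp only [m, assoc]
    rw [d3, reassoc_of% tr, o10_nat]

/-- A bialgebra with the trivial pairing `ε ⊗ ε` is coquasitriangular. -/
theorem IsBialgebra.isCoquasitriangular_trivialPair (hc : IsBraidedBy c H)
    (h : IsBialgebra c.hom H) : IsCoquasitriangular c (trivialPair c H) := by
  have hop := h.op hc
  obtain ⟨-, ⟨-, -, tl, tr⟩, -⟩ := hc
  have h' := h
  rw [isBialgebra_iff, isCoalgebra_iff] at h'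
  obtain ⟨-, ⟨a1, a2, -⟩, d1, d2, d3, d4⟩ := h'
  have hm : (trivialPair c H).barOp c.hom = H := by
    simp [trivialPair, PairData.barOp]
  have e2 := fun Z => wl V (a2 Z)
  have t1 := fun Z => wl V (tl Z)
  have e1 := fun Z => wl V (a1 Z)
  simp only [whiskerLeft_comp, whiskerLeft_id] at e2 t1 e1
  refine ⟨h, hop, ?_, ⟨(trivialPair c H).pairing, ?_, ?_⟩, ?_⟩
  · rw [hm, isBialgebraPairing_iff]
    dsimp only [trivialPair]
    simp only [tail_counit_counit]
    refine ⟨fun Z => ?_, fun Z => ?_, fun Z => ?_, fun Z => ?_⟩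
    · simp only [whiskerLeft_comp, assoc]
      rw [reassoc_of% d3]
      simp only [nats]
      rw [reassoc_of% a1]
    · simp only [whiskerLeft_comp, assoc]
      rw [reassoc_of% a2]
      simp only [nats]
      rw [d3]
    · rw [reassoc_of% d4]
    · rw [o10_nat_assoc, d4, comp_id]
  · refine (tail_convolution_eq_iff _ _ _ _ _).2 fun Z => ?_
    dsimp only [trivialPair]
    simp only [tail_counit_counit, nats, assoc]
    rw [reassoc_of% a1, reassoc_of% tr, reassoc_of% e1]
  · refine (tail_convolution_eq_iff _ _ _ _ _).2 fun Z => ?_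
    dsimp only [trivialPair]
    simp only [tail_counit_counit, nats, assoc]
    rw [reassoc_of% a1, reassoc_of% tr, reassoc_of% e1]
  · have := (tail_quasi_comm_iff c.hom H.comul (trivialPair c H).pairing H.mul H.mul).2 fun Z => ?_
    · simpa [trivialPair] using this
    · dsimp only [trivialPair]
      simp only [tail_counit_counit, whiskerLeft_comp]
      rw [← o21_nat_assoc, reassoc_of% t1]
      simp only [nats, assoc]
      rw [reassoc_of% a2, reassoc_of% a1, reassoc_of% tr, reassoc_of% e1, ← o21_nat, reassoc_of% e2]

end Opposite

section Over
variable {M : Type u} [Category.{v} M] [MonoidalCategory M] [BraidedCategory M]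
variable {A V : M} {δ : V ⟶ V ⊗ A} {B : PairData A} {H : BialgData V} {c : V ⊗ V ≅ V ⊗ V}

theorem comoduleBraiding_braid (hB : IsCoquasitriangular (β_ A A) B) (hV : IsOComodule B δ) (Z : M) :
    let d := Ψ[B] δ δ
    o22 d (V ⊗ Z) ≫ V ◁ o22 d Z ≫ o22 d (V ⊗ Z) = V ◁ o22 d Z ≫ o22 d (V ⊗ Z) ≫ V ◁ o22 d Z := by
  intro d
  have e := comoduleBraiding_natural (isComoduleHom_id δ)
    (comoduleBraiding_isComoduleHom hB hV hV.tail) B.pairing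
  rw [comoduleBraiding_tensor_right hB.pairing hV.tail.coassoc] at e
  have e' := (V ◁ (α_ V V Z).inv ≫ (α_ _ _ _).inv) ≫= whisk e Z =≫ ((α_ _ _ _).hom ≫ (α_ _ _ _).hom)
  rw [tensor_def, tensor_def] at e'
  simp only [fans, cancels, nats, r22 (Ψ[B] δ δ)] at e'
  exact e'.symm

/-- The comodule braiding of a coalgebra with itself is a distributive law of coalgebras. -/
theorem IsBialgebraOver.isCodistrib_braiding (h : IsBialgebraOver B δ H) :
    IsCodistrib (Ψ[B] δ δ) H.counit H.comul H.counit H.comul where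
  comul_left Z := by
    have e := comoduleBraiding_natural h.comul_hom (isComoduleHom_id δ) B.pairing
    rw [comoduleBraiding_tensor_left h.base.pairing h.comodule.tail.coassoc h.comodule] at e
    have e' := (α_ V V _).inv ≫= whisk e Z =≫ ((α_ _ _ _).hom ≫ V ◁ (α_ _ _ _).hom)
    rw [tensor_def, tensor_def] at e'
    simp only [fans, cancels, nats, r22 (Ψ[B] δ δ), r12 H.comul] at e'
    exact e'.symm
  comul_right Z := by
    have e := comoduleBraiding_natural (isComoduleHom_id δ) h.comul_hom B.pairing
    rw [comoduleBraiding_tensor_right h.base.pairing h.comodule.tail.coassoc] at e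
    have e' := (α_ V V _).inv ≫= whisk e Z =≫ ((α_ _ _ _).hom ≫ (α_ _ _ _).hom)
    rw [tensor_def, tensor_def] at e'
    simp only [fans, cancels, nats, r22 (Ψ[B] δ δ), r12 H.comul] at e'
    exact e'.symm
  counit_left Z := by
    have e := comoduleBraiding_natural h.counit_hom (isComoduleHom_id δ) B.pairing
    rw [comoduleBraiding_unit_left h.base.pairing h.comodule.tail.counit] at e
    have e' := (α_ V V _).inv ≫= whisk e Z =≫ ((α_ _ _ _).hom ≫ V ◁ (λ_ _).hom)
    rw [tensor_def, tensor_def] at e'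
    simp only [fans, cancels, nats, r22 (Ψ[B] δ δ), r10 H.counit] at e'
    exact e'.symm
  counit_right Z := by
    have e := comoduleBraiding_natural (isComoduleHom_id δ) h.counit_hom B.pairing
    rw [comoduleBraiding_unit_right h.base.pairing h.comodule.tail.counit] at e
    have e' := (α_ V V _).inv ≫= whisk e Z =≫ ((α_ _ _ _).hom ≫ (λ_ _).hom)
    rw [tensor_def, tensor_def] at e'
    simp only [fans, cancels, nats, r22 (Ψ[B] δ δ), r10 H.counit] at e'
    exact e'.symm

theorem IsBialgebraOver.isBraidedBy (h : IsBialgebraOver B δ H)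
    (hc : c.hom = Ψ[B] δ δ) : IsBraidedBy c H := by
  refine ⟨?_, ?_, ?_⟩ <;> rw [hc]
  · exact h.comoduleAlgebra.isDistrib h.base h.comodule h.comoduleAlgebra
  · exact h.isCodistrib_braiding
  · exact comoduleBraiding_braid h.base h.comodule

/-- A Hopf algebra in the category of comodules, paired with its opposite by `ε ⊗ ε`, is a dual
quantum braided group. -/
theorem IsBialgebraOver.isDualQuantumBraidedGroupOver (h : IsBialgebraOver B δ H)
    (hc : c.hom = Ψ[B] δ δ)
    (hS : ∃ S, IsComoduleHom δ δ S ∧ IsAntipode H S)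
    (hS' : ∃ S, IsComoduleHom δ δ S ∧ IsAntipode (trivialPair c H).bar S) :
    IsDualQuantumBraidedGroupOver B δ c (trivialPair c H) := by
  have hb : IsComoduleHom (tensorCoaction B δ δ) (tensorCoaction B δ δ) c.hom :=
    hc ▸ comoduleBraiding_isComoduleHom h.base h.comodule h.comodule.tail
  exact ⟨h.comodule, hb, h.one_hom, h.mul_hom, hb.inv.comp h.mul_hom, h.counit_hom, h.comul_hom,
    (h.counit_hom.tensorHom h.counit_hom).comp (isComoduleHom_leftUnitor h.base.bialgebra.algebra),
    (hc ▸ h.bialgebra).isCoquasitriangular_trivialPair (h.isBraidedBy hc), hS, hS'⟩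

end Over

/-! ### Tensor algebras in the category of comodules -/

section TensorAlgebra
variable {M : Type u} [Category.{v} M] [MonoidalCategory M] [BraidedCategory M] [Preadditive M]
  [MonoidalPreadditive M]
variable {A T E : M} {δ : T ⟶ T ⊗ A} {δE : E ⟶ E ⊗ A} {i : E ⟶ T} {B : PairData A} {H : BialgData T}

/-- Multiplication by a generator on the right. -/
def genMul (i : E ⟶ T) (μ : T ⊗ T ⟶ T) : T ⊗ E ⟶ T := T ◁ i ≫ μ

/-- Multiplication by `1 ⊗ x + x ⊗ 1`, for a generator `x`, in the braided tensor square of `T`. -/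
def primMul (t : T ⊗ E ⟶ E ⊗ T) (m : T ⊗ E ⟶ T) : (T ⊗ T) ⊗ E ⟶ T ⊗ T :=
  (α_ T T E).hom ≫ T ◁ m + (α_ T T E).hom ≫ T ◁ t ≫ (α_ T E T).inv ≫ m ▷ T

/-- `T` behaves like the tensor algebra of `E` in the category of comodules: a morphism out of
`W ⊗ T` is determined by its restriction to `W` and by how it changes when a generator is
multiplied to `T` from the right (`ext`), and the generators are primitive. -/
structure IsTensorBialgebra (B : PairData A) (δ : T ⟶ T ⊗ A) (δE : E ⟶ E ⊗ A) (i : E ⟶ T)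
    (H : BialgData T) : Prop where
  base : IsCoquasitriangular (β_ A A) B
  comodule : IsOComodule B δ
  comodule_gen : IsTailComodule B.toBialgData δE
  alg : IsComoduleAlgebra B δ H.one H.mul
  gen_hom : IsComoduleHom δE δ i
  ext : ∀ {W Z : M} {f g : W ⊗ T ⟶ Z} (s : Z ⊗ E ⟶ Z), W ◁ H.one ≫ f = W ◁ H.one ≫ g →
    W ◁ genMul i H.mul ≫ f = (α_ W T E).inv ≫ f ▷ E ≫ s →
    W ◁ genMul i H.mul ≫ g = (α_ W T E).inv ≫ g ▷ E ≫ s → f = g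
  one_counit : H.one ≫ H.counit = 𝟙 _
  one_comul : H.one ≫ H.comul = (λ_ (𝟙_ M)).inv ≫ (H.one ⊗ₘ H.one)
  gen_counit : genMul i H.mul ≫ H.counit = 0
  gen_comul : genMul i H.mul ≫ H.comul =
    H.comul ▷ E ≫ primMul (Ψ[B] δ δE) (genMul i H.mul)

theorem IsComoduleHom.add {V W : M} {δV : V ⟶ V ⊗ A} {δW : W ⟶ W ⊗ A} {f g : V ⟶ W}
    (hf : IsComoduleHom δV δW f) (hg : IsComoduleHom δV δW g) : IsComoduleHom δV δW (f + g) := by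
  simp only [IsComoduleHom] at *
  rw [Preadditive.add_comp, hf, hg, MonoidalPreadditive.add_whiskerRight, Preadditive.comp_add]

theorem IsComoduleHom.whiskerLeft {X V W : M} {δX : X ⟶ X ⊗ A} {δV : V ⟶ V ⊗ A} {δW : W ⟶ W ⊗ A}
    {f : V ⟶ W} (hf : IsComoduleHom δV δW f) :
    IsComoduleHom (tensorCoaction B δX δV) (tensorCoaction B δX δW) (X ◁ f) := by
  rw [← id_tensorHom]; exact (isComoduleHom_id _).tensorHom hf

theorem IsComoduleHom.whiskerRight {X V W : M} {δX : X ⟶ X ⊗ A} {δV : V ⟶ V ⊗ A} {δW : W ⟶ W ⊗ A}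
    {f : V ⟶ W} (hf : IsComoduleHom δV δW f) :
    IsComoduleHom (tensorCoaction B δV δX) (tensorCoaction B δW δX) (f ▷ X) := by
  rw [← tensorHom_id]; exact hf.tensorHom (isComoduleHom_id _)

section Naturality
variable {U V W X : M} {δU : U ⟶ U ⊗ A} {δV : V ⟶ V ⊗ A} {δW : W ⟶ W ⊗ A} {δX : X ⟶ X ⊗ A}

theorem braiding_natural_left21 (hB : IsCoquasitriangular (β_ A A) B) (hV : IsOComodule B δV)
    (hX : IsTailComodule B.toBialgData δX) {f : U ⊗ V ⟶ W}
    (hf : IsComoduleHom (tensorCoaction B δU δV) δW f) (Z : M) :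
    o21 f (X ⊗ Z) ≫ o22 (Ψ[B] δW δX) Z =
      U ◁ o22 (Ψ[B] δV δX) Z ≫
        o22 (Ψ[B] δU δX) (V ⊗ Z) ≫ X ◁ o21 f Z := by
  have e := comoduleBraiding_natural hf (isComoduleHom_id δX) B.pairing
  rw [comoduleBraiding_tensor_left hB.pairing hX.coassoc hV] at e
  have e' := ((α_ U V _).inv ≫ (α_ _ _ _).inv) ≫= whisk e Z =≫ (α_ _ _ _).hom
  rw [tensor_def, tensor_def] at e'
  simp only [fans, cancels, nats, r22 (Ψ[B] δU δX),
    r22 (Ψ[B] δV δX), r22 (Ψ[B] δW δX), r21 f] at e'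
  exact e'

theorem braiding_natural_right21 (hB : IsCoquasitriangular (β_ A A) B)
    (hX : IsTailComodule B.toBialgData δX) {f : U ⊗ V ⟶ W}
    (hf : IsComoduleHom (tensorCoaction B δU δV) δW f) (Z : M) :
    X ◁ o21 f Z ≫ o22 (Ψ[B] δX δW) Z =
      o22 (Ψ[B] δX δU) (V ⊗ Z) ≫
        U ◁ o22 (Ψ[B] δX δV) Z ≫ o21 f (X ⊗ Z) := by
  have e := comoduleBraiding_natural (isComoduleHom_id δX) hf B.pairing
  rw [comoduleBraiding_tensor_right hB.pairing hX.coassoc] at e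
  have e' := (X ◁ (α_ U V Z).inv ≫ (α_ _ _ _).inv) ≫= whisk e Z =≫ (α_ _ _ _).hom
  rw [tensor_def, tensor_def] at e'
  simp only [fans, cancels, nats, r22 (Ψ[B] δX δU),
    r22 (Ψ[B] δX δV), r22 (Ψ[B] δX δW), r21 f] at e'
  exact e'

theorem braiding_natural_left12 (hB : IsCoquasitriangular (β_ A A) B) (hV : IsOComodule B δV)
    (hX : IsTailComodule B.toBialgData δX) {f : W ⟶ U ⊗ V}
    (hf : IsComoduleHom δW (tensorCoaction B δU δV) f) (Z : M) :
    o22 (Ψ[B] δW δX) Z ≫ X ◁ o12 f Z = o12 f (X ⊗ Z) ≫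
      U ◁ o22 (Ψ[B] δV δX) Z ≫
        o22 (Ψ[B] δU δX) (V ⊗ Z) := by
  have e := comoduleBraiding_natural hf (isComoduleHom_id δX) B.pairing
  rw [comoduleBraiding_tensor_left hB.pairing hX.coassoc hV] at e
  have e' := (α_ _ _ _).inv ≫= whisk e Z =≫ ((α_ _ _ _).hom ≫ X ◁ (α_ _ _ _).hom)
  rw [tensor_def, tensor_def] at e'
  simp only [fans, cancels, nats, r22 (Ψ[B] δU δX),
    r22 (Ψ[B] δV δX), r22 (Ψ[B] δW δX), r12 f] at e'
  exact e'.symm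

theorem braiding_natural_left10 (hB : IsCoquasitriangular (β_ A A) B)
    (hX : IsTailComodule B.toBialgData δX) {f : W ⟶ 𝟙_ M}
    (hf : IsComoduleHom δW (unitCoaction B) f) (Z : M) :
    o22 (Ψ[B] δW δX) Z ≫ X ◁ o10 f Z = o10 f (X ⊗ Z) := by
  have e := comoduleBraiding_natural hf (isComoduleHom_id δX) B.pairing
  rw [comoduleBraiding_unit_left hB.pairing hX.counit] at e
  have e' := (α_ _ _ _).inv ≫= whisk e Z =≫ ((α_ _ _ _).hom ≫ X ◁ (λ_ _).hom)
  rw [tensor_def, tensor_def] at e'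
  simp only [fans, cancels, nats, r22 (Ψ[B] δW δX), r10 f] at e'
  exact e'.symm

theorem braiding_natural_left01 (hB : IsCoquasitriangular (β_ A A) B)
    (hX : IsTailComodule B.toBialgData δX) {f : 𝟙_ M ⟶ W}
    (hf : IsComoduleHom (unitCoaction B) δW f) (Z : M) :
    o01 f (X ⊗ Z) ≫ o22 (Ψ[B] δW δX) Z = X ◁ o01 f Z := by
  have e := comoduleBraiding_natural hf (isComoduleHom_id δX) B.pairing
  rw [comoduleBraiding_unit_left hB.pairing hX.counit] at e
  have e' := ((λ_ _).inv ≫ (α_ _ _ _).inv) ≫= whisk e Z =≫ (α_ _ _ _).hom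
  rw [tensor_def, tensor_def] at e'
  simp only [fans, cancels, nats, r22 (Ψ[B] δW δX), r01 f] at e'
  exact e'

theorem braiding_natural_w {f : U ⟶ V} {g : W ⟶ X} (hf : IsComoduleHom δU δV f)
    (hg : IsComoduleHom δW δX g) (ρ : A ⊗ A ⟶ 𝟙_ M) (Z : M) :
    U ◁ g ▷ Z ≫ f ▷ (X ⊗ Z) ≫ o22 (comoduleBraiding ρ δV δX) Z =
      o22 (comoduleBraiding ρ δU δW) Z ≫ g ▷ (U ⊗ Z) ≫ X ◁ f ▷ Z := by
  have e := comoduleBraiding_natural hf hg ρ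
  rw [← tail_tensorHom_comp, e, tail_comp_tensorHom]

end Naturality

namespace IsTensorBialgebra
theorem ext' (h : IsTensorBialgebra B δ δE i H) {Z : M} {f g : T ⟶ Z} (s : Z ⊗ E ⟶ Z) (h0 : H.one ≫ f = H.one ≫ g)
    (hf : genMul i H.mul ≫ f = f ▷ E ≫ s) (hg : genMul i H.mul ≫ g = g ▷ E ≫ s) : f = g := by
  have := h.ext (W := 𝟙_ M) (f := (λ_ T).hom ≫ f) (g := (λ_ T).hom ≫ g) s (by simp [h0])
    (by simp [hf]) (by simp [hg])
  exact (cancel_epi _).1 this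

theorem genMul_hom (h : IsTensorBialgebra B δ δE i H) : IsComoduleHom (tensorCoaction B δ δE) δ (genMul i H.mul) :=
  h.gen_hom.whiskerLeft.comp h.alg.mul_hom

theorem primMul_hom (h : IsTensorBialgebra B δ δE i H) : IsComoduleHom (tensorCoaction B (tensorCoaction B δ δ) δE)
    (tensorCoaction B δ δ) (primMul (Ψ[B] δ δE) (genMul i H.mul)) := by
  have ha := fun {U V W : M} {δU : U ⟶ U ⊗ A} {δV : V ⟶ V ⊗ A} {δW : W ⟶ W ⊗ A} =>
    isComoduleHom_associator (B := B) (δU := δU) (δV := δV) (δW := δW) h.base.bialgebra.algebra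
  exact (ha.comp h.genMul_hom.whiskerLeft).add (ha.comp
    ((comoduleBraiding_isComoduleHom h.base h.comodule h.comodule_gen).whiskerLeft.comp
      (ha.inv.comp h.genMul_hom.whiskerRight)))

theorem one_whiskerRight_comul (h : IsTensorBialgebra B δ δE i H) (Z : M) : o01 H.one Z ≫ o12 H.comul Z = o01 H.one Z ≫ T ◁ o01 H.one Z :=
  (tail_one_comul_iff _ _).1 h.one_comul Z

theorem genMul_comul_tail (h : IsTensorBialgebra B δ δE i H) (Z : M) : o21 (genMul i H.mul) Z ≫ o12 H.comul Z =
    o12 H.comul (E ⊗ Z) ≫ (T ◁ o21 (genMul i H.mul) Z +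
      T ◁ o22 (Ψ[B] δ δE) Z ≫ o21 (genMul i H.mul) (T ⊗ Z)) := by
  have := (α_ _ _ _).inv ≫= whisk h.gen_comul Z =≫ (α_ _ _ _).hom
  rw [primMul] at this
  simp only [MonoidalPreadditive.add_whiskerRight, Preadditive.comp_add, Preadditive.add_comp, fans,
    cancels, r12 H.comul, r21 (genMul i H.mul), r22 (Ψ[B] δ δE)] at this
  simpa only [Preadditive.comp_add, nats] using this

theorem genMul_counit_tail (h : IsTensorBialgebra B δ δE i H) (Z : M) : o21 (genMul i H.mul) Z ≫ o10 H.counit Z = 0 := by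
  have := (α_ _ _ _).inv ≫= whisk h.gen_counit Z =≫ (λ_ _).hom
  simpa [o21, o10] using this

theorem mul_genMul_tail (h : IsTensorBialgebra B δ δE i H) (Z : M) : T ◁ o21 (genMul i H.mul) Z ≫ o21 H.mul Z =
    o21 H.mul (E ⊗ Z) ≫ o21 (genMul i H.mul) Z := by
  have e : ∀ Z, o21 (genMul i H.mul) Z = T ◁ i ▷ Z ≫ o21 H.mul Z := by
    intro Z; simp [genMul, o21]
  have := ((isAlgebra_iff _ _).1 h.alg.algebra).2.2 Z
  rw [e, whiskerLeft_comp, assoc, ← this, o21_nat_assoc]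

theorem mul_genMul (h : IsTensorBialgebra B δ δE i H) :
    T ◁ genMul i H.mul ≫ H.mul = (α_ T T E).inv ≫ H.mul ▷ E ≫ genMul i H.mul := by
  refine tail_ext fun Z => ?_
  have := h.mul_genMul_tail Z
  rw [← cancel_epi (α_ _ _ _).inv, ← cancel_epi (T ◁ (α_ _ _ _).inv)]
  simpa only [fans, cancels, nats, r21 (genMul i H.mul), r21 H.mul] using this

/-- The counit is a morphism of comodules. -/
theorem counit_hom (h : IsTensorBialgebra B δ δE i H) : IsComoduleHom δ (unitCoaction B) H.counit := by
  have e := h.genMul_hom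
  rw [IsComoduleHom] at e
  refine h.ext' 0 ?_ ?_ ?_
  · have := h.alg.one_hom
    rw [IsComoduleHom] at this
    rw [reassoc_of% h.one_counit, reassoc_of% this, ← comp_whiskerRight, h.one_counit]
    simp
  · rw [reassoc_of% h.gen_counit]; simp
  · rw [reassoc_of% e, ← comp_whiskerRight, h.gen_counit]; simp

/-- The coproduct is a morphism of comodules. -/
theorem comul_hom (h : IsTensorBialgebra B δ δE i H) :
    IsComoduleHom δ (tensorCoaction B δ δ) H.comul := by
  have e := h.genMul_hom
  have e2 := h.primMul_hom
  have e3 : IsComoduleHom (unitCoaction B) (tensorCoaction B δ δ) (H.one ≫ H.comul) := by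
    rw [h.one_comul]
    exact (IsComoduleHom.inv (isComoduleHom_leftUnitor h.base.bialgebra.algebra)).comp
      (h.alg.one_hom.tensorHom h.alg.one_hom)
  have e4 := h.alg.one_hom
  rw [IsComoduleHom] at e e2 e3 e4
  refine h.ext' (((T ⊗ T) ⊗ A) ◁ δE ≫ middle (T ⊗ T) (β_ A E).hom A ≫ _ ◁ B.mul ≫
    primMul (Ψ[B] δ δE) (genMul i H.mul) ▷ A) ?_ ?_ ?_
  · rw [← assoc, e3, reassoc_of% e4, comp_whiskerRight]
  · rw [reassoc_of% h.gen_comul, e2, tensorCoaction, tensor_def]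
    simp only [comp_whiskerRight, assoc]
  · rw [reassoc_of% e, ← comp_whiskerRight, h.gen_comul, tensorCoaction, tensor_def]
    simp only [comp_whiskerRight, assoc]
    refine congrArg (δ ▷ E ≫ ·) ?_
    refine tail_ext fun Z => ?_
    simp only [fans, cancels, tail_middle, nats]

theorem mul_comul (h : IsTensorBialgebra B δ δE i H) :
    H.mul ≫ H.comul = (H.comul ⊗ₘ H.comul) ≫ middle T (Ψ[B] δ δ) T ≫
      (H.mul ⊗ₘ H.mul) := by
  have hd := h.alg.isDistrib h.base h.comodule h.alg
  obtain ⟨a1, a2, a3⟩ := (isAlgebra_iff _ _).1 h.alg.algebra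
  set c := Ψ[B] δ δ with hc
  set t := Ψ[B] δ δE with ht
  set m := genMul i H.mul with hm
  have hg : ∀ Z, o22 ((H.comul ⊗ₘ H.comul) ≫ middle T c T ≫ (H.mul ⊗ₘ H.mul)) Z =
      o12 H.comul (T ⊗ Z) ≫ T ◁ T ◁ o12 H.comul Z ≫ T ◁ o22 c (T ⊗ Z) ≫
        o21 H.mul (T ⊗ T ⊗ Z) ≫ T ◁ o21 H.mul Z := by
    intro Z
    rw [o22, tensor_def H.mul]
    simp only [tensorHom_def', fans, cancels, tail_middle, nats, r12 H.comul, r21 H.mul]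
  refine h.ext (primMul t m) ?_ ?_ ?_
  · refine tail_ext fun Z => ?_
    rw [← cancel_epi (α_ _ _ _).inv, ← cancel_epi (T ◁ (λ_ _).inv), ← cancel_mono (α_ _ _ _).hom]
    simp only [comp_whiskerRight, fans, cancels, r21 H.mul, r12 H.comul, r01 H.one,
      r22 ((H.comul ⊗ₘ H.comul) ≫ middle T c T ≫ (H.mul ⊗ₘ H.mul)), hg]
    have e1 := wl T (wl T ((h.one_whiskerRight_comul Z).trans (o01_nat _ _).symm))
    have e2 := wl T (hd.one_left (T ⊗ Z))
    have e4 := wl T (a2 Z)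
    simp only [whiskerLeft_comp, whiskerLeft_id] at e1 e2 e4
    rw [reassoc_of% a2]
    simp only [nats]
    rw [reassoc_of% e1, reassoc_of% e2, reassoc_of% a2, e4, comp_id]
  · rw [reassoc_of% h.mul_genMul, h.gen_comul, comp_whiskerRight, assoc]
  · refine tail_ext fun Z => ?_
    rw [← cancel_epi (α_ _ _ _).inv, ← cancel_epi (T ◁ (α_ _ _ _).inv), ← cancel_mono (α_ _ _ _).hom,
      primMul, ← hm]
    simp only [MonoidalPreadditive.add_whiskerRight, Preadditive.comp_add, Preadditive.add_comp, fans,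
      cancels, r21 m, r22 t, r22 ((H.comul ⊗ₘ H.comul) ≫ middle T c T ≫ (H.mul ⊗ₘ H.mul)), hg]
    simp only [nats, cancels, cancels4]
    have f1 := wl T (wl T (h.genMul_comul_tail Z))
    have f2 := wl T (h.mul_genMul_tail Z)
    have f3 := wl T (braiding_natural_right21 h.base h.comodule.tail h.genMul_hom (T ⊗ Z))
    have f4 := wl T (braiding_natural_left21 h.base h.comodule h.comodule_gen h.alg.mul_hom Z)
    have f5 := h.mul_genMul_tail (T ⊗ T ⊗ Z)
    rw [← hm] at f1 f2 f3 f5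
    rw [← hc, ← ht] at f3
    rw [← ht] at f1 f4
    simp only [whiskerLeft_comp, MonoidalPreadditive.whiskerLeft_add, Preadditive.comp_add] at f1 f2 f3 f4
    rw [reassoc_of% f1, reassoc_of% f4]
    simp only [Preadditive.add_comp, Preadditive.comp_add, assoc, nats]
    congr 1
    · rw [f2]
    · rw [reassoc_of% f3]
      simp only [nats]
      rw [reassoc_of% f5]
      simp only [nats]

theorem coassoc (h : IsTensorBialgebra B δ δE i H) :
    H.comul ≫ T ◁ H.comul = H.comul ≫ H.comul ▷ T ≫ (α_ T T T).hom := by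
  have g1 := h.genMul_comul_tail
  have g2 := braiding_natural_left12 h.base h.comodule h.comodule_gen h.comul_hom
  set t := Ψ[B] δ δE with ht
  set m := genMul i H.mul with hm
  have f1 := fun Z => wl T (g1 Z)
  have f2 := fun Z => wl T (g2 Z)
  simp only [whiskerLeft_comp, MonoidalPreadditive.whiskerLeft_add, Preadditive.comp_add] at f1 f2 g1
  refine h.ext' ((α_ T (T ⊗ T) E).hom ≫ T ◁ primMul t m + (α_ T (T ⊗ T) E).hom ≫
    T ◁ ((α_ T T E).hom ≫ T ◁ t ≫ (α_ T E T).inv ≫ t ▷ T ≫ (α_ E T T).hom) ≫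
      (α_ T E (T ⊗ T)).inv ≫ m ▷ (T ⊗ T)) ?_ ?_ ?_
  · refine tail_ext fun Z => ?_
    have e := h.one_whiskerRight_comul
    have e' := wl T (e Z)
    simp only [whiskerLeft_comp] at e'
    rw [← cancel_epi (λ_ _).inv, ← cancel_mono (α_ _ _ _).hom, ← cancel_mono (T ◁ (α_ _ _ _).hom)]
    simp only [comp_whiskerRight, fans, cancels, r12 H.comul, r01 H.one]
    rw [reassoc_of% e, e', reassoc_of% e, o12_nat, reassoc_of% e]
  · rw [← hm]
    refine tail_ext fun Z => ?_
    rw [← cancel_epi (α_ _ _ _).inv, ← cancel_mono (α_ _ _ _).hom, ← cancel_mono (T ◁ (α_ _ _ _).hom)]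
    simp only [primMul, MonoidalPreadditive.whiskerLeft_add, MonoidalPreadditive.add_whiskerRight, Preadditive.comp_add, Preadditive.add_comp, fans,
      cancels, r12 H.comul, r21 m, r22 t]
    rw [reassoc_of% g1]
    simp only [Preadditive.add_comp, Preadditive.comp_add, assoc, f1]
    simp only [← o21_nat, ← o21_nat_assoc, f2, reassoc_of% f2]
    simp only [nats, Preadditive.add_comp, Preadditive.comp_add, assoc, cancels]
  · rw [← hm]
    refine tail_ext fun Z => ?_
    rw [← cancel_epi (α_ _ _ _).inv, ← cancel_mono (α_ _ _ _).hom, ← cancel_mono (T ◁ (α_ _ _ _).hom)]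
    simp only [primMul, MonoidalPreadditive.whiskerLeft_add, MonoidalPreadditive.add_whiskerRight, Preadditive.comp_add, Preadditive.add_comp, fans,
      cancels, r12 H.comul, r21 m, r22 t]
    rw [reassoc_of% g1]
    simp only [Preadditive.add_comp, Preadditive.comp_add, assoc, g1, nats, cancels]
    simp only [add_assoc]

theorem counit_comul (h : IsTensorBialgebra B δ δE i H) :
    H.comul ≫ H.counit ▷ T = (λ_ T).inv := by
  have g1 := h.genMul_comul_tail
  have g2 := h.genMul_counit_tail
  rw [← cancel_mono (λ_ T).hom]
  refine h.ext' (genMul i H.mul) ?_ ?_ ?_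
  · rw [assoc, reassoc_of% h.one_comul, tensorHom_def', assoc, ← comp_whiskerRight_assoc,
      h.one_counit]
    simp [unitors_equal, unitors_inv_equal]
  · refine tail_ext fun Z => ?_
    rw [← cancel_epi (α_ _ _ _).inv]
    simp only [fans, cancels, r12 H.comul, r21 (genMul i H.mul), r10 H.counit, assoc]
    rw [reassoc_of% g1]
    simp only [Preadditive.comp_add, Preadditive.add_comp, assoc, g2, nats, comp_zero, add_zero, cancels]
  · simp

theorem comul_counit (h : IsTensorBialgebra B δ δE i H) :
    H.comul ≫ T ◁ H.counit = (ρ_ T).inv := by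
  have g1 := h.genMul_comul_tail
  have g2 := fun Z => wl T (h.genMul_counit_tail Z)
  have g3 := fun Z => wl T (braiding_natural_left10 h.base h.comodule_gen h.counit_hom Z)
  simp only [whiskerLeft_comp, MonoidalPreadditive.whiskerLeft_zero] at g2 g3
  rw [← cancel_mono (ρ_ T).hom]
  refine h.ext' (genMul i H.mul) ?_ ?_ ?_
  · rw [assoc, reassoc_of% h.one_comul, tensor_def, assoc, ← whiskerLeft_comp_assoc,
      h.one_counit]
    simp [unitors_equal, unitors_inv_equal]
  · refine tail_ext fun Z => ?_
    rw [← cancel_epi (α_ _ _ _).inv]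
    simp only [fans, cancels, r12 H.comul, r21 (genMul i H.mul), r10 H.counit, assoc]
    rw [reassoc_of% g1]
    simp only [Preadditive.comp_add, Preadditive.add_comp, assoc, g2, comp_zero, zero_add]
    simp only [← o21_nat, g3, reassoc_of% g3]
  · simp

theorem mul_counit (h : IsTensorBialgebra B δ δE i H) :
    H.mul ≫ H.counit = (H.counit ⊗ₘ H.counit) ≫ (λ_ (𝟙_ M)).hom := by
  obtain ⟨a1, a2, a3⟩ := (isAlgebra_iff _ _).1 h.alg.algebra
  refine h.ext 0 ?_ ?_ ?_
  · rw [reassoc_of% (tail_mul_one_iff _ _).2 a2, tensorHom_def', assoc,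
      ← whiskerLeft_comp_assoc, h.one_counit]
    simp [unitors_equal, unitors_inv_equal]
  · rw [reassoc_of% h.mul_genMul, h.gen_counit]
    simp
  · rw [tensorHom_def', assoc, ← whiskerLeft_comp_assoc, h.gen_counit]
    simp

/-- The tensor algebra of a comodule, with primitive generators, is a bialgebra in the category of
comodules. -/
theorem isBialgebraOver (h : IsTensorBialgebra B δ δE i H) : IsBialgebraOver B δ H where
  base := h.base
  comodule := h.comodule
  one_hom := h.alg.one_hom
  mul_hom := h.alg.mul_hom
  counit_hom := h.counit_hom
  comul_hom := h.comul_hom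
  bialgebra := ⟨h.alg.algebra, ⟨⟨H.counit, H.comul, h.counit_comul, h.comul_counit, h.coassoc⟩, rfl, rfl⟩,
    h.mul_comul, h.one_comul, h.mul_counit, h.one_counit⟩

theorem one_genMul (h : IsTensorBialgebra B δ δE i H) (Z : M) :
    o01 H.one (E ⊗ Z) ≫ o21 (genMul i H.mul) Z = i ▷ Z := by
  have e : o21 (genMul i H.mul) Z = T ◁ i ▷ Z ≫ o21 H.mul Z := by simp [genMul, o21]
  rw [e, ← o01_nat_assoc, ((isAlgebra_iff _ _).1 h.alg.algebra).1, comp_id]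

/-- The generators are primitive. -/
theorem gen_comul_tail (h : IsTensorBialgebra B δ δE i H) (Z : M) :
    i ▷ Z ≫ o12 H.comul Z = i ▷ Z ≫ o01 H.one (T ⊗ Z) + i ▷ Z ≫ T ◁ o01 H.one Z := by
  have e2 := wl T (h.one_genMul Z)
  have e3 := wl T (braiding_natural_left01 h.base h.comodule_gen h.alg.one_hom Z)
  simp only [whiskerLeft_comp] at e2 e3
  conv_lhs => rw [← h.one_genMul, assoc, h.genMul_comul_tail, reassoc_of% h.one_whiskerRight_comul]
  simp only [Preadditive.comp_add, e2]
  rw [reassoc_of% e3, o21_nat, reassoc_of% h.one_genMul, ← o01_nat]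

/-- A combination of products of two generators which is killed by `c + 1` is primitive. -/
theorem relation_comul (h : IsTensorBialgebra B δ δE i H) {K : M} {κ : K ⟶ E ⊗ E}
    (hκ : κ ≫ Ψ[B] δE δE + κ = 0) :
    (κ ≫ (i ⊗ₘ i) ≫ H.mul) ≫ H.comul = (κ ≫ (i ⊗ₘ i) ≫ H.mul) ≫ (λ_ T).inv ≫ H.one ▷ T +
      (κ ≫ (i ⊗ₘ i) ≫ H.mul) ≫ (ρ_ T).inv ≫ T ◁ H.one := by
  have e0 : (i ⊗ₘ i) ≫ H.mul = i ▷ E ≫ genMul i H.mul := by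
    rw [tensor_def, genMul, assoc]
  refine tail_ext fun Z => ?_
  rw [e0, ← cancel_mono (α_ _ _ _).hom]
  have k1 : o12 κ Z ≫ o22 (Ψ[B] δE δE) Z ≫ E ◁ i ▷ Z ≫ i ▷ (T ⊗ Z) +
      o12 κ Z ≫ E ◁ i ▷ Z ≫ i ▷ (T ⊗ Z) = 0 := by
    have := whisk hκ Z =≫ ((α_ _ _ _).hom ≫ E ◁ i ▷ Z ≫ i ▷ (T ⊗ Z))
    simpa only [MonoidalPreadditive.add_whiskerRight, MonoidalPreadditive.zero_whiskerRight, zero_comp,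
      Preadditive.add_comp, fans, cancels, r12 κ, r22 (Ψ[B] δE δE)] using this
  have e4 := braiding_natural_w h.gen_hom (isComoduleHom_id δE) B.pairing Z
  simp only [id_whiskerRight, whiskerLeft_id, id_comp] at e4
  have t2 : i ▷ (E ⊗ Z) ≫ o01 H.one (T ⊗ E ⊗ Z) ≫ T ◁ o22 (Ψ[B] δ δE) Z ≫
      o21 (genMul i H.mul) (T ⊗ Z) = o22 (Ψ[B] δE δE) Z ≫ E ◁ i ▷ Z ≫ i ▷ (T ⊗ Z) := by
    rw [← o01_nat_assoc, h.one_genMul, reassoc_of% e4]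
  have t3 : i ▷ (E ⊗ Z) ≫ T ◁ o01 H.one (E ⊗ Z) ≫ T ◁ o21 (genMul i H.mul) Z =
      E ◁ i ▷ Z ≫ i ▷ (T ⊗ Z) := by
    rw [← whiskerLeft_comp, h.one_genMul, whisker_exchange]
  have t4 : T ◁ o01 H.one (E ⊗ Z) ≫ T ◁ o22 (Ψ[B] δ δE) Z ≫
      o21 (genMul i H.mul) (T ⊗ Z) = o21 (genMul i H.mul) Z ≫ T ◁ o01 H.one Z := by
    rw [← whiskerLeft_comp_assoc, braiding_natural_left01 h.base h.comodule_gen h.alg.one_hom Z, o21_nat]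
  simp only [MonoidalPreadditive.add_whiskerRight, Preadditive.add_comp, fans, cancels,
    r12 κ, r21 (genMul i H.mul), r12 H.comul, r01 H.one]
  rw [h.genMul_comul_tail, reassoc_of% h.gen_comul_tail]
  simp only [Preadditive.add_comp, Preadditive.comp_add, assoc, t2, t3, t4]
  rw [eq_neg_of_add_eq_zero_left k1, o01_nat]
  abel

end IsTensorBialgebra
end TensorAlgebra

/-! ### Quotients of tensor algebras -/

section Quotient
variable {M : Type u} [Category.{v} M] [MonoidalCategory M] [BraidedCategory M]
variable {A T V : M} {δ : T ⟶ T ⊗ A} {δV : V ⟶ V ⊗ A} {B : PairData A} {H : BialgData T}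
  {HV : BialgData V} {π : T ⟶ V}

theorem epi_right_of_whiskers (hπ : ∀ W W' : M, Epi (W ◁ π ▷ W')) (W : M) : Epi (π ▷ W) := by
  have := hπ (𝟙_ M) W
  rw [id_whiskerLeft] at this
  have h1 : Epi ((λ_ (T ⊗ W)).hom ≫ π ▷ W) := by
    have e : (λ_ (T ⊗ W)).hom ≫ π ▷ W = ((λ_ (T ⊗ W)).hom ≫ π ▷ W ≫ (λ_ (V ⊗ W)).inv) ≫ (λ_ (V ⊗ W)).hom := by simp
    rw [e]; exact epi_comp _ _
  exact epi_of_epi (λ_ (T ⊗ W)).hom _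

theorem epi_left_of_whiskers (hπ : ∀ W W' : M, Epi (W ◁ π ▷ W')) (W : M) : Epi (W ◁ π) := by
  have := epi_right_of_whiskers hπ W
  have e : W ◁ π = (β_ W T).hom ≫ π ▷ W ≫ (β_ W V).inv := by simp
  rw [e]; infer_instance

theorem epi_of_whiskers (hπ : ∀ W W' : M, Epi (W ◁ π ▷ W')) : Epi π := by
  have := epi_right_of_whiskers hπ (𝟙_ M)
  rw [whiskerRight_id] at this
  have h1 : Epi ((ρ_ T).hom ≫ π) := by
    have e : (ρ_ T).hom ≫ π = ((ρ_ T).hom ≫ π ≫ (ρ_ V).inv) ≫ (ρ_ V).hom := by simp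
    rw [e]; exact epi_comp _ _
  exact epi_of_epi (ρ_ T).hom _

theorem IsComoduleHom.of_epi {X Y Z : M} {δX : X ⟶ X ⊗ A} {δY : Y ⟶ Y ⊗ A} {δZ : Z ⟶ Z ⊗ A}
    {p : X ⟶ Y} {f : Y ⟶ Z} (hp : IsComoduleHom δX δY p) (hf : IsComoduleHom δX δZ (p ≫ f)) [Epi p] :
    IsComoduleHom δY δZ f := by
  rw [IsComoduleHom] at *
  rw [← cancel_epi p, ← assoc, hf, comp_whiskerRight, reassoc_of% hp]

theorem middle_natural {c : T ⊗ T ⟶ T ⊗ T} {c' : V ⊗ V ⟶ V ⊗ V} (h : (π ⊗ₘ π) ≫ c' = c ≫ (π ⊗ₘ π)) :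
    ((π ⊗ₘ π) ⊗ₘ (π ⊗ₘ π)) ≫ middle V c' V = middle T c T ≫ ((π ⊗ₘ π) ⊗ₘ (π ⊗ₘ π)) := by
  simp only [middle, assoc, associator_naturality_assoc]
  rw [← associator_inv_naturality, ← id_tensorHom, ← id_tensorHom, tensorHom_comp_tensorHom_assoc,
    tensorHom_comp_tensorHom_assoc, comp_id, id_comp, associator_inv_naturality_assoc,
    ← tensorHom_id, tensorHom_comp_tensorHom_assoc, h, comp_id]
  simp only [assoc, ← associator_naturality, ← tensorHom_id, tensorHom_comp_tensorHom_assoc, id_comp]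

/-- The image of a comodule under a surjective morphism. -/
theorem IsOComodule.quotient (hT : IsOComodule B δ) (hπ : ∀ W W' : M, Epi (W ◁ π ▷ W'))
    (hδ : IsComoduleHom δ δV π) : IsOComodule B δV := by
  have := epi_of_whiskers hπ
  have := epi_left_of_whiskers hπ A
  rw [IsComoduleHom] at hδ
  refine ⟨?_, ?_, ?_⟩
  · rw [← cancel_epi π, reassoc_of% hδ, ← whisker_exchange, reassoc_of% hT.coassoc, reassoc_of% hδ,
      ← comp_whiskerRight_assoc, hδ]
    simp
  · rw [← cancel_epi π, reassoc_of% hδ, ← whisker_exchange, reassoc_of% hT.counit]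
    simp
  · have e1 : ∀ (ψ : A ⊗ T ⟶ T ⊗ A) (ψ' : A ⊗ V ⟶ V ⊗ A) (μ : A ⊗ A ⟶ A),
        A ◁ π ≫ ψ' = ψ ≫ π ▷ A →
        A ◁ π ≫ A ◁ δV ≫ (α_ A V A).inv ≫ ψ' ▷ A ≫ (α_ V A A).hom ≫ V ◁ μ =
          (A ◁ δ ≫ (α_ A T A).inv ≫ ψ ▷ A ≫ (α_ T A A).hom ≫ T ◁ μ) ≫ π ▷ A := by
      intro ψ ψ' μ hψ
      rw [← whiskerLeft_comp_assoc, hδ, whiskerLeft_comp_assoc, associator_inv_naturality_middle_assoc,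
        ← comp_whiskerRight_assoc, hψ, comp_whiskerRight_assoc]
      simp [whisker_exchange]
    rw [← cancel_epi (A ◁ π), e1 (β_ A T).hom _ _ (by simp), e1 (β_ T A).inv _ _ (by simp), hT.central]

/-- The axioms of a bialgebra pass to the quotient, since tensor powers of `π` are epimorphisms. -/
theorem IsBialgebraOver.quotient (h : IsBialgebraOver B δ H) (hπ : ∀ W W' : M, Epi (W ◁ π ▷ W'))
    (hδ : IsComoduleHom δ δV π) (hH : IsBialgHom π H HV) : IsBialgebraOver B δV HV := by
  have i1 := epi_of_whiskers hπ
  have i2 : ∀ W, Epi (π ▷ W) := epi_right_of_whiskers hπ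
  have i3 : ∀ W, Epi (W ◁ π) := epi_left_of_whiskers hπ
  have i4 : Epi (π ⊗ₘ π) := by rw [tensor_def]; infer_instance
  have i5 : Epi ((π ⊗ₘ π) ⊗ₘ π) := by
    rw [tensor_def, tensor_def, comp_whiskerRight]
    have : Epi (V ◁ π ▷ T) := hπ V T
    have : Epi (π ▷ T ▷ T) := by rw [whiskerRight_whiskerRight]; infer_instance
    have : Epi ((V ◁ π) ▷ T) := by rw [whisker_assoc]; infer_instance
    infer_instance
  have hV := h.comodule.quotient hπ hδ
  obtain ⟨ha, hb, hc, hd⟩ := hH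
  have one_hom : IsComoduleHom (unitCoaction B) δV HV.one := ha ▸ h.one_hom.comp hδ
  have mul_hom : IsComoduleHom (tensorCoaction B δV δV) δV HV.mul :=
    (hδ.tensorHom hδ).of_epi (hb ▸ h.mul_hom.comp hδ)
  have counit_hom : IsComoduleHom δV (unitCoaction B) HV.counit :=
    hδ.of_epi (hc.symm ▸ h.counit_hom)
  have comul_hom : IsComoduleHom δV (tensorCoaction B δV δV) HV.comul :=
    hδ.of_epi (hd.symm ▸ h.comul_hom.comp (hδ.tensorHom hδ))
  refine ⟨h.base, hV, one_hom, mul_hom, counit_hom, comul_hom, ?_⟩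
  obtain ⟨m1, m2, m3⟩ : (H.one ▷ T ≫ H.mul = (λ_ T).hom) ∧ (T ◁ H.one ≫ H.mul = (ρ_ T).hom) ∧
      H.mul ▷ T ≫ H.mul = (α_ T T T).hom ≫ T ◁ H.mul ≫ H.mul := by
    obtain ⟨k, k1, k2⟩ := h.bialgebra.algebra
    rw [← k1, ← k2]; exact ⟨k.one_mul, k.mul_one, k.mul_assoc⟩
  obtain ⟨c1, c2, c3⟩ : (H.comul ≫ H.counit ▷ T = (λ_ T).inv) ∧ (H.comul ≫ T ◁ H.counit = (ρ_ T).inv) ∧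
      H.comul ≫ T ◁ H.comul = H.comul ≫ H.comul ▷ T ≫ (α_ T T T).hom := by
    obtain ⟨k, k1, k2⟩ := h.bialgebra.coalgebra
    rw [← k1, ← k2]; exact ⟨k.counit_comul, k.comul_counit, k.comul_assoc⟩
  refine ⟨⟨⟨HV.one, HV.mul, ?_, ?_, ?_⟩, rfl, rfl⟩, ⟨⟨HV.counit, HV.comul, ?_, ?_, ?_⟩, rfl, rfl⟩, ?_, ?_, ?_, ?_⟩
  · rw [← cancel_epi (𝟙_ M ◁ π), whisker_exchange_assoc, ← ha, comp_whiskerRight_assoc,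
      ← MonoidalCategory.tensorHom_def_assoc, ← hb, reassoc_of% m1]
    simp
  · rw [← cancel_epi (π ▷ 𝟙_ M), ← whisker_exchange_assoc, ← ha, whiskerLeft_comp_assoc,
      ← tensorHom_def'_assoc, ← hb, reassoc_of% m2]
    simp
  · rw [← cancel_epi ((π ⊗ₘ π) ⊗ₘ π), associator_naturality_assoc, ← tensorHom_id, ← id_tensorHom,
      tensorHom_comp_tensorHom_assoc, tensorHom_comp_tensorHom_assoc, ← hb, comp_id]
    have e1 : ((H.mul ≫ π) ⊗ₘ π) = H.mul ▷ T ≫ (π ⊗ₘ π) := by rw [← tensorHom_id, tensorHom_comp_tensorHom, id_comp]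
    have e2 : (π ⊗ₘ (H.mul ≫ π)) = T ◁ H.mul ≫ (π ⊗ₘ π) := by rw [← id_tensorHom, tensorHom_comp_tensorHom, id_comp]
    rw [e1, e2, assoc, assoc, ← hb, reassoc_of% m3]
  · rw [← cancel_epi π, reassoc_of% hd, ← tensorHom_id, tensorHom_comp_tensorHom, hc, comp_id]
    have e1 : (H.counit ⊗ₘ π) = H.counit ▷ T ≫ 𝟙_ M ◁ π := tensor_def _ _
    rw [e1, reassoc_of% c1]; simp
  · rw [← cancel_epi π, reassoc_of% hd, ← id_tensorHom, tensorHom_comp_tensorHom, hc, comp_id]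
    have e1 : (π ⊗ₘ H.counit) = T ◁ H.counit ≫ π ▷ 𝟙_ M := tensorHom_def' _ _
    rw [e1, reassoc_of% c2]; simp
  · rw [← cancel_epi π, reassoc_of% hd, reassoc_of% hd, ← id_tensorHom, ← tensorHom_id,
      tensorHom_comp_tensorHom, tensorHom_comp_tensorHom_assoc, hd, comp_id]
    have e1 : (π ⊗ₘ (H.comul ≫ (π ⊗ₘ π))) = T ◁ H.comul ≫ (π ⊗ₘ (π ⊗ₘ π)) := by rw [← id_tensorHom, tensorHom_comp_tensorHom, id_comp]
    have e2 : ((H.comul ≫ (π ⊗ₘ π)) ⊗ₘ π) = H.comul ▷ T ≫ ((π ⊗ₘ π) ⊗ₘ π) := by rw [← tensorHom_id, tensorHom_comp_tensorHom, id_comp]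
    rw [e1, e2, assoc, associator_naturality, reassoc_of% c3]
  · have e1 := middle_natural (comoduleBraiding_natural hδ hδ B.pairing)
    rw [← cancel_epi (π ⊗ₘ π), ← reassoc_of% hb, hd, reassoc_of% h.bialgebra.mul_comul,
      tensorHom_comp_tensorHom_assoc, hd]
    simp only [← tensorHom_comp_tensorHom, assoc]
    rw [reassoc_of% e1, tensorHom_comp_tensorHom, tensorHom_comp_tensorHom, ← hb]
  · rw [← ha, assoc, hd, reassoc_of% h.bialgebra.one_comul, tensorHom_comp_tensorHom]
  · rw [← cancel_epi (π ⊗ₘ π), ← reassoc_of% hb, hc, h.bialgebra.mul_counit, tensorHom_comp_tensorHom_assoc, hc]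
  · rw [← ha, assoc, hc, h.bialgebra.one_counit]

/-- The map `x ⊗ r ⊗ y ↦ x k(r) y`, whose image is the ideal generated by `k`. -/
def idealMap {K : M} (μ : T ⊗ T ⟶ T) (k : K ⟶ T) : (T ⊗ K) ⊗ T ⟶ T := (T ◁ k ≫ μ) ▷ T ≫ μ

/-- `π` exhibits `V` as the quotient of the algebra `T` by the ideal generated by `k`, also after
tensoring with any object. -/
structure IsIdealQuotient {K : M} [Limits.HasZeroMorphisms M] (μ : T ⊗ T ⟶ T) (k : K ⟶ T) (π : T ⟶ V) : Prop where
  epi : ∀ W W' : M, Epi (W ◁ π ▷ W')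
  kill : idealMap μ k ≫ π = 0
  desc : ∀ {W Z : M} (f : T ⊗ W ⟶ Z), idealMap μ k ▷ W ≫ f = 0 → ∃ g, π ▷ W ≫ g = f

section Existence
variable [Preadditive M] [MonoidalPreadditive M] {E K : M} {δE : E ⟶ E ⊗ A} {δK : K ⟶ K ⊗ A}
  {i : E ⟶ T} {κ : K ⟶ E ⊗ E} {k : K ⟶ T} {μ : T ⊗ T ⟶ T}

theorem IsIdealQuotient.desc_id (hq : IsIdealQuotient μ k π) {Z : M} (f : T ⟶ Z)
    (hf : idealMap μ k ≫ f = 0) : ∃ g, π ≫ g = f := by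
  obtain ⟨g, hg⟩ := hq.desc (W := 𝟙_ M) ((ρ_ T).hom ≫ f) (by
    rw [rightUnitor_naturality_assoc, hf, comp_zero])
  exact ⟨(ρ_ V).inv ≫ g, by rw [rightUnitor_inv_naturality_assoc, hg, Iso.inv_hom_id_assoc]⟩

theorem IsIdealQuotient.desc_left (hq : IsIdealQuotient μ k π) {W Z : M} (f : W ⊗ T ⟶ Z)
    (hf : W ◁ idealMap μ k ≫ f = 0) : ∃ g, W ◁ π ≫ g = f := by
  obtain ⟨g, hg⟩ := hq.desc (W := W) ((β_ W T).inv ≫ f) (by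
    rw [← cancel_epi (β_ W _).hom, ← BraidedCategory.braiding_naturality_right_assoc,
      Iso.hom_inv_id_assoc, hf, comp_zero])
  exact ⟨(β_ W V).hom ≫ g, by rw [BraidedCategory.braiding_naturality_right_assoc, hg, Iso.hom_inv_id_assoc]⟩

theorem idealMap_mul_right (ha : μ ▷ T ≫ μ = (α_ T T T).hom ≫ T ◁ μ ≫ μ) :
    idealMap μ k ▷ T ≫ μ = (α_ (T ⊗ K) T T).hom ≫ (T ⊗ K) ◁ μ ≫ idealMap μ k := by
  rw [idealMap, comp_whiskerRight, assoc, ha, associator_naturality_left_assoc,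
    whisker_exchange_assoc]

theorem idealMap_mul_left (ha : μ ▷ T ≫ μ = (α_ T T T).hom ≫ T ◁ μ ≫ μ) :
    T ◁ idealMap μ k ≫ μ = (α_ T (T ⊗ K) T).inv ≫ ((α_ T T K).inv ≫ μ ▷ K) ▷ T ≫ idealMap μ k := by
  have e : T ◁ (T ◁ k ≫ μ) ≫ μ = (α_ T T K).inv ≫ μ ▷ K ≫ T ◁ k ≫ μ := by
    rw [← whisker_exchange_assoc, ha, whiskerLeft_comp, assoc, associator_naturality_right_assoc,
      Iso.inv_hom_id_assoc]
  have e2 : T ◁ μ ≫ μ = (α_ T T T).inv ≫ μ ▷ T ≫ μ := by rw [ha, Iso.inv_hom_id_assoc]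
  rw [idealMap, whiskerLeft_comp, assoc, e2, associator_inv_naturality_middle_assoc,
    ← comp_whiskerRight_assoc, e, ← comp_whiskerRight_assoc, assoc]

/-- The quotient of the tensor algebra by the ideal generated by relations that are killed by
`c + 1` is a bialgebra in the category of comodules. -/
theorem IsTensorBialgebra.exists_quotient (h : IsTensorBialgebra B δ δE i H)
    (hq : IsIdealQuotient H.mul (κ ≫ (i ⊗ₘ i) ≫ H.mul) π) (hκ : κ ≫ Ψ[B] δE δE + κ = 0)
    (hK : IsComoduleHom δK (tensorCoaction B δE δE) κ) :
    ∃ (HV : BialgData V) (δV : V ⟶ V ⊗ A), IsBialgHom π H HV ∧ IsComoduleHom δ δV π ∧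
      IsBialgebraOver B δV HV := by
  have hT := h.isBialgebraOver
  have j1 := epi_of_whiskers hq.epi
  have j2 : ∀ W, Epi (π ▷ W) := epi_right_of_whiskers hq.epi
  have hrel := h.relation_comul hκ
  have hkε : (κ ≫ (i ⊗ₘ i) ≫ H.mul) ≫ H.counit = 0 := by
    have e0 : (i ⊗ₘ i) ≫ H.mul = i ▷ E ≫ genMul i H.mul := by
      rw [tensor_def, genMul, assoc]
    rw [e0, assoc, assoc, h.gen_counit, comp_zero, comp_zero]
  have hkc : IsComoduleHom δK δ (κ ≫ (i ⊗ₘ i) ≫ H.mul) :=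
    hK.comp ((h.gen_hom.tensorHom h.gen_hom).comp h.alg.mul_hom)
  generalize κ ≫ (i ⊗ₘ i) ≫ H.mul = k at hq hrel hkε hkc
  have hgen : IsComoduleHom (tensorCoaction B (tensorCoaction B δ δK) δ) δ (idealMap H.mul k) :=
    (hkc.whiskerLeft.comp h.alg.mul_hom).whiskerRight.comp h.alg.mul_hom
  obtain ⟨m1, m2, m3⟩ : (H.one ▷ T ≫ H.mul = (λ_ T).hom) ∧ (T ◁ H.one ≫ H.mul = (ρ_ T).hom) ∧
      H.mul ▷ T ≫ H.mul = (α_ T T T).hom ≫ T ◁ H.mul ≫ H.mul := by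
    obtain ⟨k, k1, k2⟩ := hT.bialgebra.algebra
    rw [← k1, ← k2]; exact ⟨k.one_mul, k.mul_one, k.mul_assoc⟩
  have hkπ : k ≫ π = 0 := by
    have e : k = (λ_ K).inv ≫ H.one ▷ K ≫ (ρ_ (T ⊗ K)).inv ≫ (T ⊗ K) ◁ H.one ≫ idealMap H.mul k := by
      rw [idealMap, whisker_exchange_assoc, m2, rightUnitor_naturality, Iso.inv_hom_id_assoc,
        ← whisker_exchange_assoc, m1]
      simp
    rw [e]; simp only [assoc, hq.kill, comp_zero]
  -- The ideal map is equivariant, so the coaction descends.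
  obtain ⟨δV, hδ⟩ := hq.desc_id (δ ≫ π ▷ A) (by
    rw [IsComoduleHom] at hgen
    rw [reassoc_of% hgen, ← comp_whiskerRight, hq.kill, MonoidalPreadditive.zero_whiskerRight, comp_zero])
  have hπ : IsComoduleHom δ δV π := hδ
  have hV := h.comodule.quotient hq.epi hπ
  -- The product descends in one factor after the other.
  obtain ⟨ν', hν'⟩ := hq.desc (H.mul ≫ π) (by
    rw [reassoc_of% (idealMap_mul_right (k := k) m3), hq.kill, comp_zero, comp_zero])
  obtain ⟨ν, hν⟩ := hq.desc_left ν' (by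
    rw [← cancel_epi (π ▷ ((T ⊗ K) ⊗ T)), ← whisker_exchange_assoc, hν',
      reassoc_of% (idealMap_mul_left (k := k) m3), hq.kill, comp_zero, comp_zero, comp_zero])
  have hmul : H.mul ≫ π = (π ⊗ₘ π) ≫ ν := by
    rw [tensor_def, assoc, hν, hν']
  -- An algebra map that vanishes on the relations vanishes on the ideal.
  have kill : ∀ {Z : M} (φ : T ⟶ Z) (τ : Z ⊗ Z ⟶ Z), H.mul ≫ φ = (φ ⊗ₘ φ) ≫ τ → k ≫ φ = 0 →
      idealMap H.mul k ≫ φ = 0 := by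
    intro Z φ τ hφ hk
    have e : (T ◁ k ≫ H.mul) ≫ φ = 0 := by
      rw [assoc, hφ, tensorHom_def', assoc, ← whiskerLeft_comp_assoc, hk,
        MonoidalPreadditive.whiskerLeft_zero, zero_comp]
    rw [idealMap, assoc, hφ, tensor_def, assoc, ← comp_whiskerRight_assoc, e,
      MonoidalPreadditive.zero_whiskerRight, zero_comp]
  obtain ⟨ε, hε⟩ := hq.desc_id H.counit (kill _ _ hT.bialgebra.mul_counit hkε)
  obtain ⟨D, hD⟩ := hq.desc_id (H.comul ≫ (π ⊗ₘ π)) (by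
    refine kill _ (middle V (Ψ[B] δV δV) V ≫ (ν ⊗ₘ ν)) ?_ ?_
    · have e1 := middle_natural (comoduleBraiding_natural hπ hπ B.pairing)
      rw [reassoc_of% hT.bialgebra.mul_comul]
      simp only [← tensorHom_comp_tensorHom, assoc]
      rw [reassoc_of% e1, tensorHom_comp_tensorHom, tensorHom_comp_tensorHom, hmul]
    -- The relations are primitive, hence vanish in `V ⊗ V`.
    · rw [← assoc, hrel, Preadditive.add_comp, assoc, assoc, assoc, assoc]
      have e1 : k ≫ (λ_ T).inv ≫ H.one ▷ T ≫ (π ⊗ₘ π) = 0 := by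
        rw [tensorHom_def', ← whisker_exchange_assoc, ← leftUnitor_inv_naturality_assoc,
          reassoc_of% hkπ, zero_comp]
      have e2 : k ≫ (ρ_ T).inv ≫ T ◁ H.one ≫ (π ⊗ₘ π) = 0 := by
        rw [tensor_def, whisker_exchange_assoc, ← rightUnitor_inv_naturality_assoc,
          reassoc_of% hkπ, zero_comp]
      rw [e1, e2, add_zero])
  have hH : IsBialgHom π H ⟨H.one ≫ π, ν, ε, D⟩ := ⟨rfl, hmul, hε, hD⟩
  exact ⟨_, δV, hH, hπ, hT.quotient hq.epi hπ hH⟩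
end Existence
end Quotient

noncomputable section
/-! ### Antipodes of connected graded bialgebras -/

section Geometric
variable {M : Type u} [Category.{v} M] [MonoidalCategory M] [BraidedCategory M] [Preadditive M] [MonoidalPreadditive M]
  {A V : M} {B : PairData A} {δ : V ⟶ V ⊗ A} {H : BialgData V}

/-- The convolution powers `N k` of `ηε - id` and the partial sums `P n` of the geometric series, which invert
the identity up to `N n`. -/
theorem exists_geometric (halg : IsAlgebra H.one H.mul) (hco : IsCoalgebra H.counit H.comul)
    (h1 : IsComoduleHom (unitCoaction B) δ H.one) (hm : IsComoduleHom (tensorCoaction B δ δ) δ H.mul)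
    (hε : IsComoduleHom δ (unitCoaction B) H.counit) (hΔ : IsComoduleHom δ (tensorCoaction B δ δ) H.comul) :
    ∃ N P : ℕ → (V ⟶ V), (∀ k, N (k + 1) = H.comul ≫ (H.counit ≫ H.one - 𝟙 V) ▷ V ≫ V ◁ N k ≫ H.mul) ∧
      (∀ n, P (n + 1) = P n + N n) ∧ (∀ n, H.comul ≫ P n ▷ V ≫ H.mul = H.counit ≫ H.one - N n) ∧
      (∀ n, H.comul ≫ V ◁ P n ≫ H.mul = H.counit ≫ H.one - N n) ∧ ∀ n, IsComoduleHom δ δ (P n) := by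
  obtain ⟨_, k1, k2⟩ := halg
  obtain ⟨_, k3, k4⟩ := hco
  let N0 : Conv V V := (H.counit ≫ H.one - 𝟙 V : V ⟶ V)
  let N : ℕ → (V ⟶ V) := fun k => (N0 ^ k : Conv V V)
  have n0 : N 0 = H.counit ≫ H.one := by rw [← k1, ← k3]; exact pow_zero N0
  have nl : ∀ k, N (k + 1) = H.comul ≫ (H.counit ≫ H.one - 𝟙 V) ▷ V ≫ V ◁ N k ≫ H.mul := fun k => by
    rw [← k2, ← k4]; exact pow_succ' N0 k
  have nr : ∀ k, N (k + 1) = H.comul ≫ N k ▷ V ≫ V ◁ (H.counit ≫ H.one - 𝟙 V) ≫ H.mul := fun k => by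
    rw [← k2, ← k4]; exact pow_succ N0 k
  have ul : ∀ f : V ⟶ V, H.comul ≫ (H.counit ≫ H.one) ▷ V ≫ V ◁ f ≫ H.mul = f := fun f => by
    rw [← k1, ← k2, ← k3, ← k4]; exact one_mul (M := Conv V V) f
  have ur : ∀ f : V ⟶ V, H.comul ≫ f ▷ V ≫ V ◁ (H.counit ≫ H.one) ≫ H.mul = f := fun f => by
    rw [← k1, ← k2, ← k3, ← k4]; exact mul_one (M := Conv V V) f
  have sub1 : ∀ f g : V ⟶ V, (f - g) ▷ V = f ▷ V - g ▷ V := fun f g => (tensorRight V).map_sub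
  have sub2 : ∀ f g : V ⟶ V, V ◁ (f - g) = V ◁ f - V ◁ g := fun f g => (tensorLeft V).map_sub
  -- `id = ηε - (ηε - id)`, so convolution with `id` telescopes the series.
  have il : ∀ k, H.comul ≫ V ◁ N k ≫ H.mul = N k - N (k + 1) := fun k => by
    rw [nl, sub1, Preadditive.sub_comp, Preadditive.comp_sub, ul, id_whiskerRight, id_comp, sub_sub_cancel]
  have ir : ∀ k, H.comul ≫ N k ▷ V ≫ H.mul = N k - N (k + 1) := fun k => by
    rw [nr, sub2, Preadditive.sub_comp, Preadditive.comp_sub, Preadditive.comp_sub, ur, whiskerLeft_id,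
      id_comp, sub_sub_cancel]
  have hu : IsComoduleHom δ δ (H.counit ≫ H.one - 𝟙 V) := by
    have e := hε.comp h1
    simp only [IsComoduleHom] at e ⊢
    have sub3 : ∀ f g : V ⟶ V, (f - g) ▷ A = f ▷ A - g ▷ A := fun f g => (tensorRight A).map_sub
    rw [Preadditive.sub_comp, e, sub3, Preadditive.comp_sub, id_whiskerRight, id_comp, comp_id]
  have hN : ∀ k, IsComoduleHom δ δ (N k) := by
    intro k
    induction k with
    | zero => rw [n0]; exact hε.comp h1
    | succ k ih => rw [nl]; exact hΔ.comp (hu.whiskerRight.comp (ih.whiskerLeft.comp hm))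
  refine ⟨N, fun n => ∑ k ∈ Finset.range n, N k, nl, fun n => Finset.sum_range_succ _ _, fun n => ?_, fun n => ?_, fun n => ?_⟩
  · induction n with
    | zero => simp [n0, MonoidalPreadditive.zero_whiskerRight]
    | succ n ih =>
      simp only [Finset.sum_range_succ, MonoidalPreadditive.add_whiskerRight, Preadditive.add_comp, Preadditive.comp_add] at ih ⊢
      rw [ih, ir]; abel
  · induction n with
    | zero => simp [n0, MonoidalPreadditive.whiskerLeft_zero]
    | succ n ih =>
      simp only [Finset.sum_range_succ, MonoidalPreadditive.whiskerLeft_add, Preadditive.add_comp, Preadditive.comp_add] at ih ⊢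
      rw [ih, il]; abel
  · induction n with
    | zero => simp [IsComoduleHom, MonoidalPreadditive.zero_whiskerRight]
    | succ n ih =>
      simp only [Finset.sum_range_succ] at ih ⊢
      exact ih.add (hN n)
end Geometric

section Graded
variable {C : Type u} [Category.{v} C] [Preadditive C]

/-- Morphisms of graded spaces as families of rows. -/
def grHomEquiv (A B : Gr C) : (A ⟶ B) ≃ ∀ i, Gr.Row (A.obj i) B where
  toFun f := f.row
  invFun r := Gr.Hom.mk r
  left_inv _ := rfl
  right_inv _ := rfl

/-- Morphisms of graded spaces are added entrywise. -/
instance grHomGroup (A B : Gr C) : AddCommGroup (A ⟶ B) := (grHomEquiv A B).addCommGroup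

instance grPreadditive : Preadditive (Gr C) where
  add_comp _ _ _ f f' g := Gr.hom_ext fun i => map_add (Gr.post g) (f.row i) (f'.row i)
  comp_add A B D f g g' := Gr.hom_ext fun i => by
    change Gr.post (g + g') (f.row i) = Gr.post g (f.row i) + Gr.post g' (f.row i)
    generalize f.row i = r
    induction r using Gr.ind with
    | h0 => simp
    | hadd r s hr hs => rw [map_add, map_add, map_add, hr, hs]; abel
    | hs j φ =>
      rw [Gr.post_single, Gr.post_single, Gr.post_single]
      exact map_add (Gr.pre φ) (g.row j) (g'.row j)

theorem add_row {A B : Gr C} (f g : A ⟶ B) (i : A.ι) : Gr.Hom.row (f + g) i = f.row i + g.row i := rfl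
theorem sub_row {A B : Gr C} (f g : A ⟶ B) (i : A.ι) : Gr.Hom.row (f - g) i = f.row i - g.row i := rfl
theorem zero_row {A B : Gr C} (i : A.ι) : Gr.Hom.row (0 : A ⟶ B) i = 0 := rfl

/-- Only the rows of a matrix in the support of a row contribute to their product. -/
theorem post_congr {P : C} {A B : Gr C} {g g' : A ⟶ B} {r : Gr.Row P A} (h : ∀ j, r j ≠ 0 → g.row j = g'.row j) :
    Gr.post g r = Gr.post g' r := by
  classical
  simp only [Gr.post, Gr.sumHom]
  rw [DFinsupp.sumAddHom_apply, DFinsupp.sumAddHom_apply]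
  refine Finset.sum_congr rfl fun j hj => ?_
  change Gr.pre.flip (g.row j) (r j) = _
  rw [h j (by simpa using hj)]

variable [MonoidalCategory C] [MonoidalPreadditive C]

instance grMonoidalPreadditive : MonoidalPreadditive (Gr C) where
  whiskerLeft_zero {A _ _} := Gr.hom_ext fun p => map_zero (Gr.tensRow (Gr.single p.1 (𝟙 (A.obj p.1))))
  zero_whiskerRight {A _ _} := Gr.hom_ext fun p =>
    DFunLike.congr_fun (map_zero Gr.tensRow) (Gr.single p.2 (𝟙 (A.obj p.2)))
  whiskerLeft_add {A _ _} f g := Gr.hom_ext fun p => map_add (Gr.tensRow (Gr.single p.1 (𝟙 (A.obj p.1)))) (f.row p.2) (g.row p.2)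
  add_whiskerRight {A _ _} f g := Gr.hom_ext fun p =>
    DFunLike.congr_fun (map_add Gr.tensRow (f.row p.1) (g.row p.1)) (Gr.single p.2 (𝟙 (A.obj p.2)))
end Graded

section Antipode
attribute [local instance 10] Gr.monoidalCategoryStruct
variable {C : Type u} [Category.{v} C] [Preadditive C] [MonoidalCategory C] [MonoidalPreadditive C] [BraidedCategory C]

theorem whiskerRight_row {V W A : Gr C} (f : V ⟶ W) (p : V.ι × A.ι) :
    Gr.Hom.row (f ▷ A) p = Gr.tensRow (f.row p.1) (Gr.single p.2 (𝟙 _)) := rfl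
theorem whiskerLeft_row {V W A : Gr C} (f : V ⟶ W) (p : A.ι × V.ι) :
    Gr.Hom.row (A ◁ f) p = Gr.tensRow (Gr.single p.1 (𝟙 _)) (f.row p.2) := rfl

/-- In a graded bialgebra that is trivial in degree `0`, the geometric series for the convolution inverse of
the identity is finite on each component; its sum is an antipode. -/
theorem exists_antipode {A V : Gr C} {B : PairData A} {δ : V ⟶ V ⊗ A} {H : BialgData V} (deg : V.ι → ℕ)
    (halg : IsAlgebra H.one H.mul) (hco : IsCoalgebra H.counit H.comul)
    (h1 : IsComoduleHom (unitCoaction B) δ H.one) (hm : IsComoduleHom (tensorCoaction B δ δ) δ H.mul)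
    (hε : IsComoduleHom δ (unitCoaction B) H.counit) (hΔ : IsComoduleHom δ (tensorCoaction B δ δ) H.comul)
    (dΔ : ∀ v (p : V.ι × V.ι), Gr.Hom.row H.comul v p ≠ 0 → deg p.1 + deg p.2 = deg v)
    (dδ : ∀ v (p : V.ι × A.ι), Gr.Hom.row δ v p ≠ 0 → p.1 = v)
    (d0 : ∀ v, deg v = 0 → Gr.Hom.row (H.counit ≫ H.one) v = Gr.Hom.row (𝟙 V) v) :
    ∃ S, IsComoduleHom δ δ S ∧ IsAntipode H S := by
  obtain ⟨N, P, hN, hP, hl, hr, hh⟩ := exists_geometric halg hco h1 hm hε hΔ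
  -- `N 1` is zero in degree `0`, hence `N k` is zero in degrees below `k`.
  have vanish : ∀ k v, deg v < k → Gr.Hom.row (N k) v = 0 := by
    intro k
    induction k with
    | zero => intro v h; omega
    | succ k ih =>
      intro v h
      rw [hN]
      refine (post_congr (g' := 0) fun p hp => ?_).trans ?_
      · have e := dΔ v p hp
        rw [zero_row, ← whisker_exchange_assoc, ← assoc]
        have z : Gr.Hom.row (V ◁ N k ≫ (H.counit ≫ H.one - 𝟙 V) ▷ V) p = 0 := by
          rw [← tensorHom_def']
          change Gr.tensRow (Gr.Hom.row (H.counit ≫ H.one - 𝟙 V) p.1) ((N k).row p.2) = 0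
          by_cases h0 : deg p.1 = 0
          · rw [sub_row, d0 _ h0, sub_self, map_zero]; rfl
          · rw [ih p.2 (by omega), map_zero]
        rw [Gr.comp_row, z, map_zero]
      · exact congrFun (congrArg Gr.Hom.row (comp_zero (f := H.comul))) v
  -- In degree `d` the series is constant from its partial sum with `d + 1` terms on.
  let S : V ⟶ V := Gr.Hom.mk fun v => (P (deg v + 1)).row v
  have hS : ∀ n v, deg v ≤ n → S.row v = (P (n + 1)).row v := by
    intro n v h
    obtain ⟨k, rfl⟩ := Nat.exists_eq_add_of_le h
    induction k with
    | zero => rfl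
    | succ k ih =>
      rw [ih (Nat.le_add_right _ _), ← Nat.add_assoc (deg v) k 1, hP (deg v + k + 1), add_row,
        vanish _ v (by omega), add_zero]
  -- Comultiplication does not raise degrees, so `S` may be replaced by one partial sum in each row.
  refine ⟨S, Gr.hom_ext fun v => ?_, ⟨Gr.hom_ext fun v => ?_, Gr.hom_ext fun v => ?_⟩⟩
  · have e := congrFun (congrArg Gr.Hom.row (hh (deg v + 1))) v
    refine Eq.trans e (post_congr fun p hp => ?_)
    rw [whiskerRight_row, whiskerRight_row, hS (deg v) p.1 (le_of_eq (congrArg deg (dδ v p hp)))]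
  · have e := congrFun (congrArg Gr.Hom.row (hl (deg v + 1))) v
    rw [sub_row, vanish _ v (Nat.lt_succ_self _), sub_zero] at e
    refine Eq.trans (post_congr fun p hp => ?_) e
    have := dΔ v p hp
    rw [Gr.comp_row, Gr.comp_row, whiskerRight_row, whiskerRight_row, hS (deg v) p.1 (by omega)]
  · have e := congrFun (congrArg Gr.Hom.row (hr (deg v + 1))) v
    rw [sub_row, vanish _ v (Nat.lt_succ_self _), sub_zero] at e
    refine Eq.trans (post_congr fun p hp => ?_) e
    have := dΔ v p hp
    rw [Gr.comp_row, Gr.comp_row, whiskerLeft_row, whiskerLeft_row, hS (deg v) p.2 (by omega)]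
end Antipode
end

noncomputable section
attribute [local instance 10] Gr.monoidalCategoryStruct
/-! ### The tensor algebra as a bialgebra among comodules -/

section Entries
variable {C : Type u} [Category.{v} C] [Preadditive C]

theorem HasEntry.row_comp {A B D : Gr C} {f : A ⟶ B} {i : A.ι} {j : B.ι} {φ : A.obj i ⟶ B.obj j} (hf : HasEntry f i j φ)
    (g : B ⟶ D) : Gr.Hom.row (f ≫ g) i = Gr.pre φ (g.row j) := by
  unfold HasEntry at hf
  rw [Gr.comp_row, hf, Gr.post_single]

theorem HasEntry.unique {A B : Gr C} {f : A ⟶ B} {i : A.ι} {j : B.ι} {φ ψ : A.obj i ⟶ B.obj j} (hf : HasEntry f i j φ)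
    (hf' : HasEntry f i j ψ) : φ = ψ := by
  classical
  exact DFinsupp.single_injective (β := fun k => A.obj i ⟶ B.obj k) (hf.symm.trans hf')
end Entries

section TensorAlgebra
variable {C : Type u} [Category.{v} C] [MonoidalCategory C] [BraidedCategory C] [Abelian C] [MonoidalPreadditive C]
  [∀ Z : C, PreservesFiniteColimits (tensorRight Z)]
  [∀ Z : C, PreservesFiniteColimits (tensorLeft Z)]
  {X Y : C} [ExactPairing X Y] {R : X ⊗ X ⟶ X ⊗ X}

theorem hasEntry_tmul {m n N : ℕ} (h : m + n = N) :
    HasEntry (A := TensorPow X ⊗ TensorPow X) (B := TensorPow X) (tensorData R).mul (m, n) N (tpowIso X h).hom := by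
  subst h
  rw [tpowIso_hom]
  rfl

theorem isAlgebra_tensorData : IsAlgebra (tensorData R).one (tensorData R).mul := by
  refine ⟨⟨(tensorData R).one, (tensorData R).mul, ?_, ?_, ?_⟩, rfl, rfl⟩
  · refine eq_of_hasEntry ?_
    rintro ⟨⟨⟩, n⟩
    have h1 : HasEntry (A := 𝟙_ (Gr C)) (B := TensorPow X) (tensorData R).one () (0 : ℕ) (𝟙 (𝟙_ C)) := rfl
    refine ⟨_, _, (h1.whiskerRight (TensorPow X) n).comp (hasEntry_tmul (Nat.zero_add n)), (hasEntry_left_hom (TensorPow X) n).congr ?_⟩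
    have key : ∀ n : ℕ, (λ_ (tpow X n)).hom = 𝟙 (tpow X 0) ▷ tpow X n ≫ (tpowIso X (Nat.zero_add n)).hom := by
      intro n; rw [tpowIso_unit_left, id_whiskerRight]; exact (id_comp _).symm
    exact key n
  · refine eq_of_hasEntry ?_
    rintro ⟨n, ⟨⟩⟩
    have h1 : HasEntry (A := 𝟙_ (Gr C)) (B := TensorPow X) (tensorData R).one () (0 : ℕ) (𝟙 (𝟙_ C)) := rfl
    refine ⟨_, _, (h1.whiskerLeft (TensorPow X) n).comp (hasEntry_tmul (Nat.add_zero n)), (hasEntry_right_hom (TensorPow X) n).congr ?_⟩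
    have key : ∀ n : ℕ, (ρ_ (tpow X n)).hom = tpow X n ◁ 𝟙 (tpow X 0) ≫ (tpowIso X (Nat.add_zero n)).hom := by
      intro n; rw [tpowIso_unit_right, whiskerLeft_id]; exact (id_comp _).symm
    exact key n
  · refine eq_of_hasEntry ?_
    rintro ⟨⟨l, m⟩, n⟩
    exact ⟨_, _, ((hasEntry_tmul rfl).whiskerRight _ n).comp (hasEntry_tmul rfl),
      ((hasEntry_assoc_hom (TensorPow X) (TensorPow X) (TensorPow X) l m n).comp
        (((hasEntry_tmul rfl).whiskerLeft _ l).comp (hasEntry_tmul (Nat.add_assoc l m n).symm))).congr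
        (tpowIso_assoc rfl rfl rfl _).symm⟩

/-- The object `X` in degree one. -/
def genObj (X : C) : Gr C := ⟨Unit, fun _ => X⟩

/-- `X` as the first tensor power. -/
def onePow (X : C) : X ≅ tpow X 1 := (λ_ X).symm

/-- The inclusion of the generators into the tensor algebra. -/
def genIncl (X : C) : genObj X ⟶ TensorPow X :=
  Gr.ofMap (A := genObj X) (B := TensorPow X) (fun _ => Nat.succ 0) (fun _ => (onePow X).hom)

theorem hasEntry_genMul (n : ℕ) : HasEntry (A := TensorPow X ⊗ genObj X) (B := TensorPow X)
    (genMul (genIncl X) (tensorData R).mul) (n, ()) (n + 1 : ℕ) (𝟙 (tpow X (n + 1))) := by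
  have h1 : HasEntry (A := genObj X) (B := TensorPow X) (genIncl X) () (1 : ℕ) (onePow X).hom := rfl
  refine ((h1.whiskerLeft (TensorPow X) n).comp (hasEntry_tmul (R := R) (rfl : n + 1 = n + 1))).congr ?_
  rw [tpowIso_hom]
  have key : ∀ S : C, S ◁ (λ_ X).inv ≫ (α_ S (𝟙_ C) X).inv ≫ (ρ_ S).hom ▷ X = 𝟙 (S ⊗ X) := by simp
  exact key _

/-- A family of morphisms out of the tensor powers is determined by its value on the unit and by a recursion
along `X^{⊗(n+1)} = X^{⊗n} ⊗ X`. -/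
theorem tensorPow_ext {W Z : Gr C} {f g : W ⊗ TensorPow X ⟶ Z} (s : Z ⊗ genObj X ⟶ Z)
    (h0 : W ◁ (tensorData R).one ≫ f = W ◁ (tensorData R).one ≫ g)
    (hf : W ◁ genMul (genIncl X) (tensorData R).mul ≫ f = (α_ W (TensorPow X) (genObj X)).inv ≫ f ▷ genObj X ≫ s)
    (hg : W ◁ genMul (genIncl X) (tensorData R).mul ≫ g = (α_ W (TensorPow X) (genObj X)).inv ≫ g ▷ genObj X ≫ s) :
    f = g := by
  have id : ∀ {S S' : C} {B : Gr C} (r : Gr.Row (S ⊗ S') B), r = Gr.pre (S ◁ 𝟙 S') r := by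
    intro S S' B r; rw [whiskerLeft_id, Gr.pre_id]
  have key : ∀ (n : ℕ) (w : W.ι), Gr.Hom.row f (w, n) = Gr.Hom.row g (w, n) := by
    intro n w
    induction n with
    | zero =>
      have h1 : HasEntry (A := 𝟙_ (Gr C)) (B := TensorPow X) (tensorData R).one () (0 : ℕ) (𝟙 (𝟙_ C)) := rfl
      have e := congrFun (congrArg Gr.Hom.row h0) (w, ())
      rw [(h1.whiskerLeft W w).row_comp, (h1.whiskerLeft W w).row_comp] at e
      exact (id (S := W.obj w) (S' := tpow X 0) (f.row (w, (0 : ℕ)))).trans (e.trans (id (g.row (w, (0 : ℕ)))).symm)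
    | succ n ih =>
      have ef := congrFun (congrArg Gr.Hom.row hf) (w, (n, ()))
      have eg := congrFun (congrArg Gr.Hom.row hg) (w, (n, ()))
      rw [((hasEntry_genMul n).whiskerLeft W w).row_comp, (hasEntry_assoc_inv W (TensorPow X) (genObj X) w n ()).row_comp] at ef eg
      have e : Gr.Hom.row (f ▷ genObj X ≫ s) ((w, n), ()) = Gr.Hom.row (g ▷ genObj X ≫ s) ((w, n), ()) :=
        congrArg (fun r => Gr.post s (Gr.tensRow r (Gr.single (B := genObj X) () (𝟙 X)))) ih
      exact (id (S := W.obj w) (S' := tpow X (n + 1)) (f.row (w, (n + 1 : ℕ)))).trans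
        ((ef.trans ((congrArg (Gr.pre _) e).trans eg.symm)).trans (id (g.row (w, (n + 1 : ℕ)))).symm)
  exact Gr.hom_ext fun p => key p.2 p.1

theorem tensorData_gen_counit : genMul (genIncl X) (tensorData R).mul ≫ (tensorData R).counit = 0 := by
  refine Gr.hom_ext ?_
  rintro ⟨n, ⟨⟩⟩
  have h1 : HasEntry (A := TensorPow X) (B := 𝟙_ (Gr C)) (tensorData R).counit (Nat.succ n) () 0 := rfl
  refine (((hasEntry_genMul n).comp h1).congr comp_zero).trans (map_zero _)

theorem tensorData_one_comul : (tensorData R).one ≫ (tensorData R).comul =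
    (λ_ (𝟙_ (Gr C))).inv ≫ ((tensorData R).one ⊗ₘ (tensorData R).one) := by
  have h1 : HasEntry (A := 𝟙_ (Gr C)) (B := TensorPow X) (tensorData R).one () (0 : ℕ) (𝟙 (𝟙_ C)) := rfl
  have h2 : HasEntry (A := TensorPow X) (B := TensorPow X ⊗ TensorPow X) (tensorData R).comul (0 : ℕ) ((0 : ℕ), (0 : ℕ))
    (λ_ (𝟙_ C)).inv := rfl
  refine eq_of_hasEntry ?_
  rintro ⟨⟩
  refine ⟨_, _, h1.comp h2, ((hasEntry_left_inv (𝟙_ (Gr C)) ()).comp (h1.tensor h1)).congr ?_⟩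
  have key : (λ_ (𝟙_ C)).inv ≫ (𝟙 (𝟙_ C) ⊗ₘ 𝟙 (𝟙_ C)) = 𝟙 (𝟙_ C) ≫ (λ_ (𝟙_ C)).inv := by simp
  exact key

/-- The recursion that defines the braided binomial coefficients says that the generators are primitive. -/
theorem tensorData_gen_comul {t : TensorPow X ⊗ genObj X ⟶ genObj X ⊗ TensorPow X}
    (ht : ∀ n : ℕ, HasEntry (A := TensorPow X ⊗ genObj X) (B := genObj X ⊗ TensorPow X) t (n, ()) ((), n) (RPowOne R n)) :
    genMul (genIncl X) (tensorData R).mul ≫ (tensorData R).comul =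
      (tensorData R).comul ▷ genObj X ≫ primMul t (genMul (genIncl X) (tensorData R).mul) := by
  have key : ∀ {P : C} (r : Gr.Row P (Gr.tens (TensorPow X) (TensorPow X))),
      Gr.post (primMul t (genMul (genIncl X) (tensorData R).mul))
        (Gr.tensRow r (Gr.single (B := genObj X) () (𝟙 X))) =
      Gr.sumHom (B := Gr.tens (TensorPow X) (TensorPow X)) (fun p =>
        (Gr.single (B := Gr.tens (TensorPow X) (TensorPow X)) (p.1, Nat.succ p.2)).comp putRight +
        (Gr.single (B := Gr.tens (TensorPow X) (TensorPow X)) (Nat.succ p.1, p.2)).comp (putLeft (RPowOne R p.2))) r := by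
    intro P r
    induction r using Gr.ind with
    | h0 => simp
    | hadd r s hr hs => simp only [map_add, AddMonoidHom.add_apply, hr, hs]
    | hs j φ =>
      obtain ⟨a, b⟩ := j
      have e : Gr.tensRow (Gr.single (B := Gr.tens (TensorPow X) (TensorPow X)) (a, b) φ) (Gr.single (B := genObj X) () (𝟙 X)) =
        Gr.single (B := Gr.tens (Gr.tens (TensorPow X) (TensorPow X)) (genObj X)) ((a, b), ()) (Gr.tm φ (𝟙 X)) :=
        Gr.tensRow_single _ _ _ _
      have h1 := (hasEntry_assoc_hom (TensorPow X) (TensorPow X) (genObj X) a b ()).comp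
        ((hasEntry_genMul (R := R) b).whiskerLeft (TensorPow X) a)
      have h2 := (hasEntry_assoc_hom (TensorPow X) (TensorPow X) (genObj X) a b ()).comp (((ht b).whiskerLeft (TensorPow X) a).comp
        ((hasEntry_assoc_inv (TensorPow X) (genObj X) (TensorPow X) a () b).comp
          ((hasEntry_genMul (R := R) a).whiskerRight (TensorPow X) b)))
      have k1 : ∀ {S U V : C} (φ : S ⟶ U ⊗ V), (φ ⊗ₘ 𝟙 X) ≫ (α_ U V X).hom ≫ U ◁ 𝟙 (V ⊗ X) = φ ▷ X ≫ (α_ U V X).hom := by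
        intros; simp
      have k2 : ∀ {S U V : C} (φ : S ⟶ U ⊗ V) (t : V ⊗ X ⟶ X ⊗ V), (φ ⊗ₘ 𝟙 X) ≫ (α_ U V X).hom ≫ U ◁ t ≫ (α_ U X V).inv ≫
        𝟙 (U ⊗ X) ▷ V = φ ▷ X ≫ (α_ U V X).hom ≫ U ◁ t ≫ (α_ U X V).inv := by intros; simp
      refine ((congrArg (Gr.post _) e).trans (Gr.post_single _ _ _)).trans (Eq.trans ?_ (Gr.sumHom_single _ _ _).symm)
      refine (congrArg (Gr.pre _) (congrArg₂ (· + ·) h1 h2)).trans ((map_add (Gr.pre _) _ _).trans ?_)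
      exact congrArg₂ (· + ·) ((Gr.pre_single _ _ _).trans (congrArg _ (k1 φ))) ((Gr.pre_single _ _ _).trans (congrArg _ (k2 φ _)))
  refine Gr.hom_ext ?_
  rintro ⟨n, ⟨⟩⟩
  refine ((hasEntry_genMul (R := R) n).row_comp _).trans ((Gr.pre_id _).trans ?_)
  exact (key (shuffleRow R n)).symm
end TensorAlgebra

/-! ### The coaction on the tensor algebra and on `ker (R + id)` -/

section Rows
variable {C : Type u} [Category.{v} C] [Preadditive C]

theorem single_apply_of_ne {P : C} {B : Gr C} {j k : B.ι} (h : j ≠ k) (φ : P ⟶ B.obj j) : Gr.single j φ k = 0 := by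
  classical
  exact DFinsupp.single_eq_of_ne h.symm

theorem sumHom_apply_eq_zero {P P' : C} {B B' : Gr C} {φ : ∀ j, (P ⟶ B.obj j) →+ Gr.Row P' B'} {r : Gr.Row P B} {k : B'.ι}
    (h : ∀ j, r j ≠ 0 → φ j (r j) k = 0) : Gr.sumHom φ r k = 0 := by
  classical
  rw [Gr.sumHom, DFinsupp.sumAddHom_apply, DFinsupp.sum, DFinsupp.finsetSum_apply]
  exact Finset.sum_eq_zero fun j hj => h j (by simpa using hj)

theorem exists_pre_eq {P P' : C} {B : Gr C} {e : P ⟶ P'} (r : Gr.Row P B) (h : ∀ j, ∃ g, e ≫ g = r j) :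
    ∃ r' : Gr.Row P' B, Gr.pre e r' = r := by
  classical
  choose g hg using h
  refine ⟨∑ j ∈ r.support, Gr.single j (g j), ?_⟩
  rw [map_sum]
  simp only [Gr.pre_single, hg]
  exact DFinsupp.sum_single (f := r)

theorem epi_of_hasEntry {A B : Gr C} {f : A ⟶ B} (h : ∀ j, ∃ (i : A.ι) (φ : A.obj i ⟶ B.obj j), HasEntry f i j φ ∧ Epi φ) :
    Epi f where
  left_cancellation g g' e := Gr.hom_ext fun j => DFinsupp.ext fun k => by
    obtain ⟨i, φ, hφ, _⟩ := h j
    have e' := DFunLike.congr_fun (congrFun (congrArg Gr.Hom.row e) i) k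
    rw [hφ.row_comp, hφ.row_comp, pre_apply, pre_apply] at e'
    exact (cancel_epi φ).1 e'
end Rows

section Powers
variable {C : Type u} [Category.{v} C] [MonoidalCategory C] {X : C} (R : X ⊗ X ⟶ X ⊗ X)

theorem RPow_one_right (n : ℕ) : RPowOne R n ≫ (onePow X).hom ▷ tpow X n = tpow X n ◁ (onePow X).hom ≫ RPow R n 1 := by
  have key : ∀ (S : C) (t : S ⊗ X ⟶ X ⊗ S), t ≫ (λ_ X).inv ▷ S = S ◁ (λ_ X).inv ≫ (α_ S (𝟙_ C) X).inv ≫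
    ((ρ_ S).hom ≫ (λ_ S).inv) ▷ X ≫ (α_ (𝟙_ C) S X).hom ≫ 𝟙_ C ◁ t ≫ (α_ (𝟙_ C) X S).inv := by
    intro S t; simp
  exact key _ _

theorem RPowOne_one : R ≫ X ◁ (onePow X).hom = (onePow X).hom ▷ X ≫ RPowOne R 1 := by
  have key : R ≫ X ◁ (λ_ X).inv = (λ_ X).inv ▷ X ≫ (α_ (𝟙_ C) X X).hom ≫ 𝟙_ C ◁ R ≫ (α_ (𝟙_ C) X X).inv ≫
    ((λ_ X).hom ≫ (ρ_ X).inv) ▷ X ≫ (α_ X (𝟙_ C) X).hom := by simp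
  exact key

theorem RPow_one_one : R ≫ ((onePow X).hom ⊗ₘ (onePow X).hom) = ((onePow X).hom ⊗ₘ (onePow X).hom) ≫ RPow R 1 1 := by
  rw [tensorHom_def', reassoc_of% RPowOne_one R, RPow_one_right, assoc,
    whisker_exchange_assoc]

theorem onePow_tmul : ((onePow X).hom ⊗ₘ (onePow X).hom) ≫ tmul X 1 1 = (twoPow X).hom := by
  have key : ((λ_ X).inv ⊗ₘ (λ_ X).inv) ≫ (α_ (𝟙_ C ⊗ X) (𝟙_ C) X).inv ≫ (ρ_ (𝟙_ C ⊗ X)).hom ▷ X = (λ_ X).inv ▷ X := by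
    simp [tensor_def]
  exact key
end Powers

section FRT
variable {C : Type u} [Category.{v} C] [MonoidalCategory C] [BraidedCategory C] [Abelian C] [MonoidalPreadditive C]
  [∀ Z : C, PreservesFiniteColimits (tensorRight Z)]
  [∀ Z : C, PreservesFiniteColimits (tensorLeft Z)]
  {X Y : C} [ExactPairing X Y] {R : X ⊗ X ⟶ X ⊗ X} (Q : FRTQuotient X Y R)

/-- The coaction of `A(X, R)` on the generators `X`. -/
def genCoact : genObj X ⟶ genObj X ⊗ Q.gr :=
  Gr.ofMap (A := genObj X) (B := Gr.tens (genObj X) Q.gr) (fun _ => ((), (1 : ℕ)))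
    (fun _ => (onePow X).hom ≫ frtCoaction Q 1 ≫ (onePow X).inv ▷ Q.obj 1)

/-- The generators form a comodule isomorphic to the first tensor power. -/
def powerGen : IsPowerComodule Q (genCoact Q) where
  deg _ := 1
  coaction _ := (onePow X).hom ≫ frtCoaction Q 1 ≫ (onePow X).inv ▷ Q.obj 1
  hasEntry _ := rfl
  iso _ := onePow X
  hom _ := by
    have key : ∀ {S S' U : C} (e : S ≅ S') (f : S' ⟶ S' ⊗ U), e.hom ≫ f = (e.hom ≫ f ≫ e.inv ▷ U) ≫ e.hom ▷ U := by
      intros; simp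
    exact key _ _

variable {Q} {D : FRTBraiding Q}

theorem isComoduleHom_genIncl : IsComoduleHom (genCoact Q) (frtCoact Q) (genIncl X) := by
  refine IsPowerComodule.isComoduleHom (powerGen Q) (powerFrt Q) ?_
  rintro ⟨⟩
  refine ⟨(1 : ℕ), (onePow X).hom, rfl, 𝟙 _, rfl, isComoduleHom_id _, ?_⟩
  have key : ∀ {S S' : C} (f : S ⟶ S'), f ≫ (Iso.refl S').hom ≫ eqToHom rfl = f ≫ 𝟙 _ := by intros; simp
  exact key _

theorem isComoduleAlgebra_tensorData : IsComoduleAlgebra (frtPair D) (frtCoact Q) (tensorData R).one (tensorData R).mul where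
  comodule := (isOComodule_frtCoact D).tail
  algebra := isAlgebra_tensorData
  one_hom := by
    refine IsPowerComodule.isComoduleHom (powerUnit (B := frtPair D) rfl) (powerFrt Q) ?_
    rintro ⟨⟩
    refine ⟨(0 : ℕ), 𝟙 (𝟙_ C), rfl, 𝟙 _, rfl, isComoduleHom_id _, ?_⟩
    have key : ∀ {S : C}, 𝟙 S ≫ (Iso.refl S).hom ≫ eqToHom rfl = (Iso.refl S).hom ≫ 𝟙 _ := by intros; simp
    exact key
  mul_hom := by
    refine IsPowerComodule.isComoduleHom ((powerFrt Q).tensor (B := frtPair D) rfl (powerFrt Q)) (powerFrt Q) ?_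
    rintro ⟨m, n⟩
    refine ⟨_, _, rfl, 𝟙 _, hasEntry_tmul rfl, isComoduleHom_id _, ?_⟩
    have key : ∀ {S S' U : C} (e : S ⊗ S' ≅ U), e.hom ≫ (Iso.refl U).hom ≫ eqToHom rfl =
      ((Iso.refl S ⊗ᵢ Iso.refl S') ≪≫ e).hom ≫ 𝟙 _ := by intros; simp
    exact key (tpowIso X rfl)

/-- The tensor algebra, with its braided binomial comultiplication, is generated by the comodule `X`. -/
theorem isTensorBialgebra_tensorData (hD : ∀ m n, (D.g m n).hom = RPow R m n) :
    IsTensorBialgebra (frtPair D) (frtCoact Q) (genCoact Q) (genIncl X) (tensorData R) where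
  base := isCoquasitriangular_frt D
  comodule := isOComodule_frtCoact D
  comodule_gen := ⟨(tail_coassoc_iff _ _).1 ((powerGen Q).coassoc (B := frtPair D) rfl),
    (tail_counit_iff _ _).1 ((powerGen Q).counit (B := frtPair D) rfl)⟩
  alg := isComoduleAlgebra_tensorData
  gen_hom := isComoduleHom_genIncl
  ext := tensorPow_ext
  one_counit := by
    have h1 : HasEntry (A := 𝟙_ (Gr C)) (B := TensorPow X) (tensorData R).one () (0 : ℕ) (𝟙 (𝟙_ C)) := rfl
    have h2 : HasEntry (A := TensorPow X) (B := 𝟙_ (Gr C)) (tensorData R).counit (0 : ℕ) () (𝟙 (𝟙_ C)) := rfl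
    exact eq_of_hasEntry fun _ => ⟨(), _, h1.comp h2, (hasEntry_id (𝟙_ (Gr C)) ()).congr (id_comp (𝟙 (𝟙_ C))).symm⟩
  one_comul := tensorData_one_comul
  gen_counit := tensorData_gen_counit
  gen_comul := tensorData_gen_comul fun n => (powerFrt Q).braiding' D (powerGen Q) n () (by
    have key : RPowOne R n ≫ (onePow X ⊗ᵢ Iso.refl (tpow X n)).hom = (Iso.refl (tpow X n) ⊗ᵢ onePow X).hom ≫ (D.g n 1).hom := by
      rw [hD, tensorIso_hom, tensorIso_hom, Iso.refl_hom, tensorHom_id, id_tensorHom, RPow_one_right]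
    exact key)

/-- The braiding of the comodule `X` with itself is `R`. -/
theorem hasEntry_braiding_genCoact (hD : ∀ m n, (D.g m n).hom = RPow R m n) :
    HasEntry (A := genObj X ⊗ genObj X) (B := genObj X ⊗ genObj X)
      (Ψ[frtPair D] (genCoact Q) (genCoact Q)) ((), ()) ((), ()) R :=
  (powerGen Q).braiding' D (powerGen Q) () () (by
    have key : R ≫ (onePow X ⊗ᵢ onePow X).hom = (onePow X ⊗ᵢ onePow X).hom ≫ (D.g 1 1).hom := by
      rw [hD, tensorIso_hom, RPow_one_one]
    exact key)

/-- `ker(R + id)` as a graded space. -/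
def kerObj (R : X ⊗ X ⟶ X ⊗ X) : Gr C := ⟨Unit, fun _ => kernel (R + 𝟙 (X ⊗ X))⟩

/-- The inclusion of `ker(R + id)` in `X ⊗ X`. -/
def kerIncl (R : X ⊗ X ⟶ X ⊗ X) : kerObj R ⟶ genObj X ⊗ genObj X :=
  Gr.ofMap (A := kerObj R) (B := Gr.tens (genObj X) (genObj X)) (fun _ => ((), ())) (fun _ => kernel.ι (R + 𝟙 (X ⊗ X)))

theorem hasEntry_kerIncl : HasEntry (A := kerObj R) (B := genObj X ⊗ genObj X) (kerIncl R) () ((), ())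
    (kernel.ι (R + 𝟙 (X ⊗ X))) := rfl

theorem kerIncl_braiding (hD : ∀ m n, (D.g m n).hom = RPow R m n) :
    kerIncl R ≫ Ψ[frtPair D] (genCoact Q) (genCoact Q) + kerIncl R = 0 := by
  refine Gr.hom_ext ?_
  rintro ⟨⟩
  have e := (hasEntry_kerIncl (R := R)).comp (hasEntry_braiding_genCoact hD)
  have z : kernel.ι (R + 𝟙 (X ⊗ X)) ≫ R + kernel.ι (R + 𝟙 (X ⊗ X)) = 0 := by
    have := kernel.condition (R + 𝟙 (X ⊗ X))
    rwa [Preadditive.comp_add, comp_id] at this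
  exact (congrArg₂ (· + ·) e (hasEntry_kerIncl (R := R))).trans ((map_add _ _ _).symm.trans ((congrArg _ z).trans (map_zero _)))

/-- `R` is a morphism of comodules, hence so is the inclusion of the kernel of `R + id`, which the functor
`- ⊗ A_2(X, R)` preserves. -/
theorem exists_kernel_coaction (hD : ∀ m n, (D.g m n).hom = RPow R m n)
    [PreservesLimit (parallelPair (R + 𝟙 (X ⊗ X)) 0) (tensorRight (Q.obj 2))] :
    ∃ δK : kerObj R ⟶ kerObj R ⊗ Q.gr,
      IsComoduleHom δK (tensorCoaction (frtPair D) (genCoact Q) (genCoact Q)) (kerIncl R) := by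
  let h2 := (powerGen Q).tensor (B := frtPair D) rfl (powerGen Q)
  have hc : IsComoduleHom (tensorCoaction (frtPair D) (genCoact Q) (genCoact Q))
      (tensorCoaction (frtPair D) (genCoact Q) (genCoact Q))
      (Ψ[frtPair D] (genCoact Q) (genCoact Q)) := by
    refine IsPowerComodule.isComoduleHom h2 h2 ?_
    rintro ⟨⟨⟩, ⟨⟩⟩
    refine ⟨((), ()), R, rfl, _, hasEntry_braiding_genCoact hD, D.endo (m := 1) (n := 1) rfl rfl, ?_⟩
    have key : R ≫ ((onePow X ⊗ᵢ onePow X) ≪≫ tpowIso X (rfl : 1 + 1 = 1 + 1)).hom ≫ eqToHom rfl =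
        ((onePow X ⊗ᵢ onePow X) ≪≫ tpowIso X (rfl : 1 + 1 = 1 + 1)).hom ≫ swapEndo (fun m n => (D.g m n).hom) rfl rfl := by
      rw [Iso.trans_hom, tensorIso_hom, eqToHom_refl, comp_id, swapEndo, assoc, Iso.hom_inv_id_assoc,
        hD, reassoc_of% RPow_one_one R]
    exact key
  let ψ : X ⊗ X ⟶ (X ⊗ X) ⊗ Q.obj 2 := h2.coaction ((), ())
  have hψ : HasEntry (A := genObj X ⊗ genObj X) (B := (genObj X ⊗ genObj X) ⊗ Q.gr)
    (tensorCoaction (frtPair D) (genCoact Q) (genCoact Q)) ((), ()) (((), ()), (2 : ℕ)) ψ := h2.hasEntry ((), ())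
  have hR : R ≫ ψ = ψ ≫ R ▷ Q.obj 2 :=
    ((hasEntry_braiding_genCoact hD).comp hψ).unique (by
      unfold IsComoduleHom at hc
      rw [hc]
      exact hψ.comp ((hasEntry_braiding_genCoact hD).whiskerRight Q.gr (2 : ℕ)))
  -- Thus `ψ` maps the kernel to the kernel of `(R + id) ⊗ A_2`, which is `ker (R + id) ⊗ A_2`.
  have hw : (kernel.ι (R + 𝟙 (X ⊗ X)) ≫ ψ) ≫ (R + 𝟙 (X ⊗ X)) ▷ Q.obj 2 = 0 := by
    have e : ψ ≫ (R + 𝟙 (X ⊗ X)) ▷ Q.obj 2 = (R + 𝟙 (X ⊗ X)) ≫ ψ := by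
      rw [MonoidalPreadditive.add_whiskerRight, id_whiskerRight, Preadditive.comp_add, Preadditive.add_comp, hR,
        comp_id, id_comp]
    rw [assoc, e, kernel.condition_assoc, zero_comp]
  obtain ⟨l, hl⟩ := KernelFork.IsLimit.lift'
    (isLimitOfHasKernelOfPreservesLimit (tensorRight (Q.obj 2)) (R + 𝟙 (X ⊗ X))) _ hw
  let δK : kerObj R ⟶ kerObj R ⊗ Q.gr :=
    Gr.ofMap (A := kerObj R) (B := Gr.tens (kerObj R) Q.gr) (fun _ => ((), (2 : ℕ))) (fun _ => l)
  have hδ : HasEntry (A := kerObj R) (B := kerObj R ⊗ Q.gr) δK () ((), (2 : ℕ)) l := rfl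
  refine ⟨δK, eq_of_hasEntry ?_⟩
  rintro ⟨⟩
  exact ⟨_, _, hasEntry_kerIncl.comp hψ, (hδ.comp (hasEntry_kerIncl.whiskerRight Q.gr (2 : ℕ))).congr hl⟩
end FRT
/-! ### The braided vectors -/

section Ideal
variable {C : Type u} [Category.{v} C] [MonoidalCategory C] [BraidedCategory C] [Abelian C] [MonoidalPreadditive C]
  [∀ Z : C, PreservesFiniteColimits (tensorRight Z)]
  [∀ Z : C, PreservesFiniteColimits (tensorLeft Z)]
  {X : C} {R : X ⊗ X ⟶ X ⊗ X}

theorem hasEntry_vecProj (n : ℕ) : HasEntry (A := TensorPow X) (B := BraidedVec R) (vecProj R) n n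
    (cokernel.π (vecIdeal R n).arrow) := rfl

theorem hasEntry_idealMap {a b n : ℕ} (h : a + 2 + b = n) :
    HasEntry (A := (TensorPow X ⊗ kerObj R) ⊗ TensorPow X) (B := TensorPow X)
      (idealMap (tensorData R).mul (kerIncl R ≫ (genIncl X ⊗ₘ genIncl X) ≫ (tensorData R).mul)) ((a, ()), b) n
      (idealGenerator (tpow X) (tmul X) 2 (kernel.ι (R + 𝟙 (X ⊗ X)) ≫ (twoPow X).hom) a b ≫ eqToHom (congrArg (tpow X) h)) := by
  have h1 : HasEntry (A := genObj X) (B := TensorPow X) (genIncl X) () (1 : ℕ) (onePow X).hom := rfl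
  have h2 : HasEntry (A := kerObj R) (B := TensorPow X) (kerIncl R ≫ (genIncl X ⊗ₘ genIncl X) ≫ (tensorData R).mul) () (2 : ℕ)
      (kernel.ι (R + 𝟙 (X ⊗ X)) ≫ (twoPow X).hom) :=
    ((hasEntry_kerIncl (R := R)).comp ((h1.tensor h1).comp (hasEntry_tmul (R := R) (rfl : 1 + 1 = 2)))).congr
      (congrArg (kernel.ι (R + 𝟙 (X ⊗ X)) ≫ ·) ((congrArg (_ ≫ ·) (tpowIso_hom X 1 1 rfl)).trans onePow_tmul))
  have h3 := ((h2.whiskerLeft (TensorPow X) a).comp (hasEntry_tmul (R := R) (rfl : a + 2 = a + 2))).whiskerRight (TensorPow X) b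
  refine (h3.comp (hasEntry_tmul (R := R) h)).congr ?_
  subst h
  have key : ∀ (r : kernel (R + 𝟙 (X ⊗ X)) ⟶ tpow X 2), (tpow X a ◁ r ≫ (tpowIso X (rfl : a + 2 = a + 2)).hom) ▷ tpow X b ≫
      (tpowIso X (rfl : a + 2 + b = a + 2 + b)).hom = idealGenerator (tpow X) (tmul X) 2 r a b ≫ 𝟙 _ := by
    intro r; rw [tpowIso_hom, tpowIso_hom, comp_id]
  exact key _

/-- The components of the projection are cokernels, which tensoring preserves. -/
theorem isIdealQuotient_vecProj : IsIdealQuotient (tensorData R).mul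
    (kerIncl R ≫ (genIncl X ⊗ₘ genIncl X) ≫ (tensorData R).mul) (vecProj R) where
  epi W W' := epi_of_hasEntry fun p => ⟨p, _, ((hasEntry_vecProj p.2.1).whiskerRight W' p.2.2).whiskerLeft W p.1,
    have key : ∀ (n : ℕ) (S S' : C), Epi (S ◁ cokernel.π (vecIdeal R n).arrow ▷ S') := fun _ _ _ => inferInstance
    key _ _ _⟩
  kill := by
    have gen : ∀ a b : ℕ, (idealGenerator (tpow X) (tmul X) 2 (kernel.ι (R + 𝟙 (X ⊗ X)) ≫ (twoPow X).hom) a b ≫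
        eqToHom (congrArg (tpow X) rfl)) ≫ cokernel.π (vecIdeal R (a + 2 + b)).arrow = 0 := fun a b => by
      have e := (idealGen_kills_iff (tpow X) (tmul X) 2 (kernel.ι (R + 𝟙 (X ⊗ X)) ≫ (twoPow X).hom) _
        (cokernel.π (vecIdeal R (a + 2 + b)).arrow ▷ 𝟙_ C)).1
        (by
          have := cokernel.condition (vecIdeal R (a + 2 + b)).arrow
          rw [vecIdeal] at this ⊢
          rw [← comp_whiskerRight, this, MonoidalPreadditive.zero_whiskerRight]) a b rfl
      rwa [← comp_whiskerRight, ← MonoidalPreadditive.zero_whiskerRight, whiskerRight_iff] at e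
    refine Gr.hom_ext ?_
    rintro ⟨⟨a, ⟨⟩⟩, b⟩
    exact (((hasEntry_idealMap rfl).comp (hasEntry_vecProj _)).congr (gen a b)).trans (map_zero _)
  desc {W Z} f hf := by
    have row : ∀ p : (TensorPow X ⊗ W).ι, ∃ r : Gr.Row ((BraidedVec R ⊗ W).obj p) Z,
        Gr.pre (cokernel.π (vecIdeal R p.1).arrow ▷ W.obj p.2) r = f.row p := by
      rintro ⟨n, w⟩
      refine exists_pre_eq (f.row (n, w)) fun z => exists_cokernel_desc _ _ ?_
      refine (idealGen_kills_iff (tpow X) (tmul X) 2 (kernel.ι (R + 𝟙 (X ⊗ X)) ≫ (twoPow X).hom) n _).2 fun a b h => ?_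
      have e := DFunLike.congr_fun (congrFun (congrArg Gr.Hom.row hf) (((a, ()), b), w)) z
      rw [((hasEntry_idealMap h).whiskerRight W w).row_comp, pre_apply] at e
      exact e
    choose g hg using row
    exact ⟨Gr.Hom.mk g, Gr.hom_ext fun p => (((hasEntry_vecProj p.1).whiskerRight W p.2).row_comp _).trans (hg p)⟩
end Ideal

section Antipode
variable {C : Type u} [Category.{v} C] [MonoidalCategory C] [BraidedCategory C] [Abelian C] [MonoidalPreadditive C]
  [∀ Z : C, PreservesFiniteColimits (tensorRight Z)]
  [∀ Z : C, PreservesFiniteColimits (tensorLeft Z)]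
  {X : C} {R : X ⊗ X ⟶ X ⊗ X}

theorem shuffleRow_apply_eq_zero (n : ℕ) (p : ℕ × ℕ) (h : p.1 + p.2 ≠ n) : shuffleRow R n p = 0 := by
  induction n generalizing p with
  | zero => exact single_apply_of_ne (B := Gr.tens (TensorPow X) (TensorPow X)) (fun e => h (by obtain rfl := e; rfl)) _
  | succ n ih =>
    refine sumHom_apply_eq_zero (B := Gr.tens (TensorPow X) (TensorPow X)) (B' := Gr.tens (TensorPow X) (TensorPow X)) fun (j : ℕ × ℕ) hj => ?_
    have hj' : j.1 + j.2 = n := by by_contra hn; exact hj (ih j hn)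
    refine (congrArg₂ (· + ·) (single_apply_of_ne (B := Gr.tens (TensorPow X) (TensorPow X)) ?_ _)
      (single_apply_of_ne (B := Gr.tens (TensorPow X) (TensorPow X)) ?_ _)).trans (add_zero 0)
    · rintro rfl; exact h (congrArg Nat.succ hj')
    · rintro rfl; exact h ((Nat.succ_add _ _).trans (congrArg Nat.succ hj'))

/-- A bialgebra structure on the braided vectors that is induced from the tensor algebra as a coalgebra has an
antipode. -/
theorem exists_antipode_braidedVec {A : Gr C} {B : PairData A} {δT : TensorPow X ⟶ TensorPow X ⊗ A}
    {δ : BraidedVec R ⟶ BraidedVec R ⊗ A} {d : ℕ → A.ι} {φ : ∀ n, tpow X n ⟶ tpow X n ⊗ A.obj (d n)}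
    (hT : ∀ n : ℕ, HasEntry (B := TensorPow X ⊗ A) δT n (n, d n) (φ n)) (hδ : IsComoduleHom δT δ (vecProj R))
    {H : BialgData (BraidedVec R)} (e1 : (tensorData R).one ≫ vecProj R = H.one)
    (eε : vecProj R ≫ H.counit = (tensorData R).counit)
    (eΔ : vecProj R ≫ H.comul = (tensorData R).comul ≫ (vecProj R ⊗ₘ vecProj R))
    (halg : IsAlgebra H.one H.mul) (hco : IsCoalgebra H.counit H.comul)
    (h1 : IsComoduleHom (unitCoaction B) δ H.one) (hm : IsComoduleHom (tensorCoaction B δ δ) δ H.mul)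
    (hε : IsComoduleHom δ (unitCoaction B) H.counit) (hΔ : IsComoduleHom δ (tensorCoaction B δ δ) H.comul) :
    ∃ S, IsComoduleHom δ δ S ∧ IsAntipode H S := by
  -- The coproduct and the coaction preserve degrees because they do so on the tensor algebra, and in
  -- degree `0` the relation `ηε = id` is inherited from it.
  refine exists_antipode (fun n : ℕ => n) halg hco h1 hm hε hΔ (fun n p => ?_) (fun n p => ?_) ?_
  · contrapose
    intro hp
    have e := (pre_apply (B := BraidedVec R ⊗ BraidedVec R) _ _ _).symm.trans
      (congrArg (fun r : Gr.Row _ (BraidedVec R ⊗ BraidedVec R) => r p)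
        (((hasEntry_vecProj n).row_comp _).symm.trans (congrFun (congrArg Gr.Hom.row eΔ) n)))
    refine (cancel_epi (cokernel.π (vecIdeal R n).arrow)).1 ((e.trans ?_).trans comp_zero.symm)
    refine sumHom_apply_eq_zero (B := Gr.tens (TensorPow X) (TensorPow X)) fun (j : ℕ × ℕ) hj => ?_
    have hj' : j.1 + j.2 = n := by by_contra hn; exact hj (shuffleRow_apply_eq_zero n j hn)
    have ej := (hasEntry_vecProj (R := R) j.1).tensor (hasEntry_vecProj (R := R) j.2)
    unfold HasEntry at ej
    refine (congrArg (fun r => Gr.pre (shuffleRow R n j) r p) ej).trans ((congrArg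
      (fun r : Gr.Row _ (BraidedVec R ⊗ BraidedVec R) => r p) (Gr.pre_single _ _ _)).trans ?_)
    refine single_apply_of_ne ?_ _
    rintro rfl
    exact hp hj'
  · contrapose
    intro hp
    have e := (pre_apply (B := BraidedVec R ⊗ A) _ _ _).symm.trans
      (congrArg (fun r : Gr.Row _ (BraidedVec R ⊗ A) => r p)
        (((hasEntry_vecProj n).row_comp _).symm.trans (congrFun (congrArg Gr.Hom.row hδ) n)))
    have en := (hT n).comp ((hasEntry_vecProj (R := R) n).whiskerRight A (d n))
    unfold HasEntry at en
    rw [en] at e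
    refine (cancel_epi (cokernel.π (vecIdeal R n).arrow)).1 ((e.trans ?_).trans comp_zero.symm)
    refine single_apply_of_ne ?_ _
    rintro rfl
    exact hp rfl
  · rintro n rfl
    have e : vecProj R ≫ H.counit ≫ H.one = (tensorData R).counit ≫ (tensorData R).one ≫ vecProj R := by
      rw [reassoc_of% eε, e1]
    have e0 := congrFun (congrArg Gr.Hom.row e) (0 : ℕ)
    have i1 : HasEntry (A := TensorPow X) (B := 𝟙_ (Gr C)) (tensorData R).counit (0 : ℕ) () (𝟙 (𝟙_ C)) := rfl
    have i2 : HasEntry (A := 𝟙_ (Gr C)) (B := TensorPow X) (tensorData R).one () (0 : ℕ) (𝟙 (𝟙_ C)) := rfl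
    have i3 := i1.comp (i2.comp (hasEntry_vecProj (R := R) 0))
    unfold HasEntry at i3
    rw [(hasEntry_vecProj 0).row_comp, i3] at e0
    refine DFinsupp.ext fun k => (cancel_epi (cokernel.π (vecIdeal R 0).arrow)).1 ?_
    have e0k := (pre_apply _ _ _).symm.trans (DFunLike.congr_fun e0 k)
    refine e0k.trans (Eq.trans ?_ (pre_apply (cokernel.π (vecIdeal R 0).arrow) (Gr.Hom.row (𝟙 (BraidedVec R)) (0 : ℕ)) k))
    refine DFunLike.congr_fun (Eq.trans ?_ (Gr.pre_single _ _ _).symm) k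
    have key : ∀ {V : C} (f : 𝟙_ C ⟶ V), 𝟙 (𝟙_ C) ≫ 𝟙 (𝟙_ C) ≫ f = f ≫ 𝟙 V := by intros; simp
    exact congrArg _ (key _)
end Antipode
/-! ### The structures on the quotients -/

section
variable {C : Type u} [Category.{v} C] [MonoidalCategory C] [BraidedCategory C] [Abelian C] [MonoidalPreadditive C]
  [∀ Z : C, PreservesFiniteColimits (tensorRight Z)]
  [∀ Z : C, PreservesFiniteColimits (tensorLeft Z)]
  {X Y : C} [ExactPairing X Y]

/-- The braiding of tensor powers that extends an invertible solution of the braid equation. -/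
def braidEquationBraiding (X Y : C) [ExactPairing X Y] (R : X ⊗ X ≅ X ⊗ X) (hR : BraidEquation R.hom) :
    FRTBraiding (frtQuotient X Y R.hom) where
  g m n := asIso (RPow R.hom m n)
  family := isBraidFamily_RPow R.hom
  slides := slides_RTwo hR
  endo h h' := isEndo_swapEndo _ h h'

theorem hasEntry_frtProj (R : X ⊗ X ⟶ X ⊗ X) (n : ℕ) :
    HasEntry (A := FreeFRT X Y) (B := (frtQuotient X Y R).gr) (frtProj X Y R) n n ((frtQuotient X Y R).π n) := rfl

theorem isPairHom_frtProj (R : X ⊗ X ≅ X ⊗ X) (hR : BraidEquation R.hom) :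
    IsPairHom (A' := (frtQuotient X Y R.hom).gr) (frtProj X Y R.hom) (freePair X Y R.hom)
      (frtPair (braidEquationBraiding X Y R hR)) := by
  have p := hasEntry_frtProj (X := X) (Y := Y) R.hom
  have pp := fun m n : ℕ => (p m).tensor (p n)
  refine ⟨⟨eq_of_hasEntry fun _ => ?_, eq_of_hasEntry ?_, eq_of_hasEntry fun n => ?_, eq_of_hasEntry fun n => ?_⟩,
    eq_of_hasEntry ?_, eq_of_hasEntry ?_⟩
  · have h : HasEntry (A := 𝟙_ (Gr C)) (B := FreeFRT X Y) (freePair X Y R.hom).one () (0 : ℕ) (λ_ (𝟙_ C)).inv := rfl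
    exact ⟨_, _, h.comp (p 0), hasEntry_frtOne _⟩
  · rintro ⟨m, n⟩
    have h : HasEntry (A := FreeFRT X Y ⊗ FreeFRT X Y) (B := FreeFRT X Y) (freePair X Y R.hom).mul (m, n) (Nat.add m n)
      (freeMul X Y m n) := rfl
    have h' : HasEntry (A := (frtQuotient X Y R.hom).gr ⊗ (frtQuotient X Y R.hom).gr) (B := (frtQuotient X Y R.hom).gr)
      (frtPair (braidEquationBraiding X Y R hR)).mul (m, n) (Nat.add m n) (frtMul (frtQuotient X Y R.hom) m n) := rfl
    exact ⟨_, _, h.comp (p _), ((pp m n).comp h').congr (frtπ_mul (frtQuotient X Y R.hom) m n)⟩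
  · have h : HasEntry (A := FreeFRT X Y) (B := 𝟙_ (Gr C)) (freePair X Y R.hom).counit n () (evPow X Y n) := rfl
    exact ⟨_, _, ((p n).comp (hasEntry_frtCounit _ n)).congr (frtπ_counit _ n), h⟩
  · have h : HasEntry (A := FreeFRT X Y) (B := FreeFRT X Y ⊗ FreeFRT X Y) (freePair X Y R.hom).comul n (n, n)
      (freeComul X Y n) := rfl
    exact ⟨_, _, (p n).comp (hasEntry_frtComul _ n), (h.comp (pp n n)).congr (frtπ_comul _ n).symm⟩
  · rintro ⟨m, n⟩
    have h : HasEntry (A := FreeFRT X Y ⊗ FreeFRT X Y) (B := FreeFRT X Y) (freePair X Y R.hom).mulBar (m, n) (Nat.add m n)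
      (freeMulBar X Y m n) := rfl
    have h' : HasEntry (A := (frtQuotient X Y R.hom).gr ⊗ (frtQuotient X Y R.hom).gr) (B := (frtQuotient X Y R.hom).gr)
      (frtPair (braidEquationBraiding X Y R hR)).mulBar (m, n) (Nat.add m n)
      (@frtMul C _ _ (reverseBraiding C) _ _ _ _ _ _ _ _ (frtQuotient X Y R.hom) m n) := rfl
    exact ⟨_, _, h.comp (p _), ((pp m n).comp h').congr
      (@frtπ_mul C _ _ (reverseBraiding C) _ _ _ _ _ _ _ _ (frtQuotient X Y R.hom) m n)⟩
  · rintro ⟨m, n⟩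
    have h : HasEntry (A := FreeFRT X Y ⊗ FreeFRT X Y) (B := 𝟙_ (Gr C)) (freePair X Y R.hom).pairing (m, n) ()
      (freePairing X Y R.hom m n) := rfl
    let D := braidEquationBraiding X Y R hR
    have h' : HasEntry (A := (frtQuotient X Y R.hom).gr ⊗ (frtQuotient X Y R.hom).gr) (B := 𝟙_ (Gr C))
      (frtPair D).pairing (m, n) () (frtPairing (frtQuotient X Y R.hom) D.family D.slides m n) := rfl
    exact ⟨_, _, ((pp m n).comp h').congr (frtπ_pairing _ D.family D.slides m n), h⟩

theorem frtCoact_eq (R : X ⊗ X ⟶ X ⊗ X) : frtCoact (frtQuotient X Y R) =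
    tensorAlgebraCoaction X Y ≫ TensorPow X ◁ frtProj X Y R := by
  refine eq_of_hasEntry fun n => ?_
  have h : HasEntry (A := TensorPow X) (B := TensorPow X ⊗ FreeFRT X Y) (tensorAlgebraCoaction X Y) n (n, n)
    (freeCoaction X Y n) := rfl
  exact ⟨_, _, hasEntry_frtCoact _ n, h.comp ((hasEntry_frtProj R n).whiskerLeft (TensorPow X) n)⟩

variable {R : X ⊗ X ⟶ X ⊗ X} {Q : FRTQuotient X Y R} {D : FRTBraiding Q}

/-- The structure morphisms of the tensor algebra descend to the braided vectors, which thereby form a dual quantum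
braided group in the category of comodules. -/
theorem exists_braidedVec_structure (hD : ∀ m n, (D.g m n).hom = RPow R m n)
    [PreservesLimit (parallelPair (R + 𝟙 (X ⊗ X)) 0) (tensorRight (Q.obj 2))] :
    ∃ (H : BialgData (BraidedVec R)) (δ : BraidedVec R ⟶ BraidedVec R ⊗ Q.gr)
      (c : BraidedVec R ⊗ BraidedVec R ≅ BraidedVec R ⊗ BraidedVec R),
      IsBialgHom (vecProj R) (tensorData R) H ∧ IsComoduleHom (frtCoact Q) δ (vecProj R) ∧
      c.hom = Ψ[frtPair D] δ δ ∧ c.inv = comoduleBraidingInv (frtPairingInv D) δ δ ∧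
      IsDualQuantumBraidedGroupOver (frtPair D) δ c (trivialPair c H) := by
  obtain ⟨δK, hK⟩ := exists_kernel_coaction (Q := Q) hD
  obtain ⟨H, δ, hH, hδ, hV⟩ := (isTensorBialgebra_tensorData hD).exists_quotient isIdealQuotient_vecProj
    (kerIncl_braiding hD) hK
  have ht := hV.comodule.tail
  have hρ := isConvolutionInverse_frt D
  let c : BraidedVec R ⊗ BraidedVec R ≅ BraidedVec R ⊗ BraidedVec R :=
    ⟨Ψ[frtPair D] δ δ, comoduleBraidingInv (frtPairingInv D) δ δ,
      comoduleBraiding_hom_inv ht ht hρ, comoduleBraiding_inv_hom ht ht hρ⟩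
  have hc : c.hom = Ψ[frtPair D] δ δ := rfl
  have hq := (hc ▸ hV.bialgebra : IsBialgebra c.hom H).isCoquasitriangular_trivialPair (hV.isBraidedBy hc)
  have hb : IsComoduleHom (tensorCoaction (frtPair D) δ δ) (tensorCoaction (frtPair D) δ δ) c.hom :=
    comoduleBraiding_isComoduleHom hV.base hV.comodule ht
  refine ⟨H, δ, c, hH, hδ, rfl, rfl, hV.isDualQuantumBraidedGroupOver hc ?_ ?_⟩
  · exact exists_antipode_braidedVec (hasEntry_frtCoact Q) hδ hH.one hH.counit hH.comul hV.bialgebra.algebra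
      hV.bialgebra.coalgebra hV.one_hom hV.mul_hom hV.counit_hom hV.comul_hom
  · exact exists_antipode_braidedVec (hasEntry_frtCoact Q) hδ (H := (trivialPair c H).bar) hH.one hH.counit hH.comul
      hq.bialgebra_bar.algebra hq.bialgebra_bar.coalgebra hV.one_hom (hb.inv.comp hV.mul_hom) hV.counit_hom hV.comul_hom
end
end
end BraidedFRT

theorem mainTheorem9 {C : Type u} [Category.{v} C] [MonoidalCategory C] [BraidedCategory C]
    [Abelian C] [MonoidalPreadditive C]
    [∀ Z : C, PreservesFiniteColimits (tensorLeft Z)]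
    [∀ Z : C, PreservesFiniteColimits (tensorRight Z)]
    (X Y : C) [ExactPairing X Y] (R : X ⊗ X ≅ X ⊗ X) (hR : BraidEquation R.hom)
    [PreservesLimit (parallelPair (R.hom + 𝟙 (X ⊗ X)) 0) (tensorRight (frtObj X Y R.hom 2))] :
    (∀ n, frtIdealBar X Y R.inv n = frtIdeal X Y R.hom n) ∧
    ∃ (B : PairData (FRT X Y R.hom)) (ρ' : FRT X Y R.hom ⊗ FRT X Y R.hom ⟶ 𝟙_ (Gr C)),
      IsPairHom (frtProj X Y R.hom) (freePair X Y R.hom) B ∧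
      IsCoquasitriangular (β_ (FRT X Y R.hom) (FRT X Y R.hom)) B ∧
      IsConvolutionInverse (β_ (FRT X Y R.hom) (FRT X Y R.hom)).hom B.toBialgData B.pairing ρ' ∧
      ∃ (H : BialgData (BraidedVec R.hom)) (δ : BraidedVec R.hom ⟶ BraidedVec R.hom ⊗ FRT X Y R.hom)
        (c : BraidedVec R.hom ⊗ BraidedVec R.hom ≅ BraidedVec R.hom ⊗ BraidedVec R.hom),
        IsBialgHom (vecProj R.hom) (tensorData R.hom) H ∧
        vecProj R.hom ≫ δ =
          tensorAlgebraCoaction X Y ≫ (vecProj R.hom ⊗ₘ frtProj X Y R.hom) ∧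
        c.hom = comoduleBraiding B.pairing δ δ ∧
        c.inv = comoduleBraidingInv ρ' δ δ ∧
        IsDualQuantumBraidedGroupOver B δ c (trivialPair c H) ∧
        bosonizationComulBar B δ (trivialPair c H) =
          (bosonization B ρ' δ (trivialPair c H)).comul ∧
        IsCoquasitriangular (β_ (FRT X Y R.hom ⊗ BraidedVec R.hom) (FRT X Y R.hom ⊗ BraidedVec R.hom))
          (bosonization B ρ' δ (trivialPair c H)) := by
  refine ⟨frtIdealBar_eq R, ?_⟩
  let D := braidEquationBraiding X Y R hR
  have : PreservesLimit (parallelPair (R.hom + 𝟙 (X ⊗ X)) 0)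
      (tensorRight ((frtQuotient X Y R.hom).obj 2)) :=
    ‹PreservesLimit (parallelPair (R.hom + 𝟙 (X ⊗ X)) 0) (tensorRight (frtObj X Y R.hom 2))›
  obtain ⟨H, δ, c, hH, hδ, hc, hc', hV⟩ := exists_braidedVec_structure (D := D) fun _ _ => rfl
  have hB := isCoquasitriangular_frt D
  have hρ := isConvolutionInverse_frt D
  refine ⟨frtPair D, frtPairingInv D, isPairHom_frtProj R hR, hB, hρ, H, δ, c, hH, ?_, hc, hc', hV,
    hV.comodule.bosonizationComulBar _,
    bosonization_isCoquasitriangular hB hρ (isCoquasitriangular_frt_swap D) hV hc hc'⟩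
  refine (show vecProj R.hom ≫ δ = _ from hδ).trans
    ((congrArg (· ≫ vecProj R.hom ▷ FRT X Y R.hom) (frtCoact_eq R.hom)).trans ?_)
  rw [Category.assoc, MonoidalCategory.tensorHom_def']
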